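/- Let $G$ be a finite abelian group (written multiplicatively) and let $\mathbf{k}$ be a commutative $\mathbb{Q}$-algebra. **Racinet's objects.** Let $\mathbf{k}\langle\langle X\rangle\rangle$ be the algebra of noncommutative formal power series in $x_0$ and $x_g$ ($g\in G$); write $x_1$ for $x_g$ with $g=1$, and $(\Psi\,|\,w)$ for the coefficient of the word $w$ in $\Psi$, extended linearly in $w$. Let $\hat\Delta$ be the continuous algebra coproduct for which all letters are primitive, and let $\mathcal{G}=\{\Psi\in\mathbf{k}\langle\langle X\rangle\rangle^\times \mid \hat\Delta(\Psi)=\Psi\otimes\Psi\}$. For $g\in G$ let $t_g$ be the continuous automorphism $x_0\mapsto x_0$, $x_h\mapsto x_{gh}$. For $\Psi\in\mathcal{G}$ let $\mathrm{aut}_\Psi$ be the continuous algebra automorphism $x_0\mapsto x_0$, $x_g\mapsto t_g(\Psi^{-1})\,x_g\,t_g(\Psi)$, let $S_\Psi(a)=\Psi\,\mathrm{aut}_\Psi(a)$, and put $\Psi\circledast\Phi=S_\Psi(\Phi)$. Let $\mathbf{q}$ be the continuous linear automorphism of $\mathbf{k}\langle\langle X\rangle\rangle$ with $$x_0^{n_1-1}x_{g_1}x_0^{n_2-1}x_{g_2}\cdots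 x_0^{n_r-1}x_{g_r}x_0^{n_{r+1}-1}\mapsto x_0^{n_1-1}x_{g_1}x_0^{n_2-1}x_{g_2g_1^{-1}}\cdots x_0^{n_r-1}x_{g_rg_{r-1}^{-1}}x_0^{n_{r+1}-1}.$$ Let $\pi_Y$ be the projection onto $Q=\mathbf{k}\langle\langle X\rangle\rangle/\mathbf{k}\langle\langle X\rangle\rangle x_0$, and $\bar{\mathbf{q}}$ the automorphism of $Q$ induced by $\mathbf{q}$. Let $\mathbf{k}\langle\langle Y\rangle\rangle$ be the algebra of noncommutative formal power series in $y_{n,g}$ ($n\ge1$, $g\in G$), regarded as a subalgebra of $\mathbf{k}\langle\langle X\rangle\rangle$ by $y_{n,g}=x_0^{n-1}x_g$; then $\pi_Y$ restricts to a linear isomorphism $\mathbf{k}\langle\langle Y\rangle\rangle\to Q$. Let $\hat\Delta^{\mathrm{alg}}_\star$ be the continuous algebra morphism $\mathbf{k}\langle\langle Y\rangle\rangle\to\mathbf{k}\langle\langle Y\rangle\rangle^{\hat\otimes2}$ with $$y_{n,g}\mapsto y_{n,g}\otimes1+1\otimes y_{n,g}+\sum_{k=1}^{n-1}\sum_{h\in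 G}y_{k,h}\otimes y_{n-k,gh^{-1}},$$ and let $\hat\Delta^{\mathrm{mod}}_\star:Q\to Q^{\hat\otimes2}$ be the linear map with $\hat\Delta^{\mathrm{mod}}_\star\circ\pi_Y=\pi_Y^{\otimes2}\circ\hat\Delta^{\mathrm{alg}}_\star$ on $\mathbf{k}\langle\langle Y\rangle\rangle$. **The correction series.** Fix a sign $\varepsilon\in\{1,-1\}$ and put, for $\Psi\in\mathcal{G}$, $$\Gamma_\Psi(x)=\exp\Big(\varepsilon\sum_{n\ge2}\frac{(-1)^{n-1}}{n}(\Psi\,|\,x_0^{n-1}x_1)\,x^n\Big)\in\mathbf{k}[[x]]^\times .$$ **The stabilizer of $\hat\Delta^{\mathrm{mod}}_\star$.** Let $S^Y_\Psi$ be the automorphism of $Q$ with $S^Y_\Psi\circ\bar{\mathbf{q}}\circ\pi_Y=\bar{\mathbf{q}}\circ\pi_Y\circ S_\Psi$, let ${}^\Gamma S^Y_\Psi(v)=\Gamma_\Psi^{-1}(x_1)\,S^Y_\Psi(v)$, and $$\mathsf{Stab}(\hat\Delta^{\mathrm{mod}}_\star)(\mathbf{k})=\{\Psi\in\mathcal{G}\mid({}^\Gamma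 S^Y_\Psi)^{\otimes2}\circ\hat\Delta^{\mathrm{mod}}_\star=\hat\Delta^{\mathrm{mod}}_\star\circ{}^\Gamma S^Y_\Psi\}.$$ **The stabilizer of $\hat\Delta^{\mathrm{alg}}_\star$.** Let $\hat{\mathcal{V}}_G$ be the complete graded $\mathbf{k}$-algebra generated by $e_0,e_1$ (degree $1$) and the elements $g\in G$ (degree $0$), with relations $g\times h=gh$, $1_G=1$, $g\times e_0=e_0\times g$. For $a\in\mathbf{k}\langle\langle X\rangle\rangle$ let $\beta(a\otimes1)\in\hat{\mathcal{V}}_G$ be its image under the continuous algebra morphism $x_0\mapsto e_0$, $x_g\mapsto-g\,e_1\,g^{-1}$. Let $\mathrm{aut}^{\mathcal{V},(0)}_\Psi$ be the continuous algebra automorphism of $\hat{\mathcal{V}}_G$ with $e_0\mapsto e_0$, $e_1\mapsto\beta(\Psi^{-1}\otimes1)\,e_1\,\beta(\Psi\otimes1)$, $g\mapsto g$, and, with $\mathrm{Ad}_u(v)=uvu^{-1}$, let $${}^\Gamma\mathrm{aut}^{\mathcal{V},(1)}_\Psi=\mathrm{Ad}_{\Gamma_\Psi^{-1}(-e_1)}\circ\mathrm{Ad}_{\beta(\Psi\otimes1)}\circ\mathrm{aut}^{\mathcal{V},(0)}_\Psi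 .$$ It restricts to an automorphism of the subalgebra $\hat{\mathcal{W}}_G=\mathbf{k}\oplus\hat{\mathcal{V}}_Ge_1$. Let $\varpi:\mathbf{k}\langle\langle Y\rangle\rangle\to\hat{\mathcal{W}}_G$ be the continuous algebra isomorphism $y_{n,g}\mapsto-e_0^{n-1}\,g\,e_1$, let ${}^\Gamma\mathrm{aut}^Y_\Psi=\varpi^{-1}\circ{}^\Gamma\mathrm{aut}^{\mathcal{V},(1)}_\Psi|_{\hat{\mathcal{W}}_G}\circ\varpi$, and $$\mathsf{Stab}(\hat\Delta^{\mathrm{alg}}_\star)(\mathbf{k})=\{\Psi\in\mathcal{G}\mid({}^\Gamma\mathrm{aut}^Y_\Psi)^{\otimes2}\circ\hat\Delta^{\mathrm{alg}}_\star=\hat\Delta^{\mathrm{alg}}_\star\circ{}^\Gamma\mathrm{aut}^Y_\Psi\}.$$ **The set $\mathsf{DMR}_0^G(\mathbf{k})$.** If $G$ is cyclic, it is the set of $\Psi\in\mathcal{G}$ such that, with $\Psi_\star=\bar{\mathbf{q}}\circ\pi_Y(\Gamma_\Psi^{-1}(x_1)\Psi)\in Q$: (i) $(\Psi|x_0)=(\Psi|x_1)=0$;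 (ii) $\hat\Delta^{\mathrm{mod}}_\star(\Psi_\star)=\Psi_\star\otimes\Psi_\star$; (iii) if $|G|\in\{1,2\}$, then $(\Psi|x_0x_1)=0$; (iv) if $|G|\ge3$, then $(\Psi|x_g-x_{g^{-1}})=0$ for all $g\in G$. **Statement.** For each choice of the sign $\varepsilon$: $(\mathcal{G},\circledast)$ is a group, $\mathsf{Stab}(\hat\Delta^{\mathrm{mod}}_\star)(\mathbf{k})$ and $\mathsf{Stab}(\hat\Delta^{\mathrm{alg}}_\star)(\mathbf{k})$ are subgroups of it, and $$\mathsf{Stab}(\hat\Delta^{\mathrm{mod}}_\star)(\mathbf{k})\subset\mathsf{Stab}(\hat\Delta^{\mathrm{alg}}_\star)(\mathbf{k}).$$ If moreover $G$ is cyclic, then $\mathsf{DMR}_0^G(\mathbf{k})\subset\mathsf{Stab}(\hat\Delta^{\mathrm{alg}}_\star)(\mathbf{k})$. -/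

import Mathlib

set_option linter.unusedSectionVars false

namespace DoubleShuffle

universe u v w

/-! ### Noncommutative formal series over a monoid -/

/-- Formal series `∑ₘ f(m) m` with coefficients in `K`, indexed by the elements `m` of `M`.
For `M` the free monoid on an alphabet `A` this is `K⟨⟨A⟩⟩`; for a product `M × N` it is the
completed tensor product of the series over `M` and the series over `N`. -/
@[ext] structure NCSeries (K : Type u) (M : Type v) : Type (max u v) where
  /-- The coefficient of the series at `m`. -/
  coeff : M → K

namespace NCSeries

section Module

variable {K : Type u} [CommRing K] {M : Type v}

instance : Zero (NCSeries K M) := ⟨⟨fun _ => 0⟩⟩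

instance : Add (NCSeries K M) := ⟨fun f g => ⟨fun m => f.coeff m + g.coeff m⟩⟩

instance : Neg (NCSeries K M) := ⟨fun f => ⟨fun m => -f.coeff m⟩⟩

instance : SMul K (NCSeries K M) := ⟨fun c f => ⟨fun m => c * f.coeff m⟩⟩

@[simp] theorem coeff_zero (m : M) : (0 : NCSeries K M).coeff m = 0 := rfl

@[simp] theorem coeff_add (f g : NCSeries K M) (m : M) :
    (f + g).coeff m = f.coeff m + g.coeff m := rfl

@[simp] theorem coeff_neg (f : NCSeries K M) (m : M) : (-f).coeff m = -f.coeff m := rfl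

@[simp] theorem coeff_smul (c : K) (f : NCSeries K M) (m : M) :
    (c • f).coeff m = c * f.coeff m := rfl

instance : AddCommGroup (NCSeries K M) where
  add_assoc f g h := by ext m; simp [add_assoc]
  zero_add f := by ext m; simp
  add_zero f := by ext m; simp
  add_comm f g := by ext m; simp [add_comm]
  neg_add_cancel f := by ext m; simp
  nsmul := nsmulRec
  zsmul := zsmulRec

instance : Module K (NCSeries K M) where
  one_smul f := by ext m; simp
  mul_smul a b f := by ext m; simp [mul_assoc]
  smul_zero a := by ext m; simp
  smul_add a f g := by ext m; simp [mul_add]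
  add_smul a b f := by ext m; simp [add_mul]
  zero_smul f := by ext m; simp

open Classical in
/-- The basis series attached to `m : M`: coefficient `1` at `m` and `0` elsewhere. -/
noncomputable def basis (K : Type u) [CommRing K] {M : Type v} (m : M) : NCSeries K M :=
  ⟨fun n => if n = m then 1 else 0⟩

theorem coeff_basis_self (m : M) : (basis K m).coeff m = 1 := if_pos rfl

theorem coeff_basis_of_ne {m n : M} (h : n ≠ m) : (basis K m).coeff n = 0 := if_neg h

end Module

section Ring

variable {K : Type u} [CommRing K] {M : Type v} [Monoid M] [Finset.HasMulAntidiagonal M]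

noncomputable instance : One (NCSeries K M) := ⟨basis K 1⟩

/-- The Cauchy product `(f g)(m) = ∑_{a b = m} f(a) g(b)`. -/
instance : Mul (NCSeries K M) :=
  ⟨fun f g => ⟨fun m =>
    ∑ p ∈ Finset.HasMulAntidiagonal.mulAntidiagonal m, f.coeff p.1 * g.coeff p.2⟩⟩

theorem coeff_mul (f g : NCSeries K M) (m : M) :
    (f * g).coeff m =
      ∑ p ∈ Finset.HasMulAntidiagonal.mulAntidiagonal m, f.coeff p.1 * g.coeff p.2 := rfl

theorem one_def : (1 : NCSeries K M) = basis K 1 := rfl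

theorem basis_mul_basis (a b : M) : basis K a * basis K b = basis K (a * b) := by
  classical
  ext m
  rw [coeff_mul]
  by_cases h : m = a * b
  · subst h
    rw [Finset.sum_eq_single (a, b)]
    · simp [coeff_basis_self]
    · rintro ⟨c, d⟩ - hne
      by_cases hc : c = a
      · have hd : d ≠ b := by rintro rfl; exact hne (by rw [hc])
        simp [coeff_basis_of_ne hd]
      · simp [coeff_basis_of_ne hc]
    · simp
  · refine (Finset.sum_eq_zero ?_).trans (coeff_basis_of_ne h).symm
    rintro ⟨c, d⟩ hcd
    rw [Finset.HasMulAntidiagonal.mem_mulAntidiagonal] at hcd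
    by_cases hc : c = a
    · have hd : d ≠ b := by rintro rfl; exact h (by rw [← hcd, hc])
      simp [coeff_basis_of_ne hd]
    · simp [coeff_basis_of_ne hc]

noncomputable instance : Ring (NCSeries K M) where
  __ := (inferInstance : AddCommGroup (NCSeries K M))
  left_distrib f g h := by
    ext m; simp only [coeff_mul, coeff_add, mul_add, Finset.sum_add_distrib]
  right_distrib f g h := by
    ext m; simp only [coeff_mul, coeff_add, add_mul, Finset.sum_add_distrib]
  zero_mul f := by ext m; simp [coeff_mul]
  mul_zero f := by ext m; simp [coeff_mul]
  mul_assoc f g h := by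
    ext m
    simp only [coeff_mul, Finset.sum_mul, Finset.mul_sum, Finset.sum_sigma']
    refine Finset.sum_nbij' (fun x => ⟨(x.2.1, x.2.2 * x.1.2), (x.2.2, x.1.2)⟩)
      (fun x => ⟨(x.1.1 * x.2.1, x.2.2), (x.1.1, x.2.1)⟩) ?_ ?_ ?_ ?_ ?_
    · rintro ⟨⟨a, b⟩, ⟨c, d⟩⟩ h
      simp only [Finset.mem_sigma, Finset.HasMulAntidiagonal.mem_mulAntidiagonal] at h ⊢
      obtain ⟨h1, h2⟩ := h
      subst h2; subst h1
      simp [mul_assoc]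
    · rintro ⟨⟨a, b⟩, ⟨c, d⟩⟩ h
      simp only [Finset.mem_sigma, Finset.HasMulAntidiagonal.mem_mulAntidiagonal] at h ⊢
      obtain ⟨h1, h2⟩ := h
      subst h2; subst h1
      simp [mul_assoc]
    · rintro ⟨⟨a, b⟩, ⟨c, d⟩⟩ h
      simp only [Finset.mem_sigma, Finset.HasMulAntidiagonal.mem_mulAntidiagonal] at h
      obtain ⟨h1, h2⟩ := h
      subst h2; subst h1
      rfl
    · rintro ⟨⟨a, b⟩, ⟨c, d⟩⟩ h
      simp only [Finset.mem_sigma, Finset.HasMulAntidiagonal.mem_mulAntidiagonal] at h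
      obtain ⟨h1, h2⟩ := h
      subst h2; subst h1
      rfl
    · rintro ⟨⟨a, b⟩, ⟨c, d⟩⟩ _
      simp [mul_assoc]
  one_mul f := by
    ext m
    rw [coeff_mul, Finset.sum_eq_single (1, m)]
    · simp [one_def, coeff_basis_self]
    · rintro ⟨a, b⟩ h hne
      rw [Finset.HasMulAntidiagonal.mem_mulAntidiagonal] at h
      have ha : a ≠ 1 := by
        rintro rfl
        exact hne (by simp_all)
      simp [one_def, coeff_basis_of_ne ha]
    · simp
  mul_one f := by
    ext m
    rw [coeff_mul, Finset.sum_eq_single (m, 1)]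
    · simp [one_def, coeff_basis_self]
    · rintro ⟨a, b⟩ h hne
      rw [Finset.HasMulAntidiagonal.mem_mulAntidiagonal] at h
      have hb : b ≠ 1 := by
        rintro rfl
        exact hne (by simp_all)
      simp [one_def, coeff_basis_of_ne hb]
    · simp

noncomputable instance : Algebra K (NCSeries K M) :=
  Algebra.ofModule
    (fun r x y => by ext m; simp only [coeff_mul, coeff_smul, Finset.mul_sum, mul_assoc])
    (fun r x y => by
      ext m; simp only [coeff_mul, coeff_smul, Finset.mul_sum]
      exact Finset.sum_congr rfl fun p _ => by ring)

end Ring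

section Maps

variable {K : Type u} [CommRing K] {M : Type v} {N : Type w}

open Classical in
/-- The continuous `K`-linear map with `i ↦ φ i` on basis elements, that is
`∑ᵢ f(i) i ↦ ∑ᵢ f(i) φ(i)`. Every family `φ` to which this is applied below is such that only
finitely many `φ i` have a nonzero coefficient at a given `n`; coefficients for which this fails
are set to `0`. If `φ` is a monoid homomorphism, this is the extension of `φ` to a continuous
algebra homomorphism. -/
noncomputable def lsum (φ : M → NCSeries K N) : NCSeries K M →ₗ[K] NCSeries K N where
  toFun f := ⟨fun n =>
    if h : {i | (φ i).coeff n ≠ 0}.Finite then ∑ i ∈ h.toFinset, f.coeff i * (φ i).coeff n else 0⟩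
  map_add' f g := by
    ext n
    by_cases h : {i | (φ i).coeff n ≠ 0}.Finite
    · simp only [h, dite_true, coeff_add, add_mul, Finset.sum_add_distrib]
    · simp only [h, dite_false, coeff_add, add_zero]
  map_smul' c f := by
    ext n
    by_cases h : {i | (φ i).coeff n ≠ 0}.Finite
    · simp only [h, dite_true, coeff_smul, Finset.mul_sum, mul_assoc, RingHom.id_apply]
    · simp only [h, dite_false, coeff_smul, mul_zero]

/-- The linear map `∑ₙ f(n) n ↦ ∑ₘ f(r(m)) m`. -/
def reindex (r : M → N) : NCSeries K N →ₗ[K] NCSeries K M where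
  toFun f := ⟨fun m => f.coeff (r m)⟩
  map_add' _ _ := rfl
  map_smul' _ _ := rfl

/-- The linear map `∑ₘ f(m) m ↦ ∑ₘ f(m) j(m)`, for an injective map `j`. -/
noncomputable def extend (j : M → N) : NCSeries K M →ₗ[K] NCSeries K N where
  toFun f := ⟨Function.ExtendByZero.linearMap K j f.coeff⟩
  map_add' f g := by
    ext n
    exact congrFun ((Function.ExtendByZero.linearMap K j).map_add f.coeff g.coeff) n
  map_smul' c f := by
    ext n
    exact congrFun ((Function.ExtendByZero.linearMap K j).map_smul c f.coeff) n

/-- `f ⊗ g`. -/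
def tmul (f : NCSeries K M) (g : NCSeries K N) : NCSeries K (M × N) :=
  ⟨fun p => f.coeff p.1 * g.coeff p.2⟩

/-- The completed tensor square `T ⊗̂ T` of a continuous linear map `T`: apply `T` to the second
tensor factor, then to the first one. -/
def tensorSq (T : NCSeries K M →ₗ[K] NCSeries K N) :
    NCSeries K (M × M) →ₗ[K] NCSeries K (N × N) where
  toFun F := ⟨fun p => (T ⟨fun a => (T ⟨fun b => F.coeff (a, b)⟩).coeff p.2⟩).coeff p.1⟩
  map_add' F F' := by
    ext p
    have h1 : ∀ a, T ⟨fun b => (F + F').coeff (a, b)⟩ =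
        T ⟨fun b => F.coeff (a, b)⟩ + T ⟨fun b => F'.coeff (a, b)⟩ := fun a =>
      T.map_add ⟨fun b => F.coeff (a, b)⟩ ⟨fun b => F'.coeff (a, b)⟩
    simp only [h1]
    exact congrArg (fun f => f.coeff p.1)
      (T.map_add ⟨fun a => (T ⟨fun b => F.coeff (a, b)⟩).coeff p.2⟩
        ⟨fun a => (T ⟨fun b => F'.coeff (a, b)⟩).coeff p.2⟩)
  map_smul' c F := by
    ext p
    have h1 : ∀ a, T ⟨fun b => (c • F).coeff (a, b)⟩ = c • T ⟨fun b => F.coeff (a, b)⟩ :=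
      fun a => T.map_smul c ⟨fun b => F.coeff (a, b)⟩
    simp only [h1]
    exact congrArg (fun f => f.coeff p.1)
      (T.map_smul c ⟨fun a => (T ⟨fun b => F.coeff (a, b)⟩).coeff p.2⟩)

/-- The value `p(a) = ∑ₙ pₙ aⁿ` of a power series `p` at a series `a`
(used for `a` homogeneous of degree one). -/
noncomputable def evalPS [Monoid M] [Finset.HasMulAntidiagonal M] (p : PowerSeries K)
    (a : NCSeries K M) : NCSeries K M :=
  lsum (fun n : ℕ => a ^ n) ⟨fun n => PowerSeries.coeff n p⟩

end Maps

end NCSeries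

/-! ### Finiteness of factorisations in the monoids that are used -/

/-- The factorisations `p.1 * p.2 = m` in a monoid in which every `m` has finitely many of them. -/
noncomputable abbrev mulAntidiagonalOfFinite {M : Type v} [Monoid M]
    (h : ∀ m : M, {p : M × M | p.1 * p.2 = m}.Finite) : Finset.HasMulAntidiagonal M where
  mulAntidiagonal m := (h m).toFinset
  mem_mulAntidiagonal := by simp

noncomputable instance instFreeMonoid {A : Type v} : Finset.HasMulAntidiagonal (FreeMonoid A) :=
  mulAntidiagonalOfFinite fun m => by
    refine ((Set.finite_le_nat (FreeMonoid.toList m).length).image fun i =>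
      (FreeMonoid.ofList ((FreeMonoid.toList m).take i),
        FreeMonoid.ofList ((FreeMonoid.toList m).drop i))).subset ?_
    rintro ⟨a, b⟩ (rfl : a * b = m)
    exact ⟨(FreeMonoid.toList a).length, by simp, by simp⟩

noncomputable instance instProd {M : Type v} {N : Type w} [Monoid M] [Monoid N]
    [Finset.HasMulAntidiagonal M] [Finset.HasMulAntidiagonal N] : Finset.HasMulAntidiagonal (M × N) :=
  mulAntidiagonalOfFinite fun m => by
    refine (((Finset.HasMulAntidiagonal.mulAntidiagonal m.1).finite_toSet.prod (Finset.HasMulAntidiagonal.mulAntidiagonal m.2).finite_toSet).image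
      fun x => ((x.1.1, x.2.1), (x.1.2, x.2.2))).subset ?_
    rintro ⟨⟨a, b⟩, ⟨c, d⟩⟩ (rfl : (a, b) * (c, d) = m)
    exact ⟨((a, c), (b, d)), by simp, rfl⟩

/-! ### The Hopf algebra `K⟨⟨X⟩⟩` and its group-like elements -/

section Racinet

variable (K : Type u) [CommRing K] (G : Type v) [CommGroup G]

/-- Words in the alphabet `X = {x₀} ⊔ {x_g | g ∈ G}`; `none` is `x₀` and `some g` is `x_g`. -/
abbrev XWord (G : Type v) : Type v := FreeMonoid (Option G)

/-- Words in the alphabet `Y = {y_{n,g} | n ≥ 1, g ∈ G}`. -/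
abbrev YWord (G : Type v) : Type v := FreeMonoid (ℕ+ × G)

/-- `K⟨⟨X⟩⟩` -/
abbrev KX : Type (max u v) := NCSeries K (XWord G)

/-- `K⟨⟨X⟩⟩ ⊗̂ K⟨⟨X⟩⟩` -/
abbrev KXX : Type (max u v) := NCSeries K (XWord G × XWord G)

/-- `K⟨⟨Y⟩⟩` -/
abbrev KY : Type (max u v) := NCSeries K (YWord G)

/-- `K⟨⟨Y⟩⟩ ⊗̂ K⟨⟨Y⟩⟩` -/
abbrev KYY : Type (max u v) := NCSeries K (YWord G × YWord G)

variable {G}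

/-- The letter `x₀` as a word. -/
def w0 : XWord G := FreeMonoid.of none

/-- The letter `x_g` as a word. -/
def wg (g : G) : XWord G := FreeMonoid.of (some g)

/-- The element `x₀` of `K⟨⟨X⟩⟩`. -/
noncomputable def x0 : KX K G := NCSeries.basis K w0

/-- The element `x_g` of `K⟨⟨X⟩⟩`. -/
noncomputable def xg (g : G) : KX K G := NCSeries.basis K (wg g)

/-- The coproduct of `K⟨⟨X⟩⟩`: the continuous algebra homomorphism for which all letters are
primitive. -/
noncomputable def coprod : KX K G →ₗ[K] KXX K G :=
  NCSeries.lsum (FreeMonoid.lift fun a : Option G =>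
    (NCSeries.basis K (FreeMonoid.of a, 1) + NCSeries.basis K (1, FreeMonoid.of a) : KXX K G))

variable (G) in
/-- The set of group-like elements of `K⟨⟨X⟩⟩`. -/
def GroupLike : Type (max u v) :=
  {Ψ : (KX K G)ˣ // coprod K (Ψ : KX K G) = NCSeries.tmul (Ψ : KX K G) (Ψ : KX K G)}

variable {K}

/-- The series underlying a group-like element. -/
def GroupLike.ser (Ψ : GroupLike K G) : KX K G := ((Ψ.1 : (KX K G)ˣ) : KX K G)

/-- The inverse, for the product of `K⟨⟨X⟩⟩`, of a group-like element. -/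
noncomputable def GroupLike.serInv (Ψ : GroupLike K G) : KX K G := ((Ψ.1⁻¹ : (KX K G)ˣ) : KX K G)

variable (K)

/-- The automorphism `t_g` of `K⟨⟨X⟩⟩` with `x₀ ↦ x₀`, `x_h ↦ x_{gh}`: the coefficient of
`t_g(f)` at a word `w` is the coefficient of `f` at `t_{g⁻¹}(w)`. -/
def tAct (g : G) : KX K G →ₗ[K] KX K G :=
  NCSeries.reindex (FreeMonoid.map (Option.map (g⁻¹ * ·)))

variable {K}

/-- The continuous algebra automorphism `aut_Ψ` of `K⟨⟨X⟩⟩`: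
`x₀ ↦ x₀`, `x_g ↦ t_g(Ψ⁻¹) x_g t_g(Ψ)`. -/
noncomputable def autX (Ψ : GroupLike K G) : KX K G →ₗ[K] KX K G :=
  NCSeries.lsum (FreeMonoid.lift fun a : Option G =>
    match a with
    | none => x0 K
    | some g => tAct K g Ψ.serInv * xg K g * tAct K g Ψ.ser)

/-- `S_Ψ(a) = Ψ aut_Ψ(a)`; on group-like elements, `Ψ ⊛ Φ = S_Ψ(Φ)`. -/
noncomputable def S (Ψ : GroupLike K G) : KX K G →ₗ[K] KX K G :=
  LinearMap.mulLeft K Ψ.ser ∘ₗ autX Ψ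

/-! ### The map `q` -/

/-- The effect of `q` on a word: each letter `x_g` becomes `x_{g h⁻¹}`, where `x_h` is the
preceding letter different from `x₀` (and `h = p` if there is none). -/
def qList : G → List (Option G) → List (Option G)
  | _, [] => []
  | p, none :: l => none :: qList p l
  | p, some g :: l => some (g * p⁻¹) :: qList g l

/-- The inverse of `qList`. -/
def qInvList : G → List (Option G) → List (Option G)
  | _, [] => []
  | p, none :: l => none :: qInvList p l
  | p, some g :: l => some (g * p) :: qInvList (g * p) l

theorem qInvList_qList (p : G) (l : List (Option G)) : qInvList p (qList p l) = l := by
  induction l generalizing p with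
  | nil => rfl
  | cons a l ih => cases a <;> simp [qList, qInvList, ih]

theorem qList_qInvList (p : G) (l : List (Option G)) : qList p (qInvList p l) = l := by
  induction l generalizing p with
  | nil => rfl
  | cons a l ih => cases a <;> simp [qList, qInvList, ih]

theorem qList_append_none (p : G) (l : List (Option G)) :
    qList p (l ++ [none]) = qList p l ++ [none] := by
  induction l generalizing p with
  | nil => rfl
  | cons a l ih => cases a <;> simp [qList, ih]

theorem qInvList_append_none (p : G) (l : List (Option G)) :
    qInvList p (l ++ [none]) = qInvList p l ++ [none] := by
  induction l generalizing p with
  | nil => rfl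
  | cons a l ih => cases a <;> simp [qInvList, ih]

/-- The permutation of the words in `X` given by
`x₀^{n₁-1} x_{g₁} x₀^{n₂-1} x_{g₂} ⋯ ↦ x₀^{n₁-1} x_{g₁} x₀^{n₂-1} x_{g₂ g₁⁻¹} ⋯`. -/
def qWord : XWord G ≃ XWord G where
  toFun w := FreeMonoid.ofList (qList 1 (FreeMonoid.toList w))
  invFun w := FreeMonoid.ofList (qInvList 1 (FreeMonoid.toList w))
  left_inv w := by simp [qInvList_qList]
  right_inv w := by simp [qList_qInvList]

variable (K)

/-- The linear automorphism `q` of `K⟨⟨X⟩⟩` that sends each word `w` to `qWord w`. -/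
def q : KX K G ≃ₗ[K] KX K G :=
  { NCSeries.reindex qWord.symm with
    invFun := NCSeries.reindex qWord
    left_inv := fun f => by ext w; simp [NCSeries.reindex]
    right_inv := fun f => by ext w; simp [NCSeries.reindex] }

/-! ### The quotient `K⟨⟨X⟩⟩ / K⟨⟨X⟩⟩ x₀` and its completed tensor square -/

variable (G)

/-- The submodule `K⟨⟨X⟩⟩ x₀`. -/
noncomputable def I0 : Submodule K (KX K G) := LinearMap.range (LinearMap.mulRight K (x0 K : KX K G))

/-- The kernel of the projection from `K⟨⟨X⟩⟩^{⊗̂ 2}` to the completed tensor square of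
`K⟨⟨X⟩⟩ / K⟨⟨X⟩⟩ x₀`: the multiples on the right of `x₀ ⊗ 1` and of `1 ⊗ x₀`, and their sums. -/
noncomputable def I00 : Submodule K (KXX K G) :=
  LinearMap.range (LinearMap.mulRight K (NCSeries.basis K (w0, 1) : KXX K G)) ⊔
    LinearMap.range (LinearMap.mulRight K (NCSeries.basis K (1, w0) : KXX K G))

/-- `K⟨⟨X⟩⟩ / K⟨⟨X⟩⟩ x₀` -/
abbrev QX : Type (max u v) := KX K G ⧸ I0 K G

/-- The completed tensor square of `K⟨⟨X⟩⟩ / K⟨⟨X⟩⟩ x₀`. -/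
abbrev QXX : Type (max u v) := KXX K G ⧸ I00 K G

/-- The projection `π_Y`. -/
noncomputable def piY : KX K G →ₗ[K] QX K G := (I0 K G).mkQ

/-- The projection `π_Y ⊗̂ π_Y`. -/
noncomputable def piYY : KXX K G →ₗ[K] QXX K G := (I00 K G).mkQ

variable {K G}

theorem coeff_mul_basis {M : Type v} [CancelMonoid M] [Finset.HasMulAntidiagonal M]
    (f : NCSeries K M) (c m : M) : (f * NCSeries.basis K c).coeff (m * c) = f.coeff m := by
  rw [NCSeries.coeff_mul, Finset.sum_eq_single (m, c)]
  · simp [NCSeries.coeff_basis_self]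
  · rintro ⟨a, b⟩ h hne
    rw [Finset.HasMulAntidiagonal.mem_mulAntidiagonal] at h
    have hb : b ≠ c := by
      rintro rfl
      exact hne (by simpa using h)
    simp [NCSeries.coeff_basis_of_ne hb]
  · simp

theorem coeff_mul_basis_of_not {M : Type v} [Monoid M] [Finset.HasMulAntidiagonal M]
    (f : NCSeries K M) (c n : M) (h : ∀ m, m * c ≠ n) :
    (f * NCSeries.basis K c).coeff n = 0 := by
  rw [NCSeries.coeff_mul]
  refine Finset.sum_eq_zero ?_
  rintro ⟨a, b⟩ hab
  rw [Finset.HasMulAntidiagonal.mem_mulAntidiagonal] at hab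
  have hb : b ≠ c := by
    rintro rfl
    exact h a hab
  simp [NCSeries.coeff_basis_of_ne hb]

theorem mem_range_mulRight_basis {M : Type v} [CancelMonoid M] [Finset.HasMulAntidiagonal M]
    (f : NCSeries K M) (c : M) :
    f ∈ LinearMap.range (LinearMap.mulRight K (NCSeries.basis K c)) ↔
      ∀ n, (∀ m, m * c ≠ n) → f.coeff n = 0 := by
  constructor
  · rintro ⟨g, rfl⟩ n hn
    exact coeff_mul_basis_of_not g c n hn
  · intro h
    refine ⟨⟨fun m => f.coeff (m * c)⟩, ?_⟩
    ext n
    by_cases hn : ∀ m, m * c ≠ n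
    · rw [h n hn]
      exact coeff_mul_basis_of_not _ c n hn
    · push Not at hn
      obtain ⟨m, rfl⟩ := hn
      exact coeff_mul_basis _ c m

/-- `K⟨⟨X⟩⟩ x₀` consists of the series that vanish at all words that do not end in `x₀`. -/
theorem mem_I0 (f : KX K G) : f ∈ I0 K G ↔ ∀ n, (∀ m : XWord G, m * w0 ≠ n) → f.coeff n = 0 :=
  mem_range_mulRight_basis f w0

theorem mem_I00 (F : KXX K G) :
    F ∈ I00 K G ↔
      ∀ a b, (∀ m : XWord G, m * w0 ≠ a) → (∀ m : XWord G, m * w0 ≠ b) → F.coeff (a, b) = 0 := by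
  classical
  rw [I00, Submodule.mem_sup]
  constructor
  · rintro ⟨A, hA, B, hB, rfl⟩ a b ha hb
    rw [mem_range_mulRight_basis] at hA hB
    rw [NCSeries.coeff_add, hA, hB, add_zero]
    · rintro ⟨m, m'⟩ h
      exact hb m' (congrArg Prod.snd h)
    · rintro ⟨m, m'⟩ h
      exact ha m (congrArg Prod.fst h)
  · intro h
    refine ⟨⟨fun p => if ∃ m : XWord G, m * w0 = p.1 then F.coeff p else 0⟩, ?_,
      ⟨fun p => if ∃ m : XWord G, m * w0 = p.1 then 0 else F.coeff p⟩, ?_, ?_⟩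
    · rw [mem_range_mulRight_basis]
      rintro ⟨a, b⟩ hn
      refine if_neg ?_
      rintro ⟨m, hm⟩
      exact hn (m, b) (by simpa using hm)
    · rw [mem_range_mulRight_basis]
      rintro ⟨a, b⟩ hn
      by_cases ha : ∃ m : XWord G, m * w0 = a
      · exact if_pos ha
      · refine (if_neg ha).trans (h a b (by simpa using ha) ?_)
        intro m hm
        exact hn (a, m) (by simpa using hm)
    · ext p
      rw [NCSeries.coeff_add]
      by_cases ha : ∃ m : XWord G, m * w0 = p.1
      · exact (congrArg₂ (· + ·) (if_pos ha) (if_pos ha)).trans (add_zero _)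
      · exact (congrArg₂ (· + ·) (if_neg ha) (if_neg ha)).trans (zero_add _)

/-- If `T` preserves `K⟨⟨X⟩⟩ x₀`, then `T ⊗̂ T` passes to the quotient. -/
theorem I00_le_comap {T : KX K G →ₗ[K] KX K G} (hT : I0 K G ≤ (I0 K G).comap T) :
    I00 K G ≤ (I00 K G).comap (NCSeries.tensorSq T) := by
  intro F hF
  rw [mem_I00] at hF
  rw [Submodule.mem_comap, mem_I00]
  intro a b ha hb
  have key : ∀ f : KX K G, (∀ n, (∀ m : XWord G, m * w0 ≠ n) → f.coeff n = 0) →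
      ∀ n, (∀ m : XWord G, m * w0 ≠ n) → (T f).coeff n = 0 := fun f hf =>
    (mem_I0 _).1 (hT ((mem_I0 f).2 hf))
  refine key ⟨fun a => (T ⟨fun b => F.coeff (a, b)⟩).coeff b⟩ ?_ a ha
  intro a' ha'
  exact key ⟨fun b => F.coeff (a', b)⟩ (fun b' hb' => hF a' b' ha' hb') b hb

/-- The endomorphism of `K⟨⟨X⟩⟩ / K⟨⟨X⟩⟩ x₀` induced by `T`. -/
noncomputable def quotMap (T : KX K G →ₗ[K] KX K G) (hT : I0 K G ≤ (I0 K G).comap T) :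
    QX K G →ₗ[K] QX K G := (I0 K G).mapQ (I0 K G) T hT

/-- The completed tensor square of `quotMap T hT`. -/
noncomputable def quotMapSq (T : KX K G →ₗ[K] KX K G) (hT : I0 K G ≤ (I0 K G).comap T) :
    QXX K G →ₗ[K] QXX K G :=
  (I00 K G).mapQ (I00 K G) (NCSeries.tensorSq T) (I00_le_comap hT)

theorem ends_iff (n : XWord G) : (∀ m : XWord G, m * w0 ≠ n) ↔ ∀ m, m * w0 ≠ qWord n := by
  have h1 : ∀ m : XWord G, qWord (m * w0) = qWord m * w0 := fun m => by
    simp [qWord, w0, qList_append_none]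
  constructor
  · intro h m hm
    refine h (qWord.symm m) (qWord.injective ?_)
    rw [h1, Equiv.apply_symm_apply, hm]
  · rintro h m rfl
    exact h (qWord m) (h1 m).symm

theorem q_stable : I0 K G ≤ (I0 K G).comap (q K : KX K G ≃ₗ[K] KX K G).toLinearMap := by
  intro f hf
  rw [mem_I0] at hf
  rw [Submodule.mem_comap, mem_I0]
  intro n hn
  refine hf (qWord.symm n) ?_
  rw [ends_iff, Equiv.apply_symm_apply]
  exact hn

theorem q_symm_stable : I0 K G ≤ (I0 K G).comap (q K : KX K G ≃ₗ[K] KX K G).symm.toLinearMap := by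
  intro f hf
  rw [mem_I0] at hf
  rw [Submodule.mem_comap, mem_I0]
  intro n hn
  exact hf (qWord n) ((ends_iff n).1 hn)

theorem mulLeft_stable (a : KX K G) : I0 K G ≤ (I0 K G).comap (LinearMap.mulLeft K a) := by
  rintro _ ⟨g, rfl⟩
  exact ⟨a * g, by simp [mul_assoc]⟩

theorem autX_stable (Ψ : GroupLike K G) : I0 K G ≤ (I0 K G).comap (autX Ψ) := by
  intro f hf
  rw [mem_I0] at hf
  rw [Submodule.mem_comap, mem_I0]
  intro n hn
  simp only [autX, NCSeries.lsum, LinearMap.coe_mk, AddHom.coe_mk]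
  split_ifs with h
  · refine Finset.sum_eq_zero fun m _ => ?_
    by_cases hm : ∀ m' : XWord G, m' * w0 ≠ m
    · rw [hf m hm, zero_mul]
    · push Not at hm
      obtain ⟨m', rfl⟩ := hm
      rw [map_mul, w0, FreeMonoid.lift_eval_of, x0, coeff_mul_basis_of_not _ _ _ hn, mul_zero]
  · rfl

theorem comap_comp {T U : KX K G →ₗ[K] KX K G} (hT : I0 K G ≤ (I0 K G).comap T)
    (hU : I0 K G ≤ (I0 K G).comap U) : I0 K G ≤ (I0 K G).comap (T ∘ₗ U) :=
  fun _ hf => hT (hU hf)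

/-! ### The harmonic coproducts -/

variable (K)

/-- The letter `y_{n,g}` as a word. -/
def yw (n : ℕ+) (g : G) : YWord G := FreeMonoid.of (n, g)

/-- The harmonic coproduct `Δ⋆^alg`: the continuous algebra homomorphism with
`y_{n,g} ↦ y_{n,g} ⊗ 1 + 1 ⊗ y_{n,g} + ∑_{0<k<n, h ∈ G} y_{k,h} ⊗ y_{n-k,gh⁻¹}`. -/
noncomputable def deltaAlg [Fintype G] : KY K G →ₗ[K] KYY K G :=
  NCSeries.lsum (FreeMonoid.lift fun a : ℕ+ × G =>
    (NCSeries.basis K (yw a.1 a.2, 1) + NCSeries.basis K (1, yw a.1 a.2) +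
      ∑ k ∈ Finset.Ico 1 a.1, ∑ h : G,
        NCSeries.basis K (yw k h, yw (a.1 - k) (a.2 * h⁻¹)) : KYY K G))

/-- The embedding of the words in `Y` into the words in `X`: `y_{n,g} ↦ x₀^{n-1} x_g`. -/
def yToX : YWord G →* XWord G :=
  FreeMonoid.lift fun a : ℕ+ × G => w0 ^ ((a.1 : ℕ) - 1) * wg a.2

/-- The inclusion `K⟨⟨Y⟩⟩ ⊗̂ K⟨⟨Y⟩⟩ ⊂ K⟨⟨X⟩⟩ ⊗̂ K⟨⟨X⟩⟩`. -/
noncomputable def inclYY : KYY K G →ₗ[K] KXX K G :=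
  NCSeries.extend (Prod.map (yToX (G := G)) (yToX (G := G)))

/-- Restriction of the coefficients to the words in `Y`. -/
def restrY : KX K G →ₗ[K] KY K G := NCSeries.reindex yToX

theorem yToX_not_ends (w : YWord G) (m : XWord G) : m * w0 ≠ yToX w := by
  have key : ∀ (a b : XWord G) (g : G), a * w0 ≠ b * wg g := by
    intro a b g h
    have h' := congrArg (fun x => (FreeMonoid.toList x).getLast?) h
    simp [w0, wg] at h'
  rcases List.eq_nil_or_concat (FreeMonoid.toList w) with hw | ⟨l, b, hw⟩
  · have h1 : w = 1 := hw
    intro h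
    rw [h1, map_one] at h
    have h' := congrArg FreeMonoid.length h
    simp [w0] at h'
  · have h1 : w = FreeMonoid.ofList l * FreeMonoid.of b := by
      rw [← FreeMonoid.ofList_toList w, hw]
      simp [FreeMonoid.ofList_append]
    intro h
    rw [h1, map_mul, yToX, FreeMonoid.lift_eval_of, ← mul_assoc] at h
    exact key _ _ _ h

/-- The inverse of the bijection `K⟨⟨Y⟩⟩ → K⟨⟨X⟩⟩ / K⟨⟨X⟩⟩ x₀`, `f ↦ π_Y(f)`. -/
noncomputable def piYInv : QX K G →ₗ[K] KY K G :=
  (I0 K G).liftQ (restrY K) (fun f hf => by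
    rw [LinearMap.mem_ker]
    ext w
    exact (mem_I0 f).1 hf _ (yToX_not_ends w))

/-- The coproduct `Δ⋆^mod` of `K⟨⟨X⟩⟩ / K⟨⟨X⟩⟩ x₀`, which corresponds to `Δ⋆^alg` under the
bijection `π_Y` from `K⟨⟨Y⟩⟩`. -/
noncomputable def deltaMod [Fintype G] : QX K G →ₗ[K] QXX K G :=
  piYY K G ∘ₗ inclYY K ∘ₗ deltaAlg K ∘ₗ piYInv K

/-! ### The series `Γ_Ψ` and the stabiliser of `Δ⋆^mod` -/

variable {K}

/-- `Γ_Ψ(x) = exp (ε ∑_{n ≥ 2} (-1)^{n-1}/n (Ψ | x₀^{n-1} x₁) xⁿ)`, for a sign `ε`. -/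
noncomputable def Gam [Algebra ℚ K] (ε : ℤˣ) (Ψ : GroupLike K G) : PowerSeries K :=
  (PowerSeries.exp K).subst (PowerSeries.mk fun n : ℕ =>
    if 2 ≤ n then (((ε : ℤ) : ℚ) * (-1) ^ (n - 1) / n) • Ψ.ser.coeff (w0 ^ (n - 1) * wg 1) else 0)

/-- `Γ_Ψ⁻¹(x₁)` -/
noncomputable def GamInvX [Algebra ℚ K] (ε : ℤˣ) (Ψ : GroupLike K G) : KX K G :=
  NCSeries.evalPS (Ring.inverse (Gam ε Ψ)) (xg K 1)

/-- The endomorphism `S_Ψ^Y` of `K⟨⟨X⟩⟩ / K⟨⟨X⟩⟩ x₀` with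
`S_Ψ^Y ∘ (q ∘ π_Y) = (q ∘ π_Y) ∘ S_Ψ` is induced by this endomorphism of `K⟨⟨X⟩⟩`. -/
noncomputable def SYLift (Ψ : GroupLike K G) : KX K G →ₗ[K] KX K G :=
  (q K).toLinearMap ∘ₗ S Ψ ∘ₗ (q K).symm.toLinearMap

/-- The endomorphism `v ↦ Γ_Ψ⁻¹(x₁) S_Ψ^Y(v)`, lifted to `K⟨⟨X⟩⟩`. -/
noncomputable def GamSYLift [Algebra ℚ K] (ε : ℤˣ) (Ψ : GroupLike K G) : KX K G →ₗ[K] KX K G :=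
  LinearMap.mulLeft K (GamInvX ε Ψ) ∘ₗ SYLift Ψ

theorem GamSYLift_stable [Algebra ℚ K] (ε : ℤˣ) (Ψ : GroupLike K G) :
    I0 K G ≤ (I0 K G).comap (GamSYLift ε Ψ) :=
  comap_comp (mulLeft_stable _) (comap_comp q_stable
    (comap_comp (comap_comp (mulLeft_stable _) (autX_stable Ψ)) q_symm_stable))

/-- The automorphism `^Γ S_Ψ^Y` of `K⟨⟨X⟩⟩ / K⟨⟨X⟩⟩ x₀`. -/
noncomputable def GamSY [Algebra ℚ K] (ε : ℤˣ) (Ψ : GroupLike K G) : QX K G →ₗ[K] QX K G :=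
  quotMap (GamSYLift ε Ψ) (GamSYLift_stable ε Ψ)

/-- The completed tensor square of `^Γ S_Ψ^Y`. -/
noncomputable def GamSYSq [Algebra ℚ K] (ε : ℤˣ) (Ψ : GroupLike K G) : QXX K G →ₗ[K] QXX K G :=
  quotMapSq (GamSYLift ε Ψ) (GamSYLift_stable ε Ψ)

variable (K G)

/-- `Stab(Δ⋆^mod)(K)` -/
def stabMod [Fintype G] [Algebra ℚ K] (ε : ℤˣ) : Set (GroupLike K G) :=
  {Ψ | GamSYSq ε Ψ ∘ₗ deltaMod K = deltaMod K ∘ₗ GamSY ε Ψ}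

/-! ### The algebra `V_G` and the stabiliser of `Δ⋆^alg` -/

/-- The generators `e₀`, `e₁` and `g ∈ G` of `V_G`. -/
inductive VGen (G : Type v) : Type v
  | e0 : VGen G
  | e1 : VGen G
  | grp : G → VGen G

/-- The relations `g × h = gh`, `1_G = 1`, `g × e₀ = e₀ × g`. -/
inductive VRel (G : Type v) [CommGroup G] : FreeMonoid (VGen G) → FreeMonoid (VGen G) → Prop
  | mul (g h : G) : VRel G (FreeMonoid.of (VGen.grp g) * FreeMonoid.of (VGen.grp h))
      (FreeMonoid.of (VGen.grp (g * h)))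
  | one : VRel G (FreeMonoid.of (VGen.grp 1)) 1
  | comm (g : G) : VRel G (FreeMonoid.of (VGen.grp g) * FreeMonoid.of VGen.e0)
      (FreeMonoid.of VGen.e0 * FreeMonoid.of (VGen.grp g))

/-- The monoid presented by these generators and relations. -/
abbrev VMonoid : Type v := PresentedMonoid (VRel G)

variable {G}

/-- `e₀` in `VMonoid G` -/
def ve0 : VMonoid G := PresentedMonoid.of (VRel G) VGen.e0

/-- `e₁` in `VMonoid G` -/
def ve1 : VMonoid G := PresentedMonoid.of (VRel G) VGen.e1

/-- `g ∈ G` in `VMonoid G` -/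
def vgrp (g : G) : VMonoid G := PresentedMonoid.of (VRel G) (VGen.grp g)

theorem vgrp_mul (g h : G) : vgrp g * vgrp h = vgrp (g * h) :=
  PresentedMonoid.mk_eq_mk_of_rel (VRel.mul g h)

theorem vgrp_one : vgrp (1 : G) = 1 := PresentedMonoid.mk_eq_mk_of_rel VRel.one

theorem vgrp_comm (g : G) : vgrp g * ve0 = ve0 * vgrp g :=
  PresentedMonoid.mk_eq_mk_of_rel (VRel.comm g)

variable (G) in
/-- The grading of `VMonoid G`: `e₀` and `e₁` have degree `1`, and `g ∈ G` has degree `0`. -/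
def vdeg : VMonoid G →* Multiplicative ℕ :=
  PresentedMonoid.lift
    (fun x => match x with
      | VGen.e0 => Multiplicative.ofAdd 1
      | VGen.e1 => Multiplicative.ofAdd 1
      | VGen.grp _ => 1)
    (by rintro _ _ (⟨g, h⟩ | _ | g) <;> simp)

variable (G) in
/-- The elements of `VMonoid G` of a given degree. -/
def vset : ℕ → Set (VMonoid G)
  | 0 => Set.range vgrp
  | n + 1 => Set.image2 (fun g b => vgrp g * ve0 * b) Set.univ (vset n) ∪
      Set.image2 (fun g b => vgrp g * ve1 * b) Set.univ (vset n)

theorem vset_finite [Finite G] (n : ℕ) : (vset G n).Finite := by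
  induction n with
  | zero => exact Set.finite_range _
  | succ n ih =>
    exact (Set.Finite.image2 _ Set.finite_univ ih).union (Set.Finite.image2 _ Set.finite_univ ih)

theorem vgrp_mul_mem (g : G) {n : ℕ} {b : VMonoid G} (hb : b ∈ vset G n) :
    vgrp g * b ∈ vset G n := by
  cases n with
  | zero =>
    obtain ⟨h, rfl⟩ := hb
    exact ⟨g * h, (vgrp_mul g h).symm⟩
  | succ n =>
    rcases hb with ⟨h, -, c, hc, rfl⟩ | ⟨h, -, c, hc, rfl⟩
    · exact Or.inl ⟨g * h, trivial, c, hc, by simp only [← vgrp_mul, mul_assoc]⟩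
    · exact Or.inr ⟨g * h, trivial, c, hc, by simp only [← vgrp_mul, mul_assoc]⟩

theorem mem_vset (m : VMonoid G) : m ∈ vset G (Multiplicative.toAdd (vdeg G m)) := by
  obtain ⟨a, rfl⟩ := PresentedMonoid.surjective_mk m
  induction a using FreeMonoid.inductionOn' with
  | one => exact ⟨1, vgrp_one⟩
  | of_mul x a ih =>
    rw [map_mul, map_mul]
    cases x with
    | grp g =>
      have h : vdeg G (PresentedMonoid.mk (VRel G) (FreeMonoid.of (VGen.grp g))) = 1 := rfl
      rw [h, one_mul]
      exact vgrp_mul_mem g ih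
    | e0 =>
      have h : vdeg G (PresentedMonoid.mk (VRel G) (FreeMonoid.of VGen.e0)) =
        Multiplicative.ofAdd 1 := rfl
      rw [h, toAdd_mul, toAdd_ofAdd, add_comm]
      exact Or.inl ⟨1, trivial, _, ih, by simp only [vgrp_one, one_mul]; rfl⟩
    | e1 =>
      have h : vdeg G (PresentedMonoid.mk (VRel G) (FreeMonoid.of VGen.e1)) =
        Multiplicative.ofAdd 1 := rfl
      rw [h, toAdd_mul, toAdd_ofAdd, add_comm]
      exact Or.inr ⟨1, trivial, _, ih, by simp only [vgrp_one, one_mul]; rfl⟩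

noncomputable instance instVMonoid [Finite G] : Finset.HasMulAntidiagonal (VMonoid G) :=
  mulAntidiagonalOfFinite fun m => by
    have hfin : (⋃ i ∈ Set.Iic (Multiplicative.toAdd (vdeg G m)), vset G i).Finite :=
      (Set.finite_Iic _).biUnion fun i _ => vset_finite i
    refine (hfin.prod hfin).subset ?_
    rintro ⟨a, b⟩ (rfl : a * b = m)
    refine ⟨Set.mem_biUnion ?_ (mem_vset a), Set.mem_biUnion ?_ (mem_vset b)⟩ <;> simp

section V

variable [Finite G]

variable (G) in
/-- The algebra `V_G`: the complete graded algebra with generators `e₀`, `e₁` (of degree `1`) and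
`g ∈ G` (of degree `0`) and the above relations. All these relations being between monomials, its
elements are the formal series over the monoid with the same presentation. -/
abbrev VG : Type (max u v) := NCSeries K (VMonoid G)

variable {K}

/-- The continuous algebra homomorphism `a ↦ β(a ⊗ 1)` from `K⟨⟨X⟩⟩` to `V_G`:
`x₀ ↦ e₀`, `x_g ↦ - g e₁ g⁻¹`. -/
noncomputable def betaX : KX K G →ₗ[K] VG K G :=
  NCSeries.lsum (FreeMonoid.lift fun a : Option G =>
    match a with
    | none => (NCSeries.basis K ve0 : VG K G)
    | some g => -(NCSeries.basis K (vgrp g * ve1 * vgrp g⁻¹) : VG K G))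

/-- The values of `aut_Ψ^{V,(0)}` on monomials:
`e₀ ↦ e₀`, `e₁ ↦ β(Ψ⁻¹ ⊗ 1) e₁ β(Ψ ⊗ 1)`, `g ↦ g`. -/
noncomputable def autV0Mon (Ψ : GroupLike K G) : VMonoid G →* VG K G :=
  PresentedMonoid.lift
    (fun x => match x with
      | VGen.e0 => NCSeries.basis K ve0
      | VGen.e1 => betaX Ψ.serInv * NCSeries.basis K ve1 * betaX Ψ.ser
      | VGen.grp g => NCSeries.basis K (vgrp g))
    (by
      rintro _ _ (⟨g, h⟩ | _ | g)
      · simp [NCSeries.basis_mul_basis, vgrp_mul]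
      · simp [vgrp_one, NCSeries.one_def]
      · simp [NCSeries.basis_mul_basis, vgrp_comm])

/-- The continuous algebra automorphism `aut_Ψ^{V,(0)}` of `V_G`. -/
noncomputable def autV0 (Ψ : GroupLike K G) : VG K G →ₗ[K] VG K G := NCSeries.lsum (autV0Mon Ψ)

/-- `aut_Ψ^{V,(1)} = Ad(β(Ψ ⊗ 1)) ∘ aut_Ψ^{V,(0)}` -/
noncomputable def autV1 (Ψ : GroupLike K G) : VG K G →ₗ[K] VG K G :=
  LinearMap.mulLeft K (betaX Ψ.ser) ∘ₗ LinearMap.mulRight K (betaX Ψ.serInv) ∘ₗ autV0 Ψ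

/-- `^Γ aut_Ψ^{V,(1)} = Ad(Γ_Ψ⁻¹(-e₁)) ∘ aut_Ψ^{V,(1)}` -/
noncomputable def GamAutV1 [Algebra ℚ K] (ε : ℤˣ) (Ψ : GroupLike K G) : VG K G →ₗ[K] VG K G :=
  LinearMap.mulLeft K (NCSeries.evalPS (Ring.inverse (Gam ε Ψ)) (-NCSeries.basis K ve1)) ∘ₗ
    LinearMap.mulRight K (NCSeries.evalPS (Gam ε Ψ) (-NCSeries.basis K ve1)) ∘ₗ autV1 Ψ

/-- The monoid homomorphism `y_{n,g} ↦ e₀^{n-1} g e₁`. -/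
def zWord : YWord G →* VMonoid G :=
  FreeMonoid.lift fun a : ℕ+ × G => ve0 ^ ((a.1 : ℕ) - 1) * vgrp a.2 * ve1

/-- The continuous algebra homomorphism `ϖ : K⟨⟨Y⟩⟩ → V_G`, `y_{n,g} ↦ z_{n,g} = - e₀^{n-1} g e₁`.
It is injective and its image is the subalgebra `W_G = K ⊕ V_G e₁`. -/
noncomputable def varpi : KY K G →ₗ[K] VG K G :=
  NCSeries.lsum (FreeMonoid.lift fun a : ℕ+ × G =>
    (-NCSeries.basis K (ve0 ^ ((a.1 : ℕ) - 1) * vgrp a.2 * ve1) : VG K G))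

/-- The inverse of `ϖ : K⟨⟨Y⟩⟩ → W_G`. As `ϖ` sends a word `w` of length `r` in `Y` to `(-1)^r`
times the monomial `zWord w`, and as these monomials are pairwise distinct, the inverse reads off
coefficients. -/
def varpiInv : VG K G →ₗ[K] KY K G where
  toFun f := ⟨fun w => (-1) ^ (FreeMonoid.length w) * f.coeff (zWord w)⟩
  map_add' f g := by ext w; simp only [NCSeries.coeff_add, mul_add]
  map_smul' c f := by
    ext w; simp only [NCSeries.coeff_smul, RingHom.id_apply]; ring

/-- The automorphism `^Γ aut_Ψ^Y = ϖ⁻¹ ∘ ^Γ aut_Ψ^{W,(1)} ∘ ϖ` of `K⟨⟨Y⟩⟩`, where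
`^Γ aut_Ψ^{W,(1)}` is the restriction of `^Γ aut_Ψ^{V,(1)}` to `W_G`. -/
noncomputable def GamAutY [Algebra ℚ K] (ε : ℤˣ) (Ψ : GroupLike K G) : KY K G →ₗ[K] KY K G :=
  varpiInv ∘ₗ GamAutV1 ε Ψ ∘ₗ varpi

end V

variable (G)

/-- `Stab(Δ⋆^alg)(K)` -/
def stabAlg [Fintype G] [Algebra ℚ K] (ε : ℤˣ) : Set (GroupLike K G) :=
  {Ψ | NCSeries.tensorSq (GamAutY ε Ψ) ∘ₗ deltaAlg K = deltaAlg K ∘ₗ GamAutY ε Ψ}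

/-! ### The double shuffle group -/

variable {K G}

/-- `Ψ⋆`, the class of `q(Γ_Ψ⁻¹(x₁) Ψ)` in `K⟨⟨X⟩⟩ / K⟨⟨X⟩⟩ x₀`. -/
noncomputable def starLift [Algebra ℚ K] (ε : ℤˣ) (Ψ : GroupLike K G) : KX K G :=
  q K (GamInvX ε Ψ * Ψ.ser)

variable (K G)

/-- The set `DMR₀^G(K)`. -/
def DMR0 [Fintype G] [Algebra ℚ K] (ε : ℤˣ) : Set (GroupLike K G) :=
  {Ψ | Ψ.ser.coeff w0 = 0 ∧ Ψ.ser.coeff (wg 1) = 0 ∧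
    deltaMod K (piY K G (starLift ε Ψ)) =
      piYY K G (NCSeries.tmul (starLift ε Ψ) (starLift ε Ψ)) ∧
    (Fintype.card G ≤ 2 → Ψ.ser.coeff (w0 * wg 1) = 0) ∧
    (3 ≤ Fintype.card G → ∀ g : G, Ψ.ser.coeff (wg g) = Ψ.ser.coeff (wg g⁻¹))}

end Racinet

end DoubleShuffle

namespace DoubleShuffle

universe u v w

/-! ### Continuous linear maps between spaces of series -/

namespace NCSeries

section Continuity

variable {K : Type u} [CommRing K] {M : Type*} {N : Type*} {L : Type*}

/-! Group law. All spaces consist of arbitrary functions on a monoid, so a linear map is determined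
by monomials only when it is continuous (`IsCont.ext`); maps that fix the terms of lowest degree are
bijective (`Unip`). Since `aut_Ψ` commutes with the `t_g`, one has `aut_{Ψ⊛Φ} = aut_Ψ ∘ aut_Φ`, and
the inverse of `Ψ` is `S_Ψ⁻¹(1)`. The coefficients at `x₀ⁿx₁` add up under `⊛`
(`coeff_depthOne_mul`), so `Γ` is multiplicative. Hence `^ΓS^Y` and `^Γaut^Y` are actions by
continuous maps, and the stabilisers of a coproduct are subgroups.

From the module to the algebra. The quotient of `V_G` by the left ideal generated by `e₀` and the `g
- 1` is free of rank one over `W_G ≅ K⟨⟨Y⟩⟩`; `theta` is the projection. In this model `^ΓS^Y(f f')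
= ^Γaut^Y(f) ^ΓS^Y(f')` (`GamSYY_mul_apply`), so `^ΓS^Y(f) = ^Γaut^Y(f) ρ` with `ρ = ^ΓS^Y(1)`,
which is `Ψ⋆`. If `^ΓS^Y` respects the coproduct, then `ρ` is group-like, and cancelling `ρ ⊗ ρ`,
whose constant term is `1`, shows that `^Γaut^Y` respects it too.

Double shuffle. This inclusion is proved directly, without the module stabiliser. Let `A =
Γ_Ψ⁻¹(x₁)Ψ`, and let `homSer A` record each word by its `Y`-part, with a variable `t` for the total
degree. As `(Ψ|x₀) = 0`, the derivation dual to the insertion of `x₀` kills `A`. This says that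
`homSer A` is flat: it is killed by `d + t∂_t`, where `d(y_{n,g}) = (n-1)y_{n-1,g} - n y_{n,g}` is a
coderivation of the harmonic coproduct (`deltaAlg_euler`). A flat family is controlled by its terms
of highest weight, here `Ψ⋆`, so `homSer A` is group-like (`isGroupLike_of_top`). The series `Z = 1
+ ∑ y_{n,g}` is flat and group-like as well, hence so is `F = homSer A · Z · σ(homSer A)`.

By `GamAutY_yl`, `^Γaut^Y(y_{n,g})` is the part of `F · Γ_Ψ(ty)Γ_Ψ(-ty)`, with `y = y_{1,1}`, of
`G`-degree `g` in which the weight exceeds the power of `t` by `n`. Now `^Γaut^Y` fixes `y_{1,1}`.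
Induction on `j ≥ 1` then gives that `Γ_Ψ(x)Γ_Ψ(-x)` has no term in `xʲ` and that the coefficient of
`tʲ` in `F` has no term of weight at most `j` (`adjSer_vanishing`, resting on
`eq_zero_of_primitive`); the conditions on `(Ψ|x_g)` and `(Ψ|x₀x₁)` enter for `j = 1` and `j = 2`.
So `Γ_Ψ(x)Γ_Ψ(-x) = 1`, and the group-likeness of `F`, split according to weight minus power of `t`,
is the harmonic coproduct formula for the images of the letters (`deltaAlg_diagPart`). -/

/-- Every coefficient of `T f` depends on finitely many coefficients of `f` only. -/
def IsCont (T : NCSeries K M →ₗ[K] NCSeries K N) : Prop :=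
  ∀ n, ∃ s : Finset M, ∀ f : NCSeries K M, (∀ i ∈ s, f.coeff i = 0) → (T f).coeff n = 0

@[simp] theorem coeff_sub (f g : NCSeries K M) (m : M) :
    (f - g).coeff m = f.coeff m - g.coeff m := by
  rw [sub_eq_add_neg, coeff_add, coeff_neg, sub_eq_add_neg]

@[simp] theorem coeff_sum {ι : Type*} (s : Finset ι) (f : ι → NCSeries K M) (m : M) :
    (∑ i ∈ s, f i).coeff m = ∑ i ∈ s, (f i).coeff m := by
  classical
  induction s using Finset.induction_on with
  | empty => simp
  | insert a s ha ih => rw [Finset.sum_insert ha, Finset.sum_insert ha, coeff_add, ih]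

open Classical in
theorem coeff_basis (m n : M) : (basis K m).coeff n = if n = m then 1 else 0 := rfl

/-- The coefficient at `m`, as a linear form. -/
def coeffL (K : Type u) [CommRing K] {M : Type*} (m : M) : NCSeries K M →ₗ[K] K where
  toFun f := f.coeff m
  map_add' _ _ := rfl
  map_smul' _ _ := rfl

@[simp] theorem coeffL_apply (m : M) (f : NCSeries K M) : coeffL K m f = f.coeff m := rfl

/-- Once the finitely many terms indexed by `s` are subtracted, `T` no longer sees `f` at `n`; the
coefficient is therefore a finite combination of values on basis elements. -/
theorem IsCont.coeff_eq_zero_of_support {T : NCSeries K M →ₗ[K] NCSeries K N} (hT : IsCont T)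
    {n : N} {f : NCSeries K M} (h : ∀ m, f.coeff m ≠ 0 → (T (basis K m)).coeff n = 0) :
    (T f).coeff n = 0 := by
  classical
  obtain ⟨s, hs⟩ := hT n
  have h1 : (T (f - ∑ i ∈ s, f.coeff i • basis K i)).coeff n = 0 := by
    refine hs _ fun i hi => ?_
    rw [coeff_sub, coeff_sum, Finset.sum_eq_single i]
    · simp [coeff_basis_self]
    · intro j _ hj
      simp [coeff_basis_of_ne hj.symm]
    · exact fun h => absurd hi h
  rw [map_sub, coeff_sub, map_sum, coeff_sum, sub_eq_zero] at h1
  rw [h1]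
  refine Finset.sum_eq_zero fun i _ => ?_
  rw [map_smul, coeff_smul]
  by_cases hi : f.coeff i = 0
  · rw [hi, zero_mul]
  · rw [h i hi, mul_zero]

theorem IsCont.coeff_eq_zero {T : NCSeries K M →ₗ[K] NCSeries K N} (hT : IsCont T) {n : N}
    (h : ∀ m, (T (basis K m)).coeff n = 0) (f : NCSeries K M) : (T f).coeff n = 0 :=
  hT.coeff_eq_zero_of_support fun m _ => h m

theorem IsCont.sub {T U : NCSeries K M →ₗ[K] NCSeries K N} (hT : IsCont T) (hU : IsCont U) :
    IsCont (T - U) := by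
  classical
  intro n
  obtain ⟨s, hs⟩ := hT n
  obtain ⟨t, ht⟩ := hU n
  refine ⟨s ∪ t, fun f hf => ?_⟩
  rw [LinearMap.sub_apply, coeff_sub, hs f fun i hi => hf i (Finset.mem_union_left _ hi),
    ht f fun i hi => hf i (Finset.mem_union_right _ hi), sub_zero]

theorem IsCont.add {T U : NCSeries K M →ₗ[K] NCSeries K N} (hT : IsCont T) (hU : IsCont U) :
    IsCont (T + U) := by
  classical
  intro n
  obtain ⟨s, hs⟩ := hT n
  obtain ⟨t, ht⟩ := hU n
  refine ⟨s ∪ t, fun f hf => ?_⟩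
  rw [LinearMap.add_apply, coeff_add, hs f fun i hi => hf i (Finset.mem_union_left _ hi),
    ht f fun i hi => hf i (Finset.mem_union_right _ hi), add_zero]

theorem IsCont.zero : IsCont (0 : NCSeries K M →ₗ[K] NCSeries K N) := fun _ =>
  ⟨∅, fun _ _ => rfl⟩

theorem IsCont.id : IsCont (LinearMap.id : NCSeries K M →ₗ[K] NCSeries K M) := fun n =>
  ⟨{n}, fun _ hf => hf n (Finset.mem_singleton_self n)⟩

theorem IsCont.smul {T : NCSeries K M →ₗ[K] NCSeries K N} (hT : IsCont T) (c : K) :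
    IsCont (c • T) := by
  intro n
  obtain ⟨s, hs⟩ := hT n
  exact ⟨s, fun f hf => by rw [LinearMap.smul_apply, coeff_smul, hs f hf, mul_zero]⟩

theorem IsCont.sum {ι : Type*} (s : Finset ι) {T : ι → NCSeries K M →ₗ[K] NCSeries K N}
    (hT : ∀ i ∈ s, IsCont (T i)) : IsCont (∑ i ∈ s, T i) := by
  classical
  induction s using Finset.induction_on with
  | empty => simpa using IsCont.zero
  | insert a s ha ih =>
    rw [Finset.sum_insert ha]
    exact (hT a (Finset.mem_insert_self _ _)).add
      (ih fun i hi => hT i (Finset.mem_insert_of_mem hi))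

theorem IsCont.comp {T : NCSeries K N →ₗ[K] NCSeries K L} {U : NCSeries K M →ₗ[K] NCSeries K N}
    (hT : IsCont T) (hU : IsCont U) : IsCont (T ∘ₗ U) := by
  classical
  intro n
  obtain ⟨s, hs⟩ := hT n
  choose t ht using hU
  refine ⟨s.biUnion t, fun f hf => hs _ fun i hi => ht i f fun j hj => hf j ?_⟩
  exact Finset.mem_biUnion.2 ⟨i, hi, hj⟩

/-- Finite combinations of basis elements are dense. Most identities below are checked on basis
elements by this argument, one variable after the other when they are multilinear. -/
theorem IsCont.ext {T U : NCSeries K M →ₗ[K] NCSeries K N} (hT : IsCont T) (hU : IsCont U)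
    (h : ∀ m, T (basis K m) = U (basis K m)) : T = U := by
  ext f n
  rw [← sub_eq_zero, ← coeff_sub, ← LinearMap.sub_apply]
  refine (hT.sub hU).coeff_eq_zero (fun m => ?_) f
  rw [LinearMap.sub_apply, h, sub_self, coeff_zero]

theorem IsCont.ext_apply {T U : NCSeries K M →ₗ[K] NCSeries K N} (hT : IsCont T) (hU : IsCont U)
    (h : ∀ m, T (basis K m) = U (basis K m)) (f : NCSeries K M) : T f = U f := by
  rw [hT.ext hU h]

theorem IsCont.reindex (r : M → N) : IsCont (reindex r : NCSeries K N →ₗ[K] NCSeries K M) :=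
  fun m => ⟨{r m}, fun _ hf => hf _ (Finset.mem_singleton_self _)⟩

theorem coeff_reindex (r : M → N) (f : NCSeries K N) (m : M) :
    (NCSeries.reindex r f).coeff m = f.coeff (r m) := rfl

theorem coeff_extend {j : M → N} (hj : Function.Injective j) (f : NCSeries K M) (m : M) :
    (extend j f).coeff (j m) = f.coeff m :=
  hj.extend_apply _ _ _

theorem coeff_extend_of_not (j : M → N) (f : NCSeries K M) {n : N} (hn : ∀ m, j m ≠ n) :
    (extend j f).coeff n = 0 :=
  Function.extend_apply' _ _ _ fun ⟨m, hm⟩ => hn m hm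

theorem IsCont.extend {j : M → N} (hj : Function.Injective j) :
    IsCont (extend j : NCSeries K M →ₗ[K] NCSeries K N) := by
  classical
  intro n
  by_cases hn : ∃ m, j m = n
  · obtain ⟨m, rfl⟩ := hn
    refine ⟨{m}, fun f hf => ?_⟩
    rw [coeff_extend hj]
    exact hf m (Finset.mem_singleton_self m)
  · push Not at hn
    exact ⟨∅, fun f _ => coeff_extend_of_not j f hn⟩

theorem extend_basis {j : M → N} (hj : Function.Injective j) (m : M) :
    NCSeries.extend j (basis K m) = basis K (j m) := by
  ext n
  by_cases hn : ∃ m, j m = n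
  · obtain ⟨m', rfl⟩ := hn
    rw [coeff_extend hj]
    by_cases h : m' = m
    · rw [h, coeff_basis_self, coeff_basis_self]
    · rw [coeff_basis_of_ne h, coeff_basis_of_ne (hj.ne h)]
  · push Not at hn
    rw [coeff_extend_of_not j _ hn, coeff_basis_of_ne (hn m).symm]

theorem IsCont.lsum (φ : M → NCSeries K N) : IsCont (lsum φ) := by
  classical
  intro n
  by_cases h : {i | (φ i).coeff n ≠ 0}.Finite
  · refine ⟨h.toFinset, fun f hf => ?_⟩
    simp only [NCSeries.lsum, LinearMap.coe_mk, AddHom.coe_mk, h, dite_true]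
    exact Finset.sum_eq_zero fun i hi => by rw [hf i hi, zero_mul]
  · refine ⟨∅, fun f _ => ?_⟩
    simp only [NCSeries.lsum, LinearMap.coe_mk, AddHom.coe_mk, h, dite_false]

/-- At every `n`, only finitely many members of the family have a nonzero coefficient. -/
def LocFin (φ : M → NCSeries K N) : Prop := ∀ n, {i | (φ i).coeff n ≠ 0}.Finite

theorem LocFin.lsum_basis {φ : M → NCSeries K N} (h : LocFin φ) (m : M) :
    NCSeries.lsum φ (basis K m) = φ m := by
  classical
  ext n
  simp only [NCSeries.lsum, LinearMap.coe_mk, AddHom.coe_mk, h n, dite_true]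
  by_cases hm : (φ m).coeff n = 0
  · rw [hm]
    refine Finset.sum_eq_zero fun i hi => ?_
    have : i ≠ m := by
      rintro rfl
      exact (h n).mem_toFinset.1 hi hm
    rw [coeff_basis_of_ne this, zero_mul]
  · rw [Finset.sum_eq_single m]
    · rw [coeff_basis_self, one_mul]
    · intro i _ hi
      rw [coeff_basis_of_ne hi, zero_mul]
    · exact fun h' => absurd ((h n).mem_toFinset.2 hm) h'

/-! ### Tensor products -/

theorem coeff_tmul (f : NCSeries K M) (g : NCSeries K N) (p : M × N) :
    (tmul f g).coeff p = f.coeff p.1 * g.coeff p.2 := rfl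

theorem basis_prod (a : M) (b : N) : basis K (a, b) = tmul (basis K a) (basis K b) := by
  classical
  ext ⟨c, d⟩
  simp only [coeff_tmul, coeff_basis, Prod.mk.injEq]
  by_cases h1 : c = a <;> by_cases h2 : d = b <;> simp [h1, h2]

/-- `f ⊗ g` as a bilinear map. -/
def tmulL (K : Type u) [CommRing K] (M N : Type*) :
    NCSeries K M →ₗ[K] NCSeries K N →ₗ[K] NCSeries K (M × N) :=
  LinearMap.mk₂ K tmul (fun f f' g => by ext p; simp [coeff_tmul, add_mul])
    (fun c f g => by ext p; simp [coeff_tmul, mul_assoc])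
    (fun f g g' => by ext p; simp [coeff_tmul, mul_add])
    (fun c f g => by ext p; simp only [coeff_tmul, coeff_smul]; ring)

@[simp] theorem tmulL_apply (f : NCSeries K M) (g : NCSeries K N) :
    tmulL K M N f g = tmul f g := rfl

theorem IsCont.tmul_left (g : NCSeries K N) : IsCont ((tmulL K M N).flip g) := fun p =>
  ⟨{p.1}, fun f hf => by
    rw [LinearMap.flip_apply, tmulL_apply, coeff_tmul, hf _ (Finset.mem_singleton_self _),
      zero_mul]⟩

theorem IsCont.tmul_right (f : NCSeries K M) : IsCont (tmulL K M N f) := fun p =>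
  ⟨{p.2}, fun g hg => by
    rw [tmulL_apply, coeff_tmul, hg _ (Finset.mem_singleton_self _), mul_zero]⟩

/-- `T ⊗̂ id` -/
def mapLeft (P : Type*) (T : NCSeries K M →ₗ[K] NCSeries K N) :
    NCSeries K (M × P) →ₗ[K] NCSeries K (N × P) where
  toFun F := ⟨fun p => (T ⟨fun a => F.coeff (a, p.2)⟩).coeff p.1⟩
  map_add' F F' := by
    ext p
    exact congrArg (fun f => f.coeff p.1)
      (T.map_add ⟨fun a => F.coeff (a, p.2)⟩ ⟨fun a => F'.coeff (a, p.2)⟩)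
  map_smul' c F := by
    ext p
    exact congrArg (fun f => f.coeff p.1) (T.map_smul c ⟨fun a => F.coeff (a, p.2)⟩)

/-- `id ⊗̂ T` -/
def mapRight (P : Type*) (T : NCSeries K M →ₗ[K] NCSeries K N) :
    NCSeries K (P × M) →ₗ[K] NCSeries K (P × N) where
  toFun F := ⟨fun p => (T ⟨fun b => F.coeff (p.1, b)⟩).coeff p.2⟩
  map_add' F F' := by
    ext p
    exact congrArg (fun f => f.coeff p.2)
      (T.map_add ⟨fun b => F.coeff (p.1, b)⟩ ⟨fun b => F'.coeff (p.1, b)⟩)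
  map_smul' c F := by
    ext p
    exact congrArg (fun f => f.coeff p.2) (T.map_smul c ⟨fun b => F.coeff (p.1, b)⟩)

theorem coeff_mapLeft {P : Type*} (T : NCSeries K M →ₗ[K] NCSeries K N) (F : NCSeries K (M × P))
    (p : N × P) : (mapLeft P T F).coeff p = (T ⟨fun a => F.coeff (a, p.2)⟩).coeff p.1 := rfl

theorem coeff_mapRight {P : Type*} (T : NCSeries K M →ₗ[K] NCSeries K N) (F : NCSeries K (P × M))
    (p : P × N) : (mapRight P T F).coeff p = (T ⟨fun b => F.coeff (p.1, b)⟩).coeff p.2 := rfl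

theorem tensorSq_eq (T : NCSeries K M →ₗ[K] NCSeries K N) :
    tensorSq T = mapLeft N T ∘ₗ mapRight M T := rfl

theorem mapLeft_tmul {P : Type*} (T : NCSeries K M →ₗ[K] NCSeries K N) (f : NCSeries K M)
    (g : NCSeries K P) : mapLeft P T (tmul f g) = tmul (T f) g := by
  ext p
  rw [coeff_mapLeft, coeff_tmul]
  have : (⟨fun a => (tmul f g).coeff (a, p.2)⟩ : NCSeries K M) = g.coeff p.2 • f := by
    ext a
    exact mul_comm _ _
  rw [this, map_smul, coeff_smul, mul_comm]

theorem mapRight_tmul {P : Type*} (T : NCSeries K M →ₗ[K] NCSeries K N) (f : NCSeries K P)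
    (g : NCSeries K M) : mapRight P T (tmul f g) = tmul f (T g) := by
  ext p
  rw [coeff_mapRight, coeff_tmul]
  have : (⟨fun b => (tmul f g).coeff (p.1, b)⟩ : NCSeries K M) = f.coeff p.1 • g := by
    ext a
    rfl
  rw [this, map_smul, coeff_smul]

theorem tensorSq_tmul (T : NCSeries K M →ₗ[K] NCSeries K N) (f g : NCSeries K M) :
    tensorSq T (tmul f g) = tmul (T f) (T g) := by
  rw [tensorSq_eq, LinearMap.comp_apply, mapRight_tmul, mapLeft_tmul]

theorem IsCont.mapLeft {P : Type*} {T : NCSeries K M →ₗ[K] NCSeries K N} (hT : IsCont T) :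
    IsCont (mapLeft P T) := by
  classical
  intro p
  obtain ⟨s, hs⟩ := hT p.1
  exact ⟨s ×ˢ {p.2}, fun F hF => hs _ fun i hi => hF (i, p.2) (by simp [hi])⟩

theorem IsCont.mapRight {P : Type*} {T : NCSeries K M →ₗ[K] NCSeries K N} (hT : IsCont T) :
    IsCont (mapRight P T) := by
  classical
  intro p
  obtain ⟨s, hs⟩ := hT p.2
  exact ⟨{p.1} ×ˢ s, fun F hF => hs _ fun i hi => hF (p.1, i) (by simp [hi])⟩

theorem IsCont.tensorSq {T : NCSeries K M →ₗ[K] NCSeries K N} (hT : IsCont T) :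
    IsCont (tensorSq T) :=
  hT.mapLeft.comp hT.mapRight

theorem tensorSq_basis (T : NCSeries K M →ₗ[K] NCSeries K N) (a b : M) :
    NCSeries.tensorSq T (basis K (a, b)) = tmul (T (basis K a)) (T (basis K b)) := by
  rw [basis_prod, tensorSq_tmul]

/-- `tensorSq` acts on the second factor before the first, so functoriality needs partial
applications to different factors to commute. Continuity gives this, through pure tensors of basis
elements. -/
theorem tensorSq_comp {T : NCSeries K N →ₗ[K] NCSeries K L} {U : NCSeries K M →ₗ[K] NCSeries K N}
    (hT : IsCont T) (hU : IsCont U) :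
    NCSeries.tensorSq (T ∘ₗ U) = NCSeries.tensorSq T ∘ₗ NCSeries.tensorSq U := by
  refine (hT.comp hU).tensorSq.ext (hT.tensorSq.comp hU.tensorSq) ?_
  rintro ⟨a, b⟩
  rw [tensorSq_basis, LinearMap.comp_apply (NCSeries.tensorSq T), tensorSq_basis, tensorSq_tmul]
  rfl

theorem tensorSq_id :
    NCSeries.tensorSq (LinearMap.id : NCSeries K M →ₗ[K] NCSeries K M) = LinearMap.id := rfl

end Continuity

/-! ### Continuous algebra homomorphisms and products of tensors. -/

section Mul

variable {K : Type u} [CommRing K] {M : Type*} [Monoid M] [Finset.HasMulAntidiagonal M]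
  {N : Type*} [Monoid N] [Finset.HasMulAntidiagonal N] {P : Type*}

theorem IsCont.mulLeft (a : NCSeries K M) : IsCont (LinearMap.mulLeft K a) := by
  classical
  intro n
  refine ⟨(Finset.HasMulAntidiagonal.mulAntidiagonal n).image Prod.snd, fun f hf => ?_⟩
  rw [LinearMap.mulLeft_apply, coeff_mul]
  exact Finset.sum_eq_zero fun p hp => by rw [hf _ (Finset.mem_image_of_mem _ hp), mul_zero]

theorem IsCont.mulRight (a : NCSeries K M) : IsCont (LinearMap.mulRight K a) := by
  classical
  intro n
  refine ⟨(Finset.HasMulAntidiagonal.mulAntidiagonal n).image Prod.fst, fun f hf => ?_⟩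
  rw [LinearMap.mulRight_apply, coeff_mul]
  exact Finset.sum_eq_zero fun p hp => by rw [hf _ (Finset.mem_image_of_mem _ hp), zero_mul]

theorem IsCont.map_mul {T : NCSeries K M →ₗ[K] NCSeries K N} (hT : IsCont T)
    (h : ∀ a b, T (basis K (a * b)) = T (basis K a) * T (basis K b)) (f g : NCSeries K M) :
    T (f * g) = T f * T g := by
  have h1 : ∀ a, T (basis K a * g) = T (basis K a) * T g := fun a =>
    (hT.comp (IsCont.mulLeft (basis K a))).ext_apply ((IsCont.mulLeft (T (basis K a))).comp hT)
      (fun b => by simp [basis_mul_basis, h]) g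
  exact (hT.comp (IsCont.mulRight g)).ext_apply ((IsCont.mulRight (T g)).comp hT)
      (fun b => by simp [h1]) f

/-- A continuous homomorphism of algebras. -/
structure IsHom (T : NCSeries K M →ₗ[K] NCSeries K N) : Prop where
  cont : IsCont T
  map_mul : ∀ f g, T (f * g) = T f * T g
  map_one : T 1 = 1

/-- The ring homomorphism underlying a continuous homomorphism of algebras. -/
noncomputable def IsHom.toRingHom {T : NCSeries K M →ₗ[K] NCSeries K N} (hT : IsHom T) :
    NCSeries K M →+* NCSeries K N where
  toFun := T
  map_one' := hT.map_one
  map_mul' := hT.map_mul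
  map_zero' := T.map_zero
  map_add' := T.map_add

theorem IsHom.map_pow {T : NCSeries K M →ₗ[K] NCSeries K N} (hT : IsHom T) (f : NCSeries K M)
    (n : ℕ) : T (f ^ n) = T f ^ n :=
  _root_.map_pow hT.toRingHom f n

theorem IsHom.comp {P : Type*} [Monoid P] [Finset.HasMulAntidiagonal P]
    {T : NCSeries K N →ₗ[K] NCSeries K P} {U : NCSeries K M →ₗ[K] NCSeries K N} (hT : IsHom T)
    (hU : IsHom U) : IsHom (T ∘ₗ U) where
  cont := hT.cont.comp hU.cont
  map_mul f g := by simp [hU.map_mul, hT.map_mul]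
  map_one := by simp [hU.map_one, hT.map_one]

theorem LocFin.isHom {φ : M →* NCSeries K N} (h : LocFin φ) : IsHom (NCSeries.lsum φ) where
  cont := IsCont.lsum _
  map_mul := (IsCont.lsum _).map_mul fun a b => by simp only [h.lsum_basis, _root_.map_mul]
  map_one := by rw [one_def, h.lsum_basis, _root_.map_one, one_def]

theorem IsHom.ext_free {A : Type*} {T U : NCSeries K (FreeMonoid A) →ₗ[K] NCSeries K N}
    (hT : IsHom T) (hU : IsHom U)
    (h : ∀ a, T (basis K (FreeMonoid.of a)) = U (basis K (FreeMonoid.of a))) : T = U := by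
  refine hT.cont.ext hU.cont fun w => ?_
  induction w using FreeMonoid.inductionOn' with
  | one => rw [← one_def, hT.map_one, hU.map_one]
  | of_mul a w ih => rw [← basis_mul_basis, hT.map_mul, hU.map_mul, h, ih]

/-- Density in each of the four variables replaces a reindexing of the factorisations in `M × N`. -/
theorem tmul_mul_tmul (f f' : NCSeries K M) (g g' : NCSeries K N) :
    tmul f g * tmul f' g' = tmul (f * f') (g * g') := by
  have key : ∀ (a c : M) (b d : N), tmul (basis K a) (basis K b) * tmul (basis K c) (basis K d) =
      tmul (basis K a * basis K c) (basis K b * basis K d) := fun a c b d => by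
    simp only [basis_mul_basis, ← basis_prod, Prod.mk_mul_mk]
  have h1 : ∀ (a c : M) (b : N), tmul (basis K a) (basis K b) * tmul (basis K c) g' =
      tmul (basis K a * basis K c) (basis K b * g') := fun a c b =>
    ((IsCont.mulLeft (tmul (basis K a) (basis K b))).comp
      (IsCont.tmul_right (basis K c))).ext_apply
      ((IsCont.tmul_right (basis K a * basis K c)).comp (IsCont.mulLeft (basis K b)))
      (fun d => key a c b d) g'
  have h2 : ∀ (a : M) (b : N), tmul (basis K a) (basis K b) * tmul f' g' =
      tmul (basis K a * f') (basis K b * g') := fun a b =>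
    ((IsCont.mulLeft (tmul (basis K a) (basis K b))).comp (IsCont.tmul_left g')).ext_apply
      ((IsCont.tmul_left (basis K b * g')).comp (IsCont.mulLeft (basis K a)))
      (fun c => h1 a c b) f'
  have h3 : ∀ (a : M), tmul (basis K a) g * tmul f' g' =
      tmul (basis K a * f') (g * g') := fun a =>
    ((IsCont.mulRight (tmul f' g')).comp (IsCont.tmul_right (basis K a))).ext_apply
      ((IsCont.tmul_right (basis K a * f')).comp (IsCont.mulRight g'))
      (fun b => h2 a b) g
  exact ((IsCont.mulRight (tmul f' g')).comp (IsCont.tmul_left g)).ext_apply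
      ((IsCont.tmul_left (g * g')).comp (IsCont.mulRight f'))
      (fun a => h3 a) f

theorem tmul_one_one : tmul (1 : NCSeries K M) (1 : NCSeries K N) = 1 := by
  rw [one_def, one_def, ← basis_prod]
  rfl

theorem IsHom.tensorSq {T : NCSeries K M →ₗ[K] NCSeries K N} (hT : IsHom T) :
    IsHom (NCSeries.tensorSq T) where
  cont := hT.cont.tensorSq
  map_mul := hT.cont.tensorSq.map_mul fun ⟨a, b⟩ ⟨c, d⟩ => by
    rw [Prod.mk_mul_mk, tensorSq_basis, tensorSq_basis, tensorSq_basis, tmul_mul_tmul,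
      ← hT.map_mul, ← hT.map_mul, basis_mul_basis, basis_mul_basis]
  map_one := by rw [← tmul_one_one, tensorSq_tmul, hT.map_one, tmul_one_one]

end Mul

end NCSeries

/-! ### Graded monoids -/

/-- A grading of a monoid by `ℕ` with finitely many elements of bounded degree. -/
class FinGraded (M : Type*) [Monoid M] where
  /-- The degree. -/
  deg : M → ℕ
  deg_mul : ∀ a b, deg (a * b) = deg a + deg b
  finite_le : ∀ k, {m | deg m ≤ k}.Finite

open FinGraded

theorem deg_one {M : Type*} [Monoid M] [FinGraded M] : deg (1 : M) = 0 := by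
  have h := deg_mul (1 : M) 1
  rw [mul_one] at h
  omega

/-- Each letter weighs at least `1`, so a word of weight at most `k` has length at most `k` and uses
only the finitely many letters of weight at most `k`. -/
theorem finite_words {A : Type*} {f : A → ℕ} (hpos : ∀ a, 1 ≤ f a)
    (hfin : ∀ k, {a | f a ≤ k}.Finite) (k : ℕ) :
    {w : FreeMonoid A | Multiplicative.toAdd
      (FreeMonoid.lift (fun a => Multiplicative.ofAdd (f a)) w) ≤ k}.Finite := by
  have : Finite {a | f a ≤ k} := hfin k
  refine ((List.finite_length_le {a | f a ≤ k} k).image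
    fun l => FreeMonoid.ofList (l.map Subtype.val)).subset ?_
  intro w hw
  simp only [Set.mem_ofPred_eq] at hw
  have h1 : ∀ w : FreeMonoid A, (FreeMonoid.toList w).length ≤ Multiplicative.toAdd
      (FreeMonoid.lift (fun a => Multiplicative.ofAdd (f a)) w) ∧
      ∀ a ∈ FreeMonoid.toList w, f a ≤ Multiplicative.toAdd
      (FreeMonoid.lift (fun a => Multiplicative.ofAdd (f a)) w) := by
    intro w
    induction w using FreeMonoid.inductionOn' with
    | one => simp
    | of_mul a w ih =>
      have := hpos a
      simp only [FreeMonoid.toList_mul, FreeMonoid.toList_of, List.length_append,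
        List.length_singleton, map_mul, FreeMonoid.lift_eval_of, toAdd_mul, toAdd_ofAdd,
        List.mem_append, List.mem_singleton]
      refine ⟨by omega, ?_⟩
      rintro b (rfl | hb)
      · omega
      · have := ih.2 b hb
        omega
  refine ⟨(FreeMonoid.toList w).attachWith _ fun a ha => ((h1 w).2 a ha).trans hw, ?_, ?_⟩
  · simpa using (h1 w).1.trans hw
  · change FreeMonoid.ofList (List.map Subtype.val (List.attachWith _ _ _)) = w
    rw [List.attachWith_map_subtype_val, FreeMonoid.ofList_toList]

noncomputable instance {G : Type v} [Finite G] : FinGraded (XWord G) where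
  deg w := Multiplicative.toAdd (FreeMonoid.lift (fun _ => Multiplicative.ofAdd 1) w)
  deg_mul a b := by simp
  finite_le := finite_words (fun _ => le_rfl) fun _ => Set.toFinite _

noncomputable instance {G : Type v} [Finite G] : FinGraded (YWord G) where
  deg w := Multiplicative.toAdd
    (FreeMonoid.lift (fun a : ℕ+ × G => Multiplicative.ofAdd (a.1 : ℕ)) w)
  deg_mul a b := by simp
  finite_le := finite_words (fun a => a.1.2) fun k => by
    refine Set.Finite.of_finite_image (f := fun a : ℕ+ × G => ((a.1 : ℕ), a.2)) ?_ ?_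
    · refine ((Set.finite_Iic k).prod (Set.finite_univ (α := G))).subset ?_
      rintro _ ⟨a, ha, rfl⟩
      exact ⟨ha, trivial⟩
    · rintro ⟨a, b⟩ - ⟨c, d⟩ - h
      simpa using h

instance {M : Type*} {N : Type*} [Monoid M] [Monoid N] [FinGraded M] [FinGraded N] :
    FinGraded (M × N) where
  deg p := deg p.1 + deg p.2
  deg_mul a b := by simp only [Prod.fst_mul, Prod.snd_mul, deg_mul]; omega
  finite_le k := by
    refine ((finite_le (M := M) k).prod (finite_le (M := N) k)).subset ?_
    rintro ⟨a, b⟩ h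
    simp only [Set.mem_ofPred_eq, Set.mem_prod] at h ⊢
    omega

instance {G : Type v} [CommGroup G] [Finite G] : FinGraded (VMonoid G) where
  deg m := Multiplicative.toAdd (vdeg G m)
  deg_mul a b := by simp
  finite_le k := by
    refine ((Set.finite_Iic k).biUnion fun i _ => vset_finite (G := G) i).subset ?_
    intro m hm
    exact Set.mem_biUnion hm (mem_vset m)

theorem deg_prod {M : Type*} {N : Type*} [Monoid M] [Monoid N] [FinGraded M] [FinGraded N]
    (p : M × N) : deg p = deg p.1 + deg p.2 := rfl

section

variable {G : Type v} [Finite G]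

@[simp] theorem deg_of_X (a : Option G) : deg (FreeMonoid.of a : XWord G) = 1 := by
  change Multiplicative.toAdd (FreeMonoid.lift _ (FreeMonoid.of a)) = 1
  simp

@[simp] theorem deg_of_Y (a : ℕ+ × G) : deg (FreeMonoid.of a : YWord G) = a.1 := by
  change Multiplicative.toAdd (FreeMonoid.lift _ (FreeMonoid.of a)) = _
  simp

end

section

variable {G : Type v} [CommGroup G] [Finite G]

@[simp] theorem deg_ve0 : deg (ve0 : VMonoid G) = 1 := rfl

@[simp] theorem deg_ve1 : deg (ve1 : VMonoid G) = 1 := rfl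

@[simp] theorem deg_vgrp (g : G) : deg (vgrp g : VMonoid G) = 0 := rfl

end

/-! ### The filtration by degree, unipotent maps and values of power series. -/

namespace NCSeries

variable {K : Type u} [CommRing K] {M : Type*} [Monoid M] [FinGraded M]
  {N : Type*} [Monoid N] [FinGraded N]

/-- The series has no term of degree less than `k`. -/
def Ord (k : ℕ) (f : NCSeries K M) : Prop := ∀ m, deg m < k → f.coeff m = 0

theorem Ord.zero_le (f : NCSeries K M) : Ord 0 f := fun _ h => absurd h (Nat.not_lt_zero _)

theorem Ord.mono {k l : ℕ} (h : l ≤ k) {f : NCSeries K M} (hf : Ord k f) : Ord l f :=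
  fun m hm => hf m (hm.trans_le h)

theorem Ord.add {k : ℕ} {f g : NCSeries K M} (hf : Ord k f) (hg : Ord k g) : Ord k (f + g) :=
  fun m hm => by rw [coeff_add, hf m hm, hg m hm, add_zero]

theorem Ord.neg {k : ℕ} {f : NCSeries K M} (hf : Ord k f) : Ord k (-f) :=
  fun m hm => by rw [coeff_neg, hf m hm, neg_zero]

theorem Ord.sum {ι : Type*} (s : Finset ι) {k : ℕ} {f : ι → NCSeries K M}
    (hf : ∀ i ∈ s, Ord k (f i)) : Ord k (∑ i ∈ s, f i) := fun m hm => by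
  rw [coeff_sum]
  exact Finset.sum_eq_zero fun i hi => hf i hi m hm

theorem Ord.basis (m : M) : Ord (deg m) (NCSeries.basis K m) := fun n hn =>
  coeff_basis_of_ne (by rintro rfl; exact lt_irrefl _ hn)

/-- A series `φ m` that starts in degree `deg m` contributes at `n` only if `deg m ≤ deg n`. -/
theorem LocFin.of_ord {φ : M → NCSeries K N} (h : ∀ m, Ord (deg m) (φ m)) : LocFin φ := fun n => by
  refine (finite_le (M := M) (deg n)).subset fun m hm => ?_
  by_contra hlt
  exact hm (h m n (not_le.1 hlt))

/-- `T f` and `f` have the same terms of lowest degree. -/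
def Unip (T : NCSeries K M →ₗ[K] NCSeries K M) : Prop :=
  ∀ (f : NCSeries K M) (n : M), Ord (deg n) f → (T f).coeff n = f.coeff n

theorem Unip.ord {T : NCSeries K M →ₗ[K] NCSeries K M} (hT : Unip T) {k : ℕ} {f : NCSeries K M}
    (hf : Ord k f) : Ord k (T f) := fun m hm => by
  rw [hT f m (hf.mono hm.le), hf m hm]

theorem Unip.comp {T U : NCSeries K M →ₗ[K] NCSeries K M} (hT : Unip T) (hU : Unip U) :
    Unip (T ∘ₗ U) := fun f n hf => by
  rw [LinearMap.comp_apply, hT _ n (hU.ord hf), hU f n hf]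

theorem Unip.of_basis {T : NCSeries K M →ₗ[K] NCSeries K M} (hT : IsCont T)
    (h : ∀ m, Ord (deg m + 1) (T (NCSeries.basis K m) - NCSeries.basis K m)) : Unip T := by
  intro f n hf
  rw [← sub_eq_zero, ← coeff_sub]
  refine (hT.sub IsCont.id).coeff_eq_zero_of_support fun m hm => ?_
  refine h m n (Nat.lt_succ_of_le (not_lt.1 fun hlt => hm (hf m hlt)))

/-- If `F` has no term of degree below that of `(a, b)`, its row at any `a'` with `deg a' ≤ deg a`
has order at least `deg b`. So `T` can be removed along these rows, and then along the column of
`b`. -/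
theorem Unip.tensorSq {T : NCSeries K M →ₗ[K] NCSeries K M} (hT : Unip T) :
    Unip (NCSeries.tensorSq T) := by
  rintro F ⟨a, b⟩ hF
  have h1 : ∀ a', deg a' ≤ deg a → (T ⟨fun b => F.coeff (a', b)⟩).coeff b = F.coeff (a', b) :=
    fun a' ha' => hT ⟨fun b => F.coeff (a', b)⟩ b fun b' hb' => hF (a', b') (by
      simp only [deg_prod]; omega)
  have h2 := hT ⟨fun a' => (T ⟨fun b => F.coeff (a', b)⟩).coeff b⟩ a fun a' ha' => by
    change (T ⟨fun b => F.coeff (a', b)⟩).coeff b = 0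
    rw [h1 a' ha'.le]
    exact hF (a', b) (by simp only [deg_prod]; omega)
  exact h2.trans (h1 a le_rfl)

theorem Unip.injective {T : NCSeries K M →ₗ[K] NCSeries K M} (hT : Unip T) :
    Function.Injective T := by
  rw [← LinearMap.ker_eq_bot, LinearMap.ker_eq_bot']
  intro f hf
  have key : ∀ k, Ord k f := by
    intro k
    induction k with
    | zero => exact Ord.zero_le f
    | succ k ih =>
      intro m hm
      have h := hT f m (ih.mono (Nat.lt_succ_iff.1 hm))
      rw [hf, coeff_zero] at h
      exact h.symm
  ext m
  exact key _ m (Nat.lt_succ_self _)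

/-- The preimage is the Neumann series `∑ₖ (1 - T)ᵏ h`: each application of `1 - T` raises the order
by one, so the partial sums stabilise in every degree. -/
theorem Unip.surjective {T : NCSeries K M →ₗ[K] NCSeries K M} (hT : Unip T) :
    Function.Surjective T := by
  intro h
  set R : NCSeries K M →ₗ[K] NCSeries K M := LinearMap.id - T with hR
  have hord : ∀ {k f}, Ord k f → Ord (k + 1) (R f) := by
    intro k f hf m hm
    rw [hR, LinearMap.sub_apply, coeff_sub, hT f m (hf.mono (Nat.lt_succ_iff.1 hm)),
      LinearMap.id_apply, sub_self]
  have hpow : ∀ k, Ord k ((R ^ k) h) := by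
    intro k
    induction k with
    | zero => exact Ord.zero_le _
    | succ k ih =>
      rw [pow_succ', Module.End.mul_apply]
      exact hord ih
  set p : ℕ → NCSeries K M := fun n => ∑ k ∈ Finset.range n, (R ^ k) h with hp
  set f : NCSeries K M := ⟨fun m => (p (deg m + 1)).coeff m⟩ with hf
  have hstab : ∀ n m, deg m < n → (p n).coeff m = f.coeff m := by
    intro n m hm
    obtain ⟨d, rfl⟩ := Nat.exists_eq_add_of_le (Nat.succ_le_of_lt hm)
    simp only [hp, hf, coeff_sum]
    refine (Finset.sum_subset (Finset.range_subset_range.2 (by omega)) ?_).symm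
    intro k _ hk
    exact hpow k m (by simpa using hk)
  have hT' : ∀ n, T (p n) = h - (R ^ n) h := by
    intro n
    induction n with
    | zero => simp [hp]
    | succ n ih =>
      have h1 : p (n + 1) = p n + (R ^ n) h := Finset.sum_range_succ _ _
      have h2 : T ((R ^ n) h) = (R ^ n) h - (R ^ (n + 1)) h := by
        rw [pow_succ', Module.End.mul_apply, hR, LinearMap.sub_apply, LinearMap.id_apply,
          sub_sub_cancel]
      rw [h1, map_add, ih, h2]
      abel
  refine ⟨f, ?_⟩
  ext m
  -- The limit and the partial sum agree up to degree `deg m`, hence so do their images; only the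
  -- filtration is used here, not continuity.
  have h3 : Ord (deg m + 1) (f - p (deg m + 1)) := fun m' hm' => by
    rw [coeff_sub, hstab _ _ hm', sub_self]
  have h4 := hT.ord h3 m (Nat.lt_succ_self _)
  rw [map_sub, coeff_sub, sub_eq_zero, hT', coeff_sub, hpow _ m (Nat.lt_succ_self _),
    sub_zero] at h4
  exact h4

section Mul

variable [Finset.HasMulAntidiagonal M] [Finset.HasMulAntidiagonal N]

theorem Ord.mul {k l : ℕ} {f g : NCSeries K M} (hf : Ord k f) (hg : Ord l g) :
    Ord (k + l) (f * g) := fun m hm => by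
  rw [coeff_mul]
  refine Finset.sum_eq_zero fun p hp => ?_
  have h := deg_mul p.1 p.2
  rw [Finset.HasMulAntidiagonal.mem_mulAntidiagonal.1 hp] at h
  by_cases h1 : deg p.1 < k
  · rw [hf _ h1, zero_mul]
  · rw [hg _ (by omega), mul_zero]

theorem Ord.pow {k : ℕ} {f : NCSeries K M} (hf : Ord k f) (n : ℕ) : Ord (n * k) (f ^ n) := by
  induction n with
  | zero => simpa using Ord.zero_le _
  | succ n ih =>
    rw [pow_succ, Nat.succ_mul]
    exact ih.mul hf

theorem Ord.lift {A : Type*} [FinGraded (FreeMonoid A)] {φ : A → NCSeries K N}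
    (h : ∀ a, Ord (deg (FreeMonoid.of a)) (φ a)) (w : FreeMonoid A) :
    Ord (deg w) (FreeMonoid.lift φ w) := by
  induction w using FreeMonoid.inductionOn' with
  | one =>
    rw [deg_one]
    exact Ord.zero_le _
  | of_mul a w ih =>
    rw [map_mul, FreeMonoid.lift_eval_of, deg_mul]
    exact (h a).mul ih

theorem LocFin.lift {A : Type*} [FinGraded (FreeMonoid A)] {φ : A → NCSeries K N}
    (h : ∀ a, Ord (deg (FreeMonoid.of a)) (φ a)) : LocFin (FreeMonoid.lift φ) :=
  LocFin.of_ord (Ord.lift h)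

/-- By `T(aw) - aw = (Ta - a)Tw + a(Tw - w)`, where both summands have order greater than the degree
of `aw`. -/
theorem IsHom.unip_free {A : Type*} [FinGraded (FreeMonoid A)]
    {T : NCSeries K (FreeMonoid A) →ₗ[K] NCSeries K (FreeMonoid A)} (hT : IsHom T)
    (h : ∀ a, Ord (deg (FreeMonoid.of a) + 1)
      (T (NCSeries.basis K (FreeMonoid.of a)) - NCSeries.basis K (FreeMonoid.of a))) :
    Unip T := by
  refine Unip.of_basis hT.cont fun w => ?_
  induction w using FreeMonoid.inductionOn' with
  | one =>
    rw [← one_def, hT.map_one, sub_self]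
    exact fun _ _ => rfl
  | of_mul a w ih =>
    have h1 : T (NCSeries.basis K (FreeMonoid.of a * w)) - NCSeries.basis K (FreeMonoid.of a * w) =
        (T (NCSeries.basis K (FreeMonoid.of a)) - NCSeries.basis K (FreeMonoid.of a)) *
          ((T (NCSeries.basis K w) - NCSeries.basis K w) + NCSeries.basis K w) +
        NCSeries.basis K (FreeMonoid.of a) * (T (NCSeries.basis K w) - NCSeries.basis K w) := by
      rw [← basis_mul_basis, hT.map_mul]
      noncomm_ring
    rw [h1, deg_mul]
    refine Ord.add ?_ ?_
    · exact ((h a).mul ((ih.mono (Nat.le_succ _)).add (Ord.basis w))).mono (by omega)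
    · exact ((Ord.basis _).mul ih).mono (by omega)

/-- The constant term of a product. -/
theorem coeff_one_mul {M : Type*} [Monoid M] [FinGraded M] [Finset.HasMulAntidiagonal M]
    (hM : ∀ m : M, deg m = 0 → m = 1) (f g : NCSeries K M) :
    (f * g).coeff 1 = f.coeff 1 * g.coeff 1 := by
  rw [coeff_mul, Finset.sum_eq_single (1, 1)]
  · rintro ⟨a, b⟩ hp hne
    have h := Finset.HasMulAntidiagonal.mem_mulAntidiagonal.1 hp
    have h1 := deg_mul a b
    change a * b = 1 at h
    rw [h, deg_one] at h1
    exact absurd (Prod.ext (hM a (by omega)) (hM b (by omega))) hne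
  · simp

theorem ord_sub_one {M : Type*} [Monoid M] [FinGraded M] [Finset.HasMulAntidiagonal M]
    (hM : ∀ m : M, deg m = 0 → m = 1) {f : NCSeries K M} (hf : f.coeff 1 = 1) :
    Ord 1 (f - 1) := fun m hm => by
  rw [hM m (by omega), coeff_sub, hf, one_def, coeff_basis_self, sub_self]

theorem unip_mulLeft {f : NCSeries K M} (hf : Ord 1 (f - 1)) : Unip (LinearMap.mulLeft K f) :=
  Unip.of_basis (IsCont.mulLeft f) fun m => by
    have h : LinearMap.mulLeft K f (NCSeries.basis K m) - NCSeries.basis K m =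
        (f - 1) * NCSeries.basis K m := by
      rw [LinearMap.mulLeft_apply, sub_mul, one_mul]
    rw [h, add_comm]
    exact hf.mul (Ord.basis m)

theorem unip_mulRight {f : NCSeries K M} (hf : Ord 1 (f - 1)) : Unip (LinearMap.mulRight K f) :=
  Unip.of_basis (IsCont.mulRight f) fun m => by
    have h : LinearMap.mulRight K f (NCSeries.basis K m) - NCSeries.basis K m =
        NCSeries.basis K m * (f - 1) := by
      rw [LinearMap.mulRight_apply, mul_sub, mul_one]
    rw [h]
    exact (Ord.basis m).mul hf

/-! ### Values of power series -/

theorem locFin_pow {a : NCSeries K M} (ha : Ord 1 a) : LocFin fun n : ℕ => a ^ n := fun m => by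
  refine (Set.finite_Iic (deg m)).subset fun n hn => ?_
  by_contra hlt
  refine hn ((ha.pow n) m ?_)
  rw [mul_one]
  exact not_le.1 hlt

/-- Power series as series indexed by `ℕ`. -/
noncomputable def psSer (K : Type u) [CommRing K] : PowerSeries K ≃ₗ[K] NCSeries K ℕ where
  toFun p := ⟨fun n => PowerSeries.coeff n p⟩
  map_add' p q := by ext n; simp
  map_smul' c p := by ext n; simp
  invFun f := PowerSeries.mk f.coeff
  left_inv p := by ext n; simp
  right_inv f := by ext n; simp

theorem coeff_psSer (p : PowerSeries K) (n : ℕ) :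
    (psSer K p).coeff n = PowerSeries.coeff n p := rfl

theorem coeff_psSer_symm (f : NCSeries K ℕ) (n : ℕ) :
    PowerSeries.coeff n ((psSer K).symm f) = f.coeff n := by
  change PowerSeries.coeff n (PowerSeries.mk f.coeff) = _
  simp

theorem evalPS_eq (p : PowerSeries K) (a : NCSeries K M) :
    evalPS p a = lsum (fun n : ℕ => a ^ n) (psSer K p) := rfl

theorem psSer_symm_basis (n : ℕ) :
    (psSer K).symm (NCSeries.basis K n) = (PowerSeries.X : PowerSeries K) ^ n := by
  ext m
  rw [coeff_psSer_symm, coeff_basis, PowerSeries.coeff_X_pow]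
  congr

theorem evalPS_X_pow {a : NCSeries K M} (ha : Ord 1 a) (n : ℕ) :
    evalPS (PowerSeries.X ^ n) a = a ^ n := by
  rw [evalPS_eq, ← psSer_symm_basis, LinearEquiv.apply_symm_apply, (locFin_pow ha).lsum_basis]

theorem evalPS_one {a : NCSeries K M} (ha : Ord 1 a) : evalPS (1 : PowerSeries K) a = 1 := by
  simpa using evalPS_X_pow ha 0

/-- Two continuous linear functions of a power series agree if they agree on monomials. -/
theorem ext_powerSeries {T U : PowerSeries K →ₗ[K] NCSeries K M}
    (hT : IsCont (T ∘ₗ (psSer K).symm.toLinearMap)) (hU : IsCont (U ∘ₗ (psSer K).symm.toLinearMap))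
    (h : ∀ n, T (PowerSeries.X ^ n) = U (PowerSeries.X ^ n)) (p : PowerSeries K) : T p = U p := by
  have := hT.ext_apply hU (fun n => by simpa [psSer_symm_basis] using h n) (psSer K p)
  simpa using this

/-- `evalPS` as a linear map. -/
noncomputable def evalL (a : NCSeries K M) : PowerSeries K →ₗ[K] NCSeries K M :=
  lsum (fun n : ℕ => a ^ n) ∘ₗ (psSer K).toLinearMap

theorem evalL_apply (a : NCSeries K M) (p : PowerSeries K) : evalL a p = evalPS p a := rfl

theorem cont_evalL (a : NCSeries K M) : IsCont (evalL a ∘ₗ (psSer K).symm.toLinearMap) := by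
  have : evalL a ∘ₗ (psSer K).symm.toLinearMap = lsum (fun n : ℕ => a ^ n) := by
    ext f : 1
    simp [evalL]
  rw [this]
  exact IsCont.lsum _

theorem cont_psMul (p : PowerSeries K) :
    IsCont ((psSer K).toLinearMap ∘ₗ LinearMap.mulLeft K p ∘ₗ (psSer K).symm.toLinearMap) := by
  intro n
  refine ⟨Finset.range (n + 1), fun f hf => ?_⟩
  change PowerSeries.coeff n (p * (psSer K).symm f) = 0
  rw [PowerSeries.coeff_mul]
  refine Finset.sum_eq_zero fun x hx => ?_
  rw [coeff_psSer_symm, hf x.2 (by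
    have := Finset.HasAntidiagonal.mem_antidiagonal.1 hx
    simp; omega), mul_zero]

theorem evalPS_mul {a : NCSeries K M} (ha : Ord 1 a) (p q : PowerSeries K) :
    evalPS (p * q) a = evalPS p a * evalPS q a := by
  have hc : ∀ p : PowerSeries K, IsCont ((evalL a ∘ₗ LinearMap.mulLeft K p) ∘ₗ
      (psSer K).symm.toLinearMap) := fun p => by
    have : (evalL a ∘ₗ LinearMap.mulLeft K p) ∘ₗ (psSer K).symm.toLinearMap =
        (evalL a ∘ₗ (psSer K).symm.toLinearMap) ∘ₗ
        ((psSer K).toLinearMap ∘ₗ LinearMap.mulLeft K p ∘ₗ (psSer K).symm.toLinearMap) := by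
      ext f : 1
      simp
    rw [this]
    exact (cont_evalL a).comp (cont_psMul p)
  have h1 : ∀ n q, evalPS (PowerSeries.X ^ n * q) a = a ^ n * evalPS q a := fun n q =>
    ext_powerSeries (T := evalL a ∘ₗ LinearMap.mulLeft K (PowerSeries.X ^ n))
      (U := LinearMap.mulLeft K (a ^ n) ∘ₗ evalL a) (hc _)
      (by rw [LinearMap.comp_assoc]; exact (IsCont.mulLeft _).comp (cont_evalL a))
      (fun m => by simp [evalL_apply, ← pow_add, evalPS_X_pow ha]) q
  have h2 := ext_powerSeries (T := evalL a ∘ₗ LinearMap.mulLeft K q)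
      (U := LinearMap.mulRight K (evalPS q a) ∘ₗ evalL a) (hc _)
      (by rw [LinearMap.comp_assoc]; exact (IsCont.mulRight _).comp (cont_evalL a))
      (fun m => by
        simp only [LinearMap.comp_apply, LinearMap.mulLeft_apply, LinearMap.mulRight_apply,
          evalL_apply]
        rw [mul_comm, h1, evalPS_X_pow ha]) p
  simp only [LinearMap.comp_apply, LinearMap.mulLeft_apply, LinearMap.mulRight_apply,
          evalL_apply] at h2
  rw [mul_comm, h2]

/-- If `T` intertwines the multiplications by `a` and `b`, it does so for `p(a)` and `p(b)`. -/
theorem evalPS_intertwine {T : NCSeries K M →ₗ[K] NCSeries K N} (hT : IsCont T)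
    {a : NCSeries K M} {b : NCSeries K N} (ha : Ord 1 a) (hb : Ord 1 b)
    (h : ∀ f, T (a * f) = b * T f) (p : PowerSeries K) (f : NCSeries K M) :
    T (evalPS p a * f) = evalPS p b * T f := by
  have hp : ∀ n f, T (a ^ n * f) = b ^ n * T f := by
    intro n
    induction n with
    | zero => simp
    | succ n ih => intro f; rw [pow_succ, mul_assoc, ih, h, pow_succ, mul_assoc]
  exact ext_powerSeries (T := T ∘ₗ LinearMap.mulRight K f ∘ₗ evalL a)
      (U := LinearMap.mulRight K (T f) ∘ₗ evalL b)
      (by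
        rw [LinearMap.comp_assoc, LinearMap.comp_assoc]
        exact hT.comp ((IsCont.mulRight _).comp (cont_evalL a)))
      (by rw [LinearMap.comp_assoc]; exact (IsCont.mulRight _).comp (cont_evalL b))
      (fun m => by simp [evalL_apply, evalPS_X_pow ha, evalPS_X_pow hb, hp]) p

theorem IsHom.map_evalPS {T : NCSeries K M →ₗ[K] NCSeries K N} (hT : IsHom T)
    {a : NCSeries K M} (ha : Ord 1 a) (hb : Ord 1 (T a)) (p : PowerSeries K) :
    T (evalPS p a) = evalPS p (T a) := by
  have := evalPS_intertwine hT.cont ha hb (fun f => hT.map_mul a f) p 1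
  rwa [mul_one, hT.map_one, mul_one] at this

theorem evalPS_comm {a f : NCSeries K M} (ha : Ord 1 a) (h : a * f = f * a) (p : PowerSeries K) :
    evalPS p a * f = f * evalPS p a := by
  have := evalPS_intertwine (T := LinearMap.mulLeft K f) (IsCont.mulLeft f) ha ha
    (fun g => by simp only [LinearMap.mulLeft_apply]; rw [← mul_assoc, ← h, mul_assoc]) p 1
  simpa using this.symm

theorem coeff_evalPS_one {a : NCSeries K M} (ha : Ord 1 a) (p : PowerSeries K) :
    (evalPS p a).coeff 1 = PowerSeries.coeff 0 p := by
  -- The scalar-valued constant term is multiplied by the series `1`, so that the density argument,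
  -- which concerns series-valued maps, applies to it.
  have := ext_powerSeries (M := M)
    (T := (coeffL K (1 : M)).smulRight (1 : NCSeries K M) ∘ₗ evalL a)
    (U := (PowerSeries.coeff 0).smulRight (1 : NCSeries K M))
    (by
      rw [LinearMap.comp_assoc]
      refine IsCont.comp (fun n => ⟨{1}, fun f hf => ?_⟩) (cont_evalL a)
      simp [hf 1 (Finset.mem_singleton_self _)])
    (fun n => ⟨{0}, fun f hf => by
      rw [LinearMap.comp_apply, LinearMap.smulRight_apply, LinearEquiv.coe_coe, coeff_psSer_symm,
        hf 0 (Finset.mem_singleton_self _), zero_smul, coeff_zero]⟩)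
    (fun n => by
      simp only [LinearMap.comp_apply, LinearMap.smulRight_apply, coeffL_apply, evalL_apply,
        evalPS_X_pow ha]
      cases n with
      | zero => simp [one_def, coeff_basis_self]
      | succ n =>
        rw [(ha.pow (n + 1)) 1 (by rw [deg_one]; omega)]
        simp) p
  have h2 := congrArg (fun f => f.coeff 1) this
  simpa [evalL_apply, one_def, coeff_basis_self] using h2

end Mul

end NCSeries

open FinGraded NCSeries

/-! ### The group of group-like series -/

section XAlgebra

variable {K : Type u} [CommRing K] {G : Type v}

theorem eq_one_of_deg_X [Finite G] (w : XWord G) (h : deg w = 0) : w = 1 := by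
  induction w using FreeMonoid.inductionOn' with
  | one => rfl
  | of_mul a w _ => rw [deg_mul, deg_of_X] at h; omega

theorem eq_one_of_deg_Y [Finite G] (w : YWord G) (h : deg w = 0) : w = 1 := by
  induction w using FreeMonoid.inductionOn' with
  | one => rfl
  | of_mul a w _ =>
    rw [deg_mul, deg_of_Y] at h
    have := a.1.pos
    omega

theorem eq_one_of_deg_prod {M : Type*} [Monoid M] [FinGraded M]
    (hM : ∀ m : M, deg m = 0 → m = 1) (p : M × M) (h : deg p = 0) : p = 1 := by
  rw [deg_prod] at h
  exact Prod.ext (hM _ (by omega)) (hM _ (by omega))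

/-- The letter of `K⟨⟨X⟩⟩` attached to `a`. -/
noncomputable abbrev xl (K : Type u) [CommRing K] {G : Type v} (a : Option G) : KX K G :=
  basis K (FreeMonoid.of a)

variable [CommGroup G]

theorem x0_eq : x0 K = xl K (none : Option G) := rfl

theorem xg_eq (g : G) : xg K g = xl K (some g) := rfl

theorem ord_xl [Finite G] (a : Option G) : Ord 1 (xl K a) := by
  simpa using Ord.basis (K := K) (FreeMonoid.of a : XWord G)

theorem isHom_coprod [Finite G] : IsHom (coprod K : KX K G →ₗ[K] KXX K G) :=
  (LocFin.lift fun a => by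
    refine Ord.add ?_ ?_
    · exact (Ord.basis _).mono (by simp [deg_prod, deg_one])
    · exact (Ord.basis _).mono (by simp [deg_prod, deg_one])).isHom

theorem locFin_coprod [Finite G] : LocFin (FreeMonoid.lift fun a : Option G =>
    (basis K (FreeMonoid.of a, 1) + basis K (1, FreeMonoid.of a) : KXX K G)) :=
  LocFin.lift fun a => by
    refine Ord.add ?_ ?_
    · exact (Ord.basis _).mono (by simp [deg_prod, deg_one])
    · exact (Ord.basis _).mono (by simp [deg_prod, deg_one])

theorem coprod_xl [Finite G] (a : Option G) :
    coprod K (xl K a) = tmul (xl K a) 1 + tmul 1 (xl K a) := by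
  rw [coprod, locFin_coprod.lsum_basis, FreeMonoid.lift_eval_of, basis_prod, basis_prod]
  rfl

theorem tAct_basis (g : G) (w : XWord G) :
    tAct K g (basis K w) = basis K (FreeMonoid.map (Option.map (g * ·)) w) := by
  have hinv : ∀ (h : G) (w : XWord G), FreeMonoid.map (Option.map (h⁻¹ * ·))
      (FreeMonoid.map (Option.map (h * ·)) w) = w := fun h w => by
    rw [← MonoidHom.comp_apply, ← FreeMonoid.map_comp]
    have : (Option.map (h⁻¹ * ·) ∘ Option.map (h * ·) : Option G → Option G) = id := by
      ext a : 1
      cases a <;> simp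
    rw [this]
    simp
  ext n
  rw [tAct, coeff_reindex]
  by_cases h : n = FreeMonoid.map (Option.map (g * ·)) w
  · rw [h, hinv, coeff_basis_self, coeff_basis_self]
  · rw [coeff_basis_of_ne h, coeff_basis_of_ne]
    intro h'
    apply h
    rw [← h']
    simpa using (hinv g⁻¹ n).symm

theorem tAct_xl (g : G) (a : Option G) : tAct K g (xl K a) = xl K (a.map (g * ·)) := by
  rw [tAct_basis, FreeMonoid.map_of]

theorem isHom_tAct (g : G) : IsHom (tAct K g : KX K G →ₗ[K] KX K G) where
  cont := IsCont.reindex _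
  map_mul := (IsCont.reindex _).map_mul fun a b => by
    change tAct K g _ = tAct K g _ * tAct K g _
    simp only [tAct_basis, map_mul, basis_mul_basis]
  map_one := by rw [one_def, tAct_basis, map_one]

theorem tAct_tAct (g h : G) (f : KX K G) : tAct K g (tAct K h f) = tAct K (g * h) f := by
  refine LinearMap.congr_fun (((isHom_tAct g).comp (isHom_tAct h)).ext_free
    (isHom_tAct (g * h)) fun a => ?_) f
  change tAct K g (tAct K h (xl K a)) = tAct K (g * h) (xl K a)
  simp only [tAct_xl]
  cases a <;> simp [mul_assoc]

theorem tAct_one (f : KX K G) : tAct K (1 : G) f = f := by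
  refine LinearMap.congr_fun ((isHom_tAct 1).ext_free (U := LinearMap.id)
    ⟨IsCont.id, fun _ _ => rfl, rfl⟩ fun a => ?_) f
  rw [tAct_basis, FreeMonoid.map_of]
  cases a <;> simp

theorem coprod_tAct [Finite G] (g : G) (f : KX K G) :
    coprod K (tAct K g f) = tensorSq (tAct K g) (coprod K f) := by
  refine LinearMap.congr_fun ((isHom_coprod.comp (isHom_tAct g)).ext_free
    ((isHom_tAct g).tensorSq.comp isHom_coprod) fun a => ?_) f
  simp only [LinearMap.comp_apply]
  change coprod K (tAct K g (xl K a)) = tensorSq (tAct K g) (coprod K (xl K a))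
  rw [tAct_xl, coprod_xl, coprod_xl, map_add, tensorSq_tmul, tensorSq_tmul, tAct_xl,
    (isHom_tAct g).map_one]

namespace GroupLike

variable (Ψ : GroupLike K G)

theorem serInv_mul_ser : Ψ.serInv * Ψ.ser = 1 := Ψ.1.inv_mul

theorem ser_mul_serInv : Ψ.ser * Ψ.serInv = 1 := Ψ.1.mul_inv

theorem coprod_ser : coprod K Ψ.ser = tmul Ψ.ser Ψ.ser := Ψ.2

theorem coprod_serInv [Finite G] : coprod K Ψ.serInv = tmul Ψ.serInv Ψ.serInv := by
  have h1 : coprod K Ψ.serInv * tmul Ψ.ser Ψ.ser = 1 := by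
    rw [← coprod_ser, ← isHom_coprod.map_mul, serInv_mul_ser, isHom_coprod.map_one]
  have h2 : tmul Ψ.ser Ψ.ser * tmul Ψ.serInv Ψ.serInv = 1 := by
    rw [tmul_mul_tmul, ser_mul_serInv, tmul_one_one]
  calc coprod K Ψ.serInv = coprod K Ψ.serInv * (tmul Ψ.ser Ψ.ser * tmul Ψ.serInv Ψ.serInv) := by
        rw [h2, mul_one]
    _ = _ := by rw [← mul_assoc, h1, one_mul]

theorem coeff_one_coprod [Finite G] (f : KX K G) : (coprod K f).coeff 1 = f.coeff 1 := by
  have h : IsCont ((coeffL K (1 : XWord G × XWord G)).smulRight (1 : KX K G) ∘ₗ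
      (coprod K : KX K G →ₗ[K] KXX K G)) :=
    IsCont.comp (fun n => ⟨{1}, fun f hf => by
      simp [hf 1 (Finset.mem_singleton_self _)]⟩) isHom_coprod.cont
  have h' : IsCont ((coeffL K (1 : XWord G)).smulRight (1 : KX K G)) := fun n =>
    ⟨{1}, fun f hf => by simp [hf 1 (Finset.mem_singleton_self _)]⟩
  have h2 := h.ext_apply h' (fun w => by
    simp only [LinearMap.comp_apply, LinearMap.smulRight_apply, coeffL_apply]
    congr 1
    induction w using FreeMonoid.inductionOn' with
    | one => rw [← one_def, isHom_coprod.map_one, one_def, one_def, coeff_basis_self,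
        coeff_basis_self]
    | of_mul a w ih =>
      rw [← basis_mul_basis, isHom_coprod.map_mul, coeff_one_mul
        (eq_one_of_deg_prod eq_one_of_deg_X), coeff_one_mul eq_one_of_deg_X, ih]
      congr 1
      rw [coprod_xl]
      have h0 : (xl K a).coeff 1 = 0 := ord_xl a 1 (by rw [deg_one]; omega)
      simp [coeff_tmul, h0]) f
  simpa [one_def, coeff_basis_self] using congrArg (fun f => f.coeff 1) h2

/-- The constant term is idempotent because the series is group-like, and it is invertible. -/
theorem coeff_one_ser [Finite G] : Ψ.ser.coeff 1 = 1 := by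
  have h1 := congrArg (fun f => f.coeff 1) Ψ.coprod_ser
  simp only [coeff_one_coprod, coeff_tmul, Prod.fst_one, Prod.snd_one] at h1
  have h2 := congrArg (fun f => f.coeff 1) Ψ.ser_mul_serInv
  simp only [coeff_one_mul eq_one_of_deg_X, one_def, coeff_basis_self] at h2
  calc Ψ.ser.coeff 1 = Ψ.ser.coeff 1 * (Ψ.ser.coeff 1 * Ψ.serInv.coeff 1) := by rw [h2, mul_one]
    _ = 1 := by rw [← mul_assoc, ← h1, h2]

theorem coeff_one_serInv [Finite G] : Ψ.serInv.coeff 1 = 1 := by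
  have h2 := congrArg (fun f => f.coeff 1) Ψ.ser_mul_serInv
  simpa [coeff_one_mul eq_one_of_deg_X, one_def, coeff_basis_self, coeff_one_ser] using h2

theorem ord_ser [Finite G] : Ord 1 (Ψ.ser - 1) :=
  ord_sub_one eq_one_of_deg_X Ψ.coeff_one_ser

theorem ord_serInv [Finite G] : Ord 1 (Ψ.serInv - 1) :=
  ord_sub_one eq_one_of_deg_X Ψ.coeff_one_serInv

end GroupLike

theorem ord_tAct [Finite G] (g : G) {k : ℕ} {f : KX K G} (hf : Ord k f) : Ord k (tAct K g f) :=
  fun m hm => hf _ (by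
    have : ∀ w : XWord G, deg (FreeMonoid.map (Option.map (g⁻¹ * ·)) w) = deg w := fun w => by
      induction w using FreeMonoid.inductionOn' with
      | one => rw [map_one]
      | of_mul a w ih => rw [map_mul, deg_mul, deg_mul, ih, FreeMonoid.map_of, deg_of_X, deg_of_X]
    rwa [this])

/-- The images of the letters under `aut_Ψ`. -/
noncomputable def autLetter (Ψ : GroupLike K G) (a : Option G) : KX K G :=
  match a with
  | none => x0 K
  | some g => tAct K g Ψ.serInv * xg K g * tAct K g Ψ.ser

theorem autX_eq (Ψ : GroupLike K G) : autX Ψ = lsum (FreeMonoid.lift (autLetter Ψ)) := rfl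

/-- Conjugation by a series with constant term `1` alters a letter only in degree `2` and above;
this makes `aut_Ψ` unipotent. -/
theorem ord_autLetter [Finite G] (Ψ : GroupLike K G) (a : Option G) : Ord 2 (autLetter Ψ a - xl K a) := by
  cases a with
  | none => intro m _; simp [autLetter, x0_eq]
  | some g =>
    have h1 := ord_tAct g Ψ.ord_serInv
    have h2 := ord_tAct g Ψ.ord_ser
    rw [map_sub, (isHom_tAct g).map_one] at h1 h2
    have h : autLetter Ψ (some g) - xl K (some g) =
        (tAct K g Ψ.serInv - 1) * xl K (some g) * (tAct K g Ψ.ser - 1) +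
        (tAct K g Ψ.serInv - 1) * xl K (some g) + xl K (some g) * (tAct K g Ψ.ser - 1) := by
      simp only [autLetter, xg_eq]
      noncomm_ring
    rw [h]
    exact ((((h1.mul (ord_xl _)).mul h2).mono (by omega)).add
      ((h1.mul (ord_xl _)).mono (by omega))).add (((ord_xl _).mul h2).mono (by omega))

theorem locFin_autX [Finite G] (Ψ : GroupLike K G) : LocFin (FreeMonoid.lift (autLetter Ψ)) :=
  LocFin.lift fun a => by
    rw [deg_of_X]
    have := ((ord_autLetter Ψ a).mono (l := 1) (by omega)).add (ord_xl a)
    simpa using this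

theorem isHom_autX [Finite G] (Ψ : GroupLike K G) : IsHom (autX Ψ) := (locFin_autX Ψ).isHom

theorem autX_xl [Finite G] (Ψ : GroupLike K G) (a : Option G) :
    autX Ψ (xl K a) = autLetter Ψ a := by
  rw [autX_eq, (locFin_autX Ψ).lsum_basis, FreeMonoid.lift_eval_of]

theorem unip_autX [Finite G] (Ψ : GroupLike K G) : Unip (autX Ψ) :=
  (isHom_autX Ψ).unip_free fun a => by
    rw [deg_of_X]
    simpa [autX_xl] using ord_autLetter Ψ a

/-- This equivariance turns `aut_Ψ(t_g(Φ))` into `t_g(aut_Ψ(Φ))`, which is what makes `aut`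
multiplicative in `autX_mul`. -/
theorem autX_tAct [Finite G] (Ψ : GroupLike K G) (g : G) (f : KX K G) :
    autX Ψ (tAct K g f) = tAct K g (autX Ψ f) := by
  refine LinearMap.congr_fun (((isHom_autX Ψ).comp (isHom_tAct g)).ext_free
    ((isHom_tAct g).comp (isHom_autX Ψ)) fun a => ?_) f
  change autX Ψ (tAct K g (xl K a)) = tAct K g (autX Ψ (xl K a))
  rw [tAct_xl, autX_xl, autX_xl]
  cases a with
  | none => simp only [autLetter, Option.map_none, x0_eq, tAct_xl]
  | some h =>
    simp only [autLetter, Option.map_some, (isHom_tAct g).map_mul, tAct_tAct, xg_eq, tAct_xl]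

/-- A primitive letter stays primitive when it is conjugated by the group-like series `t_g(Ψ)`. -/
theorem coprod_autX [Finite G] (Ψ : GroupLike K G) (f : KX K G) :
    coprod K (autX Ψ f) = tensorSq (autX Ψ) (coprod K f) := by
  refine LinearMap.congr_fun ((isHom_coprod.comp (isHom_autX Ψ)).ext_free
    ((isHom_autX Ψ).tensorSq.comp isHom_coprod) fun a => ?_) f
  change coprod K (autX Ψ (xl K a)) = tensorSq (autX Ψ) (coprod K (xl K a))
  rw [autX_xl, coprod_xl, map_add, tensorSq_tmul, tensorSq_tmul, autX_xl, (isHom_autX Ψ).map_one]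
  cases a with
  | none => simp only [autLetter, x0_eq, coprod_xl]
  | some g =>
    have h : tAct K g Ψ.serInv * tAct K g Ψ.ser = 1 := by
      rw [← (isHom_tAct g).map_mul, Ψ.serInv_mul_ser, (isHom_tAct g).map_one]
    simp only [autLetter, xg_eq, isHom_coprod.map_mul, coprod_xl, coprod_tAct, Ψ.coprod_ser,
      Ψ.coprod_serInv, tensorSq_tmul, mul_add, add_mul, tmul_mul_tmul, mul_one, h]

theorem S_apply (Ψ : GroupLike K G) (f : KX K G) : S Ψ f = Ψ.ser * autX Ψ f := rfl

theorem coprod_S [Finite G] (Ψ : GroupLike K G) (f : KX K G) :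
    coprod K (S Ψ f) = tensorSq (S Ψ) (coprod K f) := by
  have h : tensorSq (S Ψ) =
      LinearMap.mulLeft K (tmul Ψ.ser Ψ.ser) ∘ₗ tensorSq (autX Ψ) := by
    refine ((IsCont.mulLeft _).comp (isHom_autX Ψ).cont).tensorSq.ext
      ((IsCont.mulLeft _).comp (isHom_autX Ψ).cont.tensorSq) ?_
    rintro ⟨a, b⟩
    rw [LinearMap.comp_apply, tensorSq_basis, tensorSq_basis, LinearMap.mulLeft_apply,
      tmul_mul_tmul]
    rfl
  rw [S_apply, isHom_coprod.map_mul, coprod_autX, Ψ.coprod_ser, h]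
  rfl

theorem unip_S [Finite G] (Ψ : GroupLike K G) : Unip (S Ψ) :=
  (unip_mulLeft Ψ.ord_ser).comp (unip_autX Ψ)

namespace GroupLike

theorem ser_injective : Function.Injective (ser : GroupLike K G → KX K G) := fun _ _ h =>
  Subtype.ext (Units.ext h)

/-- The product `Ψ ⊛ Φ`. -/
noncomputable scoped instance instMul [Finite G] : Mul (GroupLike K G) where
  mul Ψ Φ := ⟨⟨Ψ.ser * autX Ψ Φ.ser, autX Ψ Φ.serInv * Ψ.serInv, by
      rw [mul_assoc, ← mul_assoc (autX Ψ _), ← (isHom_autX Ψ).map_mul, Φ.ser_mul_serInv,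
        (isHom_autX Ψ).map_one, one_mul, Ψ.ser_mul_serInv], by
      rw [mul_assoc, ← mul_assoc Ψ.serInv, Ψ.serInv_mul_ser, one_mul, ← (isHom_autX Ψ).map_mul,
        Φ.serInv_mul_ser, (isHom_autX Ψ).map_one]⟩, by
      change coprod K (S Ψ Φ.ser) = tmul (S Ψ Φ.ser) (S Ψ Φ.ser)
      rw [coprod_S, Φ.coprod_ser, tensorSq_tmul]⟩

theorem mul_ser [Finite G] (Ψ Φ : GroupLike K G) : (Ψ * Φ).ser = Ψ.ser * autX Ψ Φ.ser := rfl

theorem mul_serInv [Finite G] (Ψ Φ : GroupLike K G) :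
    (Ψ * Φ).serInv = autX Ψ Φ.serInv * Ψ.serInv := rfl

noncomputable scoped instance instOne [Finite G] : One (GroupLike K G) where
  one := ⟨1, by simp only [Units.val_one, isHom_coprod.map_one, tmul_one_one]⟩

theorem one_ser [Finite G] : (1 : GroupLike K G).ser = 1 := rfl

theorem one_serInv [Finite G] : (1 : GroupLike K G).serInv = 1 := rfl

theorem autX_mul [Finite G] (Ψ Φ : GroupLike K G) : autX (Ψ * Φ) = autX Ψ ∘ₗ autX Φ := by
  refine (isHom_autX _).ext_free ((isHom_autX Ψ).comp (isHom_autX Φ)) fun a => ?_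
  change autX (Ψ * Φ) (xl K a) = autX Ψ (autX Φ (xl K a))
  rw [autX_xl, autX_xl]
  cases a with
  | none => simp only [autLetter, x0_eq, autX_xl]
  | some g =>
    simp only [autLetter, mul_ser, mul_serInv, (isHom_autX Ψ).map_mul, (isHom_tAct g).map_mul,
      autX_tAct, xg_eq, autX_xl, mul_assoc]

theorem autX_one [Finite G] : autX (1 : GroupLike K G) = LinearMap.id := by
  refine (isHom_autX _).ext_free ⟨IsCont.id, fun _ _ => rfl, rfl⟩ fun a => ?_
  change autX _ (xl K a) = xl K a
  rw [autX_xl]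
  cases a with
  | none => rfl
  | some g => simp only [autLetter, one_ser, one_serInv, (isHom_tAct g).map_one, xg_eq, one_mul,
      mul_one]

/-- The inverse is `S_Ψ⁻¹(1) = aut_Ψ⁻¹(Ψ⁻¹)`, which exists because `aut_Ψ` is unipotent. It is
group-like because the injective map `S_Ψ ⊗ S_Ψ` sends both sides of that condition to `1`. -/
theorem exists_mul_eq_one [Finite G] (Ψ : GroupLike K G) : ∃ Φ : GroupLike K G, Ψ * Φ = 1 := by
  obtain ⟨f, hf⟩ := (unip_autX Ψ).surjective Ψ.serInv
  obtain ⟨f', hf'⟩ := (unip_autX Ψ).surjective Ψ.ser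
  have h1 : f * f' = 1 := (unip_autX Ψ).injective (by
    rw [(isHom_autX Ψ).map_mul, hf, hf', Ψ.serInv_mul_ser, (isHom_autX Ψ).map_one])
  have h2 : f' * f = 1 := (unip_autX Ψ).injective (by
    rw [(isHom_autX Ψ).map_mul, hf, hf', Ψ.ser_mul_serInv, (isHom_autX Ψ).map_one])
  have h3 : S Ψ f = 1 := by rw [S_apply, hf, Ψ.ser_mul_serInv]
  refine ⟨⟨⟨f, f', h1, h2⟩, (unip_S Ψ).tensorSq.injective ?_⟩, ser_injective h3⟩
  rw [← coprod_S, tensorSq_tmul]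
  change coprod K (S Ψ f) = tmul (S Ψ f) (S Ψ f)
  rw [h3, isHom_coprod.map_one, tmul_one_one]

noncomputable scoped instance instInv [Finite G] : Inv (GroupLike K G) where
  inv Ψ := Ψ.exists_mul_eq_one.choose

noncomputable scoped instance instGroup [Finite G] : Group (GroupLike K G) :=
  Group.ofRightAxioms
    (fun Ψ Φ Θ => ser_injective (by
      rw [mul_ser, autX_mul, mul_ser, mul_ser, mul_ser, (isHom_autX Ψ).map_mul, mul_assoc]
      rfl))
    (fun Ψ => ser_injective (by rw [mul_ser, one_ser, (isHom_autX Ψ).map_one, mul_one]))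
    (fun Ψ => Ψ.exists_mul_eq_one.choose_spec)

end GroupLike

end XAlgebra

open scoped DoubleShuffle.GroupLike

/-! ### The series `Γ_Ψ` -/

section ExpSubst

variable {K : Type u} [CommRing K] [Algebra ℚ K]

/-- Positive powers of `p` are divisible by `Xᵏ`, so below degree `k` only the constant term of the
exponential is seen. -/
theorem constantCoeff_exp_subst {p : PowerSeries K} {k : ℕ} (hk : 0 < k)
    (hp : PowerSeries.X ^ k ∣ p) {n : ℕ} (hn : n < k) :
    PowerSeries.coeff n ((PowerSeries.exp K).subst p) = if n = 0 then 1 else 0 := by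
  have h0 : PowerSeries.constantCoeff p = 0 :=
    PowerSeries.X_dvd_iff.1 ((dvd_pow_self _ hk.ne').trans hp)
  rw [PowerSeries.coeff_subst' (PowerSeries.HasSubst.of_constantCoeff_zero' h0),
    finsum_eq_single _ 0]
  · simp [PowerSeries.coeff_one]
  · intro d hd
    have : PowerSeries.X ^ k ∣ p ^ d := hp.trans (dvd_pow_self p hd)
    rw [PowerSeries.X_pow_dvd_iff.1 this n hn, smul_zero]

/-- The quotient of the two sides has derivative zero and constant term `1`; over a `ℚ`-algebra it
is therefore `1`. -/
theorem exp_subst_add {p q : PowerSeries K} (hp : PowerSeries.constantCoeff p = 0)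
    (hq : PowerSeries.constantCoeff q = 0) :
    (PowerSeries.exp K).subst (p + q) =
      (PowerSeries.exp K).subst p * (PowerSeries.exp K).subst q := by
  have htf : IsAddTorsionFree K := IsAddTorsionFree.of_module_rat K
  have hs : ∀ {p : PowerSeries K}, PowerSeries.constantCoeff p = 0 → PowerSeries.HasSubst p :=
    fun h => PowerSeries.HasSubst.of_constantCoeff_zero' h
  have hc : ∀ {p : PowerSeries K}, PowerSeries.constantCoeff p = 0 →
      PowerSeries.constantCoeff ((PowerSeries.exp K).subst p) = 1 := fun {p} h => by
    have := constantCoeff_exp_subst (K := K) (p := p) (k := 1) one_pos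
      (by rw [pow_one]; exact PowerSeries.X_dvd_iff.2 h) one_pos
    simpa using this
  have hd : ∀ {p : PowerSeries K}, PowerSeries.constantCoeff p = 0 →
      PowerSeries.derivative K ((PowerSeries.exp K).subst p) =
        (PowerSeries.exp K).subst p * PowerSeries.derivative K p := fun h => by
    rw [PowerSeries.derivative_subst (hs h), PowerSeries.derivative_exp]
  have hpq : PowerSeries.constantCoeff (p + q) = 0 := by rw [map_add, hp, hq, add_zero]
  set B := (PowerSeries.exp K).subst p * (PowerSeries.exp K).subst q with hB
  have hBc : PowerSeries.constantCoeff B = 1 := by rw [hB, map_mul, hc hp, hc hq, one_mul]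
  obtain ⟨b, hb⟩ : IsUnit B := PowerSeries.isUnit_iff_constantCoeff.2 (by rw [hBc]; exact isUnit_one)
  have hBd : PowerSeries.derivative K B = B * PowerSeries.derivative K (p + q) := by
    rw [hB, Derivation.leibniz, hd hp, hd hq, map_add, smul_eq_mul, smul_eq_mul]
    ring
  have hone : (PowerSeries.exp K).subst (p + q) * ((b⁻¹ : (PowerSeries K)ˣ) : PowerSeries K) = 1 := by
    refine PowerSeries.derivative.ext ?_ ?_
    · rw [Derivation.leibniz, PowerSeries.derivative_inv, hd hpq, smul_eq_mul, smul_eq_mul, hb, hBd,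
        PowerSeries.derivative_one]
      have h1 : ((b⁻¹ : (PowerSeries K)ˣ) : PowerSeries K) * B = 1 := by rw [← hb, Units.inv_mul]
      linear_combination -((PowerSeries.exp K).subst (p + q) * ((b⁻¹ : (PowerSeries K)ˣ) : PowerSeries K) *
        PowerSeries.derivative K (p + q)) * h1
    · have h1 : PowerSeries.constantCoeff ((b⁻¹ : (PowerSeries K)ˣ) : PowerSeries K) = 1 := by
        have h2 := congrArg PowerSeries.constantCoeff b.inv_mul
        rwa [map_mul, hb, hBc, mul_one, map_one] at h2
      rw [map_mul, h1, hc hpq, map_one, one_mul]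
  calc _ = (PowerSeries.exp K).subst (p + q) * (((b⁻¹ : (PowerSeries K)ˣ) : PowerSeries K) * b) := by
        rw [Units.inv_mul, mul_one]
    _ = B := by rw [← mul_assoc, hone, one_mul, hb]

end ExpSubst

/-! ### Coefficients at the words `x₀ⁿx₁`, and multiplicativity of `Gam`. -/

section Gam

variable {K : Type u} [CommRing K] {G : Type v} [CommGroup G]

/-- The projection that kills all words with a letter `x_g`. -/
noncomputable def projX0 (K : Type u) [CommRing K] (G : Type v) : KX K G →ₗ[K] KX K G :=
  lsum (FreeMonoid.lift fun a : Option G => if a = none then xl K a else 0)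

theorem locFin_projX0 [Finite G] :
    LocFin (FreeMonoid.lift fun a : Option G => if a = none then xl K a else 0) :=
  LocFin.lift fun a => by
    rw [deg_of_X]
    split_ifs
    · exact ord_xl a
    · intro _ _
      rfl

theorem isHom_projX0 [Finite G] : IsHom (projX0 K G) := locFin_projX0.isHom

theorem projX0_xl [Finite G] (a : Option G) :
    projX0 K G (xl K a) = if a = none then xl K a else 0 := by
  rw [projX0, locFin_projX0.lsum_basis, FreeMonoid.lift_eval_of]

theorem projX0_basis [Finite G] (w : XWord G) :
    projX0 K G (basis K w) = 0 ∨
      projX0 K G (basis K w) = basis K w ∧ ∃ n : ℕ, w = w0 ^ n := by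
  induction w using FreeMonoid.inductionOn' with
  | one => exact Or.inr ⟨by rw [← one_def, isHom_projX0.map_one], 0, by rw [pow_zero]⟩
  | of_mul a w ih =>
    rw [← basis_mul_basis, isHom_projX0.map_mul]
    rcases ih with h | ⟨h, n, rfl⟩
    · left
      rw [h, mul_zero]
    · cases a with
      | none =>
        right
        rw [h, projX0_xl, if_pos rfl]
        exact ⟨rfl, n + 1, (pow_succ' _ _).symm⟩
      | some g =>
        left
        rw [projX0_xl, if_neg (by simp), zero_mul]

theorem projX0_pow [Finite G] (n : ℕ) : projX0 K G (basis K (w0 ^ n)) = basis K (w0 ^ n) := by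
  induction n with
  | zero => rw [pow_zero, ← one_def, isHom_projX0.map_one]
  | succ n ih =>
    rw [pow_succ', ← basis_mul_basis, isHom_projX0.map_mul, ih]
    congr 1
    exact (projX0_xl none).trans (if_pos rfl)

theorem coeff_projX0 [Finite G] (f : KX K G) (n : ℕ) :
    (projX0 K G f).coeff (w0 ^ n) = f.coeff (w0 ^ n) := by
  rw [← sub_eq_zero, ← coeff_sub]
  refine (isHom_projX0.cont.sub IsCont.id).coeff_eq_zero (fun w => ?_) f
  rw [LinearMap.sub_apply, LinearMap.id_apply, coeff_sub, sub_eq_zero]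
  by_cases hw : w0 ^ n = w
  · rw [← hw, projX0_pow]
  · rcases projX0_basis (K := K) w with h | ⟨h, -⟩
    · rw [h, coeff_zero, coeff_basis_of_ne hw]
    · rw [h]

theorem projX0_comm [Finite G] (f : KX K G) : projX0 K G f * x0 K = x0 K * projX0 K G f :=
  ((IsCont.mulRight (x0 K)).comp isHom_projX0.cont).ext_apply
    ((IsCont.mulLeft (x0 K)).comp isHom_projX0.cont) (fun w => by
      simp only [LinearMap.comp_apply, LinearMap.mulRight_apply, LinearMap.mulLeft_apply]
      rcases projX0_basis (K := K) w with h | ⟨h, n, rfl⟩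
      · rw [h, zero_mul, mul_zero]
      · rw [h, x0, basis_mul_basis, basis_mul_basis, ← pow_succ, ← pow_succ']) f

theorem eq_one_or_mul_of {A : Type*} (w : FreeMonoid A) :
    w = 1 ∨ ∃ u a, w = u * FreeMonoid.of a := by
  rcases List.eq_nil_or_concat (FreeMonoid.toList w) with h | ⟨l, a, h⟩
  · exact Or.inl h
  · refine Or.inr ⟨FreeMonoid.ofList l, a, ?_⟩
    rw [← FreeMonoid.ofList_toList w, h, List.concat_eq_append, FreeMonoid.ofList_append]
    rfl

/-- The coefficients at the words ending in `x_1`. -/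
def dropX1 (K : Type u) [CommRing K] (G : Type v) [CommGroup G] : KX K G →ₗ[K] KX K G :=
  reindex (· * wg 1)

theorem cont_dropX1 : IsCont (dropX1 K G) := IsCont.reindex _

theorem coeff_dropX1 (f : KX K G) (w : XWord G) : (dropX1 K G f).coeff w = f.coeff (w * wg 1) := rfl

theorem dropX1_basis_mul (u : XWord G) (a : Option G) :
    dropX1 K G (basis K (u * FreeMonoid.of a)) =
      basis K u * dropX1 K G (basis K (FreeMonoid.of a)) := by
  classical
  have hinj : ∀ {u u' : XWord G} {a b : Option G},
      u * FreeMonoid.of a = u' * FreeMonoid.of b → u = u' ∧ a = b := by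
    intro u u' a b h
    have := congrArg FreeMonoid.toList h
    simpa [FreeMonoid.toList_mul, FreeMonoid.toList_of] using this
  by_cases ha : a = some 1
  · subst ha
    have h1 : dropX1 K G (basis K (FreeMonoid.of (some 1))) = 1 := by
      ext w
      rw [coeff_dropX1, one_def]
      by_cases hw : w = 1
      · subst hw
        rw [one_mul]
        exact (coeff_basis_self _).trans (coeff_basis_self _).symm
      · rw [coeff_basis_of_ne hw, coeff_basis_of_ne]
        intro h
        exact hw (hinj (h.trans (one_mul _).symm)).1
    rw [h1, mul_one]
    ext w
    rw [coeff_dropX1]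
    by_cases hw : w = u
    · subst hw
      exact (coeff_basis_self _).trans (coeff_basis_self _).symm
    · rw [coeff_basis_of_ne hw, coeff_basis_of_ne]
      intro h
      exact hw (hinj h).1
  · have h1 : ∀ u : XWord G, dropX1 K G (basis K (u * FreeMonoid.of a)) = 0 := by
      intro u
      ext w
      rw [coeff_dropX1, coeff_basis_of_ne, coeff_zero]
      intro h
      exact ha (hinj h).2.symm
    have h2 := h1 1
    rw [one_mul] at h2
    rw [h1, h2, mul_zero]

/-- The last letter of a product belongs to the second factor, unless that factor contributes only
its constant term. -/
theorem dropX1_mul [Finite G] (f g : KX K G) :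
    dropX1 K G (f * g) = f * dropX1 K G g + g.coeff 1 • dropX1 K G f := by
  have hone : dropX1 K G 1 = 0 := by
    ext w
    rw [coeff_dropX1, one_def, coeff_basis_of_ne, coeff_zero]
    intro h
    simpa [wg] using congrArg FreeMonoid.length h
  have key : ∀ u v : XWord G, dropX1 K G (basis K u * basis K v) =
      basis K u * dropX1 K G (basis K v) + (basis K v).coeff 1 • dropX1 K G (basis K u) := by
    intro u v
    rcases eq_one_or_mul_of v with rfl | ⟨v, a, rfl⟩
    · rw [← one_def, hone, mul_one, mul_zero, zero_add, one_def, coeff_basis_self, one_smul]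
    · rw [basis_mul_basis, ← mul_assoc, dropX1_basis_mul, dropX1_basis_mul, coeff_basis_of_ne,
        zero_smul, add_zero, ← basis_mul_basis, mul_assoc]
      exact fun h => by simpa using congrArg FreeMonoid.length h
  have hsmul : ∀ h : KX K G, IsCont ((coeffL K (1 : XWord G)).smulRight h) := fun h n =>
    ⟨{1}, fun f hf => by simp [hf 1 (Finset.mem_singleton_self _)]⟩
  have h1 : ∀ u : XWord G, dropX1 K G (basis K u * g) =
      basis K u * dropX1 K G g + g.coeff 1 • dropX1 K G (basis K u) := fun u =>
    (cont_dropX1.comp (IsCont.mulLeft (basis K u))).ext_apply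
      (((IsCont.mulLeft (basis K u)).comp cont_dropX1).add (hsmul (dropX1 K G (basis K u))))
      (key u) g
  exact (cont_dropX1.comp (IsCont.mulRight g)).ext_apply
      ((IsCont.mulRight (dropX1 K G g)).add (cont_dropX1.smul (g.coeff 1))) h1 f

theorem dropX1_x0 : dropX1 K G (x0 K) = 0 := by
  ext w
  rw [coeff_dropX1, coeff_zero, x0, coeff_basis_of_ne]
  intro h
  have h1 := congrArg (fun w => (FreeMonoid.toList w).getLast?) h
  simp [FreeMonoid.toList_mul, FreeMonoid.toList_of, wg, w0] at h1

/-- The coefficients at the words `x₀ⁿ x_1`. -/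
noncomputable def depthOne (K : Type u) [CommRing K] (G : Type v) [CommGroup G] :
    KX K G →ₗ[K] KX K G :=
  projX0 K G ∘ₗ dropX1 K G

theorem coeff_depthOne [Finite G] (f : KX K G) (n : ℕ) :
    (depthOne K G f).coeff (w0 ^ n) = f.coeff (w0 ^ n * wg 1) := by
  rw [depthOne, LinearMap.comp_apply, coeff_projX0, coeff_dropX1]

theorem depthOne_mul [Finite G] (f g : KX K G) :
    depthOne K G (f * g) = projX0 K G f * depthOne K G g + g.coeff 1 • depthOne K G f := by
  simp only [depthOne, LinearMap.comp_apply, dropX1_mul, map_add, map_smul, isHom_projX0.map_mul]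

theorem projX0_tAct [Finite G] (g : G) (f : KX K G) :
    projX0 K G (tAct K g f) = projX0 K G f := by
  refine LinearMap.congr_fun ((isHom_projX0.comp (isHom_tAct g)).ext_free isHom_projX0
    fun a => ?_) f
  change projX0 K G (tAct K g (xl K a)) = projX0 K G (xl K a)
  rw [tAct_xl, projX0_xl, projX0_xl]
  cases a <;> simp

/-- Only the factor `t_g(Ψ⁻¹)` to the left of the single letter `x_g` contributes, by its powers of
`x₀`, which `t_g` does not move; the factor `t_g(Ψ)` on the right contributes its constant term `1`.
Powers of `x₀` commute with `x₀`, so the factor can be moved to the front. -/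
theorem depthOne_autX [Finite G] (Ψ : GroupLike K G) (f : KX K G) :
    depthOne K G (autX Ψ f) = projX0 K G Ψ.serInv * depthOne K G f := by
  have hd : IsCont (depthOne K G) := isHom_projX0.cont.comp cont_dropX1
  refine (hd.comp (isHom_autX Ψ).cont).ext_apply ((IsCont.mulLeft _).comp hd) (fun w => ?_) f
  simp only [LinearMap.comp_apply, LinearMap.mulLeft_apply]
  induction w using FreeMonoid.inductionOn' with
  | one =>
    have h : depthOne K G 1 = 0 := by
      have h1 := depthOne_mul (1 : KX K G) 1
      have h2 : (1 : KX K G).coeff 1 = 1 := coeff_basis_self _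
      rwa [mul_one, isHom_projX0.map_one, one_mul, h2, one_smul, left_eq_add] at h1
    rw [← one_def, (isHom_autX Ψ).map_one, h, mul_zero]
  | of_mul a w ih =>
    have h1 : (autX Ψ (basis K w)).coeff 1 = (basis K w).coeff 1 :=
      unip_autX Ψ _ _ fun m hm => by rw [deg_one] at hm; omega
    rw [← basis_mul_basis, (isHom_autX Ψ).map_mul, depthOne_mul, depthOne_mul, h1, ih, autX_xl]
    cases a with
    | none =>
      have h2 : depthOne K G (x0 K) = 0 := by
        rw [depthOne, LinearMap.comp_apply, dropX1_x0, map_zero]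
      have h3 : projX0 K G (x0 K) = x0 K := (projX0_xl none).trans (if_pos rfl)
      change projX0 K G (x0 K) * _ + _ • depthOne K G (x0 K) =
        _ * (projX0 K G (x0 K) * _ + _ • depthOne K G (x0 K))
      rw [h2, h3, smul_zero, add_zero, add_zero, ← mul_assoc, ← mul_assoc, projX0_comm]
    | some g =>
      have h2 : projX0 K G (xl K (some g)) = 0 := (projX0_xl _).trans (if_neg (by simp))
      have h3 : projX0 K G (autLetter Ψ (some g)) = 0 := by
        simp only [autLetter, isHom_projX0.map_mul, xg_eq, h2, mul_zero, zero_mul]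
      have h4 : (tAct K g Ψ.ser).coeff 1 = 1 := Ψ.coeff_one_ser
      have h5 : (xl K (some g)).coeff 1 = 0 := ord_xl _ 1 (by rw [deg_one]; omega)
      have h6 : depthOne K G (autLetter Ψ (some g)) =
          projX0 K G Ψ.serInv * depthOne K G (xl K (some g)) := by
        simp only [autLetter, depthOne_mul, xg_eq, isHom_projX0.map_mul, h2, mul_zero, zero_mul,
          zero_add, h4, one_smul, h5, zero_smul, add_zero, projX0_tAct]
      rw [h2, h3, h6, zero_mul, zero_mul, zero_add, zero_add, mul_smul_comm]

/-- In `Ψ aut_Ψ(Φ)` the power series in `x₀` coming from `Ψ` cancels the one from `Ψ⁻¹` produced by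
`aut_Ψ`. This additivity makes `Γ` a homomorphism. -/
theorem coeff_depthOne_mul [Finite G] (Ψ Φ : GroupLike K G) (n : ℕ) :
    (Ψ * Φ).ser.coeff (w0 ^ n * wg 1) =
      Ψ.ser.coeff (w0 ^ n * wg 1) + Φ.ser.coeff (w0 ^ n * wg 1) := by
  have h1 : (autX Ψ Φ.ser).coeff 1 = Φ.ser.coeff 1 :=
      unip_autX Ψ _ _ fun m hm => by rw [deg_one] at hm; omega
  rw [← coeff_depthOne, ← coeff_depthOne, ← coeff_depthOne, GroupLike.mul_ser, depthOne_mul,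
    depthOne_autX, ← mul_assoc, ← isHom_projX0.map_mul, Ψ.ser_mul_serInv, isHom_projX0.map_one,
    one_mul, h1, Φ.coeff_one_ser, one_smul, add_comm, coeff_add]

variable [Algebra ℚ K] (ε : ℤˣ)

/-- The logarithm of `Γ_Ψ`. -/
noncomputable def logGam (Ψ : GroupLike K G) : PowerSeries K :=
  PowerSeries.mk fun n : ℕ =>
    if 2 ≤ n then (((ε : ℤ) : ℚ) * (-1) ^ (n - 1) / n) • Ψ.ser.coeff (w0 ^ (n - 1) * wg 1) else 0

theorem Gam_eq (Ψ : GroupLike K G) : Gam ε Ψ = (PowerSeries.exp K).subst (logGam ε Ψ) := rfl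

theorem X_sq_dvd_logGam (Ψ : GroupLike K G) : PowerSeries.X ^ 2 ∣ logGam ε Ψ :=
  PowerSeries.X_pow_dvd_iff.2 fun n hn => by
    rw [logGam, PowerSeries.coeff_mk, if_neg (by omega)]

theorem coeff_Gam_of_lt_two (Ψ : GroupLike K G) {n : ℕ} (hn : n < 2) :
    PowerSeries.coeff n (Gam ε Ψ) = if n = 0 then 1 else 0 :=
  constantCoeff_exp_subst (by omega) (X_sq_dvd_logGam ε Ψ) hn

theorem coeff_two_Gam (Ψ : GroupLike K G) (h : Ψ.ser.coeff (w0 * wg 1) = 0) :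
    PowerSeries.coeff 2 (Gam ε Ψ) = 0 := by
  have h3 : PowerSeries.X ^ 3 ∣ logGam ε Ψ := PowerSeries.X_pow_dvd_iff.2 fun n hn => by
    rw [logGam, PowerSeries.coeff_mk]
    split_ifs with h2
    · have : n = 2 := by omega
      subst this
      simp [h]
    · rfl
  exact (constantCoeff_exp_subst (by omega) h3 (by omega)).trans (if_neg (by omega))

theorem isUnit_Gam (Ψ : GroupLike K G) : IsUnit (Gam ε Ψ) :=
  PowerSeries.isUnit_iff_constantCoeff.2 (by
    have := coeff_Gam_of_lt_two ε Ψ (n := 0) (by omega)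
    rw [if_pos rfl, PowerSeries.coeff_zero_eq_constantCoeff_apply] at this
    rw [this]
    exact isUnit_one)

theorem Gam_mul_inv (Ψ : GroupLike K G) : Gam ε Ψ * Ring.inverse (Gam ε Ψ) = 1 :=
  Ring.mul_inverse_cancel _ (isUnit_Gam ε Ψ)

theorem inv_mul_Gam (Ψ : GroupLike K G) : Ring.inverse (Gam ε Ψ) * Gam ε Ψ = 1 :=
  Ring.inverse_mul_cancel _ (isUnit_Gam ε Ψ)

theorem constantCoeff_inv_Gam (Ψ : GroupLike K G) :
    PowerSeries.coeff 0 (Ring.inverse (Gam ε Ψ)) = 1 := by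
  have h := congrArg (PowerSeries.coeff 0) (Gam_mul_inv ε Ψ)
  have h0 := coeff_Gam_of_lt_two ε Ψ (n := 0) (by omega)
  simp only [PowerSeries.coeff_zero_eq_constantCoeff_apply, map_mul, map_one, if_true] at *
  rwa [h0, one_mul] at h

theorem Gam_mul [Finite G] (Ψ Φ : GroupLike K G) : Gam ε (Ψ * Φ) = Gam ε Ψ * Gam ε Φ := by
  have h0 : ∀ Ψ : GroupLike K G, PowerSeries.constantCoeff (logGam ε Ψ) = 0 := fun Ψ =>
    PowerSeries.X_dvd_iff.1 ((dvd_pow_self _ two_ne_zero).trans (X_sq_dvd_logGam ε Ψ))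
  have h : logGam ε (Ψ * Φ) = logGam ε Ψ + logGam ε Φ := by
    ext n
    simp only [logGam, PowerSeries.coeff_mk, map_add]
    split_ifs
    · rw [coeff_depthOne_mul, smul_add]
    · rw [add_zero]
  rw [Gam_eq, Gam_eq, Gam_eq, h, exp_subst_add (h0 Ψ) (h0 Φ)]

theorem inv_Gam_mul [Finite G] (Ψ Φ : GroupLike K G) :
    Ring.inverse (Gam ε (Ψ * Φ)) = Ring.inverse (Gam ε Ψ) * Ring.inverse (Gam ε Φ) := by
  rw [Gam_mul, Ring.mul_inverse_rev, mul_comm]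

end Gam

/-! ### Normal forms in `VMonoid G` -/

section NormalForm

variable {G : Type v}

theorem free_induction_right {A : Type*} {p : FreeMonoid A → Prop} (one : p 1)
    (mul_of : ∀ w a, p w → p (w * FreeMonoid.of a)) (w : FreeMonoid A) : p w := by
  have h : ∀ l : List A, p (FreeMonoid.ofList l) := fun l => by
    induction l using List.reverseRecOn with
    | nil => exact one
    | append_singleton l a ih => exact mul_of _ a ih
  exact h (FreeMonoid.toList w)

variable [CommGroup G]

/-- A generator of `VMonoid G`. -/
def vof (x : VGen G) : VMonoid G := PresentedMonoid.of (VRel G) x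

theorem vmonoid_induction {p : VMonoid G → Prop} (one : p 1)
    (of_mul : ∀ x m, p m → p (vof x * m)) (m : VMonoid G) : p m := by
  obtain ⟨a, rfl⟩ := PresentedMonoid.surjective_mk m
  induction a using FreeMonoid.inductionOn' with
  | one => exact one
  | of_mul x a ih => rw [map_mul]; exact of_mul x _ ih

theorem vmonoid_induction_right {p : VMonoid G → Prop} (one : p 1)
    (mul_of : ∀ m x, p m → p (m * vof x)) (m : VMonoid G) : p m := by
  obtain ⟨a, rfl⟩ := PresentedMonoid.surjective_mk m
  induction a using free_induction_right with
  | one => exact one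
  | mul_of a x ih => rw [map_mul]; exact mul_of _ x ih

/-- The action from the right of the generators on normal forms. -/
def nfStep : VGen G → YWord G × ℕ × G → YWord G × ℕ × G
  | VGen.e0, t => (t.1, t.2.1 + 1, t.2.2)
  | VGen.e1, t => (t.1 * FreeMonoid.of (t.2.1.succPNat, t.2.2), 0, 1)
  | VGen.grp g, t => (t.1, t.2.1, t.2.2 * g)

/-- `nfStep` as a map to the opposite of the monoid of self-maps. -/
def nfEnd (x : VGen G) : (Function.End (YWord G × ℕ × G))ᵐᵒᵖ := MulOpposite.op (nfStep x)

theorem unop_nfEnd_mul (x y : VGen G) (t : YWord G × ℕ × G) :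
    (nfEnd x * nfEnd y).unop t = nfStep y (nfStep x t) := rfl

variable (G) in
theorem nfStep_rel : ∀ a b, VRel G a b →
    FreeMonoid.lift nfEnd a =
    FreeMonoid.lift nfEnd b := by
  rintro _ _ (⟨g, h⟩ | _ | g)
  · simp only [map_mul, FreeMonoid.lift_eval_of]
    refine MulOpposite.unop_injective (funext fun t => ?_)
    rw [unop_nfEnd_mul]
    exact Prod.ext rfl (Prod.ext rfl (mul_assoc _ _ _))
  · simp only [map_one, FreeMonoid.lift_eval_of]
    exact MulOpposite.unop_injective (funext fun t => Prod.ext rfl (Prod.ext rfl (mul_one _)))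
  · simp only [map_mul, FreeMonoid.lift_eval_of]
    exact MulOpposite.unop_injective (funext fun t => rfl)

variable (G) in
/-- The right action of `VMonoid G` on normal forms. -/
def nfAct : VMonoid G →* (Function.End (YWord G × ℕ × G))ᵐᵒᵖ :=
  PresentedMonoid.lift nfEnd
    (nfStep_rel G)

/-- The normal form of an element of `VMonoid G`. -/
def nf (m : VMonoid G) : YWord G × ℕ × G := (nfAct G m).unop (1, 0, 1)

theorem nfAct_mul (m m' : VMonoid G) (t : YWord G × ℕ × G) :
    (nfAct G (m * m')).unop t = (nfAct G m').unop ((nfAct G m).unop t) := by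
  rw [map_mul]
  rfl

theorem nfAct_ve0_pow (k : ℕ) (t : YWord G × ℕ × G) :
    (nfAct G (ve0 ^ k)).unop t = (t.1, t.2.1 + k, t.2.2) := by
  induction k with
  | zero => rw [pow_zero, map_one]; rfl
  | succ k ih => rw [pow_succ, nfAct_mul, ih]; rfl

theorem zWord_of (a : ℕ+ × G) :
    zWord (FreeMonoid.of a) = ve0 ^ ((a.1 : ℕ) - 1) * vgrp a.2 * ve1 := by
  rw [zWord, FreeMonoid.lift_eval_of]

theorem nfAct_zWord (w u : YWord G) : (nfAct G (zWord w)).unop (u, 0, 1) = (u * w, 0, 1) := by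
  induction w using FreeMonoid.inductionOn' generalizing u with
  | one => rw [map_one, map_one, mul_one]; rfl
  | of_mul a w ih =>
    rw [map_mul, nfAct_mul, zWord_of, nfAct_mul, nfAct_mul, nfAct_ve0_pow]
    change (nfAct G (zWord w)).unop (u * FreeMonoid.of ((0 + ((a.1 : ℕ) - 1)).succPNat, 1 * a.2), 0, 1)
      = _
    -- A letter `y_{n,g}` has the block `e₀^{n-1}`, and the `e₁` that closes the block restores the
    -- index `n`; truncated subtraction is harmless because `n ≥ 1`.
    have h1 : (0 + ((a.1 : ℕ) - 1)).succPNat = a.1 := by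
      apply PNat.coe_injective
      have := a.1.pos
      simp
      omega
    rw [h1, one_mul, ih, mul_assoc]

/-- Acting on the empty triple recovers `(w, k, g)` from the product, so normal forms are unique. -/
theorem nf_mk (w : YWord G) (k : ℕ) (g : G) : nf (zWord w * ve0 ^ k * vgrp g) = (w, k, g) := by
  rw [nf, nfAct_mul, nfAct_mul, nfAct_zWord, nfAct_ve0_pow]
  change nfStep (VGen.grp g) _ = _
  simp [nfStep]

/-- Since `g` commutes with `e₀`, everything after the last `e₁` can be sorted as `e₀ᵏ g`; a further
`e₁` closes this tail into a letter of `Y`. -/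
theorem exists_nf (m : VMonoid G) : ∃ w k g, m = zWord w * ve0 ^ k * vgrp g := by
  induction m using vmonoid_induction_right with
  | one => exact ⟨1, 0, 1, by rw [map_one, pow_zero, vgrp_one, mul_one, mul_one]⟩
  | mul_of m x ih =>
    obtain ⟨w, k, g, rfl⟩ := ih
    cases x with
    | e0 =>
      refine ⟨w, k + 1, g, ?_⟩
      rw [pow_succ, mul_assoc, mul_assoc, mul_assoc (zWord w), mul_assoc (ve0 ^ k)]
      congr 2
      exact vgrp_comm g
    | e1 =>
      refine ⟨w * FreeMonoid.of (k.succPNat, g), 0, 1, ?_⟩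
      rw [map_mul, zWord_of, pow_zero, vgrp_one, mul_one, mul_one, Nat.succPNat_coe,
        Nat.succ_sub_one, mul_assoc, mul_assoc, mul_assoc (ve0 ^ k)]
      rfl
    | grp h =>
      refine ⟨w, k, g * h, ?_⟩
      rw [← vgrp_mul, mul_assoc, mul_assoc, mul_assoc]
      rfl

theorem nf_injective {w w' : YWord G} {k k' : ℕ} {g g' : G}
    (h : zWord w * ve0 ^ k * vgrp g = zWord w' * ve0 ^ k' * vgrp g') :
    w = w' ∧ k = k' ∧ g = g' := by
  have := congrArg nf h
  rw [nf_mk, nf_mk] at this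
  simpa using this

theorem zWord_injective : Function.Injective (zWord : YWord G →* VMonoid G) := fun w w' h =>
  (nf_injective (k := 0) (k' := 0) (g := 1) (g' := 1) (by rw [h])).1

theorem vgrp_comm_pow (g : G) (k : ℕ) : vgrp g * ve0 ^ k = ve0 ^ k * vgrp g :=
  (show Commute (vgrp g) ve0 from vgrp_comm g).pow_right k

theorem vgrp_inv_mul (g : G) : vgrp g⁻¹ * vgrp g = 1 := by
  rw [vgrp_mul, inv_mul_cancel, vgrp_one]

theorem vgrp_mul_inv (g : G) : vgrp g * vgrp g⁻¹ = 1 := by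
  rw [vgrp_mul, mul_inv_cancel, vgrp_one]

/-! ### Words in `X` and words in `Y` -/

variable (G) in
/-- The degree of a word in `Y` with respect to `G`. -/
def gdeg : YWord G →* G := FreeMonoid.lift Prod.snd

@[simp] theorem gdeg_of (a : ℕ+ × G) : gdeg G (FreeMonoid.of a) = a.2 := FreeMonoid.lift_eval_of _ _

/-- The inverse image under `q` of a word in `Y`, preceded by a letter `x_p`. -/
def xyList : G → List (ℕ+ × G) → List (Option G)
  | _, [] => []
  | p, a :: l => List.replicate ((a.1 : ℕ) - 1) none ++ some (p * a.2) :: xyList (p * a.2) l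

/-- The inverse image under `q` of a word in `Y`, preceded by a letter `x_p`. -/
def xyWord (p : G) (w : YWord G) : XWord G := FreeMonoid.ofList (xyList p (FreeMonoid.toList w))

theorem xyWord_one (p : G) : xyWord p 1 = 1 := rfl

theorem toList_w0_pow (k : ℕ) : FreeMonoid.toList (w0 ^ k : XWord G) = List.replicate k none := by
  induction k with
  | zero => rfl
  | succ k ih => rw [pow_succ', FreeMonoid.toList_mul, ih]; rfl

theorem xyWord_of_mul (p : G) (a : ℕ+ × G) (w : YWord G) :
    xyWord p (FreeMonoid.of a * w) =
      w0 ^ ((a.1 : ℕ) - 1) * wg (p * a.2) * xyWord (p * a.2) w := by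
  apply FreeMonoid.toList.injective
  rw [FreeMonoid.toList_mul, FreeMonoid.toList_mul, toList_w0_pow, List.append_assoc]
  rfl

theorem xyWord_mul (p : G) (u w : YWord G) :
    xyWord p (u * w) = xyWord p u * xyWord (p * gdeg G u) w := by
  induction u using FreeMonoid.inductionOn' generalizing p with
  | one => rw [one_mul, xyWord_one, one_mul, map_one, mul_one]
  | of_mul a u ih =>
    rw [mul_assoc, xyWord_of_mul, xyWord_of_mul, ih, map_mul, gdeg_of]
    simp only [mul_assoc]

theorem xyWord_of (p : G) (a : ℕ+ × G) :
    xyWord p (FreeMonoid.of a) = w0 ^ ((a.1 : ℕ) - 1) * wg (p * a.2) := by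
  have := xyWord_of_mul p a 1
  rwa [mul_one, xyWord_one, mul_one] at this

theorem yToX_of (a : ℕ+ × G) : yToX (FreeMonoid.of a) = w0 ^ ((a.1 : ℕ) - 1) * wg a.2 := by
  rw [yToX, FreeMonoid.lift_eval_of]

/-- `xyWord` takes partial products of the group labels and `qWord` takes successive quotients, so
they cancel; a tail of letters `x₀` is not affected. -/
theorem qWord_xyWord (w : YWord G) (k : ℕ) :
    qWord (xyWord 1 w * w0 ^ k) = yToX w * w0 ^ k := by
  have h0 : ∀ (p : G) (k : ℕ) (l : List (Option G)),
      qList p (List.replicate k none ++ l) = List.replicate k none ++ qList p l := by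
    intro p k l
    induction k with
    | zero => rfl
    | succ k ih => simp [List.replicate_succ, qList, ih]
  have h1 : ∀ (p : G) (w : YWord G), qList p (FreeMonoid.toList (xyWord p w * w0 ^ k)) =
      FreeMonoid.toList (yToX w * w0 ^ k) := by
    intro p w
    induction w using FreeMonoid.inductionOn' generalizing p with
    | one =>
      rw [xyWord_one, map_one, one_mul, toList_w0_pow]
      simpa [qList] using h0 p k []
    | of_mul a w ih =>
      rw [xyWord_of_mul, map_mul yToX, yToX_of]
      simp only [FreeMonoid.toList_mul, List.append_assoc, toList_w0_pow, h0]
      have h2 := ih (p * a.2)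
      simp only [FreeMonoid.toList_mul, toList_w0_pow] at h2
      rw [← h2]
      change _ ++ some (p * a.2 * p⁻¹) :: _ = _ ++ some a.2 :: _
      rw [mul_inv_cancel_comm]
      rfl
  exact congrArg FreeMonoid.ofList (h1 1 w)

theorem qWord_symm_yToX (w : YWord G) : qWord.symm (yToX w) = xyWord 1 w := by
  rw [Equiv.symm_apply_eq]
  simpa using (qWord_xyWord w 0).symm

theorem exists_xyWord (m : XWord G) : ∃ w k, m = xyWord 1 w * w0 ^ k := by
  induction m using free_induction_right with
  | one => exact ⟨1, 0, by rw [xyWord_one, pow_zero, mul_one]⟩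
  | mul_of m x ih =>
    obtain ⟨w, k, rfl⟩ := ih
    cases x with
    | none => exact ⟨w, k + 1, by rw [pow_succ, mul_assoc]; rfl⟩
    | some g =>
      refine ⟨w * FreeMonoid.of (k.succPNat, (gdeg G w)⁻¹ * g), 0, ?_⟩
      rw [xyWord_mul, xyWord_of, pow_zero, mul_one, one_mul, mul_inv_cancel_left, Nat.succPNat_coe,
        Nat.succ_sub_one, mul_assoc]
      rfl

theorem yToX_pow_injective {w w' : YWord G} {k k' : ℕ}
    (h : yToX w * w0 ^ k = yToX w' * w0 ^ k') : w = w' ∧ k = k' := by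
  -- This homomorphism carries `yToX w` to `zWord w`, so uniqueness is inherited from the normal
  -- forms of `VMonoid G`.
  set c : XWord G →* VMonoid G := FreeMonoid.lift fun a =>
    match a with
    | none => ve0
    | some g => vgrp g * ve1 with hc
  have h0 : c w0 = ve0 := FreeMonoid.lift_eval_of _ _
  have h2 : ∀ w, c (yToX w) = zWord w := by
    intro w
    induction w using FreeMonoid.inductionOn' with
    | one => rw [map_one, map_one, map_one]
    | of_mul a w ih =>
      have h3 : c (wg a.2) = vgrp a.2 * ve1 := FreeMonoid.lift_eval_of _ _
      rw [map_mul, map_mul, map_mul, ih, yToX_of, map_mul, map_pow, h0, h3, zWord_of]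
      simp only [mul_assoc]
  have h4 := congrArg c h
  rw [map_mul, map_mul, h2, h2, map_pow, map_pow, h0] at h4
  have h5 := nf_injective (g := 1) (g' := 1) (congrArg (· * vgrp 1) h4)
  exact ⟨h5.1, h5.2.1⟩

theorem yToX_injective : Function.Injective (yToX : YWord G →* XWord G) := fun w w' h =>
  (yToX_pow_injective (k := 0) (k' := 0) (by rw [h])).1

theorem xyWord_injective {w w' : YWord G} {k k' : ℕ}
    (h : xyWord 1 w * w0 ^ k = xyWord 1 w' * w0 ^ k') : w = w' ∧ k = k' := by
  have := congrArg qWord h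
  rw [qWord_xyWord, qWord_xyWord] at this
  exact yToX_pow_injective this

end NormalForm

/-! ### The maps `β` and `ϖ` -/

section Maps

variable {K : Type u} [CommRing K] {G : Type v} [CommGroup G] [Finite G]

theorem IsHom.ext_V {M : Type*} [Monoid M] [Finset.HasMulAntidiagonal M]
    {T U : VG K G →ₗ[K] NCSeries K M} (hT : IsHom T) (hU : IsHom U)
    (h0 : T (basis K ve0) = U (basis K ve0)) (h1 : T (basis K ve1) = U (basis K ve1))
    (hg : ∀ g, T (basis K (vgrp g)) = U (basis K (vgrp g))) : T = U := by
  refine hT.cont.ext hU.cont fun m => ?_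
  induction m using vmonoid_induction with
  | one => rw [← one_def, hT.map_one, hU.map_one]
  | of_mul x m ih =>
    rw [← basis_mul_basis, hT.map_mul, hU.map_mul, ih]
    cases x with
    | e0 => exact congrArg (· * _) h0
    | e1 => exact congrArg (· * _) h1
    | grp g => exact congrArg (· * _) (hg g)

theorem deg_ve0_pow (k : ℕ) : deg (ve0 ^ k : VMonoid G) = k := by
  induction k with
  | zero => rw [pow_zero, deg_one]
  | succ k ih => rw [pow_succ, deg_mul, ih, deg_ve0]

/-- The images of the letters under `β`. -/
noncomputable def betaLetter (K : Type u) [CommRing K] (a : Option G) : VG K G :=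
  match a with
  | none => (basis K ve0 : VG K G)
  | some g => -(basis K (vgrp g * ve1 * vgrp g⁻¹) : VG K G)

theorem locFin_betaX : LocFin (FreeMonoid.lift (betaLetter (G := G) K)) :=
  LocFin.lift fun a => by
    rw [deg_of_X]
    cases a with
    | none =>
      change Ord 1 (basis K ve0)
      simpa using Ord.basis (K := K) (ve0 : VMonoid G)
    | some g =>
      refine Ord.neg ?_
      have := Ord.basis (K := K) (vgrp g * ve1 * vgrp g⁻¹ : VMonoid G)
      simpa [deg_mul] using this

theorem isHom_betaX : IsHom (betaX : KX K G →ₗ[K] VG K G) := locFin_betaX.isHom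

theorem betaX_xl (a : Option G) : betaX (xl K a) = betaLetter K a := by
  change lsum (FreeMonoid.lift (betaLetter (G := G) K)) _ = _
  rw [locFin_betaX.lsum_basis, FreeMonoid.lift_eval_of]

theorem betaX_x0 : betaX (x0 K) = (basis K ve0 : VG K G) := betaX_xl none

theorem betaX_xg (g : G) :
    betaX (xg K g) = -(basis K (vgrp g * ve1 * vgrp g⁻¹) : VG K G) := betaX_xl (some g)

theorem locFin_varpi : LocFin (FreeMonoid.lift fun a : ℕ+ × G =>
    (-basis K (ve0 ^ ((a.1 : ℕ) - 1) * vgrp a.2 * ve1) : VG K G)) :=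
  LocFin.lift fun a => by
    have h := Ord.basis (K := K) (ve0 ^ ((a.1 : ℕ) - 1) * vgrp a.2 * ve1 : VMonoid G)
    have := a.1.pos
    rw [deg_of_Y]
    refine (h.mono ?_).neg
    rw [deg_mul, deg_mul, deg_ve0_pow, deg_ve1]
    omega

theorem isHom_varpi : IsHom (varpi : KY K G →ₗ[K] VG K G) := locFin_varpi.isHom

theorem varpi_of (a : ℕ+ × G) : varpi (basis K (FreeMonoid.of a)) =
    (-basis K (ve0 ^ ((a.1 : ℕ) - 1) * vgrp a.2 * ve1) : VG K G) := by
  rw [varpi, locFin_varpi.lsum_basis, FreeMonoid.lift_eval_of]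

theorem varpi_basis (w : YWord G) :
    varpi (basis K w) = (-1 : K) ^ FreeMonoid.length w • (basis K (zWord w) : VG K G) := by
  induction w using FreeMonoid.inductionOn' with
  | one => rw [← one_def, isHom_varpi.map_one, FreeMonoid.length_one, pow_zero, one_smul, map_one,
      one_def]
  | of_mul a w ih =>
    rw [← basis_mul_basis, isHom_varpi.map_mul, ih, varpi_of, FreeMonoid.length_mul,
      FreeMonoid.length_of, map_mul, zWord_of, pow_add, pow_one, neg_one_mul, neg_smul, neg_mul,
      mul_smul_comm, basis_mul_basis]

/-- The image of `x_g` is `-g e₁ g⁻¹`. Between consecutive letters the group elements telescope to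
the labels of the word in `Y`, and what is left over stands at the two ends. -/
theorem betaX_xyWord (p : G) (w : YWord G) : betaX (basis K (xyWord p w)) =
    basis K (vgrp p) * varpi (basis K w) * (basis K (vgrp (p * gdeg G w)⁻¹) : VG K G) := by
  induction w using FreeMonoid.inductionOn' generalizing p with
  | one =>
    rw [xyWord_one, map_one, ← one_def, ← one_def, isHom_betaX.map_one, isHom_varpi.map_one,
      mul_one, mul_one, basis_mul_basis, vgrp_mul_inv, one_def]
  | of_mul a w ih =>
    have h0 : betaX (basis K (w0 ^ ((a.1 : ℕ) - 1))) =
        (basis K (ve0 ^ ((a.1 : ℕ) - 1)) : VG K G) := by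
      generalize (a.1 : ℕ) - 1 = k
      induction k with
      | zero => rw [pow_zero, pow_zero, ← one_def, isHom_betaX.map_one, one_def]
      | succ k ih =>
        rw [pow_succ, pow_succ, ← basis_mul_basis, isHom_betaX.map_mul, ih, ← basis_mul_basis]
        congr 1
        exact betaX_xl none
    have h1 : betaX (basis K (wg (p * a.2))) = -(basis K (vgrp (p * a.2) * ve1 *
        vgrp (p * a.2)⁻¹) : VG K G) := betaX_xg _
    rw [xyWord_of_mul, ← basis_mul_basis, ← basis_mul_basis, isHom_betaX.map_mul,
      isHom_betaX.map_mul, ih, h0, h1, ← basis_mul_basis (FreeMonoid.of a) w, isHom_varpi.map_mul,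
      varpi_of, map_mul,
      gdeg_of]
    simp only [mul_neg, neg_mul, ← mul_assoc, basis_mul_basis]
    rw [mul_assoc (ve0 ^ _ * vgrp (p * a.2) * ve1), vgrp_inv_mul, mul_one, ← vgrp_mul,
      ← mul_assoc, vgrp_comm_pow, mul_assoc p]

theorem betaX_word (w : YWord G) (k : ℕ) : betaX (basis K (xyWord 1 w * w0 ^ k)) =
    varpi (basis K w) * (basis K (vgrp (gdeg G w)⁻¹ * ve0 ^ k) : VG K G) := by
  have h0 : betaX (basis K (w0 ^ k)) = (basis K (ve0 ^ k) : VG K G) := by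
    induction k with
    | zero => rw [pow_zero, pow_zero, ← one_def, isHom_betaX.map_one, one_def]
    | succ k ih =>
      rw [pow_succ, pow_succ, ← basis_mul_basis, isHom_betaX.map_mul, ih, ← basis_mul_basis]
      congr 1
      exact betaX_xl none
  rw [← basis_mul_basis, isHom_betaX.map_mul, h0, betaX_xyWord, vgrp_one, ← one_def, one_mul,
    one_mul, mul_assoc, basis_mul_basis]

/-- Under `β` the automorphism `t_g` becomes inner; `e₀` causes no trouble because it commutes with
`g`. -/
theorem betaX_tAct (g : G) (f : KX K G) :
    betaX (tAct K g f) = basis K (vgrp g) * betaX f * (basis K (vgrp g⁻¹) : VG K G) := by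
  have hconj : IsHom (LinearMap.mulLeft K (basis K (vgrp g)) ∘ₗ
      LinearMap.mulRight K (basis K (vgrp g⁻¹) : VG K G)) := by
    refine ⟨(IsCont.mulLeft _).comp (IsCont.mulRight _), fun a b => ?_, ?_⟩
    · have h : (basis K (vgrp g⁻¹) : VG K G) * basis K (vgrp g) = 1 := by
        rw [basis_mul_basis, vgrp_inv_mul, one_def]
      simp only [LinearMap.comp_apply, LinearMap.mulLeft_apply, LinearMap.mulRight_apply]
      calc _ = basis K (vgrp g) * a * 1 * b * (basis K (vgrp g⁻¹) : VG K G) := by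
            noncomm_ring
        _ = _ := by rw [← h]; noncomm_ring
    · simp only [LinearMap.comp_apply, LinearMap.mulLeft_apply, LinearMap.mulRight_apply, one_mul]
      rw [basis_mul_basis, vgrp_mul_inv, one_def]
  have := LinearMap.congr_fun ((isHom_betaX.comp (isHom_tAct g)).ext_free
    (hconj.comp isHom_betaX) fun a => by
      change betaX (tAct K g (xl K a)) = basis K (vgrp g) * (betaX (xl K a) * basis K (vgrp g⁻¹))
      rw [tAct_xl, betaX_xl, betaX_xl]
      cases a with
      | none =>
        simp only [Option.map_none, betaLetter, basis_mul_basis]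
        rw [← mul_assoc, vgrp_comm, mul_assoc, vgrp_mul_inv, mul_one]
      | some h =>
        simp only [Option.map_some, betaLetter, basis_mul_basis, neg_mul, mul_neg]
        rw [← vgrp_mul, mul_inv_rev, ← vgrp_mul]
        simp only [mul_assoc]) f
  simpa [mul_assoc] using this

theorem varpiInv_varpi (f : KY K G) : varpiInv (varpi f) = f := by
  have hc : IsCont (varpiInv : VG K G →ₗ[K] KY K G) := fun w => ⟨{zWord w}, fun f hf => by
    simp [varpiInv, hf _ (Finset.mem_singleton_self _)]⟩
  refine (hc.comp isHom_varpi.cont).ext_apply IsCont.id (fun w => ?_) f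
  ext w'
  simp only [LinearMap.comp_apply, LinearMap.id_apply, varpi_basis]
  change (-1) ^ FreeMonoid.length w' * ((-1) ^ FreeMonoid.length w *
    (basis K (zWord w)).coeff (zWord w')) = _
  by_cases h : w' = w
  · subst h
    rw [coeff_basis_self, coeff_basis_self, mul_one, ← mul_pow, neg_one_mul, neg_neg, one_pow]
  · rw [coeff_basis_of_ne h, coeff_basis_of_ne (zWord_injective.ne h), mul_zero, mul_zero]

theorem cont_varpiInv : IsCont (varpiInv : VG K G →ₗ[K] KY K G) := fun w =>
  ⟨{zWord w}, fun f hf => by simp [varpiInv, hf _ (Finset.mem_singleton_self _)]⟩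

/-- The image of `ϖ` consists of the series supported on the monomials `zWord w`. -/
theorem varpi_varpiInv {f : VG K G} (hf : ∀ m, (∀ w, zWord w ≠ m) → f.coeff m = 0) :
    varpi (varpiInv f) = f := by
  have h0 : ∀ (g : KY K G) (m : VMonoid G), (∀ w, zWord w ≠ m) → (varpi g).coeff m = 0 :=
    fun g m hm => isHom_varpi.cont.coeff_eq_zero (fun w => by
      rw [varpi_basis, coeff_smul, coeff_basis_of_ne (hm w).symm, mul_zero]) g
  ext m
  by_cases hm : ∀ w, zWord w ≠ m
  · rw [hf m hm, h0 _ m hm]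
  · push Not at hm
    obtain ⟨w, rfl⟩ := hm
    have h1 := congrArg (fun f => f.coeff w) (varpiInv_varpi (varpiInv f))
    have h2 : ∀ f : VG K G, f.coeff (zWord w) =
        (-1) ^ FreeMonoid.length w * (varpiInv f).coeff w := fun f => by
      change _ = (-1) ^ FreeMonoid.length w * ((-1) ^ FreeMonoid.length w * f.coeff (zWord w))
      rw [← mul_assoc, ← mul_pow, neg_one_mul, neg_neg, one_pow, one_mul]
    rw [h2, h2 f, varpiInv_varpi]

theorem varpi_injective : Function.Injective (varpi : KY K G →ₗ[K] VG K G) := fun f g h => by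
  rw [← varpiInv_varpi f, h, varpiInv_varpi]

end Maps

/-! ### The automorphisms of `V_G` -/

section AutV

variable {K : Type u} [CommRing K] {G : Type v} [CommGroup G] [Finite G]

/-- The images of the generators under `aut_Ψ^{V,(0)}`. -/
noncomputable def autVGen (Ψ : GroupLike K G) (x : VGen G) : VG K G :=
  match x with
  | VGen.e0 => basis K ve0
  | VGen.e1 => betaX Ψ.serInv * basis K ve1 * betaX Ψ.ser
  | VGen.grp g => basis K (vgrp g)

theorem locFin_autV0 (Ψ : GroupLike K G) : LocFin (autV0Mon Ψ) := LocFin.of_ord fun m => by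
  induction m using vmonoid_induction with
  | one => rw [deg_one]; exact Ord.zero_le _
  | of_mul x m ih =>
    rw [deg_mul, map_mul]
    refine Ord.mul ?_ ih
    change Ord _ (autVGen Ψ x)
    cases x with
    | e0 => exact Ord.basis (K := K) (ve0 : VMonoid G)
    | e1 =>
      have h := ((Ord.zero_le (betaX Ψ.serInv)).mul
        (Ord.basis (K := K) (ve1 : VMonoid G))).mul (Ord.zero_le (betaX Ψ.ser))
      exact h.mono (by change 1 ≤ _; rw [deg_ve1])
    | grp g => exact Ord.basis (K := K) (vgrp g : VMonoid G)

theorem isHom_autV0 (Ψ : GroupLike K G) : IsHom (autV0 Ψ) := (locFin_autV0 Ψ).isHom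

theorem autV0_vof (Ψ : GroupLike K G) (x : VGen G) : autV0 Ψ (basis K (vof x)) = autVGen Ψ x := by
  rw [autV0, (locFin_autV0 Ψ).lsum_basis]
  rfl

theorem autV0_e0 (Ψ : GroupLike K G) : autV0 Ψ (basis K ve0) = basis K ve0 := autV0_vof Ψ VGen.e0

theorem autV0_e1 (Ψ : GroupLike K G) :
    autV0 Ψ (basis K ve1) = betaX Ψ.serInv * basis K ve1 * betaX Ψ.ser := autV0_vof Ψ VGen.e1

theorem autV0_grp (Ψ : GroupLike K G) (g : G) :
    autV0 Ψ (basis K (vgrp g)) = basis K (vgrp g) := autV0_vof Ψ (VGen.grp g)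

/-- On `x_g` both sides are the conjugate by `g` of the image of `e₁`, by `betaX_tAct`. This
transports `aut_Ψ` from `K⟨⟨X⟩⟩` to `V_G`. -/
theorem betaX_autX (Ψ : GroupLike K G) (f : KX K G) :
    betaX (autX Ψ f) = autV0 Ψ (betaX f) := by
  refine LinearMap.congr_fun ((isHom_betaX.comp (isHom_autX Ψ)).ext_free
    ((isHom_autV0 Ψ).comp isHom_betaX) fun a => ?_) f
  change betaX (autX Ψ (xl K a)) = autV0 Ψ (betaX (xl K a))
  rw [autX_xl, betaX_xl]
  cases a with
  | none => exact (betaX_xl none).trans (autV0_e0 Ψ).symm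
  | some g =>
    change betaX (tAct K g Ψ.serInv * xg K g * tAct K g Ψ.ser) =
      autV0 Ψ (-(basis K (vgrp g * ve1 * vgrp g⁻¹)))
    have h : (basis K (vgrp g⁻¹) : VG K G) * basis K (vgrp g) = 1 := by
      rw [basis_mul_basis, vgrp_inv_mul, one_def]
    rw [isHom_betaX.map_mul, isHom_betaX.map_mul, betaX_tAct, betaX_tAct, betaX_xg, map_neg,
      ← basis_mul_basis, ← basis_mul_basis, (isHom_autV0 Ψ).map_mul, (isHom_autV0 Ψ).map_mul,
      autV0_e1, autV0_grp, autV0_grp]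
    calc _ = -(basis K (vgrp g) * betaX Ψ.serInv * (basis K (vgrp g⁻¹) * basis K (vgrp g)) *
          basis K ve1 * (basis K (vgrp g⁻¹) * basis K (vgrp g)) * betaX Ψ.ser *
          basis K (vgrp g⁻¹)) := by noncomm_ring
      _ = _ := by rw [h]; noncomm_ring

theorem autV0_mul (Ψ Φ : GroupLike K G) : autV0 (Ψ * Φ) = autV0 Ψ ∘ₗ autV0 Φ := by
  refine IsHom.ext_V (isHom_autV0 _) ((isHom_autV0 Ψ).comp (isHom_autV0 Φ)) ?_ ?_ fun g => ?_
  · simp only [LinearMap.comp_apply, autV0_e0]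
  · simp only [LinearMap.comp_apply, autV0_e1, (isHom_autV0 Ψ).map_mul, ← betaX_autX,
      GroupLike.mul_ser, GroupLike.mul_serInv, isHom_betaX.map_mul, mul_assoc]
  · simp only [LinearMap.comp_apply, autV0_grp]

theorem autV0_one : autV0 (1 : GroupLike K G) = LinearMap.id := by
  refine IsHom.ext_V (isHom_autV0 _) ⟨IsCont.id, fun _ _ => rfl, rfl⟩ ?_ ?_ fun g => ?_
  · rw [autV0_e0]; rfl
  · rw [autV0_e1, GroupLike.one_ser, GroupLike.one_serInv, isHom_betaX.map_one, one_mul, mul_one]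
    rfl
  · rw [autV0_grp]; rfl

theorem ord_neg_ve1 : Ord 1 (-basis K ve1 : VG K G) := by
  have := Ord.basis (K := K) (ve1 : VMonoid G)
  rw [deg_ve1] at this
  exact this.neg

variable [Algebra ℚ K] (ε : ℤˣ)

/-- `Γ_Ψ⁻¹(-e₁) β(Ψ ⊗ 1)` -/
noncomputable def conjV (Ψ : GroupLike K G) : VG K G :=
  evalPS (Ring.inverse (Gam ε Ψ)) (-basis K ve1) * betaX Ψ.ser

/-- `β(Ψ⁻¹ ⊗ 1) Γ_Ψ(-e₁)` -/
noncomputable def conjVInv (Ψ : GroupLike K G) : VG K G :=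
  betaX Ψ.serInv * evalPS (Gam ε Ψ) (-basis K ve1)

theorem conjV_mul_conjVInv (Ψ : GroupLike K G) : conjV ε Ψ * conjVInv ε Ψ = 1 := by
  have h : betaX Ψ.ser * betaX Ψ.serInv = (1 : VG K G) := by
    rw [← isHom_betaX.map_mul, Ψ.ser_mul_serInv, isHom_betaX.map_one]
  calc _ = evalPS (Ring.inverse (Gam ε Ψ)) (-basis K ve1) * (betaX Ψ.ser * betaX Ψ.serInv) *
        evalPS (Gam ε Ψ) (-basis K ve1) := by rw [conjV, conjVInv]; noncomm_ring
    _ = _ := by rw [h, mul_one, ← evalPS_mul ord_neg_ve1, inv_mul_Gam, evalPS_one ord_neg_ve1]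

theorem conjVInv_mul_conjV (Ψ : GroupLike K G) : conjVInv ε Ψ * conjV ε Ψ = 1 := by
  have h : betaX Ψ.serInv * betaX Ψ.ser = (1 : VG K G) := by
    rw [← isHom_betaX.map_mul, Ψ.serInv_mul_ser, isHom_betaX.map_one]
  calc _ = betaX Ψ.serInv * (evalPS (Gam ε Ψ) (-basis K ve1) *
        evalPS (Ring.inverse (Gam ε Ψ)) (-basis K ve1)) * betaX Ψ.ser := by
          rw [conjV, conjVInv]; noncomm_ring
    _ = _ := by rw [← evalPS_mul ord_neg_ve1, Gam_mul_inv, evalPS_one ord_neg_ve1, mul_one, h]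

theorem GamAutV1_apply (Ψ : GroupLike K G) (v : VG K G) :
    GamAutV1 ε Ψ v = conjV ε Ψ * autV0 Ψ v * conjVInv ε Ψ := by
  simp only [GamAutV1, autV1, conjV, conjVInv, LinearMap.comp_apply, LinearMap.mulLeft_apply,
    LinearMap.mulRight_apply, mul_assoc]

theorem isHom_GamAutV1 (Ψ : GroupLike K G) : IsHom (GamAutV1 ε Ψ) where
  cont := (IsCont.mulLeft _).comp ((IsCont.mulRight _).comp
    ((IsCont.mulLeft _).comp ((IsCont.mulRight _).comp (isHom_autV0 Ψ).cont)))
  map_mul f g := by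
    simp only [GamAutV1_apply, (isHom_autV0 Ψ).map_mul]
    calc _ = conjV ε Ψ * autV0 Ψ f * 1 * autV0 Ψ g * conjVInv ε Ψ := by noncomm_ring
      _ = _ := by rw [← conjVInv_mul_conjV ε Ψ]; noncomm_ring
  map_one := by rw [GamAutV1_apply, (isHom_autV0 Ψ).map_one, mul_one, conjV_mul_conjVInv]

/-- The conjugation by `β(Ψ ⊗ 1)` undoes the one in `aut^{V,(0)}`, and a power series in `-e₁`
commutes with `e₁`. Hence `V_G e₁` is preserved, which is why the map restricts to `W_G`. -/
theorem GamAutV1_e1 (Ψ : GroupLike K G) :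
    GamAutV1 ε Ψ (basis K ve1) = basis K ve1 := by
  have h : betaX Ψ.ser * betaX Ψ.serInv = (1 : VG K G) := by
    rw [← isHom_betaX.map_mul, Ψ.ser_mul_serInv, isHom_betaX.map_one]
  have h1 : evalPS (Ring.inverse (Gam ε Ψ)) (-basis K ve1) * basis K ve1 =
      (basis K ve1 : VG K G) * evalPS (Ring.inverse (Gam ε Ψ)) (-basis K ve1) :=
    evalPS_comm ord_neg_ve1 (by noncomm_ring) _
  rw [GamAutV1_apply, autV0_e1, conjV, conjVInv]
  calc _ = evalPS (Ring.inverse (Gam ε Ψ)) (-basis K ve1) * (betaX Ψ.ser * betaX Ψ.serInv) *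
        basis K ve1 * (betaX Ψ.ser * betaX Ψ.serInv) * evalPS (Gam ε Ψ) (-basis K ve1) := by
          noncomm_ring
    _ = _ := by
      rw [h, mul_one, mul_one, h1, mul_assoc, ← evalPS_mul ord_neg_ve1, inv_mul_Gam,
        evalPS_one ord_neg_ve1, mul_one]

theorem GamAutV1_evalPS (Ψ : GroupLike K G) (p : PowerSeries K) :
    GamAutV1 ε Ψ (evalPS p (-basis K ve1)) = evalPS p (-basis K ve1) := by
  have h : GamAutV1 ε Ψ (-basis K ve1) = -basis K ve1 := by rw [map_neg, GamAutV1_e1]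
  rw [(isHom_GamAutV1 ε Ψ).map_evalPS ord_neg_ve1 (by rw [h]; exact ord_neg_ve1), h]

/-- A cocycle rule in reversed order. The factor `Γ_Φ⁻¹(-e₁)` passes through `^Γaut_Ψ` unchanged
because `e₁` is fixed, and `Γ` is multiplicative. -/
theorem conjV_mul (Ψ Φ : GroupLike K G) :
    conjV ε (Ψ * Φ) = GamAutV1 ε Ψ (conjV ε Φ) * conjV ε Ψ := by
  rw [conjV.eq_1 ε Φ, (isHom_GamAutV1 ε Ψ).map_mul, GamAutV1_evalPS, GamAutV1_apply, mul_assoc,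
    mul_assoc _ (conjVInv ε Ψ), conjVInv_mul_conjV, mul_one, conjV, conjV, GroupLike.mul_ser,
    isHom_betaX.map_mul, betaX_autX, inv_Gam_mul, mul_comm (Ring.inverse _),
    evalPS_mul ord_neg_ve1]
  simp only [mul_assoc]

theorem conjVInv_mul (Ψ Φ : GroupLike K G) :
    conjVInv ε (Ψ * Φ) = conjVInv ε Ψ * GamAutV1 ε Ψ (conjVInv ε Φ) := by
  refine left_inv_eq_right_inv (conjVInv_mul_conjV ε (Ψ * Φ)) ?_
  rw [conjV_mul]
  calc _ = GamAutV1 ε Ψ (conjV ε Φ) * (conjV ε Ψ * conjVInv ε Ψ) *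
        GamAutV1 ε Ψ (conjVInv ε Φ) := by noncomm_ring
    _ = _ := by
      rw [conjV_mul_conjVInv, mul_one, ← (isHom_GamAutV1 ε Ψ).map_mul, conjV_mul_conjVInv,
        (isHom_GamAutV1 ε Ψ).map_one]

theorem GamAutV1_mul (Ψ Φ : GroupLike K G) (v : VG K G) :
    GamAutV1 ε (Ψ * Φ) v = GamAutV1 ε Ψ (GamAutV1 ε Φ v) := by
  rw [GamAutV1_apply ε Φ, (isHom_GamAutV1 ε Ψ).map_mul, (isHom_GamAutV1 ε Ψ).map_mul,
    GamAutV1_apply ε (Ψ * Φ), conjV_mul, conjVInv_mul, autV0_mul, GamAutV1_apply ε Ψ (autV0 Φ v)]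
  simp only [LinearMap.comp_apply, mul_assoc]

theorem Gam_one : Gam ε (1 : GroupLike K G) = 1 := by
  have h := Gam_mul ε (1 : GroupLike K G) 1
  rw [mul_one] at h
  calc Gam ε (1 : GroupLike K G) = Gam ε (1 : GroupLike K G) * Gam ε (1 : GroupLike K G) *
        Ring.inverse (Gam ε (1 : GroupLike K G)) := by rw [mul_assoc, Gam_mul_inv, mul_one]
    _ = 1 := by rw [← h, Gam_mul_inv]

theorem GamAutV1_one (v : VG K G) : GamAutV1 ε (1 : GroupLike K G) v = v := by
  rw [GamAutV1_apply, autV0_one, conjV, conjVInv, Gam_one, Ring.inverse_one,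
    evalPS_one ord_neg_ve1, GroupLike.one_ser, GroupLike.one_serInv, isHom_betaX.map_one]
  simp

/-! ### The automorphism of `K⟨⟨Y⟩⟩` -/

theorem exists_zWord (m : VMonoid G) : ∃ w, zWord w = m * ve1 := by
  obtain ⟨w, k, g, rfl⟩ := exists_nf m
  refine ⟨w * FreeMonoid.of (k.succPNat, g), ?_⟩
  rw [map_mul, zWord_of, Nat.succPNat_coe, Nat.succ_sub_one]
  simp only [mul_assoc]

/-- A nonempty word maps to a multiple of `e₁` on the right, since `e₁` is fixed. So the image lies
in `W_G`, where `varpiInv`, which merely reads coefficients, is a true inverse. -/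
theorem varpi_GamAutY (Ψ : GroupLike K G) (f : KY K G) :
    varpi (GamAutY ε Ψ f) = GamAutV1 ε Ψ (varpi f) := by
  refine varpi_varpiInv fun m hm => ?_
  refine ((isHom_GamAutV1 ε Ψ).comp isHom_varpi).cont.coeff_eq_zero (fun w => ?_) f
  rw [LinearMap.comp_apply, varpi_basis, map_smul, coeff_smul]
  rcases eq_one_or_mul_of w with rfl | ⟨u, a, rfl⟩
  · rw [map_one, ← one_def, (isHom_GamAutV1 ε Ψ).map_one, one_def, coeff_basis_of_ne, mul_zero]
    rintro rfl
    exact hm 1 (map_one _)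
  · rw [map_mul, zWord_of, ← mul_assoc, ← basis_mul_basis, (isHom_GamAutV1 ε Ψ).map_mul,
      GamAutV1_e1, coeff_mul_basis_of_not, mul_zero]
    rintro m' rfl
    obtain ⟨w, hw⟩ := exists_zWord m'
    exact hm w hw

theorem isHom_GamAutY (Ψ : GroupLike K G) : IsHom (GamAutY ε Ψ) where
  cont := cont_varpiInv.comp ((isHom_GamAutV1 ε Ψ).cont.comp isHom_varpi.cont)
  map_mul f g := varpi_injective (by
    simp only [varpi_GamAutY, isHom_varpi.map_mul, (isHom_GamAutV1 ε Ψ).map_mul])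
  map_one := varpi_injective (by
    rw [varpi_GamAutY, isHom_varpi.map_one, (isHom_GamAutV1 ε Ψ).map_one])

theorem GamAutY_mul (Ψ Φ : GroupLike K G) :
    GamAutY ε (Ψ * Φ) = GamAutY ε Ψ ∘ₗ GamAutY ε Φ :=
  LinearMap.ext fun f => varpi_injective (by
    rw [LinearMap.comp_apply, varpi_GamAutY, varpi_GamAutY, varpi_GamAutY, GamAutV1_mul])

theorem GamAutY_one : GamAutY ε (1 : GroupLike K G) = LinearMap.id :=
  LinearMap.ext fun f => varpi_injective (by rw [varpi_GamAutY, GamAutV1_one]; rfl)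

/-- This invariance will later control both `Γ_Ψ(x)Γ_Ψ(-x)` and the low weights of `adjSer`. -/
theorem GamAutY_y1 (Ψ : GroupLike K G) :
    GamAutY ε Ψ (basis K (yw 1 1)) = basis K (yw 1 1) := varpi_injective (by
  have h : varpi (basis K (yw 1 1)) = (-basis K ve1 : VG K G) := by
    rw [yw, varpi_of]
    simp [vgrp_one]
  rw [varpi_GamAutY, h, map_neg, GamAutV1_e1])

end AutV

/-! ### The endomorphism of `K⟨⟨Y⟩⟩` that corresponds to `^Γ S_Ψ^Y` -/

section ModY

variable {K : Type u} [CommRing K] {G : Type v} [CommGroup G]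

theorem exists_yToX (m : XWord G) : ∃ w k, m = yToX w * w0 ^ k := by
  obtain ⟨w, k, h⟩ := exists_xyWord (qWord.symm m)
  exact ⟨w, k, by rw [← qWord_xyWord, ← h, Equiv.apply_symm_apply]⟩

theorem exists_yToX_of_not_ends {m : XWord G} (h : ∀ n, n * w0 ≠ m) : ∃ w, yToX w = m := by
  obtain ⟨w, k, rfl⟩ := exists_yToX m
  cases k with
  | zero => exact ⟨w, by rw [pow_zero, mul_one]⟩
  | succ k => exact absurd (by rw [pow_succ, mul_assoc]) (h (yToX w * w0 ^ k))

theorem mem_I0_iff (f : KX K G) : f ∈ I0 K G ↔ restrY K f = 0 := by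
  rw [mem_I0]
  constructor
  · intro h
    ext w
    exact h _ (yToX_not_ends w)
  · intro h m hm
    obtain ⟨w, rfl⟩ := exists_yToX_of_not_ends hm
    exact congrArg (fun f => f.coeff w) h

theorem mem_I00_iff (F : KXX K G) : F ∈ I00 K G ↔ tensorSq (restrY K) F = 0 := by
  rw [mem_I00]
  constructor
  · intro h
    ext p
    exact h _ _ (yToX_not_ends p.1) (yToX_not_ends p.2)
  · intro h a b ha hb
    obtain ⟨u, rfl⟩ := exists_yToX_of_not_ends ha
    obtain ⟨w, rfl⟩ := exists_yToX_of_not_ends hb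
    exact congrArg (fun f => f.coeff (u, w)) h

theorem piYY_eq_iff (F F' : KXX K G) :
    piYY K G F = piYY K G F' ↔ tensorSq (restrY K) F = tensorSq (restrY K) F' := by
  rw [piYY, Submodule.mkQ_apply, Submodule.mkQ_apply, Submodule.Quotient.eq, mem_I00_iff, map_sub,
    sub_eq_zero]

theorem cont_restrY : IsCont (restrY K : KX K G →ₗ[K] KY K G) := IsCont.reindex _

variable (K G) in
/-- The inclusion `K⟨⟨Y⟩⟩ ⊂ K⟨⟨X⟩⟩`. -/
noncomputable def inclY : KY K G →ₗ[K] KX K G := NCSeries.extend yToX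

theorem cont_inclY : IsCont (inclY K G) := IsCont.extend yToX_injective

theorem inclY_basis (w : YWord G) : inclY K G (basis K w) = basis K (yToX w) :=
  extend_basis yToX_injective w

theorem restrY_inclY (f : KY K G) : restrY K (inclY K G f) = f := by
  ext w
  exact coeff_extend yToX_injective f w

theorem inclYY_eq : (inclYY K : KYY K G →ₗ[K] KXX K G) = tensorSq (inclY K G) := by
  refine (IsCont.extend ?_).ext cont_inclY.tensorSq ?_
  · exact yToX_injective.prodMap yToX_injective
  · rintro ⟨a, b⟩
    rw [tensorSq_basis, inclY_basis, inclY_basis, ← basis_prod]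
    exact extend_basis (yToX_injective.prodMap yToX_injective) (a, b)

theorem tensorSq_restrY_inclYY (F : KYY K G) : tensorSq (restrY K) (inclYY K F) = F := by
  have h : restrY K ∘ₗ inclY K G = LinearMap.id := LinearMap.ext restrY_inclY
  rw [inclYY_eq, ← LinearMap.comp_apply, ← tensorSq_comp cont_restrY cont_inclY, h]
  rfl

/-- The condition of compatibility with `Δ⋆^mod`, expressed in `K⟨⟨Y⟩⟩`. -/
theorem quotMap_deltaMod_iff [Fintype G] {T : KX K G →ₗ[K] KX K G} (hc : IsCont T)
    (hT : I0 K G ≤ (I0 K G).comap T) :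
    quotMapSq T hT ∘ₗ deltaMod K = deltaMod K ∘ₗ quotMap T hT ↔
      tensorSq (restrY K ∘ₗ T ∘ₗ inclY K G) ∘ₗ deltaAlg K =
        deltaAlg K ∘ₗ (restrY K ∘ₗ T ∘ₗ inclY K G) := by
  have h1 : ∀ f : KX K G, quotMapSq T hT (deltaMod K (piY K G f)) =
      piYY K G (tensorSq T (inclYY K (deltaAlg K (restrY K f)))) := fun f => rfl
  have h2 : ∀ f : KX K G, deltaMod K (quotMap T hT (piY K G f)) =
      piYY K G (inclYY K (deltaAlg K (restrY K (T f)))) := fun f => rfl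
  have h3 : ∀ F : KYY K G, tensorSq (restrY K) (tensorSq T (inclYY K F)) =
      tensorSq (restrY K ∘ₗ T ∘ₗ inclY K G) F := fun F => by
    rw [tensorSq_comp cont_restrY (hc.comp cont_inclY), tensorSq_comp hc cont_inclY, inclYY_eq]
    rfl
  constructor
  · intro h
    ext f : 1
    have h4 := LinearMap.congr_fun h (piY K G (inclY K G f))
    rw [LinearMap.comp_apply, LinearMap.comp_apply, h1, h2, piYY_eq_iff, h3,
      tensorSq_restrY_inclYY, restrY_inclY] at h4
    exact h4
  · intro h
    refine LinearMap.ext fun f' => ?_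
    obtain ⟨f, rfl⟩ := (I0 K G).mkQ_surjective f'
    change quotMapSq T hT (deltaMod K (piY K G f)) = deltaMod K (quotMap T hT (piY K G f))
    rw [h1, h2, piYY_eq_iff, h3, tensorSq_restrY_inclYY]
    refine (LinearMap.congr_fun h (restrY K f)).trans ?_
    have h5 : inclY K G (restrY K f) - f ∈ I0 K G := by
      rw [mem_I0_iff, map_sub, restrY_inclY, sub_self]
    have h6 := (mem_I0_iff _).1 (hT h5)
    rw [map_sub, map_sub, sub_eq_zero] at h6
    rw [← h6]
    rfl

theorem q_basis (w : XWord G) : q K (basis K w) = basis K (qWord w) := by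
  ext m
  change (basis K w).coeff (qWord.symm m) = _
  by_cases h : m = qWord w
  · rw [h, Equiv.symm_apply_apply, coeff_basis_self, coeff_basis_self]
  · rw [coeff_basis_of_ne h, coeff_basis_of_ne fun h' => h (by rw [← h', Equiv.apply_symm_apply])]

theorem cont_q : IsCont (q K : KX K G ≃ₗ[K] KX K G).toLinearMap := IsCont.reindex _

theorem cont_q_symm : IsCont (q K : KX K G ≃ₗ[K] KX K G).symm.toLinearMap := IsCont.reindex _

theorem ord_xg [Finite G] (g : G) : Ord 1 (xg K g) := ord_xl (some g)

/-- A leading letter with label `1` divides the next label by `1`, which is also what the initial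
value in `qList` does. -/
theorem q_xg_one_mul (f : KX K G) : q K (xg K 1 * f) = xg K 1 * q K f := by
  refine (cont_q.comp (IsCont.mulLeft _)).ext_apply ((IsCont.mulLeft (xg K 1)).comp cont_q)
    (fun w => ?_) f
  change q K (basis K (wg 1) * basis K w) = basis K (wg 1) * q K (basis K w)
  rw [basis_mul_basis, q_basis, q_basis, basis_mul_basis]
  congr 1
  apply FreeMonoid.toList.injective
  change some ((1 : G) * 1⁻¹) :: _ = some (1 : G) :: _
  rw [mul_inv_cancel]
  rfl

theorem q_symm_xg_one_mul (f : KX K G) : (q K).symm (xg K 1 * f) = xg K 1 * (q K).symm f := by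
  rw [LinearEquiv.symm_apply_eq, q_xg_one_mul, LinearEquiv.apply_symm_apply]

variable [Finite G]

theorem q_evalPS_mul (p : PowerSeries K) (f : KX K G) :
    q K (evalPS p (xg K 1) * f) = evalPS p (xg K 1) * q K f :=
  evalPS_intertwine cont_q (ord_xg 1) (ord_xg 1) (fun f => q_xg_one_mul f) p f

theorem cont_SYLift (Ψ : GroupLike K G) : IsCont (SYLift Ψ) :=
  cont_q.comp (((IsCont.mulLeft _).comp (isHom_autX Ψ).cont).comp cont_q_symm)

theorem SYLift_apply (Ψ : GroupLike K G) (f : KX K G) :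
    SYLift Ψ f = q K (S Ψ ((q K).symm f)) := rfl

/-- As `aut_Ψ(x₁) = Ψ⁻¹x₁Ψ`, the map `S_Ψ` commutes with left multiplication by `x₁`; so the factors
`Γ(x₁)` pass through it and the corrected maps compose correctly. -/
theorem SYLift_xg_one_mul (Ψ : GroupLike K G) (f : KX K G) :
    SYLift Ψ (xg K 1 * f) = xg K 1 * SYLift Ψ f := by
  rw [SYLift_apply, SYLift_apply, q_symm_xg_one_mul, ← q_xg_one_mul]
  congr 1
  rw [S_apply, S_apply, (isHom_autX Ψ).map_mul, xg_eq, autX_xl]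
  change Ψ.ser * (tAct K 1 Ψ.serInv * xg K 1 * tAct K 1 Ψ.ser * _) = _
  rw [tAct_one, tAct_one, ← mul_assoc, ← mul_assoc, ← mul_assoc, Ψ.ser_mul_serInv, one_mul,
    mul_assoc]
  rfl

theorem SYLift_mul (Ψ Φ : GroupLike K G) (f : KX K G) :
    SYLift (Ψ * Φ) f = SYLift Ψ (SYLift Φ f) := by
  rw [SYLift_apply, SYLift_apply, SYLift_apply, LinearEquiv.symm_apply_apply]
  congr 1
  rw [S_apply, S_apply, S_apply, GroupLike.autX_mul, GroupLike.mul_ser, (isHom_autX Ψ).map_mul,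
    mul_assoc]
  rfl

variable [Algebra ℚ K] (ε : ℤˣ)

theorem GamSYLift_apply (Ψ : GroupLike K G) (f : KX K G) :
    GamSYLift ε Ψ f = GamInvX ε Ψ * SYLift Ψ f := rfl

theorem cont_GamSYLift (Ψ : GroupLike K G) : IsCont (GamSYLift ε Ψ) :=
  (IsCont.mulLeft _).comp (cont_SYLift Ψ)

theorem GamSYLift_mul (Ψ Φ : GroupLike K G) (f : KX K G) :
    GamSYLift ε (Ψ * Φ) f = GamSYLift ε Ψ (GamSYLift ε Φ f) := by
  rw [GamSYLift_apply, GamSYLift_apply, GamSYLift_apply, GamInvX, GamInvX, GamInvX, inv_Gam_mul,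
    evalPS_mul (ord_xg 1), evalPS_intertwine (cont_SYLift Ψ) (ord_xg 1) (ord_xg 1)
      (SYLift_xg_one_mul Ψ), SYLift_mul, mul_assoc]

theorem GamSYLift_one (f : KX K G) : GamSYLift ε (1 : GroupLike K G) f = f := by
  rw [GamSYLift_apply, GamInvX, Gam_one, Ring.inverse_one, evalPS_one (ord_xg 1), one_mul,
    SYLift_apply, S_apply, GroupLike.autX_one, GroupLike.one_ser, one_mul, LinearMap.id_apply,
    LinearEquiv.apply_symm_apply]

/-- The automorphism of `K⟨⟨Y⟩⟩` that corresponds to `^Γ S_Ψ^Y` under `π_Y`. -/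
noncomputable def GamSYY (Ψ : GroupLike K G) : KY K G →ₗ[K] KY K G :=
  restrY K ∘ₗ GamSYLift ε Ψ ∘ₗ inclY K G

theorem cont_GamSYY (Ψ : GroupLike K G) : IsCont (GamSYY ε Ψ) :=
  cont_restrY.comp ((cont_GamSYLift ε Ψ).comp cont_inclY)

theorem GamSYY_restrY (Ψ : GroupLike K G) (f : KX K G) :
    GamSYY ε Ψ (restrY K f) = restrY K (GamSYLift ε Ψ f) := by
  have h5 : inclY K G (restrY K f) - f ∈ I0 K G := by
    rw [mem_I0_iff, map_sub, restrY_inclY, sub_self]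
  have h6 := (mem_I0_iff _).1 (GamSYLift_stable ε Ψ h5)
  rw [map_sub, map_sub, sub_eq_zero] at h6
  exact h6

theorem GamSYY_mul (Ψ Φ : GroupLike K G) : GamSYY ε (Ψ * Φ) = GamSYY ε Ψ ∘ₗ GamSYY ε Φ := by
  ext f : 1
  rw [LinearMap.comp_apply, GamSYY, GamSYY.eq_1 ε Φ]
  simp only [LinearMap.comp_apply]
  rw [GamSYY_restrY, GamSYLift_mul]

theorem GamSYY_one : GamSYY ε (1 : GroupLike K G) = LinearMap.id := by
  ext f : 1
  rw [GamSYY, LinearMap.comp_apply, LinearMap.comp_apply, GamSYLift_one, restrY_inclY]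
  rfl

theorem mem_stabMod {G : Type v} [CommGroup G] [Fintype G] (Ψ : GroupLike K G) :
    Ψ ∈ stabMod K G ε ↔ tensorSq (GamSYY ε Ψ) ∘ₗ deltaAlg K = deltaAlg K ∘ₗ GamSYY ε Ψ :=
  quotMap_deltaMod_iff (cont_GamSYLift ε Ψ) (GamSYLift_stable ε Ψ)

theorem mem_stabAlg {G : Type v} [CommGroup G] [Fintype G] (Ψ : GroupLike K G) :
    Ψ ∈ stabAlg K G ε ↔ tensorSq (GamAutY ε Ψ) ∘ₗ deltaAlg K = deltaAlg K ∘ₗ GamAutY ε Ψ :=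
  Iff.rfl

end ModY

/-- The stabiliser of a coproduct under an action by continuous linear maps. -/
def stabCoprod {K : Type u} [CommRing K] {M : Type*} {H : Type*} [Group H]
    (ρ : H → NCSeries K M →ₗ[K] NCSeries K M) (hc : ∀ g, IsCont (ρ g))
    (h1 : ρ 1 = LinearMap.id) (hm : ∀ g h, ρ (g * h) = ρ g ∘ₗ ρ h)
    (D : NCSeries K M →ₗ[K] NCSeries K (M × M)) : Subgroup H where
  carrier := {g | tensorSq (ρ g) ∘ₗ D = D ∘ₗ ρ g}
  one_mem' := by
    rw [Set.mem_ofPred_eq, h1, tensorSq_id, LinearMap.id_comp, LinearMap.comp_id]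
  mul_mem' {g h} hg hh := by
    rw [Set.mem_ofPred_eq] at hg hh ⊢
    rw [hm, tensorSq_comp (hc g) (hc h), LinearMap.comp_assoc, hh, ← LinearMap.comp_assoc, hg,
      LinearMap.comp_assoc]
  inv_mem' {g} hg := by
    rw [Set.mem_ofPred_eq] at hg ⊢
    have h2 : ρ g ∘ₗ ρ g⁻¹ = LinearMap.id := by rw [← hm, mul_inv_cancel, h1]
    have h3 : tensorSq (ρ g⁻¹) ∘ₗ tensorSq (ρ g) = LinearMap.id := by
      rw [← tensorSq_comp (hc _) (hc _), ← hm, inv_mul_cancel, h1, tensorSq_id]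
    calc tensorSq (ρ g⁻¹) ∘ₗ D = tensorSq (ρ g⁻¹) ∘ₗ (D ∘ₗ ρ g) ∘ₗ ρ g⁻¹ := by
          rw [LinearMap.comp_assoc, h2, LinearMap.comp_id]
      _ = (tensorSq (ρ g⁻¹) ∘ₗ tensorSq (ρ g)) ∘ₗ D ∘ₗ ρ g⁻¹ := by
          rw [← hg]; simp only [LinearMap.comp_assoc]
      _ = D ∘ₗ ρ g⁻¹ := by rw [h3, LinearMap.id_comp]

/-! ### The stabiliser of `Δ⋆^mod` is contained in the stabiliser of `Δ⋆^alg` -/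

section Theta

variable {K : Type u} [CommRing K] {G : Type v} [CommGroup G] [Fintype G]

theorem varpiInv_basis_nf (w : YWord G) (k : ℕ) (g : G) [Decidable (k = 0 ∧ g = 1)] :
    varpiInv (basis K (zWord w * ve0 ^ k * vgrp g)) =
      if k = 0 ∧ g = 1 then (-1 : K) ^ FreeMonoid.length w • basis K w else 0 := by
  split_ifs with h
  · obtain ⟨rfl, rfl⟩ := h
    rw [← varpiInv_varpi ((-1 : K) ^ FreeMonoid.length w • basis K w), map_smul, varpi_basis,
      smul_smul, ← mul_pow, neg_one_mul, neg_neg, one_pow, one_smul, pow_zero, mul_one, vgrp_one,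
      mul_one]
  · ext u
    change _ * _ = (0 : K)
    rw [coeff_basis_of_ne, mul_zero]
    intro h'
    have := nf_injective (w := u) (k := 0) (g := 1) (k' := k) (g' := g) (w' := w)
      (by rw [pow_zero, vgrp_one, mul_one, mul_one, h'])
    exact h ⟨this.2.1.symm, this.2.2.symm⟩

/-- Left multiplication by a monomial `zWord w` does not change the tail `e₀ᵏ g` of a normal form,
and `varpiInv` selects the trivial tail. -/
theorem varpiInv_varpi_mul (f : KY K G) (v : VG K G) :
    varpiInv (varpi f * v) = f * varpiInv v := by
  classical
  have h1 : ∀ w m, varpiInv (varpi (basis K w) * (basis K m : VG K G)) =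
      basis K w * varpiInv (basis K m) := fun w m => by
    obtain ⟨u, k, g, rfl⟩ := exists_nf m
    rw [varpi_basis, smul_mul_assoc, basis_mul_basis, map_smul, varpiInv_basis_nf, ← mul_assoc,
      ← mul_assoc, ← map_mul, varpiInv_basis_nf]
    split_ifs with h
    · rw [mul_smul_comm, basis_mul_basis, smul_smul, FreeMonoid.length_mul, pow_add, ← mul_assoc,
        ← mul_pow, neg_one_mul, neg_neg, one_pow, one_mul]
    · rw [smul_zero, mul_zero]
  have h2 : ∀ w, varpiInv (varpi (basis K w) * v) = basis K w * varpiInv v := fun w =>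
    (cont_varpiInv.comp (IsCont.mulLeft _)).ext_apply ((IsCont.mulLeft _).comp cont_varpiInv)
      (h1 w) v
  exact (cont_varpiInv.comp ((IsCont.mulRight v).comp isHom_varpi.cont)).ext_apply
    (IsCont.mulRight (varpiInv v)) h2 f

variable (K G) in
/-- The linear map `V_G → K⟨⟨Y⟩⟩` that corresponds to the projection of `V_G` onto its quotient by
the left ideal generated by `e₀` and the elements `g - 1`. -/
noncomputable def theta : VG K G →ₗ[K] KY K G :=
  ∑ g : G, varpiInv ∘ₗ LinearMap.mulRight K (basis K (vgrp g))

/-- `varpiInv` keeps the tails with `k = 0` and group element `1`; the sum over right translates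
keeps the tails with `k = 0` and any group element. -/
theorem theta_apply (v : VG K G) : theta K G v = ∑ g : G, varpiInv (v * basis K (vgrp g)) := by
  simp [theta]

theorem cont_theta : IsCont (theta K G) :=
  IsCont.sum _ fun _ _ => cont_varpiInv.comp (IsCont.mulRight _)

theorem theta_varpi_mul (f : KY K G) (v : VG K G) : theta K G (varpi f * v) = f * theta K G v := by
  simp only [theta_apply, mul_assoc, varpiInv_varpi_mul, Finset.mul_sum]

theorem theta_mul_grp (v : VG K G) (h : G) : theta K G (v * basis K (vgrp h)) = theta K G v := by
  simp only [theta_apply, mul_assoc, basis_mul_basis, vgrp_mul]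
  exact Fintype.sum_equiv (Equiv.mulLeft h) _ _ fun _ => rfl

theorem theta_e0_pow (k : ℕ) : theta K G (basis K (ve0 ^ k)) = if k = 0 then 1 else 0 := by
  classical
  have h : ∀ g : G, varpiInv (basis K (ve0 ^ k) * basis K (vgrp g)) =
      if k = 0 ∧ g = 1 then (1 : KY K G) else 0 := fun g => by
    have := varpiInv_basis_nf (K := K) 1 k g
    rwa [map_one, one_mul, FreeMonoid.length_one, pow_zero, one_smul, ← one_def,
      ← basis_mul_basis] at this
  rw [theta_apply, Finset.sum_congr rfl fun g _ => h g]
  split_ifs with hk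
  · simp [hk]
  · simp [hk]

/-- On a word with tail `x₀ᵏ`, `β` produces the image under `ϖ` of its `Y`-part, followed by a group
element and `e₀ᵏ`. Passing to the quotient by `e₀` and the `g - 1` drops the group element and kills
the term unless `k = 0`, exactly as `π_Y` does. -/
theorem theta_betaX (f : KX K G) : theta K G (betaX f) = restrY K (q K f) := by
  refine (cont_theta.comp isHom_betaX.cont).ext_apply (cont_restrY.comp cont_q) (fun m => ?_) f
  obtain ⟨w, k, rfl⟩ := exists_xyWord m
  change theta K G (betaX _) = restrY K (q K _)
  rw [betaX_word, q_basis, qWord_xyWord, theta_varpi_mul, vgrp_comm_pow, ← basis_mul_basis,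
    theta_mul_grp, theta_e0_pow]
  split_ifs with hk
  · rw [hk, pow_zero, mul_one, mul_one, ← inclY_basis, restrY_inclY]
  · rw [mul_zero]
    refine ((mem_I0_iff _).1 ?_).symm
    obtain ⟨j, rfl⟩ := Nat.exists_eq_succ_of_ne_zero hk
    refine ⟨basis K (yToX w * w0 ^ j), ?_⟩
    rw [LinearMap.mulRight_apply, x0, basis_mul_basis, pow_succ, mul_assoc]

/-- The letter of `K⟨⟨Y⟩⟩` attached to `a`. -/
noncomputable abbrev yl (K : Type u) [CommRing K] {G : Type v} (a : ℕ+ × G) : KY K G :=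
  basis K (FreeMonoid.of a)

theorem locFin_deltaAlg : LocFin (FreeMonoid.lift fun a : ℕ+ × G =>
    (NCSeries.basis K (yw a.1 a.2, 1) + NCSeries.basis K (1, yw a.1 a.2) +
      ∑ k ∈ Finset.Ico 1 a.1, ∑ h : G,
        NCSeries.basis K (yw k h, yw (a.1 - k) (a.2 * h⁻¹)) : KYY K G)) :=
  LocFin.lift fun a => by
    rw [deg_of_Y]
    refine Ord.add (Ord.add ?_ ?_) (Ord.sum _ fun k hk => Ord.sum _ fun h _ => ?_)
    · exact (Ord.basis _).mono (by rw [deg_prod, deg_one, yw, deg_of_Y, add_zero])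
    · exact (Ord.basis _).mono (by rw [deg_prod, deg_one, yw, deg_of_Y, zero_add])
    · refine (Ord.basis _).mono ?_
      rw [deg_prod, yw, yw, deg_of_Y, deg_of_Y]
      have h2 := (Finset.mem_Ico.1 hk).2
      exact (congrArg PNat.val (PNat.add_sub_of_lt h2)).ge

theorem isHom_deltaAlg : IsHom (deltaAlg K : KY K G →ₗ[K] KYY K G) := locFin_deltaAlg.isHom

variable [Algebra ℚ K] (ε : ℤˣ)

theorem betaX_GamInvX (Ψ : GroupLike K G) :
    betaX (GamInvX ε Ψ) = evalPS (Ring.inverse (Gam ε Ψ)) (-basis K ve1 : VG K G) := by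
  have h : betaX (xg K 1) = (-basis K ve1 : VG K G) := by
    rw [betaX_xg, inv_one, vgrp_one, one_mul, mul_one]
  rw [GamInvX, isHom_betaX.map_evalPS (ord_xg 1) (by rw [h]; exact ord_neg_ve1), h]

/-- This describes the module automorphism inside `V_G`. The group element left over by `betaX_word`
is fixed by `aut^{V,(0)}` and disappears under `theta`. -/
theorem GamSYY_eq_theta (Ψ : GroupLike K G) (f : KY K G) :
    GamSYY ε Ψ f = theta K G (conjV ε Ψ * autV0 Ψ (varpi f)) := by
  refine (cont_GamSYY ε Ψ).ext_apply (cont_theta.comp ((IsCont.mulLeft _).comp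
    ((isHom_autV0 Ψ).cont.comp isHom_varpi.cont))) (fun w => ?_) f
  have h0 : (q K).symm (basis K (yToX w)) = basis K (xyWord 1 w) := by
    rw [LinearEquiv.symm_apply_eq, q_basis, ← qWord_symm_yToX, Equiv.apply_symm_apply]
  have h1 := betaX_word (K := K) w 0
  rw [pow_zero, pow_zero, mul_one, mul_one] at h1
  change restrY K (GamSYLift ε Ψ (inclY K G (basis K w))) =
    theta K G (conjV ε Ψ * autV0 Ψ (varpi (basis K w)))
  rw [inclY_basis, GamSYLift_apply, SYLift_apply, h0, GamInvX, ← q_evalPS_mul, ← theta_betaX,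
    isHom_betaX.map_mul, S_apply, isHom_betaX.map_mul, betaX_autX, h1, (isHom_autV0 Ψ).map_mul,
    autV0_grp, ← mul_assoc, ← mul_assoc, theta_mul_grp]
  congr 2
  rw [conjV, ← betaX_GamInvX, GamInvX]

/-- `conjV · aut(f) = ^Γaut(f) · conjV`, and `theta` is linear on the left over `W_G`. So the module
map is semilinear along the algebra map. -/
theorem GamSYY_mul_apply (Ψ : GroupLike K G) (f f' : KY K G) :
    GamSYY ε Ψ (f * f') = GamAutY ε Ψ f * GamSYY ε Ψ f' := by
  rw [GamSYY_eq_theta, GamSYY_eq_theta, ← theta_varpi_mul, varpi_GamAutY, GamAutV1_apply]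
  congr 1
  rw [isHom_varpi.map_mul, (isHom_autV0 Ψ).map_mul]
  calc _ = conjV ε Ψ * autV0 Ψ (varpi f) * 1 * autV0 Ψ (varpi f') := by noncomm_ring
    _ = _ := by rw [← conjVInv_mul_conjV ε Ψ]; noncomm_ring

theorem GamSYY_apply_one (Ψ : GroupLike K G) : GamSYY ε Ψ 1 = restrY K (starLift ε Ψ) := by
  rw [GamSYY_eq_theta, isHom_varpi.map_one, (isHom_autV0 Ψ).map_one, mul_one, starLift,
    ← theta_betaX, isHom_betaX.map_mul, betaX_GamInvX, conjV]

theorem coeff_one_restrY_starLift (Ψ : GroupLike K G) :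
    (restrY K (starLift ε Ψ)).coeff 1 = 1 := by
  change (GamInvX ε Ψ * Ψ.ser).coeff 1 = 1
  rw [coeff_one_mul eq_one_of_deg_X, Ψ.coeff_one_ser, mul_one, GamInvX,
    coeff_evalPS_one (ord_xg 1), constantCoeff_inv_Gam]

/-- Semilinearity gives `GamSYY f = GamAutY f · ρ`. The hypothesis at `1` makes `ρ` group-like, and
the hypothesis at `f` is the claim multiplied on the right by `ρ ⊗ ρ`, which is cancelled because
its constant term is `1`. -/
theorem stabMod_subset_stabAlg : stabMod K G ε ⊆ stabAlg K G ε := by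
  intro Ψ hΨ
  rw [mem_stabMod] at hΨ
  rw [mem_stabAlg]
  set ρ := GamSYY ε Ψ 1 with hρ
  have hT : GamSYY ε Ψ = LinearMap.mulRight K ρ ∘ₗ GamAutY ε Ψ := by
    ext f : 1
    have := GamSYY_mul_apply ε Ψ f 1
    rwa [mul_one] at this
  have hsq : ∀ F : KYY K G, tensorSq (GamSYY ε Ψ) F = tensorSq (GamAutY ε Ψ) F * tmul ρ ρ := by
    have h1 : tensorSq (LinearMap.mulRight K ρ) = LinearMap.mulRight K (tmul ρ ρ) :=
      (IsCont.mulRight ρ).tensorSq.ext (IsCont.mulRight _) fun ⟨a, b⟩ => by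
        rw [tensorSq_basis, LinearMap.mulRight_apply, LinearMap.mulRight_apply,
          LinearMap.mulRight_apply, basis_prod, tmul_mul_tmul]
    intro F
    rw [hT, tensorSq_comp (IsCont.mulRight ρ) (isHom_GamAutY ε Ψ).cont, h1]
    rfl
  have hΔρ : deltaAlg K ρ = tmul ρ ρ := by
    have := LinearMap.congr_fun hΨ 1
    rw [LinearMap.comp_apply, LinearMap.comp_apply, isHom_deltaAlg.map_one, ← tmul_one_one,
      tensorSq_tmul] at this
    exact this.symm
  have hinj : Function.Injective (LinearMap.mulRight K (tmul ρ ρ)) := by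
    refine (unip_mulRight (ord_sub_one (eq_one_of_deg_prod eq_one_of_deg_Y) ?_)).injective
    change ρ.coeff 1 * ρ.coeff 1 = 1
    rw [hρ, GamSYY_apply_one, coeff_one_restrY_starLift, mul_one]
  ext f : 1
  refine hinj ?_
  have h2 := LinearMap.congr_fun hΨ f
  rw [LinearMap.comp_apply, LinearMap.comp_apply, hsq] at h2
  rw [LinearMap.mulRight_apply, LinearMap.mulRight_apply, LinearMap.comp_apply,
    LinearMap.comp_apply, h2, ← hΔρ, ← isHom_deltaAlg.map_mul, hT]
  rfl

end Theta

/-! ### Removing the first letter -/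

section LDeriv

variable {K : Type u} [CommRing K] {A : Type*}

/-- The series `w ↦ f(a w)`. -/
def lderiv (K : Type u) [CommRing K] {A : Type*} (a : A) :
    NCSeries K (FreeMonoid A) →ₗ[K] NCSeries K (FreeMonoid A) :=
  NCSeries.reindex (FreeMonoid.of a * ·)

theorem coeff_lderiv (a : A) (f : NCSeries K (FreeMonoid A)) (w : FreeMonoid A) :
    (lderiv K a f).coeff w = f.coeff (FreeMonoid.of a * w) := rfl

theorem cont_lderiv (a : A) : IsCont (lderiv K a) := IsCont.reindex _

theorem of_mul_ne_one (a : A) (w : FreeMonoid A) : FreeMonoid.of a * w ≠ 1 := fun h => by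
  simpa using congrArg FreeMonoid.length h

theorem of_mul_inj {a b : A} {w w' : FreeMonoid A} :
    FreeMonoid.of a * w = FreeMonoid.of b * w' ↔ a = b ∧ w = w' :=
  List.cons_eq_cons

theorem lderiv_basis_one (a : A) : lderiv K a (1 : NCSeries K (FreeMonoid A)) = 0 := by
  ext w
  exact coeff_basis_of_ne (of_mul_ne_one a w)

theorem lderiv_basis_of_mul [DecidableEq A] (a b : A) (w : FreeMonoid A) :
    lderiv K a (basis K (FreeMonoid.of b * w)) = if a = b then basis K w else 0 := by
  ext w'
  rw [coeff_lderiv]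
  split_ifs with h
  · subst h
    by_cases hw : w' = w
    · rw [hw, coeff_basis_self, coeff_basis_self]
    · rw [coeff_basis_of_ne hw, coeff_basis_of_ne fun h => hw (of_mul_inj.1 h).2]
  · exact coeff_basis_of_ne fun h' => h (of_mul_inj.1 h').1

/-- The first letter of a product comes from the first factor, unless that factor contributes only
its constant term. -/
theorem lderiv_mul (a : A) (f g : NCSeries K (FreeMonoid A)) :
    lderiv K a (f * g) = lderiv K a f * g + f.coeff 1 • lderiv K a g := by
  classical
  have hc : IsCont (LinearMap.mulRight K g ∘ₗ lderiv K a +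
      (coeffL K (1 : FreeMonoid A)).smulRight (lderiv K a g)) := by
    refine ((IsCont.mulRight g).comp (cont_lderiv a)).add fun n => ⟨{1}, fun f hf => ?_⟩
    have h1 := hf 1 (Finset.mem_singleton_self _)
    simp [h1]
  refine ((cont_lderiv a).comp (IsCont.mulRight g)).ext_apply hc (fun w => ?_) f
  simp only [LinearMap.comp_apply, LinearMap.add_apply, LinearMap.mulRight_apply,
    LinearMap.smulRight_apply, coeffL_apply]
  refine ((cont_lderiv a).comp (IsCont.mulLeft (basis K w))).ext_apply (((IsCont.mulLeft
    (lderiv K a (basis K w)))).add ((cont_lderiv a).smul ((basis K w).coeff 1)))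
    (fun w' => ?_) g
  simp only [LinearMap.comp_apply, LinearMap.add_apply, LinearMap.mulLeft_apply,
    LinearMap.smul_apply, basis_mul_basis]
  induction w using FreeMonoid.inductionOn' with
  | one => rw [one_mul, ← one_def, lderiv_basis_one, zero_mul, zero_add, one_def,
      coeff_basis_self, one_smul]
  | of_mul b w _ =>
    rw [mul_assoc, lderiv_basis_of_mul, lderiv_basis_of_mul,
      coeff_basis_of_ne (of_mul_ne_one b w).symm, zero_smul, add_zero]
    split_ifs
    · rw [basis_mul_basis]
    · rw [zero_mul]

end LDeriv

/-! ### The Euler derivation of `K⟨⟨Y⟩⟩` -/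

section Euler

variable {K : Type u} [CommRing K] {G : Type v}

/-- The sum, over the letters of the word, of the index of the letter times the coefficient of `f`
at the word in which this index is raised by `1`. -/
noncomputable def raiseAux : List (ℕ+ × G) → KY K G → K
  | [], _ => 0
  | a :: l, f => (a.1 : ℕ) * f.coeff (FreeMonoid.of (a.1 + 1, a.2) * FreeMonoid.ofList l) +
      raiseAux l (lderiv K a f)

theorem raiseAux_add (l : List (ℕ+ × G)) (f g : KY K G) :
    raiseAux l (f + g) = raiseAux l f + raiseAux l g := by
  induction l generalizing f g with
  | nil => simp [raiseAux]
  | cons a l ih => simp only [raiseAux, map_add, ih, coeff_add]; ring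

theorem raiseAux_smul (l : List (ℕ+ × G)) (c : K) (f : KY K G) :
    raiseAux l (c • f) = c * raiseAux l f := by
  induction l generalizing f with
  | nil => simp [raiseAux]
  | cons a l ih => simp only [raiseAux, map_smul, ih, coeff_smul]; ring

variable (K G) in
/-- The derivation of `K⟨⟨Y⟩⟩` with `y_{n,g} ↦ (n - 1) y_{n-1,g}`. -/
noncomputable def raise : KY K G →ₗ[K] KY K G where
  toFun f := ⟨fun w => raiseAux (FreeMonoid.toList w) f⟩
  map_add' f g := by ext w; exact raiseAux_add _ f g
  map_smul' c f := by ext w; exact raiseAux_smul _ c f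

theorem coeff_raise_one (f : KY K G) : (raise K G f).coeff 1 = 0 := rfl

theorem coeff_raise_of_mul (f : KY K G) (a : ℕ+ × G) (w : YWord G) :
    (raise K G f).coeff (FreeMonoid.of a * w) =
      (a.1 : ℕ) * f.coeff (FreeMonoid.of (a.1 + 1, a.2) * w) +
        (raise K G (lderiv K a f)).coeff w := rfl

theorem lderiv_raise (f : KY K G) (a : ℕ+ × G) :
    lderiv K a (raise K G f) =
      ((a.1 : ℕ) : K) • lderiv K (a.1 + 1, a.2) f + raise K G (lderiv K a f) := by
  ext w
  exact coeff_raise_of_mul f a w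

theorem raise_one : raise K G 1 = 0 := by
  ext w
  induction w using FreeMonoid.inductionOn' with
  | one => rfl
  | of_mul a w _ =>
    rw [coeff_raise_of_mul, lderiv_basis_one, map_zero, one_def,
      coeff_basis_of_ne (of_mul_ne_one _ w), mul_zero, zero_add]
    rfl

/-- `raise` lowers the weight by one and preserves the `G`-degree, so a coefficient of the image
depends only on the coefficients of `f` in the next weight. -/
theorem coeff_raise_eq_zero [CommGroup G] [Finite G] {f : KY K G} {u : YWord G}
    (h : ∀ w : YWord G, deg w = deg u + 1 → gdeg G w = gdeg G u → f.coeff w = 0) :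
    (raise K G f).coeff u = 0 := by
  induction u using FreeMonoid.inductionOn' generalizing f with
  | one => rfl
  | of_mul a u ih =>
    rw [coeff_raise_of_mul, ih, h, mul_zero, add_zero]
    · rw [deg_mul, deg_mul, deg_of_Y, deg_of_Y]
      simp only [PNat.add_coe, PNat.val_ofNat]
      omega
    · rw [map_mul, map_mul, gdeg_of, gdeg_of]
    · intro w hw hw'
      refine h _ ?_ ?_
      · rw [deg_mul, deg_mul, hw]; omega
      · rw [map_mul, map_mul, hw']

theorem coeff_raise_congr [CommGroup G] [Finite G] {f g : KY K G} {u : YWord G}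
    (h : ∀ w : YWord G, deg w = deg u + 1 → gdeg G w = gdeg G u → f.coeff w = g.coeff w) :
    (raise K G f).coeff u = (raise K G g).coeff u := by
  rw [← sub_eq_zero, ← coeff_sub, ← map_sub]
  exact coeff_raise_eq_zero fun w hw hw' => by rw [coeff_sub, h w hw hw', sub_self]

theorem cont_raise [CommGroup G] [Finite G] : IsCont (raise K G) := fun u =>
  ⟨(FinGraded.finite_le (M := YWord G) (deg u + 1)).toFinset, fun f hf =>
    coeff_raise_eq_zero fun w hw _ => hf w (by simp [hw])⟩

/-- The Leibniz rule is propagated along the word by removing first letters; the constant terms that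
arise are compatible because `raise` has no constant term. -/
theorem raise_mul (f g : KY K G) :
    raise K G (f * g) = raise K G f * g + f * raise K G g := by
  ext u
  induction u using FreeMonoid.inductionOn' generalizing f g with
  | one =>
    have h : ∀ f g : KY K G, (f * g).coeff 1 = f.coeff 1 * g.coeff 1 := fun f g => by
      rw [coeff_mul, Finset.sum_eq_single (1, 1)]
      · rintro ⟨a, b⟩ h hne
        rw [Finset.HasMulAntidiagonal.mem_mulAntidiagonal] at h
        have h' : FreeMonoid.length a + FreeMonoid.length b = 0 := by
          simpa using congrArg FreeMonoid.length h
        have ha : a = 1 := FreeMonoid.length_eq_zero.1 (by omega)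
        have hb : b = 1 := FreeMonoid.length_eq_zero.1 (by omega)
        exact absurd (by rw [ha, hb]) hne
      · simp
    rw [coeff_add, h, h, coeff_raise_one, coeff_raise_one, coeff_raise_one, zero_mul, mul_zero,
      add_zero]
  | of_mul a u ih =>
    rw [coeff_raise_of_mul, coeff_add, ← coeff_lderiv, ← coeff_lderiv a, ← coeff_lderiv a,
      lderiv_mul, lderiv_mul, lderiv_mul, lderiv_mul, lderiv_raise, lderiv_raise, map_add, map_smul]
    simp only [coeff_add, coeff_smul, ih, coeff_raise_one, add_mul, zero_smul, coeff_zero,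
      smul_mul_assoc, mul_add]
    ring

/-- The raised letter lies in `u` or in `w`. This allows letters to be split off at the right end,
as reversal requires. -/
theorem coeff_raise_mul_right (f : KY K G) (u w : YWord G) :
    (raise K G f).coeff (u * w) = (raise K G (NCSeries.reindex (· * w) f)).coeff u +
      (raise K G (NCSeries.reindex (u * ·) f)).coeff w := by
  induction u using FreeMonoid.inductionOn' generalizing f with
  | one =>
    rw [coeff_raise_one, zero_add, one_mul]
    congr 2
  | of_mul a u ih =>
    rw [mul_assoc, coeff_raise_of_mul, coeff_raise_of_mul, ih, add_assoc]
    congr 1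

theorem coeff_raise_of (f : KY K G) (a : ℕ+ × G) :
    (raise K G f).coeff (FreeMonoid.of a) =
      (a.1 : ℕ) * f.coeff (FreeMonoid.of (a.1 + 1, a.2)) := by
  have := coeff_raise_of_mul f a 1
  rwa [coeff_raise_one, add_zero, mul_one, mul_one] at this

variable [CommGroup G] [Finite G]

variable (K G) in
/-- The derivation of `K⟨⟨Y⟩⟩` with `y_{n,g} ↦ (n - 1) y_{n-1,g} - n y_{n,g}`. -/
noncomputable def euler : KY K G →ₗ[K] KY K G where
  toFun f := ⟨fun w => (raise K G f).coeff w - (deg w : K) * f.coeff w⟩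
  map_add' f g := by ext w; simp only [map_add, coeff_add]; ring
  map_smul' c f := by ext w; simp only [map_smul, coeff_smul, RingHom.id_apply]; ring

theorem coeff_euler (f : KY K G) (w : YWord G) :
    (euler K G f).coeff w = (raise K G f).coeff w - (deg w : K) * f.coeff w := rfl

theorem cont_euler : IsCont (euler K G) := by
  classical
  intro w
  obtain ⟨s, hs⟩ := cont_raise (K := K) (G := G) w
  refine ⟨insert w s, fun f hf => ?_⟩
  rw [coeff_euler, hs f fun i hi => hf i (Finset.mem_insert_of_mem hi),
    hf w (Finset.mem_insert_self _ _), mul_zero, sub_zero]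

theorem euler_mul (f g : KY K G) : euler K G (f * g) = euler K G f * g + f * euler K G g := by
  ext w
  rw [coeff_euler, raise_mul, coeff_add, coeff_add, coeff_mul, coeff_mul, coeff_mul, coeff_mul,
    coeff_mul, Finset.mul_sum, ← Finset.sum_add_distrib, ← Finset.sum_add_distrib,
    ← Finset.sum_sub_distrib]
  refine Finset.sum_congr rfl fun p hp => ?_
  rw [Finset.HasMulAntidiagonal.mem_mulAntidiagonal] at hp
  rw [coeff_euler, coeff_euler, ← hp, deg_mul, Nat.cast_add]
  ring

end Euler

/-! ### Homogeneity of the harmonic coproduct -/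

section Harmonic

variable {K : Type u} [CommRing K] {G : Type v}

theorem word_cases {A : Type*} (w : FreeMonoid A) :
    w = 1 ∨ (∃ a, w = FreeMonoid.of a) ∨
      ∃ a b w', w = FreeMonoid.of a * (FreeMonoid.of b * w') := by
  rcases w with _ | ⟨a, _ | ⟨b, l⟩⟩
  · exact Or.inl rfl
  · exact Or.inr (Or.inl ⟨a, rfl⟩)
  · exact Or.inr (Or.inr ⟨a, b, l, rfl⟩)

/-- The series `1 + ∑ y_{n,g}`. -/
def ySum (K : Type u) [CommRing K] (G : Type v) : KY K G :=
  ⟨fun w => if FreeMonoid.length w ≤ 1 then 1 else 0⟩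

theorem coeff_ySum (w : YWord G) :
    (ySum K G).coeff w = if FreeMonoid.length w ≤ 1 then 1 else 0 := rfl

theorem coeff_ySum_one : (ySum K G).coeff 1 = 1 := rfl

theorem coeff_ySum_of (a : ℕ+ × G) : (ySum K G).coeff (FreeMonoid.of a) = 1 := rfl

theorem coeff_ySum_of_mul_of_mul (a b : ℕ+ × G) (w : YWord G) :
    (ySum K G).coeff (FreeMonoid.of a * (FreeMonoid.of b * w)) = 0 := by
  rw [coeff_ySum, if_neg]
  simp [FreeMonoid.length_mul]

theorem of_ne_of_mul {A : Type*} (a b c : A) (w : FreeMonoid A) :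
    FreeMonoid.of a * (FreeMonoid.of b * w) ≠ FreeMonoid.of c := fun h => by
  simpa [FreeMonoid.length_mul] using congrArg FreeMonoid.length h

/-- At `y_{n,g}` the derivation returns `n` times the coefficient at `y_{n+1,g}`, that is, `n`;
hence `1 + ∑ y_{n,g}` is annihilated by the Euler derivation. -/
theorem raise_ySum [Finite G] (w : YWord G) :
    (raise K G (ySum K G)).coeff w = (deg w : K) * (ySum K G).coeff w := by
  rcases word_cases w with rfl | ⟨a, rfl⟩ | ⟨a, b, w, rfl⟩
  · rw [coeff_raise_one, deg_one, Nat.cast_zero, zero_mul]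
  · rw [coeff_raise_of, deg_of_Y, coeff_ySum_of, coeff_ySum_of]
  · have h : lderiv K a (ySum K G) = 1 := by
      ext w
      rcases word_cases w with rfl | ⟨c, rfl⟩ | ⟨c, d, w, rfl⟩
      · rw [coeff_lderiv, mul_one, coeff_ySum_of, one_def, coeff_basis_self]
      · rw [coeff_lderiv, one_def, coeff_basis_of_ne (FreeMonoid.of_ne_one c),
          ← mul_one (FreeMonoid.of c), coeff_ySum_of_mul_of_mul]
      · rw [coeff_lderiv, one_def, coeff_basis_of_ne (of_mul_ne_one _ _), coeff_ySum_of_mul_of_mul]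
    rw [coeff_raise_of_mul, h, raise_one, coeff_ySum_of_mul_of_mul, coeff_ySum_of_mul_of_mul,
      mul_zero, mul_zero, coeff_zero, add_zero]

theorem raise_yl_one (g : G) : raise K G (yl K (1, g)) = 0 := by
  classical
  ext w
  induction w using FreeMonoid.inductionOn' with
  | one => rfl
  | of_mul b w _ =>
    have h := lderiv_basis_of_mul (K := K) b (1, g) 1
    rw [mul_one] at h
    rw [coeff_raise_of_mul, h, coeff_basis_of_ne]
    · split_ifs
      · rw [← one_def, raise_one, mul_zero, zero_add]; rfl
      · rw [map_zero, mul_zero, zero_add]; rfl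
    · rw [← mul_one (FreeMonoid.of (1, g)), Ne, of_mul_inj, Prod.mk.injEq]
      rintro ⟨⟨h, -⟩, -⟩
      have := congrArg PNat.val h
      simp at this

theorem raise_yl_succ (n : ℕ+) (g : G) :
    raise K G (yl K (n + 1, g)) = ((n : ℕ) : K) • yl K (n, g) := by
  classical
  ext w
  induction w using FreeMonoid.inductionOn' with
  | one => rw [coeff_raise_one, coeff_smul, coeff_basis_of_ne (FreeMonoid.of_ne_one _).symm,
      mul_zero]
  | of_mul b w _ =>
    have h := lderiv_basis_of_mul (K := K) b (n + 1, g) 1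
    rw [mul_one] at h
    have h0 : (raise K G (lderiv K b (yl K (n + 1, g)))).coeff w = 0 := by
      rw [h]
      split_ifs
      · rw [← one_def, raise_one]; rfl
      · rw [map_zero]; rfl
    rw [coeff_raise_of_mul, h0, add_zero, coeff_smul]
    by_cases hb : b = (n, g) ∧ w = 1
    · rw [hb.1, hb.2, mul_one, mul_one, coeff_basis_self, coeff_basis_self]
    · rw [coeff_basis_of_ne, coeff_basis_of_ne, mul_zero, mul_zero]
      · rw [← mul_one (FreeMonoid.of (n, g)), Ne, of_mul_inj]
        exact hb
      · rw [← mul_one (FreeMonoid.of (n + 1, g)), Ne, of_mul_inj, Prod.mk.injEq]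
        rintro ⟨⟨h1, h2⟩, h3⟩
        exact hb ⟨Prod.ext (add_right_cancel h1) h2, h3⟩

variable [CommGroup G] [Fintype G]

theorem deltaAlg_yl (a : ℕ+ × G) : deltaAlg K (yl K a) =
    basis K (FreeMonoid.of a, 1) + basis K (1, FreeMonoid.of a) +
      ∑ k ∈ Finset.Ico 1 a.1, ∑ h : G,
        basis K (FreeMonoid.of (k, h), FreeMonoid.of (a.1 - k, a.2 * h⁻¹)) := by
  rw [deltaAlg, locFin_deltaAlg.lsum_basis, FreeMonoid.lift_eval_of]
  rfl

/-- With `Z = 1 + ∑ y_{n,g}`, the defining formula says that the coproduct of `y_{n,g}` is the part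
of `Z ⊗ Z` of weight `n` and `G`-degree `g`. All later computations with the harmonic coproduct use
this form. -/
theorem coeff_deltaAlg_yl_aux (a : ℕ+ × G) (u w : YWord G) (P : Prop) [Decidable P]
    (hP : P ↔ deg u + deg w = a.1 ∧ gdeg G u * gdeg G w = a.2) :
    (deltaAlg K (yl K a)).coeff (u, w) =
      if P then (ySum K G).coeff u * (ySum K G).coeff w else 0 := by
  classical
  have hpos := a.1.pos
  rw [deltaAlg_yl, coeff_add, coeff_add, coeff_sum]
  simp only [coeff_sum, coeff_basis, Prod.mk.injEq]
  rcases word_cases u with rfl | ⟨b, rfl⟩ | ⟨b, b', u, rfl⟩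
  · rw [deg_one, zero_add, map_one, one_mul] at hP
    rw [coeff_ySum_one, one_mul, if_neg fun h => (FreeMonoid.of_ne_one _).symm h.1, zero_add,
      Finset.sum_eq_zero fun k _ => Finset.sum_eq_zero fun h _ =>
        if_neg fun h => (FreeMonoid.of_ne_one _).symm h.1, add_zero]
    rcases word_cases w with rfl | ⟨c, rfl⟩ | ⟨c, c', w, rfl⟩
    · rw [deg_one] at hP
      rw [if_neg fun h => (FreeMonoid.of_ne_one a).symm h.2, if_neg fun h => by
        have := (hP.1 h).1; omega]
    · rw [deg_of_Y, gdeg_of] at hP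
      rw [coeff_ySum_of]
      refine if_congr (Iff.trans ?_ hP.symm) rfl rfl
      rw [← mul_one (FreeMonoid.of c), ← mul_one (FreeMonoid.of a), of_mul_inj, Prod.ext_iff,
        ← PNat.coe_inj]
      simp
    · rw [coeff_ySum_of_mul_of_mul, ite_self, if_neg fun h => of_ne_of_mul _ _ _ _ h.2]
  · rw [deg_of_Y, gdeg_of] at hP
    rw [if_neg (c := FreeMonoid.of b = 1 ∧ w = FreeMonoid.of a)
      fun h => FreeMonoid.of_ne_one _ h.1, add_zero, coeff_ySum_of, one_mul]
    rcases word_cases w with rfl | ⟨c, rfl⟩ | ⟨c, c', w, rfl⟩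
    · rw [deg_one, map_one, mul_one, add_zero] at hP
      rw [Finset.sum_eq_zero fun k _ => Finset.sum_eq_zero fun h _ =>
        if_neg fun h => (FreeMonoid.of_ne_one _).symm h.2, add_zero, coeff_ySum_one]
      refine if_congr (Iff.trans ?_ hP.symm) rfl rfl
      rw [← mul_one (FreeMonoid.of b), ← mul_one (FreeMonoid.of a), of_mul_inj, Prod.ext_iff,
        ← PNat.coe_inj]
      simp
    · rw [deg_of_Y, gdeg_of] at hP
      rw [if_neg fun h => FreeMonoid.of_ne_one _ h.2, zero_add, coeff_ySum_of]
      split_ifs with h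
      · have h := hP.1 h
        have h1 : b.1 + c.1 = a.1 := PNat.coe_inj.1 (by rw [PNat.add_coe]; exact h.1)
        have h2 : a.1 - b.1 = c.1 := by rw [← h1, add_comm]; exact PNat.add_sub
        have hlt : b.1 < a.1 := by rw [← h1]; exact PNat.lt_add_right _ _
        rw [Finset.sum_eq_single b.1, Finset.sum_eq_single b.2]
        · refine if_pos ⟨rfl, ?_⟩
          rw [h2, ← h.2, mul_inv_cancel_comm]
        · intro g _ hg
          refine if_neg fun h' => hg ?_
          exact (congrArg Prod.snd (FreeMonoid.of_injective h'.1)).symm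
        · exact fun h => absurd (Finset.mem_univ _) h
        · intro k _ hk
          refine Finset.sum_eq_zero fun g _ => if_neg fun h' => hk ?_
          exact (congrArg Prod.fst (FreeMonoid.of_injective h'.1)).symm
        · exact fun h' => absurd (Finset.mem_Ico.2 ⟨one_le, hlt⟩) h'
      · refine Finset.sum_eq_zero fun k hk => Finset.sum_eq_zero fun g _ =>
          if_neg fun h' => h (hP.2 ?_)
        have h3 := FreeMonoid.of_injective h'.1
        have h4 := FreeMonoid.of_injective h'.2
        rw [h3, h4]
        refine ⟨?_, ?_⟩
        · have := PNat.add_sub_of_lt (Finset.mem_Ico.1 hk).2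
          rw [← PNat.add_coe, this]
        · exact mul_mul_inv_cancel'_right _ _
    · rw [if_neg fun h => of_mul_ne_one _ _ h.2, zero_add, coeff_ySum_of_mul_of_mul, ite_self]
      exact Finset.sum_eq_zero fun k _ => Finset.sum_eq_zero fun g _ =>
        if_neg fun h => of_ne_of_mul _ _ _ _ h.2
  · rw [coeff_ySum_of_mul_of_mul, zero_mul, ite_self, if_neg fun h => of_ne_of_mul _ _ _ _ h.1,
      if_neg fun h => of_mul_ne_one _ _ h.1, zero_add, zero_add]
    exact Finset.sum_eq_zero fun k _ => Finset.sum_eq_zero fun g _ =>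
      if_neg fun h => of_ne_of_mul _ _ _ _ h.1

theorem coeff_deltaAlg_yl (a : ℕ+ × G) (u w : YWord G)
    [Decidable (deg u + deg w = a.1 ∧ gdeg G u * gdeg G w = a.2)] :
    (deltaAlg K (yl K a)).coeff (u, w) =
      if deg u + deg w = a.1 ∧ gdeg G u * gdeg G w = a.2 then
        (ySum K G).coeff u * (ySum K G).coeff w else 0 :=
  coeff_deltaAlg_yl_aux a u w _ Iff.rfl

theorem deltaAlg_basis_support (w : YWord G) (p : YWord G × YWord G)
    (h : (deltaAlg K (basis K w)).coeff p ≠ 0) :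
    deg p.1 + deg p.2 = deg w ∧ gdeg G p.1 * gdeg G p.2 = gdeg G w := by
  classical
  induction w using FreeMonoid.inductionOn' generalizing p with
  | one =>
    rw [← one_def, isHom_deltaAlg.map_one, one_def] at h
    have : p = 1 := by
      by_contra hp
      exact h (coeff_basis_of_ne hp)
    rw [this]
    simp [deg_one]
  | of_mul a w ih =>
    rw [← basis_mul_basis, isHom_deltaAlg.map_mul, coeff_mul] at h
    obtain ⟨⟨c, d⟩, hcd, h⟩ := Finset.exists_ne_zero_of_sum_ne_zero h
    rw [Finset.HasMulAntidiagonal.mem_mulAntidiagonal] at hcd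
    have h2 := ih d (right_ne_zero_of_mul h)
    have h1 := left_ne_zero_of_mul h
    obtain ⟨c1, c2⟩ := c
    rw [coeff_deltaAlg_yl] at h1
    have h3 := (ite_ne_right_iff.1 h1).1
    rw [← hcd, deg_mul, deg_of_Y, map_mul, gdeg_of, ← h3.1, ← h3.2, ← h2.1, ← h2.2, Prod.fst_mul,
      Prod.snd_mul, deg_mul, deg_mul, map_mul, map_mul]
    exact ⟨by dsimp only; omega, mul_mul_mul_comm _ _ _ _⟩

theorem coeff_deltaAlg_eq_zero {f : KY K G} {u w : YWord G}
    (h : ∀ m : YWord G, deg m = deg u + deg w → gdeg G m = gdeg G u * gdeg G w → f.coeff m = 0) :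
    (deltaAlg K f).coeff (u, w) = 0 :=
  isHom_deltaAlg.cont.coeff_eq_zero_of_support fun m hm => by
    by_contra h'
    have := deltaAlg_basis_support m _ h'
    exact hm (h m this.1.symm this.2.symm)

theorem coeff_deltaAlg_congr {f g : KY K G} {u w : YWord G}
    (h : ∀ m : YWord G, deg m = deg u + deg w → gdeg G m = gdeg G u * gdeg G w →
      f.coeff m = g.coeff m) :
    (deltaAlg K f).coeff (u, w) = (deltaAlg K g).coeff (u, w) := by
  rw [← sub_eq_zero, ← coeff_sub, ← map_sub]
  exact coeff_deltaAlg_eq_zero fun m hm hm' => by rw [coeff_sub, h m hm hm', sub_self]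

theorem coeff_ySum_eq_coeff_yl {m : YWord G} {n : ℕ+} {g : G} (hm : deg m = n) (hg : gdeg G m = g) :
    (ySum K G).coeff m = (yl K (n, g)).coeff m := by
  rcases word_cases m with rfl | ⟨c, rfl⟩ | ⟨c, d, w, rfl⟩
  · rw [deg_one] at hm
    exact absurd hm.symm n.ne_zero
  · rw [deg_of_Y] at hm
    rw [gdeg_of] at hg
    have : c = (n, g) := Prod.ext (PNat.coe_inj.1 hm) hg
    rw [coeff_ySum_of, this, coeff_basis_self]
  · rw [coeff_ySum_of_mul_of_mul, coeff_basis_of_ne (of_ne_of_mul _ _ _ _)]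

/-- The coproduct preserves weight and `G`-degree, so this is the sum over all bidegrees of the
formula for letters. -/
theorem deltaAlg_ySum : deltaAlg K (ySum K G) = tmul (ySum K G) (ySum K G) := by
  classical
  ext ⟨u, w⟩
  rw [coeff_tmul]
  rcases Nat.eq_zero_or_pos (deg u + deg w) with h0 | h0
  · have hu := eq_one_of_deg_Y u (by omega)
    have hw := eq_one_of_deg_Y w (by omega)
    rw [coeff_deltaAlg_congr (g := 1), isHom_deltaAlg.map_one, hu, hw, coeff_ySum_one, mul_one]
    · exact coeff_basis_self _
    · intro m hm _
      rw [eq_one_of_deg_Y m (by omega), coeff_ySum_one, one_def, coeff_basis_self]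
  · rw [coeff_deltaAlg_congr (g := yl K (⟨_, h0⟩, gdeg G u * gdeg G w)), coeff_deltaAlg_yl,
      if_pos ⟨rfl, rfl⟩]
    exact fun m hm hm' => coeff_ySum_eq_coeff_yl hm hm'

/-! ### The Euler derivation is a coderivation -/

variable (K G) in
/-- The derivation `d ⊗ 1 + 1 ⊗ d`, for the Euler derivation `d`. -/
noncomputable def eulerSq : KYY K G →ₗ[K] KYY K G :=
  mapLeft (YWord G) (euler K G) + mapRight (YWord G) (euler K G)

theorem cont_eulerSq : IsCont (eulerSq K G) := cont_euler.mapLeft.add cont_euler.mapRight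

theorem eulerSq_tmul (f g : KY K G) :
    eulerSq K G (tmul f g) = tmul (euler K G f) g + tmul f (euler K G g) := by
  rw [eulerSq, LinearMap.add_apply, mapLeft_tmul, mapRight_tmul]

theorem tmul_add_left {M N : Type*} (f f' : NCSeries K M) (g : NCSeries K N) :
    tmul (f + f') g = tmul f g + tmul f' g := (tmulL K M N).map_add₂ f f' g

theorem tmul_add_right {M N : Type*} (f : NCSeries K M) (g g' : NCSeries K N) :
    tmul f (g + g') = tmul f g + tmul f g' := (tmulL K M N f).map_add g g'

theorem eulerSq_mul (F H : KYY K G) :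
    eulerSq K G (F * H) = eulerSq K G F * H + F * eulerSq K G H := by
  have h1 : ∀ p q : YWord G × YWord G, eulerSq K G (basis K p * basis K q) =
      eulerSq K G (basis K p) * basis K q + basis K p * eulerSq K G (basis K q) := by
    rintro ⟨a, b⟩ ⟨c, d⟩
    simp only [basis_prod, tmul_mul_tmul, eulerSq_tmul, euler_mul, tmul_add_left, tmul_add_right,
      add_mul, mul_add]
    abel
  have h2 : ∀ p, eulerSq K G (basis K p * H) =
      eulerSq K G (basis K p) * H + basis K p * eulerSq K G H := fun p =>
    (cont_eulerSq.comp (IsCont.mulLeft (basis K p))).ext_apply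
      ((IsCont.mulLeft (eulerSq K G (basis K p))).add ((IsCont.mulLeft (basis K p)).comp
        cont_eulerSq)) (h1 p) H
  exact (cont_eulerSq.comp (IsCont.mulRight H)).ext_apply
      (((IsCont.mulRight H).comp cont_eulerSq).add (IsCont.mulRight (eulerSq K G H))) h2 F

theorem coeff_eulerSq (F : KYY K G) (u w : YWord G) :
    (eulerSq K G F).coeff (u, w) = (raise K G ⟨fun x => F.coeff (x, w)⟩).coeff u +
      (raise K G ⟨fun x => F.coeff (u, x)⟩).coeff w - ((deg u + deg w : ℕ) : K) * F.coeff (u, w) := by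
  rw [eulerSq, LinearMap.add_apply, coeff_add, coeff_mapLeft, coeff_mapRight, coeff_euler,
    coeff_euler, Nat.cast_add]
  ring

theorem coeff_deltaAlg_raise_yl (a : ℕ+ × G) (u w : YWord G)
    [Decidable (deg u + deg w + 1 = a.1 ∧ gdeg G u * gdeg G w = a.2)] :
    (deltaAlg K (raise K G (yl K a))).coeff (u, w) =
      if deg u + deg w + 1 = a.1 ∧ gdeg G u * gdeg G w = a.2 then
        ((deg u + deg w : ℕ) : K) * ((ySum K G).coeff u * (ySum K G).coeff w) else 0 := by
  classical
  obtain ⟨n, g⟩ := a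
  by_cases hn : n = 1
  · subst hn
    rw [raise_yl_one, map_zero, coeff_zero]
    split_ifs with h
    · have : deg u + deg w = 0 := by simpa using h.1
      rw [this, Nat.cast_zero, zero_mul]
    · rfl
  · obtain ⟨m, rfl⟩ := PNat.exists_eq_succ_of_ne_one hn
    rw [raise_yl_succ, map_smul, coeff_smul, coeff_deltaAlg_yl, mul_ite, mul_zero]
    have : deg u + deg w + 1 = ((m + 1 : ℕ+) : ℕ) ↔ deg u + deg w = (m : ℕ) := by
      rw [PNat.add_coe, PNat.one_coe]; omega
    simp only [this]
    split_ifs with h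
    · rw [h.1]
    · rfl

/-- Both sides satisfy the Leibniz rule along the coproduct, so letters suffice. There the coproduct
is a graded part of `Z ⊗ Z`, and `raise` acts on `Z` as multiplication by the weight. -/
theorem deltaAlg_euler (f : KY K G) :
    deltaAlg K (euler K G f) = eulerSq K G (deltaAlg K f) := by
  classical
  have hl : ∀ a, deltaAlg K (euler K G (yl K a)) = eulerSq K G (deltaAlg K (yl K a)) := by
    intro a
    have h0 : euler K G (yl K a) = raise K G (yl K a) - ((a.1 : ℕ) : K) • yl K a := by
      ext m
      rw [coeff_euler, coeff_sub, coeff_smul]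
      by_cases hm : m = FreeMonoid.of a
      · rw [hm, deg_of_Y]
      · rw [coeff_basis_of_ne hm, mul_zero, mul_zero]
    ext ⟨u, w⟩
    rw [h0, map_sub, map_smul, coeff_sub, coeff_smul, coeff_deltaAlg_raise_yl, coeff_deltaAlg_yl,
      coeff_eulerSq, coeff_deltaAlg_yl]
    -- On the words `x` that matter, of weight `deg u + 1` and of the `G`-degree of `u`, the slice
    -- is a constant multiple of `ySum`; hence the weight `deg u` appears as a factor.
    have hL : (raise K G ⟨fun x => (deltaAlg K (yl K a)).coeff (x, w)⟩).coeff u =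
        if deg u + deg w + 1 = a.1 ∧ gdeg G u * gdeg G w = a.2 then
          (deg u : K) * ((ySum K G).coeff u * (ySum K G).coeff w) else 0 := by
      rw [coeff_raise_congr (g := (if deg u + deg w + 1 = a.1 ∧ gdeg G u * gdeg G w = a.2 then
        (ySum K G).coeff w else 0) • ySum K G), map_smul, coeff_smul, raise_ySum]
      · split_ifs <;> ring
      · intro x hx hx'
        change (deltaAlg K (yl K a)).coeff (x, w) = _
        rw [coeff_deltaAlg_yl, coeff_smul, hx, hx', add_right_comm]
        split_ifs <;> ring
    have hR : (raise K G ⟨fun x => (deltaAlg K (yl K a)).coeff (u, x)⟩).coeff w =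
        if deg u + deg w + 1 = a.1 ∧ gdeg G u * gdeg G w = a.2 then
          (deg w : K) * ((ySum K G).coeff u * (ySum K G).coeff w) else 0 := by
      rw [coeff_raise_congr (g := (if deg u + deg w + 1 = a.1 ∧ gdeg G u * gdeg G w = a.2 then
        (ySum K G).coeff u else 0) • ySum K G), map_smul, coeff_smul, raise_ySum]
      · split_ifs <;> ring
      · intro x hx hx'
        change (deltaAlg K (yl K a)).coeff (u, x) = _
        rw [coeff_deltaAlg_yl, coeff_smul, hx, hx', add_assoc]
        split_ifs <;> ring
    rw [hL, hR]
    by_cases h1 : deg u + deg w = a.1 ∧ gdeg G u * gdeg G w = a.2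
    · rw [if_pos h1, h1.1]
      split_ifs
      · push_cast [← h1.1]; ring
      · ring
    · rw [if_neg h1]
      split_ifs
      · push_cast; ring
      · ring
  refine (isHom_deltaAlg.cont.comp cont_euler).ext_apply (cont_eulerSq.comp isHom_deltaAlg.cont)
    (fun w => ?_) f
  simp only [LinearMap.comp_apply]
  induction w using FreeMonoid.inductionOn' with
  | one =>
    have h1 : euler K G (1 : KY K G) = 0 := by
      have := euler_mul (1 : KY K G) 1
      simpa using this
    have h2 : eulerSq K G (1 : KYY K G) = 0 := by
      have := eulerSq_mul (1 : KYY K G) 1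
      simpa using this
    rw [← one_def, isHom_deltaAlg.map_one, h1, h2, map_zero]
  | of_mul a w ih =>
    rw [← basis_mul_basis, euler_mul, map_add, isHom_deltaAlg.map_mul, isHom_deltaAlg.map_mul,
      isHom_deltaAlg.map_mul, eulerSq_mul, ih, hl]

end Harmonic

/-! ### Reversal of words -/

section Reversal

variable {K : Type u} [CommRing K] {G : Type v} [CommGroup G]

/-- The word `y_{n₁,g₁} ⋯ y_{n_r,g_r}` becomes `y_{n_r,g_r⁻¹} ⋯ y_{n₁,g₁⁻¹}`. -/
def tauWord (w : YWord G) : YWord G :=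
  FreeMonoid.ofList ((FreeMonoid.toList w).map fun a => (a.1, a.2⁻¹)).reverse

theorem tauWord_one : tauWord (1 : YWord G) = 1 := rfl

theorem tauWord_of (a : ℕ+ × G) : tauWord (FreeMonoid.of a) = FreeMonoid.of (a.1, a.2⁻¹) := rfl

theorem tauWord_mul (u w : YWord G) : tauWord (u * w) = tauWord w * tauWord u := by
  simp [tauWord, FreeMonoid.toList_mul, FreeMonoid.ofList_append]

theorem tauWord_tauWord (w : YWord G) : tauWord (tauWord w) = w := by
  simp [tauWord, Function.comp_def]

theorem gdeg_tauWord (w : YWord G) : gdeg G (tauWord w) = (gdeg G w)⁻¹ := by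
  induction w using FreeMonoid.inductionOn' with
  | one => rw [tauWord_one, map_one, inv_one]
  | of_mul a w ih => rw [tauWord_mul, map_mul, map_mul, ih, tauWord_of, gdeg_of, gdeg_of, mul_inv,
      mul_comm]

theorem deg_tauWord [Finite G] (w : YWord G) : deg (tauWord w) = deg w := by
  induction w using FreeMonoid.inductionOn' with
  | one => rfl
  | of_mul a w ih => rw [tauWord_mul, deg_mul, deg_mul, ih, tauWord_of, deg_of_Y, deg_of_Y,
      add_comm]

variable (K G) in
/-- The continuous anti-automorphism of `K⟨⟨Y⟩⟩` with `y_{n,g} ↦ y_{n,g⁻¹}`. -/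
def tau : KY K G →ₗ[K] KY K G := NCSeries.reindex tauWord

theorem coeff_tau (f : KY K G) (w : YWord G) : (tau K G f).coeff w = f.coeff (tauWord w) := rfl

theorem cont_tau : IsCont (tau K G) := IsCont.reindex _

theorem tau_basis (w : YWord G) : tau K G (basis K w) = basis K (tauWord w) := by
  ext m
  rw [coeff_tau]
  by_cases h : m = tauWord w
  · rw [h, tauWord_tauWord, coeff_basis_self, coeff_basis_self]
  · rw [coeff_basis_of_ne h, coeff_basis_of_ne fun h' => h (by rw [← h', tauWord_tauWord])]

theorem IsCont.map_mul_rev {M : Type*} {N : Type*} [Monoid M] [Monoid N]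
    [Finset.HasMulAntidiagonal M] [Finset.HasMulAntidiagonal N]
    {T : NCSeries K M →ₗ[K] NCSeries K N} (hT : IsCont T)
    (h : ∀ a b, T (basis K (a * b)) = T (basis K b) * T (basis K a)) (f g : NCSeries K M) :
    T (f * g) = T g * T f := by
  have h1 : ∀ a, T (basis K a * g) = T g * T (basis K a) := fun a =>
    (hT.comp (IsCont.mulLeft (basis K a))).ext_apply ((IsCont.mulRight (T (basis K a))).comp hT)
      (fun b => by simp [basis_mul_basis, h]) g
  exact (hT.comp (IsCont.mulRight g)).ext_apply ((IsCont.mulLeft (T g)).comp hT) h1 f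

theorem tau_mul (f g : KY K G) : tau K G (f * g) = tau K G g * tau K G f :=
  IsCont.map_mul_rev cont_tau (fun a b => by
    rw [tau_basis, tau_basis, tau_basis, basis_mul_basis, tauWord_mul]) f g

theorem tau_one : tau K G 1 = 1 := by rw [one_def, tau_basis, tauWord_one]

theorem tensorSq_tau_mul (F H : KYY K G) :
    tensorSq (tau K G) (F * H) = tensorSq (tau K G) H * tensorSq (tau K G) F :=
  IsCont.map_mul_rev cont_tau.tensorSq (fun ⟨a, b⟩ ⟨c, d⟩ => by
    rw [Prod.mk_mul_mk, tensorSq_basis, tensorSq_basis, tensorSq_basis, tmul_mul_tmul,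
      ← tau_mul, ← tau_mul, basis_mul_basis, basis_mul_basis]) F H

theorem coeff_raise_tau (f : KY K G) (w : YWord G) :
    (raise K G (tau K G f)).coeff w = (raise K G f).coeff (tauWord w) := by
  induction w using FreeMonoid.inductionOn' generalizing f with
  | one => rfl
  | of_mul a w ih =>
    have h : lderiv K a (tau K G f) =
        tau K G (NCSeries.reindex (· * FreeMonoid.of (a.1, a.2⁻¹)) f) := by
      ext m
      rw [coeff_lderiv, coeff_tau, coeff_tau, coeff_reindex, tauWord_mul, tauWord_of]
    rw [coeff_raise_of_mul, h, ih, tauWord_mul, tauWord_of, coeff_raise_mul_right, coeff_raise_of,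
      coeff_tau, coeff_reindex, tauWord_mul, tauWord_of, add_comm]

theorem euler_tau [Finite G] (f : KY K G) : euler K G (tau K G f) = tau K G (euler K G f) := by
  ext w
  rw [coeff_euler, coeff_raise_tau, coeff_tau, coeff_tau, coeff_euler, deg_tauWord]

theorem tau_ySum : tau K G (ySum K G) = ySum K G := by
  ext w
  rw [coeff_tau, coeff_ySum, coeff_ySum]
  simp [tauWord, FreeMonoid.length]
  rfl

variable [Fintype G]

/-- Both sides reverse products, so letters suffice. There `Z` is invariant under reversal, and the
condition on `G`-degrees is invariant under inversion because `G` is abelian; the tensor factors are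
not exchanged. -/
theorem deltaAlg_tau (f : KY K G) :
    deltaAlg K (tau K G f) = tensorSq (tau K G) (deltaAlg K f) := by
  classical
  refine (isHom_deltaAlg.cont.comp cont_tau).ext_apply (cont_tau.tensorSq.comp isHom_deltaAlg.cont)
    (fun w => ?_) f
  simp only [LinearMap.comp_apply]
  induction w using FreeMonoid.inductionOn' with
  | one =>
    rw [← one_def, isHom_deltaAlg.map_one, tau_one, isHom_deltaAlg.map_one, ← tmul_one_one,
      tensorSq_tmul, tau_one]
  | of_mul a w ih =>
    rw [← basis_mul_basis, tau_mul, isHom_deltaAlg.map_mul, isHom_deltaAlg.map_mul,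
      tensorSq_tau_mul, ih]
    congr 1
    ext ⟨u, w⟩
    rw [tau_basis, tauWord_of, coeff_deltaAlg_yl]
    change _ = (deltaAlg K (yl K a)).coeff (tauWord u, tauWord w)
    rw [coeff_deltaAlg_yl]
    have hz : ∀ u, (ySum K G).coeff (tauWord u) = (ySum K G).coeff u := fun u => by
      rw [← coeff_tau, tau_ySum]
    rw [hz, hz]
    refine if_congr ?_ rfl rfl
    rw [deg_tauWord, deg_tauWord, gdeg_tauWord, gdeg_tauWord, ← mul_inv, inv_eq_iff_eq_inv]

end Reversal

/-! ### Families of series -/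

section Families

variable {K : Type u} [CommRing K] {G : Type v} [CommGroup G]

/-- A power series `F` over `K⟨⟨Y⟩⟩` is flat if it is annihilated by the sum of the Euler
derivation of `K⟨⟨Y⟩⟩` and of that of the power series. -/
def IsFlat [Finite G] (F : PowerSeries (KY K G)) : Prop :=
  ∀ j, euler K G (PowerSeries.coeff j F) + (j : K) • PowerSeries.coeff j F = 0

theorem IsFlat.mul [Finite G] {F H : PowerSeries (KY K G)} (hF : IsFlat F) (hH : IsFlat H) :
    IsFlat (F * H) := fun j => by
  rw [PowerSeries.coeff_mul, map_sum, Finset.smul_sum, ← Finset.sum_add_distrib]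
  refine Finset.sum_eq_zero fun p hp => ?_
  rw [Finset.HasAntidiagonal.mem_antidiagonal] at hp
  have h1 := congrArg (· * PowerSeries.coeff p.2 H) (hF p.1)
  have h2 := congrArg (PowerSeries.coeff p.1 F * ·) (hH p.2)
  simp only [add_mul, mul_add, zero_mul, mul_zero, smul_mul_assoc, mul_smul_comm] at h1 h2
  rw [euler_mul, ← hp, Nat.cast_add, add_smul]
  rw [add_add_add_comm, h1, h2, add_zero]

theorem IsFlat.coeff_eq [Finite G] {F : PowerSeries (KY K G)} (hF : IsFlat F) (j : ℕ)
    (w : YWord G) : (raise K G (PowerSeries.coeff j F)).coeff w =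
      ((deg w : K) - j) * (PowerSeries.coeff j F).coeff w := by
  have := congrArg (fun f => f.coeff w) (hF j)
  simp only [coeff_add, coeff_euler, coeff_smul, coeff_zero] at this
  linear_combination this

theorem isFlat_C_ySum [Finite G] : IsFlat (PowerSeries.C (ySum K G)) := fun j => by
  rw [PowerSeries.coeff_C]
  split_ifs with h
  · ext w
    rw [h, Nat.cast_zero, zero_smul, add_zero, coeff_euler, raise_ySum, sub_self]
    rfl
  · rw [map_zero, smul_zero, add_zero]

/-- The anti-automorphism of the power series over `K⟨⟨Y⟩⟩` that extends `τ` and changes the sign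
of the variable. -/
noncomputable def sigma (F : PowerSeries (KY K G)) : PowerSeries (KY K G) :=
  PowerSeries.mk fun j => (-1 : K) ^ j • tau K G (PowerSeries.coeff j F)

theorem coeff_sigma (F : PowerSeries (KY K G)) (j : ℕ) :
    PowerSeries.coeff j (sigma F) = (-1 : K) ^ j • tau K G (PowerSeries.coeff j F) :=
  PowerSeries.coeff_mk _ _

theorem sigma_mul (F H : PowerSeries (KY K G)) : sigma (F * H) = sigma H * sigma F := by
  ext j : 1
  rw [coeff_sigma, PowerSeries.coeff_mul, PowerSeries.coeff_mul, map_sum, Finset.smul_sum,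
    ← Finset.Nat.sum_antidiagonal_swap]
  refine Finset.sum_congr rfl fun p hp => ?_
  rw [Finset.HasAntidiagonal.mem_antidiagonal] at hp
  rw [coeff_sigma, coeff_sigma, smul_mul_smul_comm, ← pow_add, hp, tau_mul]
  rfl

theorem IsFlat.sigma [Finite G] {F : PowerSeries (KY K G)} (hF : IsFlat F) :
    IsFlat (sigma F) := fun j => by
  rw [coeff_sigma, map_smul, euler_tau, smul_comm (j : K), ← smul_add, ← map_smul, ← map_add, hF,
    map_zero, smul_zero]

variable [Fintype G]

/-- A power series over `K⟨⟨Y⟩⟩` is group-like for the harmonic coproduct. -/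
def IsGroupLike (F : PowerSeries (KY K G)) : Prop :=
  ∀ j, deltaAlg K (PowerSeries.coeff j F) = ∑ p ∈ Finset.HasAntidiagonal.antidiagonal j,
    tmul (PowerSeries.coeff p.1 F) (PowerSeries.coeff p.2 F)

variable (K G) in
/-- The embedding `f ↦ f ⊗ 1`. -/
noncomputable def inclLeft : KY K G →+* KYY K G where
  toFun f := tmul f 1
  map_one' := tmul_one_one
  map_mul' f g := by rw [tmul_mul_tmul, one_mul]
  map_zero' := (tmulL K (YWord G) (YWord G)).map_zero₂ 1
  map_add' f g := tmul_add_left f g 1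

variable (K G) in
/-- The embedding `f ↦ 1 ⊗ f`. -/
noncomputable def inclRight : KY K G →+* KYY K G where
  toFun f := tmul 1 f
  map_one' := tmul_one_one
  map_mul' f g := by rw [tmul_mul_tmul, one_mul]
  map_zero' := (tmulL K (YWord G) (YWord G) 1).map_zero
  map_add' f g := tmul_add_right 1 f g

theorem inclLeft_mul_inclRight (f g : KY K G) : inclLeft K G f * inclRight K G g = tmul f g := by
  change tmul f 1 * tmul 1 g = _
  rw [tmul_mul_tmul, one_mul, mul_one]

theorem inclRight_mul_inclLeft (f g : KY K G) : inclRight K G g * inclLeft K G f = tmul f g := by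
  change tmul 1 g * tmul f 1 = _
  rw [tmul_mul_tmul, one_mul, mul_one]

/-- In this form group-likeness is an identity between images under ring homomorphisms, so its
multiplicativity reduces to the commutation of `F ⊗ 1` with `1 ⊗ H`. -/
theorem isGroupLike_iff (F : PowerSeries (KY K G)) :
    IsGroupLike F ↔ PowerSeries.map isHom_deltaAlg.toRingHom F =
      PowerSeries.map (inclLeft K G) F * PowerSeries.map (inclRight K G) F := by
  rw [PowerSeries.ext_iff]
  refine forall_congr' fun j => ?_
  rw [PowerSeries.coeff_mul, PowerSeries.coeff_map]
  simp only [PowerSeries.coeff_map, inclLeft_mul_inclRight]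
  rfl

theorem map_incl_comm (F H : PowerSeries (KY K G)) :
    PowerSeries.map (inclRight K G) H * PowerSeries.map (inclLeft K G) F =
      PowerSeries.map (inclLeft K G) F * PowerSeries.map (inclRight K G) H := by
  ext j : 1
  rw [PowerSeries.coeff_mul, PowerSeries.coeff_mul, ← Finset.Nat.sum_antidiagonal_swap]
  refine Finset.sum_congr rfl fun p _ => ?_
  simp only [PowerSeries.coeff_map, Prod.fst_swap, Prod.snd_swap]
  rw [inclRight_mul_inclLeft, inclLeft_mul_inclRight]

theorem IsGroupLike.mul {F H : PowerSeries (KY K G)} (hF : IsGroupLike F) (hH : IsGroupLike H) :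
    IsGroupLike (F * H) := by
  rw [isGroupLike_iff] at hF hH ⊢
  rw [map_mul, map_mul, map_mul, hF, hH, mul_assoc, mul_assoc, ← mul_assoc _ _
    (PowerSeries.map (inclRight K G) H), map_incl_comm, mul_assoc]

theorem isGroupLike_C_ySum : IsGroupLike (PowerSeries.C (ySum K G)) := by
  rw [isGroupLike_iff, PowerSeries.map_C, PowerSeries.map_C, PowerSeries.map_C, ← map_mul,
    inclLeft_mul_inclRight]
  exact congrArg _ deltaAlg_ySum

theorem IsGroupLike.sigma {F : PowerSeries (KY K G)} (hF : IsGroupLike F) :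
    IsGroupLike (sigma F) := fun j => by
  rw [coeff_sigma, map_smul, deltaAlg_tau, hF, map_sum, Finset.smul_sum]
  refine Finset.sum_congr rfl fun p hp => ?_
  rw [Finset.HasAntidiagonal.mem_antidiagonal] at hp
  rw [coeff_sigma, coeff_sigma, tensorSq_tmul, ← hp, pow_add]
  ext q
  simp only [coeff_smul, coeff_tmul]
  ring

end Families

/-! ### The derivation of `K⟨⟨X⟩⟩` dual to the insertion of `x₀` -/

section Insertion

variable {K : Type u} [CommRing K] {G : Type v}

theorem lderiv_basis_mul {A : Type*} [DecidableEq A] (a b : A) (f : NCSeries K (FreeMonoid A)) :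
    lderiv K a (basis K (FreeMonoid.of b) * f) = if a = b then f else 0 := by
  have h := lderiv_basis_of_mul (K := K) a b 1
  rw [mul_one] at h
  rw [lderiv_mul, h, coeff_basis_of_ne (FreeMonoid.of_ne_one b).symm, zero_smul, add_zero,
    ite_mul, ← one_def, one_mul, zero_mul]

/-- The part of a series in `K⟨⟨M × N⟩⟩` with first component `p`. -/
def slice {M N : Type*} (p : M) : NCSeries K (M × N) →ₗ[K] NCSeries K N :=
  NCSeries.reindex fun n => (p, n)

theorem cont_slice {M N : Type*} (p : M) :
    IsCont (slice p : NCSeries K (M × N) →ₗ[K] NCSeries K N) := IsCont.reindex _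

theorem slice_tmul {M N : Type*} (p : M) (f : NCSeries K M) (g : NCSeries K N) :
    slice p (tmul f g) = f.coeff p • g := rfl

theorem slice_one_tmul_mul {M N : Type*} [Monoid M] [Monoid N] [Finset.HasMulAntidiagonal M]
    [Finset.HasMulAntidiagonal N] (p : M) (g : NCSeries K N) (F : NCSeries K (M × N)) :
    slice p (tmul 1 g * F) = g * slice p F := by
  refine ((cont_slice p).comp (IsCont.mulLeft _)).ext_apply ((IsCont.mulLeft g).comp (cont_slice p))
    (fun m => ?_) F
  obtain ⟨a, b⟩ := m
  simp only [LinearMap.comp_apply, LinearMap.mulLeft_apply]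
  rw [basis_prod, tmul_mul_tmul, one_mul, slice_tmul, slice_tmul, mul_smul_comm]

theorem slice_one_tmul_one_mul (a : Option G) (F : KXX K G) :
    slice 1 (tmul (xl K a) 1 * F) = 0 := by
  refine ((cont_slice 1).comp (IsCont.mulLeft _)).ext_apply IsCont.zero (fun m => ?_) F
  obtain ⟨b, c⟩ := m
  simp only [LinearMap.comp_apply, LinearMap.mulLeft_apply]
  rw [basis_prod, tmul_mul_tmul, slice_tmul, basis_mul_basis,
    coeff_basis_of_ne (of_mul_ne_one a b).symm, zero_smul]
  rfl

theorem slice_w0_tmul_one_mul [DecidableEq G] (a : Option G) (F : KXX K G) :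
    slice w0 (tmul (xl K a) 1 * F) = if none = a then slice 1 F else 0 := by
  refine ((cont_slice w0).comp (IsCont.mulLeft (tmul (xl K a) 1))).ext_apply
    (U := if none = a then slice 1 else 0) ?_ (fun m => ?_) F |>.trans ?_
  · split_ifs
    · exact cont_slice 1
    · exact IsCont.zero
  · obtain ⟨b, c⟩ := m
    simp only [LinearMap.comp_apply, LinearMap.mulLeft_apply]
    rw [basis_prod, tmul_mul_tmul, slice_tmul, basis_mul_basis, one_mul]
    have h : (basis K (FreeMonoid.of a * b)).coeff w0 =
        (lderiv K none (basis K (FreeMonoid.of a * b))).coeff 1 := rfl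
    rw [h, lderiv_basis_of_mul]
    split_ifs
    · rw [slice_tmul]
    · rw [coeff_zero, zero_smul]; rfl
  · split_ifs <;> rfl

variable [CommGroup G] [Finite G]

theorem slice_one_coprod (f : KX K G) : slice 1 (coprod K f) = f := by
  refine ((cont_slice 1).comp isHom_coprod.cont).ext_apply IsCont.id (fun w => ?_) f
  simp only [LinearMap.comp_apply, LinearMap.id_apply]
  induction w using FreeMonoid.inductionOn' with
  | one =>
    rw [← one_def, isHom_coprod.map_one, ← tmul_one_one, slice_tmul, one_def, coeff_basis_self,
      one_smul]
  | of_mul a w ih =>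
    rw [← basis_mul_basis, isHom_coprod.map_mul, coprod_xl, add_mul, map_add,
      slice_one_tmul_one_mul, zero_add, slice_one_tmul_mul, ih]

variable (K G) in
/-- The continuous derivation of `K⟨⟨X⟩⟩` with `x₀ ↦ 1` and `x_g ↦ 0`. -/
noncomputable def dX0 : KX K G →ₗ[K] KX K G := slice w0 ∘ₗ coprod K

theorem cont_dX0 : IsCont (dX0 K G) := (cont_slice w0).comp isHom_coprod.cont

/-- In the part of `Δ(x_a)Δ(f)` with first component `x₀`, the term `x_a ⊗ 1` contributes only for
`a = x₀`, followed by the part of `Δ(f)` over the empty word, which is `f`. -/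
theorem dX0_xl_mul [DecidableEq G] (a : Option G) (f : KX K G) :
    dX0 K G (xl K a * f) = (if none = a then f else 0) + xl K a * dX0 K G f := by
  rw [dX0, LinearMap.comp_apply, isHom_coprod.map_mul, coprod_xl, add_mul, map_add,
    slice_w0_tmul_one_mul, slice_one_tmul_mul, slice_one_coprod]
  rfl

theorem dX0_one : dX0 K G 1 = 0 := by
  rw [dX0, LinearMap.comp_apply, isHom_coprod.map_one, ← tmul_one_one, slice_tmul, one_def,
    w0, coeff_basis_of_ne (FreeMonoid.of_ne_one _), zero_smul]

/-- For a group-like series the part over `x₀` is `(Ψ|x₀)Ψ`; this is where the vanishing of `(Ψ|x₀)`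
enters. -/
theorem dX0_ser (Ψ : GroupLike K G) (h : Ψ.ser.coeff w0 = 0) : dX0 K G Ψ.ser = 0 := by
  rw [dX0, LinearMap.comp_apply, Ψ.coprod_ser, slice_tmul, h, zero_smul]

theorem dX0_xg_mul (g : G) (f : KX K G) : dX0 K G (xg K g * f) = xg K g * dX0 K G f := by
  classical
  rw [xg_eq, dX0_xl_mul, if_neg (Option.some_ne_none g).symm, zero_add]

theorem lderiv_dX0 (a : Option G) (f : KX K G) : lderiv K a (dX0 K G f) =
    lderiv K a (lderiv K none f) + dX0 K G (lderiv K a f) := by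
  classical
  refine ((cont_lderiv a).comp cont_dX0).ext_apply (((cont_lderiv a).comp (cont_lderiv none)).add
    (cont_dX0.comp (cont_lderiv a))) (fun w => ?_) f
  simp only [LinearMap.comp_apply, LinearMap.add_apply]
  induction w using FreeMonoid.inductionOn' with
  | one => simp only [← one_def, dX0_one, lderiv_basis_one, map_zero, add_zero]
  | of_mul b w _ =>
    rw [← basis_mul_basis, dX0_xl_mul, map_add, lderiv_basis_mul, lderiv_basis_mul,
      lderiv_basis_mul]
    congr 1
    split_ifs
    · rfl
    · rw [map_zero]

theorem coeff_dX0_of_mul (f : KX K G) (a : Option G) (w : XWord G) :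
    (dX0 K G f).coeff (FreeMonoid.of a * w) = f.coeff (w0 * (FreeMonoid.of a * w)) +
      (dX0 K G (lderiv K a f)).coeff w :=
  congrArg (fun f => f.coeff w) (lderiv_dX0 a f)

theorem coeff_dX0_w0_pow (f : KX K G) (k : ℕ) :
    (dX0 K G f).coeff (w0 ^ k) = (k + 1) * f.coeff (w0 ^ (k + 1)) := by
  induction k generalizing f with
  | zero =>
    have h2 : ∀ f : KX K G, (dX0 K G f).coeff 1 = (lderiv K none f).coeff 1 := fun f => by
      rw [← sub_eq_zero]
      have : ((dX0 K G - lderiv K (none : Option G) : KX K G →ₗ[K] KX K G) f).coeff 1 = 0 := by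
        classical
        refine (cont_dX0.sub (cont_lderiv none)).coeff_eq_zero (fun w => ?_) f
        induction w using FreeMonoid.inductionOn' with
        | one => rw [← one_def, LinearMap.sub_apply, dX0_one, lderiv_basis_one, sub_zero]; rfl
        | of_mul b w _ =>
          rw [← basis_mul_basis, LinearMap.sub_apply, dX0_xl_mul, lderiv_basis_mul,
            add_sub_cancel_left, coeff_one_mul eq_one_of_deg_X,
            coeff_basis_of_ne (FreeMonoid.of_ne_one b).symm, zero_mul]
      rwa [LinearMap.sub_apply, coeff_sub] at this
    rw [pow_zero, h2, Nat.cast_zero, zero_add, one_mul, zero_add, pow_one, coeff_lderiv, mul_one]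
    rfl
  | succ k ih =>
    rw [pow_succ', w0, coeff_dX0_of_mul, ← w0, ih, coeff_lderiv, ← w0, ← pow_succ', ← pow_succ']
    push_cast
    ring

/-- A new `x₀` has `n + 1` places in the block before `x_g`; all other insertions take place after
`x_g`. -/
theorem coeff_dX0_block (f : KX K G) (n : ℕ) (g : G) (w : XWord G) :
    (dX0 K G f).coeff (w0 ^ n * (wg g * w)) = (n + 1) * f.coeff (w0 ^ (n + 1) * (wg g * w)) +
      (dX0 K G (NCSeries.reindex (fun w => w0 ^ n * (wg g * w)) f)).coeff w := by
  induction n generalizing f with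
  | zero =>
    simp only [pow_zero, one_mul, zero_add, pow_one, Nat.cast_zero]
    rw [wg, coeff_dX0_of_mul]
    rfl
  | succ n ih =>
    rw [pow_succ', mul_assoc, w0, coeff_dX0_of_mul, ← w0, ih, coeff_lderiv, ← w0, pow_succ' w0 n,
      pow_succ' _ (n + 1), pow_succ']
    simp only [mul_assoc]
    have : NCSeries.reindex (fun w => w0 ^ n * (wg g * w)) (lderiv K none f) =
        NCSeries.reindex (fun w => w0 * (w0 ^ n * (wg g * w))) f := rfl
    rw [this]
    push_cast
    ring

/-- The block of `y_{n,g}` has `n - 1` letters `x₀`, hence `n` places for one more, which produces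
`y_{n+1,g}`: this is `raise`. The tail `x₀ᵏ` has `k + 1` places. -/
theorem coeff_dX0_xyWord (f : KX K G) (p : G) (u : YWord G) (k : ℕ) :
    (dX0 K G f).coeff (xyWord p u * w0 ^ k) =
      (raise K G (NCSeries.reindex (fun u => xyWord p u * w0 ^ k) f)).coeff u +
        (k + 1) * f.coeff (xyWord p u * w0 ^ (k + 1)) := by
  induction u using FreeMonoid.inductionOn' generalizing p f with
  | one => rw [coeff_raise_one, zero_add, xyWord_one, one_mul, one_mul, coeff_dX0_w0_pow]
  | of_mul a u ih =>
    have hp : ((a.1 : ℕ) - 1 : ℕ) + 1 = (a.1 : ℕ) := Nat.sub_add_cancel a.1.pos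
    rw [coeff_raise_of_mul, xyWord_of_mul, mul_assoc, mul_assoc, mul_assoc, mul_assoc,
      coeff_dX0_block, ih, ← Nat.cast_add_one, hp, coeff_reindex, coeff_reindex,
      xyWord_of_mul, PNat.add_coe, PNat.one_coe, Nat.add_sub_cancel, mul_assoc, mul_assoc]
    have : NCSeries.reindex (fun u => xyWord (p * a.2) u * w0 ^ k)
        (NCSeries.reindex (fun w => w0 ^ ((a.1 : ℕ) - 1) * (wg (p * a.2) * w)) f) =
        lderiv K a (NCSeries.reindex (fun u => xyWord p u * w0 ^ k) f) := by
      ext w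
      simp only [coeff_reindex, coeff_lderiv, xyWord_of_mul, mul_assoc]
    rw [this]
    ring

/-! ### The family of series attached to an element of `K⟨⟨X⟩⟩` -/

/-- The component of degree `j` of a series in `K⟨⟨X⟩⟩`, as a series in `K⟨⟨Y⟩⟩`: the word
`xyWord 1 u * x₀ᵏ` becomes `u`. -/
noncomputable def homY (j : ℕ) : KX K G →ₗ[K] KY K G where
  toFun f := ⟨fun u => if deg u ≤ j then f.coeff (xyWord 1 u * w0 ^ (j - deg u)) else 0⟩
  map_add' f g := by
    ext u
    simp only [coeff_add]
    split_ifs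
    · rfl
    · rw [add_zero]
  map_smul' c f := by
    ext u
    simp only [coeff_smul, RingHom.id_apply]
    split_ifs
    · rfl
    · rw [mul_zero]

theorem coeff_homY (j : ℕ) (f : KX K G) (u : YWord G) : (homY j f).coeff u =
    if deg u ≤ j then f.coeff (xyWord 1 u * w0 ^ (j - deg u)) else 0 := rfl

theorem cont_homY (j : ℕ) : IsCont (homY j : KX K G →ₗ[K] KY K G) := fun u =>
  ⟨{xyWord 1 u * w0 ^ (j - deg u)}, fun f hf => by
    rw [coeff_homY, hf _ (Finset.mem_singleton_self _), ite_self]⟩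

/-- The power series with coefficients `homY j f`. -/
noncomputable def homSer (f : KX K G) : PowerSeries (KY K G) := PowerSeries.mk fun j => homY j f

theorem coeff_homSer (j : ℕ) (f : KX K G) : PowerSeries.coeff j (homSer f) = homY j f :=
  PowerSeries.coeff_mk _ _

/-- In total degree `j` the tail of `u` has length `j - deg u`, so for `deg u < j` flatness at `u`
is the vanishing of `dX0 f` at the word one degree lower. For `deg u ≥ j` the raised words have
weight greater than `j` and do not occur. -/
theorem isFlat_homSer {f : KX K G} (hf : dX0 K G f = 0) : IsFlat (homSer f) := fun j => by
  rw [coeff_homSer]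
  ext u
  rw [coeff_add, coeff_euler, coeff_smul]
  rcases lt_trichotomy (deg u) j with h | h | h
  · obtain ⟨k, rfl⟩ := Nat.exists_eq_add_of_lt h
    have h1 := coeff_dX0_xyWord f 1 u k
    rw [hf, coeff_zero] at h1
    rw [coeff_raise_congr (g := NCSeries.reindex (fun u => xyWord 1 u * w0 ^ k) f), coeff_homY,
      if_pos (by omega), show deg u + k + 1 - deg u = k + 1 by omega]
    · push_cast
      rw [coeff_zero]
      linear_combination -h1
    · intro w hw _
      rw [coeff_homY, if_pos (by omega), coeff_reindex, show deg u + k + 1 - deg w = k by omega]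
  · rw [coeff_raise_eq_zero, h, coeff_zero]
    · ring
    · intro w hw _
      rw [coeff_homY, if_neg (by omega)]
  · rw [coeff_raise_eq_zero, coeff_homY, if_neg (by omega), coeff_zero]
    · ring
    · intro w hw _
      rw [coeff_homY, if_neg (by omega)]

end Insertion

/-! ### Flat families are determined by their components of highest weight -/

section TopWeight

variable {K : Type u} [CommRing K] [Algebra ℚ K] {G : Type v} [CommGroup G] [Fintype G]

theorem isUnit_natCast {n : ℕ} (hn : n ≠ 0) : IsUnit (n : K) := by
  have h : (n : K) = algebraMap ℚ K n := by simp
  rw [h]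
  exact (isUnit_iff_ne_zero.2 (Nat.cast_ne_zero.2 hn)).map _

/-- The defect of group-likeness is flat because the Euler derivation is a coderivation. In degree
`j` it vanishes above weight `j` by the support of `F`, and in weight `j` because `ρ` is group-like.
Flatness expresses its part of lower weight through the part of the next weight. -/
theorem isGroupLike_of_top {F : PowerSeries (KY K G)} (hF : IsFlat F)
    (h0 : ∀ j w, j < deg w → (PowerSeries.coeff j F).coeff w = 0) {ρ : KY K G}
    (hρ : deltaAlg K ρ = tmul ρ ρ) (htop : ∀ w, (PowerSeries.coeff (deg w) F).coeff w = ρ.coeff w) :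
    IsGroupLike F := fun j => by
  set H : KYY K G := deltaAlg K (PowerSeries.coeff j F) - ∑ p ∈ Finset.HasAntidiagonal.antidiagonal j,
    tmul (PowerSeries.coeff p.1 F) (PowerSeries.coeff p.2 F) with hH
  have hflat : eulerSq K G H + (j : K) • H = 0 := by
    rw [hH, map_sub, ← deltaAlg_euler, smul_sub, sub_add_sub_comm, ← map_smul, ← map_add, hF,
      map_zero, zero_sub, neg_eq_zero, map_sum, Finset.smul_sum, ← Finset.sum_add_distrib]
    refine Finset.sum_eq_zero fun p hp => ?_
    rw [Finset.HasAntidiagonal.mem_antidiagonal] at hp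
    have h1 : euler K G (PowerSeries.coeff p.1 F) = -((p.1 : K) • PowerSeries.coeff p.1 F) :=
      eq_neg_of_add_eq_zero_left (hF p.1)
    have h2 : euler K G (PowerSeries.coeff p.2 F) = -((p.2 : K) • PowerSeries.coeff p.2 F) :=
      eq_neg_of_add_eq_zero_left (hF p.2)
    rw [eulerSq_tmul, h1, h2, ← hp]
    ext q
    simp only [coeff_add, coeff_tmul, coeff_smul, coeff_neg, coeff_zero]
    push_cast
    ring
  have hsum : ∀ u w : YWord G, j < deg u + deg w → ∑ p ∈ Finset.HasAntidiagonal.antidiagonal j,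
      (PowerSeries.coeff p.1 F).coeff u * (PowerSeries.coeff p.2 F).coeff w = 0 :=
    fun u w huw => Finset.sum_eq_zero fun p hp => by
      rw [Finset.HasAntidiagonal.mem_antidiagonal] at hp
      rcases Nat.lt_or_ge p.1 (deg u) with h | h
      · rw [h0 _ _ h, zero_mul]
      · rw [h0 p.2 w (by omega), mul_zero]
  have hcoeff : ∀ u w, H.coeff (u, w) = (deltaAlg K (PowerSeries.coeff j F)).coeff (u, w) -
      ∑ p ∈ Finset.HasAntidiagonal.antidiagonal j,
        (PowerSeries.coeff p.1 F).coeff u * (PowerSeries.coeff p.2 F).coeff w := fun u w => by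
    rw [hH, coeff_sub, coeff_sum]
    rfl
  have hgt : ∀ u w : YWord G, j < deg u + deg w → H.coeff (u, w) = 0 := fun u w huw => by
    rw [hcoeff, hsum u w huw, coeff_deltaAlg_eq_zero fun m hm _ => h0 _ _ (by omega), sub_zero]
  have heq : ∀ u w : YWord G, deg u + deg w = j → H.coeff (u, w) = 0 := fun u w huw => by
    rw [hcoeff, coeff_deltaAlg_congr (g := ρ) fun m hm _ => by rw [← htop, hm, huw], hρ, coeff_tmul,
      Finset.sum_eq_single (deg u, deg w)]
    · rw [htop, htop, sub_self]
    · rintro ⟨a, b⟩ hp hne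
      rw [Finset.HasAntidiagonal.mem_antidiagonal] at hp
      dsimp only at hp ⊢
      rcases Nat.lt_or_ge a (deg u) with h | h
      · rw [h0 _ _ h, zero_mul]
      · rw [h0 b w, mul_zero]
        by_contra hb
        exact hne (Prod.ext (by dsimp only; omega) (by dsimp only; omega))
    · intro h
      exact absurd (Finset.HasAntidiagonal.mem_antidiagonal.2 huw) h
  -- Descending induction on the weight, `d` being its distance to `j`: flatness gives `(d + 1) H =
  -- 0` in weight `j - (d + 1)`, and `d + 1` is invertible.
  have hlt : ∀ d (u w : YWord G), deg u + deg w + d = j → H.coeff (u, w) = 0 := fun d => by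
    induction d with
    | zero => exact fun u w h => heq u w (by omega)
    | succ d ih =>
      intro u w h
      have h1 := congrArg (fun F => F.coeff (u, w)) hflat
      simp only [coeff_add, coeff_eulerSq, coeff_smul, coeff_zero] at h1
      rw [coeff_raise_eq_zero fun x hx _ => ih x w (by omega),
        coeff_raise_eq_zero fun x hx _ => ih u x (by omega), ← h] at h1
      have h2 : ((d + 1 : ℕ) : K) * H.coeff (u, w) = 0 := by
        push_cast at h1 ⊢
        linear_combination h1
      exact (isUnit_natCast (Nat.succ_ne_zero d)).mul_right_eq_zero.1 h2
  rw [← sub_eq_zero, ← hH]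
  ext ⟨u, w⟩
  rcases Nat.lt_or_ge j (deg u + deg w) with h | h
  · exact hgt u w h
  · exact hlt (j - (deg u + deg w)) u w (by omega)

variable (ε : ℤˣ)

theorem dX0_GamInvX_mul (Ψ : GroupLike K G) (h : Ψ.ser.coeff w0 = 0) :
    dX0 K G (GamInvX ε Ψ * Ψ.ser) = 0 := by
  rw [GamInvX, evalPS_intertwine cont_dX0 (ord_xg 1) (ord_xg 1) (dX0_xg_mul 1), dX0_ser Ψ h,
    mul_zero]

/-- The terms of `homSer A` whose weight equals the power of the variable come from words without a
tail of `x₀`; they form the series `Ψ⋆`, which is group-like by hypothesis. -/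
theorem isGroupLike_homSer (Ψ : GroupLike K G) (h : Ψ.ser.coeff w0 = 0)
    (hΔ : deltaMod K (piY K G (starLift ε Ψ)) =
      piYY K G (NCSeries.tmul (starLift ε Ψ) (starLift ε Ψ))) :
    IsGroupLike (homSer (GamInvX ε Ψ * Ψ.ser)) := by
  refine isGroupLike_of_top (isFlat_homSer (dX0_GamInvX_mul ε Ψ h)) (fun j w hw => ?_)
    (ρ := restrY K (starLift ε Ψ)) ?_ fun w => ?_
  · rw [coeff_homSer, coeff_homY, if_neg (by omega)]
  · have h1 : deltaMod K (piY K G (starLift ε Ψ)) =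
      piYY K G (inclYY K (deltaAlg K (restrY K (starLift ε Ψ)))) := rfl
    rw [h1, piYY_eq_iff, tensorSq_restrY_inclYY, tensorSq_tmul] at hΔ
    exact hΔ
  · rw [coeff_homSer, coeff_homY, if_pos le_rfl, Nat.sub_self, pow_zero, mul_one,
      ← qWord_symm_yToX]
    rfl

end TopWeight

/-! ### The antipode of `K⟨⟨X⟩⟩` -/

section Antipode

variable {K : Type u} [CommRing K] {G : Type v}

/-- The reversal of a word. -/
def revX (w : XWord G) : XWord G := FreeMonoid.ofList (FreeMonoid.toList w).reverse

theorem revX_revX (w : XWord G) : revX (revX w) = w := by simp [revX]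

theorem revX_mul (u w : XWord G) : revX (u * w) = revX w * revX u := by
  simp [revX, FreeMonoid.toList_mul, FreeMonoid.ofList_append]

theorem length_revX (w : XWord G) : FreeMonoid.length (revX w) = FreeMonoid.length w :=
  List.length_reverse

variable (K G) in
/-- The antipode of `K⟨⟨X⟩⟩`. -/
def antiX : KX K G →ₗ[K] KX K G where
  toFun f := ⟨fun w => (-1) ^ FreeMonoid.length w * f.coeff (revX w)⟩
  map_add' f g := by ext w; simp only [coeff_add, mul_add]
  map_smul' c f := by ext w; simp only [coeff_smul, RingHom.id_apply]; ring

theorem coeff_antiX (f : KX K G) (w : XWord G) :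
    (antiX K G f).coeff w = (-1) ^ FreeMonoid.length w * f.coeff (revX w) := rfl

theorem cont_antiX : IsCont (antiX K G) := fun w =>
  ⟨{revX w}, fun f hf => by rw [coeff_antiX, hf _ (Finset.mem_singleton_self _), mul_zero]⟩

theorem antiX_antiX (f : KX K G) : antiX K G (antiX K G f) = f := by
  ext w
  rw [coeff_antiX, coeff_antiX, length_revX, revX_revX, ← mul_assoc, ← mul_pow, neg_one_mul,
    neg_neg, one_pow, one_mul]

theorem antiX_basis (w : XWord G) :
    antiX K G (basis K w) = (-1 : K) ^ FreeMonoid.length w • basis K (revX w) := by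
  ext m
  rw [coeff_antiX, coeff_smul]
  by_cases h : m = revX w
  · rw [h, revX_revX, length_revX, coeff_basis_self, coeff_basis_self]
  · rw [coeff_basis_of_ne h, coeff_basis_of_ne fun h' => h (by rw [← h', revX_revX]), mul_zero,
      mul_zero]

theorem antiX_xl (a : Option G) : antiX K G (xl K a) = -xl K a := by
  rw [antiX_basis, FreeMonoid.length_of, pow_one, neg_one_smul]
  rfl

theorem antiX_one : antiX K G 1 = 1 := by
  rw [one_def, antiX_basis, FreeMonoid.length_one, pow_zero, one_smul]
  rfl

theorem antiX_mul (f g : KX K G) : antiX K G (f * g) = antiX K G g * antiX K G f :=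
  IsCont.map_mul_rev cont_antiX (fun a b => by
    rw [antiX_basis, antiX_basis, antiX_basis, smul_mul_smul_comm, basis_mul_basis, revX_mul,
      FreeMonoid.length_mul, ← pow_add, add_comm]) f g

theorem antiX_pow (f : KX K G) (n : ℕ) : antiX K G (f ^ n) = antiX K G f ^ n := by
  induction n with
  | zero => rw [pow_zero, pow_zero, antiX_one]
  | succ n ih => rw [pow_succ, antiX_mul, ih, pow_succ']

variable [CommGroup G] [Finite G]

theorem locFin_convAntiX : LocFin fun p : XWord G × XWord G =>
    (-1 : K) ^ FreeMonoid.length p.1 • basis K (revX p.1 * p.2) := LocFin.of_ord fun p m hm => by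
  have hd : ∀ w : XWord G, deg (revX w) = deg w := fun w => by
    induction w using FreeMonoid.inductionOn' with
    | one => rfl
    | of_mul a w ih =>
      rw [revX_mul, deg_mul, deg_mul, ih, add_comm]
      rfl
  rw [coeff_smul, Ord.basis _ m (by rw [deg_mul, hd, ← deg_prod]; exact hm), mul_zero]

/-- The convolution of the antipode with the identity annihilates the augmentation ideal. -/
theorem antiX_ser (Ψ : GroupLike K G) : antiX K G Ψ.ser = Ψ.serInv := by
  -- `μ` is the multiplication composed with the antipode on the first factor.
  set μ : KXX K G →ₗ[K] KX K G := lsum fun p : XWord G × XWord G =>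
    (-1 : K) ^ FreeMonoid.length p.1 • basis K (revX p.1 * p.2) with hμ
  have hc : IsCont μ := IsCont.lsum _
  have hb : ∀ a b, μ (basis K (a, b)) = antiX K G (basis K a) * basis K b := fun a b => by
    rw [hμ, locFin_convAntiX.lsum_basis, antiX_basis, smul_mul_assoc, basis_mul_basis]
  have ht : ∀ f g : KX K G, μ (tmul f g) = antiX K G f * g := fun f g => by
    have h1 : ∀ a, μ (tmul (basis K a) g) = antiX K G (basis K a) * g := fun a =>
      (hc.comp (IsCont.tmul_right (basis K a))).ext_apply (IsCont.mulLeft (antiX K G (basis K a)))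
        (fun b => by
          rw [LinearMap.comp_apply, tmulL_apply, ← basis_prod, hb, LinearMap.mulLeft_apply]) g
    exact (hc.comp (IsCont.tmul_left g)).ext_apply ((IsCont.mulRight g).comp cont_antiX) h1 f
  -- The antipode reverses products, so the two terms of `Δ(x_a)` yield `S(b)(-x_a)c` and `S(b)x_a
  -- c`, which cancel.
  have hl : ∀ (a : Option G) (F : KXX K G), μ ((tmul (xl K a) 1 + tmul 1 (xl K a)) * F) = 0 :=
    fun a F => (hc.comp (IsCont.mulLeft _)).ext_apply IsCont.zero (fun ⟨b, c⟩ => by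
      rw [LinearMap.comp_apply, LinearMap.mulLeft_apply, basis_prod, add_mul, tmul_mul_tmul,
        tmul_mul_tmul, map_add, ht, ht, one_mul, one_mul, antiX_mul, antiX_xl, LinearMap.zero_apply]
      noncomm_ring) F
  have hf : ∀ f : KX K G, μ (coprod K f) = f.coeff 1 • (1 : KX K G) := fun f => by
    refine (hc.comp isHom_coprod.cont).ext_apply
      (U := (coeffL K (1 : XWord G)).smulRight (1 : KX K G)) (fun n => ⟨{1}, fun f hf => ?_⟩)
      (fun w => ?_) f
    · have h1 := hf 1 (Finset.mem_singleton_self _)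
      simp [h1]
    · induction w using FreeMonoid.inductionOn' with
      | one =>
        rw [LinearMap.comp_apply, ← one_def, isHom_coprod.map_one, ← tmul_one_one, ht, antiX_one,
          one_mul, LinearMap.smulRight_apply, coeffL_apply, one_def, coeff_basis_self, one_smul]
      | of_mul a w _ =>
        rw [LinearMap.comp_apply, ← basis_mul_basis, isHom_coprod.map_mul, coprod_xl, hl,
          basis_mul_basis, LinearMap.smulRight_apply, coeffL_apply,
          coeff_basis_of_ne (of_mul_ne_one a w).symm, zero_smul]
  refine left_inv_eq_right_inv ?_ Ψ.ser_mul_serInv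
  rw [← ht, ← Ψ.coprod_ser, hf, Ψ.coeff_one_ser, one_smul]

variable (K) in
/-- The substitution `x ↦ -x` in power series. -/
noncomputable def negVar : PowerSeries K →ₗ[K] PowerSeries K where
  toFun := PowerSeries.rescale (-1 : K)
  map_add' := map_add _
  map_smul' c p := by
    ext n
    rw [PowerSeries.coeff_rescale, map_smul, map_smul, PowerSeries.coeff_rescale, smul_eq_mul,
      RingHom.id_apply, smul_eq_mul]
    ring

theorem coeff_negVar (p : PowerSeries K) (n : ℕ) :
    PowerSeries.coeff n (negVar K p) = (-1) ^ n * PowerSeries.coeff n p :=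
  PowerSeries.coeff_rescale p (-1) n

theorem negVar_X_pow (n : ℕ) : negVar K (PowerSeries.X ^ n) = (-1 : K) ^ n • PowerSeries.X ^ n := by
  ext m
  rw [coeff_negVar, map_smul, PowerSeries.coeff_X_pow, smul_eq_mul]
  split_ifs with hm
  · rw [hm]
  · rw [mul_zero, mul_zero]

theorem cont_negVar :
    IsCont ((psSer K).toLinearMap ∘ₗ negVar K ∘ₗ (psSer K).symm.toLinearMap) := fun n =>
  ⟨{n}, fun f hf => by
    simp only [LinearMap.comp_apply, LinearEquiv.coe_coe]
    rw [coeff_psSer, coeff_negVar, coeff_psSer_symm, hf n (Finset.mem_singleton_self _), mul_zero]⟩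

theorem antiX_evalPS (p : PowerSeries K) : antiX K G (evalPS p (xg K 1)) =
    evalPS (negVar K p) (xg K 1) := by
  refine ext_powerSeries (T := antiX K G ∘ₗ evalL (xg K 1)) (U := evalL (xg K 1) ∘ₗ negVar K)
    ?_ ?_ (fun n => ?_) p
  · exact cont_antiX.comp (cont_evalL _)
  · have h := (cont_evalL (xg K (1 : G))).comp (cont_negVar (K := K))
    convert h using 1
    ext f : 1
    simp only [LinearMap.comp_apply, LinearEquiv.coe_coe, LinearEquiv.symm_apply_apply]
  · rw [LinearMap.comp_apply, LinearMap.comp_apply, negVar_X_pow, map_smul, evalL_apply,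
      evalPS_X_pow (ord_xg 1), antiX_pow, xg_eq, antiX_xl]
    rcases Nat.even_or_odd n with h | h
    · rw [h.neg_pow, h.neg_one_pow, one_smul]
    · rw [h.neg_pow, h.neg_one_pow, neg_one_smul]

end Antipode

/-! ### A formula for conjugates of `e₀^{n-1} g` in terms of series over `Y`. -/

section Formula

variable {K : Type u} [CommRing K] {G : Type v} [CommGroup G] [Finite G]

theorem homY_basis (j : ℕ) (w : YWord G) (k : ℕ) : homY j (basis K (xyWord 1 w * w0 ^ k)) =
    if deg w + k = j then basis K w else 0 := by
  ext m
  rw [coeff_homY]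
  by_cases hm : m = w
  · subst hm
    by_cases h : deg m + k = j
    · rw [if_pos (by omega), if_pos h, show j - deg m = k by omega, coeff_basis_self,
        coeff_basis_self]
    · rw [if_neg h, coeff_zero]
      split_ifs with h1
      · exact coeff_basis_of_ne fun h2 => h (by have := (xyWord_injective h2).2; omega)
      · rfl
  · rw [coeff_basis_of_ne fun h => hm (xyWord_injective h).1, ite_self]
    split_ifs
    · rw [coeff_basis_of_ne hm]
    · rfl

theorem homSer_basis (w : YWord G) (k : ℕ) : homSer (basis K (xyWord 1 w * w0 ^ k)) =
    PowerSeries.monomial (deg w + k) (basis K w) := by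
  ext j : 1
  rw [coeff_homSer, homY_basis, PowerSeries.coeff_monomial]
  simp only [eq_comm]

/-- The part of degree `(n, g)` with respect to the difference of the degrees of `K⟨⟨Y⟩⟩` and of the
power series. -/
noncomputable def diagPart (n : ℕ) (g : G) : PowerSeries (KY K G) →ₗ[K] KY K G where
  toFun F := ⟨fun w => open Classical in
    if n ≤ deg w ∧ gdeg G w = g then (PowerSeries.coeff (deg w - n) F).coeff w else 0⟩
  map_add' F H := by
    ext w
    simp only [coeff_add, map_add]
    split_ifs
    · rfl
    · rw [add_zero]
  map_smul' c F := by
    ext w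
    simp only [coeff_smul, RingHom.id_apply, PowerSeries.coeff_smul]
    split_ifs
    · rfl
    · rw [mul_zero]

theorem coeff_diagPart (n : ℕ) (g : G) (F : PowerSeries (KY K G)) (w : YWord G)
    [Decidable (n ≤ deg w ∧ gdeg G w = g)] : (diagPart n g F).coeff w =
      if n ≤ deg w ∧ gdeg G w = g then (PowerSeries.coeff (deg w - n) F).coeff w else 0 := by
  simp only [diagPart, LinearMap.coe_mk, AddHom.coe_mk]
  congr

/-- Continuity is defined for series over monoids only. A coefficient of `diagPart` involves a
single coefficient of the power series, so it is enough that these depend continuously on the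
argument. -/
theorem IsCont.diagPart {M : Type*} (n : ℕ) (g : G)
    {T : NCSeries K M →ₗ[K] PowerSeries (KY K G)} {U : ℕ → NCSeries K M →ₗ[K] KY K G}
    (hU : ∀ j, IsCont (U j)) (hT : ∀ j f, PowerSeries.coeff j (T f) = U j f) :
    IsCont (diagPart n g ∘ₗ T) := fun w => by
  classical
  obtain ⟨s, hs⟩ := hU (deg w - n) w
  refine ⟨s, fun f hf => ?_⟩
  rw [LinearMap.comp_apply, coeff_diagPart, hT, hs f hf, ite_self]

theorem coeff_basis_mul_mul_basis_congr {f f' : KY K G} {u v w : YWord G}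
    (h : ∀ m, deg u + deg m + deg v = deg w → gdeg G u * gdeg G m * gdeg G v = gdeg G w →
      f.coeff m = f'.coeff m) :
    (basis K u * f * basis K v).coeff w = (basis K u * f' * basis K v).coeff w := by
  rw [← sub_eq_zero, ← coeff_sub, ← sub_mul, ← mul_sub]
  refine ((IsCont.mulRight (basis K v)).comp
    (IsCont.mulLeft (basis K u))).coeff_eq_zero_of_support fun m hm => ?_
  rw [LinearMap.comp_apply, LinearMap.mulLeft_apply, LinearMap.mulRight_apply, basis_mul_basis,
    basis_mul_basis]
  refine coeff_basis_of_ne ?_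
  rintro rfl
  refine hm ?_
  rw [coeff_sub, h m (by rw [deg_mul, deg_mul]) (by rw [map_mul, map_mul]), sub_self]

/-- Weight minus power of the variable must be `n`, so the factor taken from `ySum` must have weight
`n + k`; its `G`-degree is prescribed as well, which leaves one letter. -/
theorem diagPart_monomial {n k : ℕ} {N : ℕ+} (hN : N = n + k) (g : G) (u v : YWord G) :
    diagPart n g (PowerSeries.monomial (deg u + deg v + k) (basis K u * ySum K G * basis K v)) =
      basis K (u * FreeMonoid.of (N, g * (gdeg G u * gdeg G v)⁻¹) * v) := by
  classical
  have := Fintype.ofFinite G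
  have hG : ∀ x y g : G, x * (g * (x * y)⁻¹) * y = g := fun x y g => by
    rw [mul_left_comm, mul_assoc, mul_right_comm, mul_inv_cancel, mul_one]
  ext w
  rw [coeff_diagPart, PowerSeries.coeff_monomial]
  by_cases h : n + (deg u + deg v + k) = deg w ∧ gdeg G w = g
  · obtain ⟨h1, rfl⟩ := h
    rw [if_pos ⟨by omega, rfl⟩, if_pos (by omega), ← basis_mul_basis, ← basis_mul_basis]
    refine coeff_basis_mul_mul_basis_congr fun m hm hg => coeff_ySum_eq_coeff_yl ?_ ?_
    · omega
    · rw [← hg, mul_right_comm (gdeg G u), mul_comm (gdeg G u * _), mul_inv_cancel_right]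
  · rw [coeff_basis_of_ne]
    · split_ifs with h1 h2
      · exact absurd ⟨by omega, h1.2⟩ h
      · rfl
      · rfl
    · rintro rfl
      refine h ⟨?_, ?_⟩
      · rw [deg_mul, deg_mul, deg_of_Y, hN]
        omega
      · rw [map_mul, map_mul, gdeg_of, hG]

theorem basis_pow {M : Type*} [Monoid M] [Finset.HasMulAntidiagonal M] (m : M) (n : ℕ) :
    basis K m ^ n = basis K (m ^ n) := by
  induction n with
  | zero => rw [pow_zero, pow_zero, one_def]
  | succ n ih => rw [pow_succ, pow_succ, ih, basis_mul_basis]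

/-- The antipode reverses the word, so each block of `x₀` is now closed by the `e₁` on its right,
the last one by the extra `e₁`. The labels telescope to their inverses, which gives `tauWord`. The
antipode contributes one sign for each letter of `X`, hence `(-1)^{deg v}`; the signs in `β` are
those in `ϖ`. -/
theorem betaX_antiX_xyWord (p : G) (v : YWord G) :
    betaX (antiX K G (basis K (xyWord p v))) * basis K (vgrp p * ve1) =
      (-1 : K) ^ deg v • (basis K (vgrp (p * gdeg G v) * ve1) * varpi (basis K (tauWord v)) :
        VG K G) := by
  induction v using FreeMonoid.inductionOn' generalizing p with
  | one =>
    rw [xyWord_one, ← one_def, antiX_one, isHom_betaX.map_one, one_mul, deg_one, pow_zero,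
      one_smul, map_one, mul_one, tauWord_one, ← one_def, isHom_varpi.map_one, mul_one]
  | of_mul a v ih =>
    have h3 : antiX K G (x0 K ^ ((a.1 : ℕ) - 1)) =
        (-1 : K) ^ ((a.1 : ℕ) - 1) • x0 K ^ ((a.1 : ℕ) - 1) := by
      rw [antiX_pow, x0_eq, antiX_xl]
      rcases Nat.even_or_odd ((a.1 : ℕ) - 1) with h | h
      · rw [h.neg_pow, h.neg_one_pow, one_smul]
      · rw [h.neg_pow, h.neg_one_pow, neg_one_smul]
    have h4 : (-1 : K) ^ (a.1 : ℕ) = - (-1) ^ ((a.1 : ℕ) - 1) := by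
      rw [← mul_neg_one ((-1 : K) ^ _), ← pow_succ, Nat.sub_add_cancel a.1.pos]
    have h5 : antiX K G (basis K (wg (p * a.2))) = -xg K (p * a.2) := antiX_xl (some (p * a.2))
    have h6 : (basis K (vgrp (p * a.2) * ve1 * vgrp (p * a.2)⁻¹) : VG K G) *
        (basis K (ve0 ^ ((a.1 : ℕ) - 1)) * basis K (vgrp p * ve1)) =
        basis K (vgrp (p * a.2) * ve1) * basis K (ve0 ^ ((a.1 : ℕ) - 1) * vgrp a.2⁻¹ * ve1) := by
      simp only [basis_mul_basis]
      congr 1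
      have h7 : (p * a.2)⁻¹ * p = a.2⁻¹ := by rw [mul_inv_rev, mul_assoc, inv_mul_cancel, mul_one]
      rw [mul_assoc, ← mul_assoc (vgrp (p * a.2)⁻¹), vgrp_comm_pow, mul_assoc (ve0 ^ _),
        ← mul_assoc (vgrp (p * a.2)⁻¹), vgrp_mul, h7, mul_assoc (ve0 ^ _)]
    rw [xyWord_of_mul, ← basis_mul_basis, ← basis_mul_basis, antiX_mul, antiX_mul, ← basis_pow, ← x0,
      h3, h5,
      isHom_betaX.map_mul, isHom_betaX.map_mul, map_neg, betaX_xg, neg_neg, map_smul,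
      isHom_betaX.map_pow, betaX_x0, basis_pow, mul_smul_comm, mul_smul_comm, smul_mul_assoc, mul_assoc,
      mul_assoc, h6, ← mul_assoc, ih, tauWord_mul, tauWord_of, ← basis_mul_basis (tauWord v),
      isHom_varpi.map_mul, varpi_of, deg_mul, deg_of_Y, pow_add, h4, map_mul (gdeg G), gdeg_of]
    simp only [smul_mul_assoc, smul_smul, mul_neg, smul_neg, neg_mul, neg_smul, neg_neg, mul_assoc]

variable (K G) in
/-- `homSer` as a linear map. -/
noncomputable def homSerL : KX K G →ₗ[K] PowerSeries (KY K G) where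
  toFun := homSer
  map_add' f g := by
    ext j : 1
    rw [map_add, coeff_homSer, coeff_homSer, coeff_homSer, map_add]
  map_smul' c f := by
    ext j : 1
    rw [PowerSeries.coeff_smul, coeff_homSer, coeff_homSer, map_smul]
    rfl

theorem homSerL_apply (f : KX K G) : homSerL K G f = homSer f := rfl

variable (K G) in
/-- `sigma` as a linear map. -/
noncomputable def sigmaL : PowerSeries (KY K G) →ₗ[K] PowerSeries (KY K G) where
  toFun := sigma
  map_add' f g := by
    ext j : 1
    rw [map_add, coeff_sigma, coeff_sigma, coeff_sigma, map_add, map_add, smul_add]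
  map_smul' c f := by
    ext j : 1
    rw [PowerSeries.coeff_smul, coeff_sigma, coeff_sigma, PowerSeries.coeff_smul, map_smul,
      smul_comm]
    rfl

theorem sigmaL_apply (F : PowerSeries (KY K G)) : sigmaL K G F = sigma F := rfl

theorem sigma_monomial (j : ℕ) (f : KY K G) : sigma (PowerSeries.monomial j f) =
    (-1 : K) ^ j • PowerSeries.monomial j (tau K G f) := by
  ext i : 1
  rw [coeff_sigma, PowerSeries.coeff_smul, PowerSeries.coeff_monomial, PowerSeries.coeff_monomial]
  split_ifs with h
  · rw [h]
  · rw [map_zero, smul_zero, smul_zero]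

/-- The tails `x₀ᵏ` and `x₀ˡ` on either side merge with `e₀^{n-1}` into one block, closed by the
`e₁` that precedes the image of `tauWord v`. This creates a single new letter, of index `n + k + l`.
-/
theorem varpiInv_betaX_word_mul (n : ℕ+) (g : G) (u v : YWord G) (k l : ℕ) {N : ℕ+}
    (hN : (N : ℕ) = n + (k + l)) :
    varpiInv (-(betaX (basis K (xyWord 1 u * w0 ^ k)) * basis K (ve0 ^ ((n : ℕ) - 1) * vgrp g) *
      (betaX (antiX K G (basis K (xyWord 1 v * w0 ^ l))) * basis K ve1) : VG K G)) =
    (-1 : K) ^ (deg v + l) •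
      basis K (u * FreeMonoid.of (N,
        g * (gdeg G u * (gdeg G (tauWord v)))⁻¹) * tauWord v) := by
  have h3 : antiX K G (x0 K ^ l) = (-1 : K) ^ l • x0 K ^ l := by
    rw [antiX_pow, x0_eq, antiX_xl]
    rcases Nat.even_or_odd l with h | h
    · rw [h.neg_pow, h.neg_one_pow, one_smul]
    · rw [h.neg_pow, h.neg_one_pow, neg_one_smul]
  have h4 := betaX_antiX_xyWord (K := K) 1 v
  rw [vgrp_one, one_mul, one_mul] at h4
  have h5 : vgrp (gdeg G u)⁻¹ * ve0 ^ k * (ve0 ^ ((n : ℕ) - 1) * vgrp g) *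
      (ve0 ^ l * (vgrp (gdeg G v) * ve1)) = ve0 ^ ((N : ℕ) - 1) *
        vgrp (g * (gdeg G u * (gdeg G (tauWord v)))⁻¹) * ve1 := by
    have hn : (N : ℕ) - 1 = k + ((n : ℕ) - 1) + l := by have := n.pos; omega
    have hg : g * (gdeg G u * (gdeg G (tauWord v)))⁻¹ = (gdeg G u)⁻¹ * g * gdeg G v := by
      rw [gdeg_tauWord, mul_inv, inv_inv, ← mul_assoc, mul_comm g]
    rw [hn, hg, pow_add, pow_add, ← vgrp_mul, ← vgrp_mul]
    simp only [← mul_assoc]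
    rw [vgrp_comm_pow]
    simp only [mul_assoc]
    rw [← mul_assoc (vgrp (gdeg G u)⁻¹) (ve0 ^ _), vgrp_comm_pow, mul_assoc,
      ← mul_assoc (vgrp g) (ve0 ^ _), vgrp_comm_pow, mul_assoc,
      ← mul_assoc (vgrp (gdeg G u)⁻¹) (ve0 ^ _), vgrp_comm_pow, mul_assoc]
  rw [betaX_word, ← basis_mul_basis (xyWord 1 v), ← basis_pow, ← x0, antiX_mul, h3,
    isHom_betaX.map_mul, map_smul, isHom_betaX.map_pow, betaX_x0, basis_pow, mul_assoc _ _
    (basis K ve1), h4]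
  simp only [smul_mul_assoc, mul_smul_comm, smul_smul]
  rw [← mul_assoc (basis K (ve0 ^ l)), ← mul_assoc _ _ (varpi _), basis_mul_basis (ve0 ^ l),
    mul_assoc (varpi _), mul_assoc (varpi _), basis_mul_basis, basis_mul_basis, h5]
  have h6 := varpi_of (K := K) (N,
    g * (gdeg G u * (gdeg G (tauWord v)))⁻¹)
  rw [← neg_eq_iff_eq_neg] at h6
  rw [← h6, ← smul_neg, mul_neg, neg_mul, neg_neg, ← isHom_varpi.map_mul, ← isHom_varpi.map_mul,
    basis_mul_basis, basis_mul_basis, map_smul, varpiInv_varpi, pow_add, mul_comm]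

/-- On words, the factor `ySum` supplies the letter created in the middle, and the powers of the
variable remember the tails that it absorbs; `diagPart` selects its index and label. The general
case follows by density in `f'` and then in `f`. -/
theorem varpiInv_betaX_mul (n : ℕ+) (g : G) (f f' : KX K G) :
    varpiInv (-(betaX f * basis K (ve0 ^ ((n : ℕ) - 1) * vgrp g) *
      (betaX (antiX K G f') * basis K ve1) : VG K G)) =
    diagPart n g (homSer f * PowerSeries.C (ySum K G) * sigma (homSer f')) := by
  set c : VG K G := basis K (ve0 ^ ((n : ℕ) - 1) * vgrp g) with hc
  have key : ∀ u k v l, varpiInv (-(betaX (basis K (xyWord 1 u * w0 ^ k)) * c *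
      (betaX (antiX K G (basis K (xyWord 1 v * w0 ^ l))) * basis K ve1) : VG K G)) =
      diagPart n g (homSer (basis K (xyWord 1 u * w0 ^ k)) * PowerSeries.C (ySum K G) *
        sigma (homSer (basis K (xyWord 1 v * w0 ^ l)))) := fun u k v l => by
    have hN : ((⟨n + (k + l), Nat.add_pos_left n.pos _⟩ : ℕ+) : ℕ) = n + (k + l) := rfl
    rw [varpiInv_betaX_word_mul n g u v k l hN, homSer_basis, homSer_basis, sigma_monomial, tau_basis,
      mul_smul_comm, map_smul, ← PowerSeries.monomial_zero_eq_C_apply, PowerSeries.monomial_mul_monomial,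
      PowerSeries.monomial_mul_monomial,
      show deg u + k + 0 + (deg v + l) = deg u + deg (tauWord v) + (k + l) by
        rw [deg_tauWord]; omega, diagPart_monomial hN]
  have h1 : ∀ u k, varpiInv (-(betaX (basis K (xyWord 1 u * w0 ^ k)) * c *
      (betaX (antiX K G f') * basis K ve1) : VG K G)) =
      diagPart n g (homSer (basis K (xyWord 1 u * w0 ^ k)) * PowerSeries.C (ySum K G) *
        sigma (homSer f')) := fun u k => by
    set b : VG K G := betaX (basis K (xyWord 1 u * w0 ^ k)) * c
    set H : PowerSeries (KY K G) := homSer (basis K (xyWord 1 u * w0 ^ k)) *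
      PowerSeries.C (ySum K G)
    suffices h : (varpiInv ∘ₗ LinearMap.mulLeft K (-b) ∘ₗ LinearMap.mulRight K (basis K ve1) ∘ₗ
        betaX ∘ₗ antiX K G) f' =
        (diagPart n g ∘ₗ LinearMap.mulLeft K H ∘ₗ sigmaL K G ∘ₗ homSerL K G) f' by
      simpa only [LinearMap.comp_apply, LinearMap.mulLeft_apply, LinearMap.mulRight_apply,
        homSerL_apply, sigmaL_apply, neg_mul] using h
    refine IsCont.ext_apply
      (cont_varpiInv.comp ((IsCont.mulLeft _).comp ((IsCont.mulRight _).comp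
        (isHom_betaX.cont.comp cont_antiX))))
      (IsCont.diagPart n g (U := fun j => ∑ p ∈ Finset.HasAntidiagonal.antidiagonal j,
          LinearMap.mulLeft K (PowerSeries.coeff p.1 H) ∘ₗ ((-1 : K) ^ p.2 • tau K G) ∘ₗ homY p.2)
        (fun j => IsCont.sum _ fun p _ => (IsCont.mulLeft _).comp
          ((cont_tau.smul _).comp (cont_homY _))) fun j f => ?_) (fun m => ?_) f'
    · rw [LinearMap.sum_apply]
      exact PowerSeries.coeff_mul j _ _ |>.trans (Finset.sum_congr rfl fun p _ => by
        rw [LinearMap.comp_apply, sigmaL_apply, coeff_sigma, homSerL_apply, coeff_homSer]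
        rfl)
    · obtain ⟨v, l, rfl⟩ := exists_xyWord m
      simp only [LinearMap.comp_apply, LinearMap.mulLeft_apply, LinearMap.mulRight_apply,
        homSerL_apply, sigmaL_apply, neg_mul]
      exact key u k v l
  set d : VG K G := betaX (antiX K G f') * basis K ve1
  set H : PowerSeries (KY K G) := sigma (homSer f')
  suffices h : (varpiInv ∘ₗ LinearMap.mulRight K (-d) ∘ₗ LinearMap.mulRight K c ∘ₗ betaX) f =
      (diagPart n g ∘ₗ LinearMap.mulRight K H ∘ₗ
      LinearMap.mulRight K (PowerSeries.C (ySum K G)) ∘ₗ homSerL K G) f by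
    simpa only [LinearMap.comp_apply, LinearMap.mulRight_apply, homSerL_apply, mul_neg] using h
  refine IsCont.ext_apply
    (cont_varpiInv.comp ((IsCont.mulRight _).comp ((IsCont.mulRight _).comp isHom_betaX.cont)))
    (IsCont.diagPart n g (U := fun j => ∑ p ∈ Finset.HasAntidiagonal.antidiagonal j,
        LinearMap.mulRight K (PowerSeries.coeff p.2 H) ∘ₗ
          LinearMap.mulRight K (ySum K G) ∘ₗ homY p.1)
      (fun j => IsCont.sum _ fun p _ => (IsCont.mulRight _).comp
        ((IsCont.mulRight _).comp (cont_homY _))) fun j f => ?_) (fun m => ?_) f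
  · rw [LinearMap.sum_apply]
    exact PowerSeries.coeff_mul j _ _ |>.trans (Finset.sum_congr rfl fun p _ => by
      rw [LinearMap.comp_apply, LinearMap.mulRight_apply, PowerSeries.coeff_mul_C, homSerL_apply,
        coeff_homSer]
      rfl)
  · obtain ⟨u, k, rfl⟩ := exists_xyWord m
    simp only [LinearMap.comp_apply, LinearMap.mulRight_apply, homSerL_apply, mul_neg]
    exact h1 u k

end Formula

/-! ### Left multiplication by power series in `x₁`, seen in `homSer`. -/

section Letters

variable {K : Type u} [CommRing K] {G : Type v} [CommGroup G]

variable (K G) in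
/-- The power series obtained by the substitution of `y_{1,1}` times the variable. -/
noncomputable def psY : PowerSeries K →ₗ[K] PowerSeries (KY K G) where
  toFun p := PowerSeries.mk fun n => PowerSeries.coeff n p • yl K ((1 : ℕ+), (1 : G)) ^ n
  map_add' p p' := by
    ext n : 1
    simp only [map_add, PowerSeries.coeff_mk, add_smul]
  map_smul' c p := by
    ext n : 1
    simp only [map_smul, PowerSeries.coeff_mk, PowerSeries.coeff_smul, smul_eq_mul,
      RingHom.id_apply, mul_smul]

theorem coeff_psY (p : PowerSeries K) (n : ℕ) : PowerSeries.coeff n (psY K G p) =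
    PowerSeries.coeff n p • yl K ((1 : ℕ+), (1 : G)) ^ n :=
  PowerSeries.coeff_mk n fun n => PowerSeries.coeff n p • yl K ((1 : ℕ+), (1 : G)) ^ n

theorem psY_X_pow (n : ℕ) : psY K G (PowerSeries.X ^ n) =
    PowerSeries.monomial n (yl K ((1 : ℕ+), (1 : G)) ^ n) := by
  ext m : 1
  rw [coeff_psY, PowerSeries.coeff_X_pow, PowerSeries.coeff_monomial]
  split_ifs with h
  · rw [one_smul, h]
  · rw [zero_smul]

theorem sigma_psY (p : PowerSeries K) : sigma (psY K G p) = psY K G (negVar K p) := by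
  ext n : 1
  rw [coeff_sigma, coeff_psY, coeff_psY, coeff_negVar, map_smul, smul_smul]
  congr 1
  induction n with
  | zero => rw [pow_zero, tau_one]
  | succ n ih =>
    rw [pow_succ, tau_mul, ih, tau_basis, tauWord_of, inv_one, ← pow_succ', pow_succ]

variable [Finite G]

/-- A leading `x₁` becomes the letter `y_{1,1}`, raises the degree by one and leaves the labels that
follow unchanged. -/
theorem homSer_xg_one_mul (f : KX K G) : homSer (xg K 1 * f) =
    PowerSeries.monomial 1 (yl K ((1 : ℕ+), (1 : G))) * homSer f := by
  have hX : (PowerSeries.monomial 1 (yl K ((1 : ℕ+), (1 : G))) : PowerSeries (KY K G)) =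
      PowerSeries.C (yl K ((1 : ℕ+), (1 : G))) * PowerSeries.X := by
    rw [PowerSeries.X_eq, ← PowerSeries.monomial_zero_eq_C_apply,
      PowerSeries.monomial_mul_monomial, zero_add, mul_one]
  have hw : ∀ (w : YWord G) (k : ℕ), xg K 1 * basis K (xyWord 1 w * w0 ^ k) =
      basis K (xyWord 1 (FreeMonoid.of ((1 : ℕ+), (1 : G)) * w) * w0 ^ k) := fun w k => by
    rw [xg, basis_mul_basis, xyWord_of_mul, mul_one]
    rfl
  ext j : 1
  rw [hX, mul_assoc, PowerSeries.coeff_C_mul, coeff_homSer]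
  rcases j with _ | j
  · rw [PowerSeries.coeff_zero_X_mul, mul_zero]
    refine ((cont_homY 0).comp (IsCont.mulLeft (xg K 1))).ext_apply IsCont.zero (fun m => ?_) f
    obtain ⟨w, k, rfl⟩ := exists_xyWord m
    rw [LinearMap.comp_apply, LinearMap.mulLeft_apply, hw, homY_basis, deg_mul, deg_of_Y, if_neg]
    · rfl
    · rw [PNat.one_coe]; omega
  · rw [PowerSeries.coeff_succ_X_mul, coeff_homSer]
    refine ((cont_homY (j + 1)).comp (IsCont.mulLeft (xg K 1))).ext_apply
      ((IsCont.mulLeft _).comp (cont_homY j)) (fun m => ?_) f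
    obtain ⟨w, k, rfl⟩ := exists_xyWord m
    rw [LinearMap.comp_apply, LinearMap.comp_apply, LinearMap.mulLeft_apply,
      LinearMap.mulLeft_apply, hw, homY_basis, homY_basis, deg_mul, deg_of_Y, PNat.one_coe]
    by_cases h : deg w + k = j
    · rw [if_pos (by omega), if_pos h, basis_mul_basis]
    · rw [if_neg (by omega), if_neg h, mul_zero]

theorem homSer_evalPS_mul (p : PowerSeries K) (f : KX K G) :
    homSer (evalPS p (xg K 1) * f) = psY K G p * homSer f := by
  have hX : ∀ n : ℕ, homSer (xg K 1 ^ n * f) =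
      PowerSeries.monomial n (yl K ((1 : ℕ+), (1 : G)) ^ n) * homSer f := fun n => by
    induction n with
    | zero =>
      rw [pow_zero, pow_zero, one_mul, PowerSeries.monomial_zero_eq_C_apply, map_one, one_mul]
    | succ n ih =>
      rw [pow_succ', mul_assoc, homSer_xg_one_mul, ih, ← mul_assoc,
        PowerSeries.monomial_mul_monomial, add_comm 1, ← pow_succ']
  ext j : 1
  rw [coeff_homSer]
  refine ext_powerSeries (T := homY j ∘ₗ LinearMap.mulRight K f ∘ₗ evalL (xg K 1))
    (U := (PowerSeries.coeff j : _ →ₗ[KY K G] _).restrictScalars K ∘ₗ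
      LinearMap.mulRight K (homSer f) ∘ₗ psY K G)
    ((cont_homY j).comp ((IsCont.mulRight f).comp (cont_evalL _))) (fun w => ?_) (fun n => ?_) p
  · refine ⟨Finset.range (j + 1), fun q hq => ?_⟩
    simp only [LinearMap.comp_apply, LinearMap.mulRight_apply, LinearMap.restrictScalars_apply,
      LinearEquiv.coe_coe]
    rw [PowerSeries.coeff_mul, Finset.sum_eq_zero, coeff_zero]
    intro p hp
    rw [Finset.HasAntidiagonal.mem_antidiagonal] at hp
    rw [coeff_psY, coeff_psSer_symm, hq _ (Finset.mem_range.2 (by omega)), zero_smul, zero_mul]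
  · simp only [LinearMap.comp_apply, LinearMap.mulRight_apply, LinearMap.restrictScalars_apply]
    rw [evalL_apply, evalPS_X_pow (ord_xg 1), psY_X_pow, ← hX, coeff_homSer]

end Letters

/-! ### The images of the letters of `Y` under `^Γaut^Y`. -/

section Automorphism

variable {K : Type u} [CommRing K] [Algebra ℚ K] {G : Type v} [CommGroup G] [Fintype G] (ε : ℤˣ)

/-- The power series over `K⟨⟨Y⟩⟩` that corresponds to `g ↦ Γ_Ψ⁻¹(x₁) Ψ g Ψ⁻¹ Γ_Ψ(x₁)`, up to a factor. -/
noncomputable def adjSer (Ψ : GroupLike K G) : PowerSeries (KY K G) :=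
  homSer (GamInvX ε Ψ * Ψ.ser) * PowerSeries.C (ySum K G) *
    sigma (homSer (GamInvX ε Ψ * Ψ.ser))

/-- `Γ_Ψ(x) Γ_Ψ(-x)` -/
noncomputable def GamSym (Ψ : GroupLike K G) : PowerSeries K :=
  negVar K (negVar K (Gam ε Ψ) * Gam ε Ψ)

/-- `aut^{V,(0)}` fixes `e₀^{n-1} g` and `^Γaut` fixes `e₁`, so the image is obtained from `e₀^{n-1}
g` by conjugation, and `varpiInv_betaX_mul` applies. -/
theorem GamAutY_yl (Ψ : GroupLike K G) (a : ℕ+ × G) : GamAutY ε Ψ (yl K a) =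
    diagPart a.1 a.2 (adjSer ε Ψ * psY K G (GamSym ε Ψ)) := by
  have hx : betaX (xg K 1) = (-basis K ve1 : VG K G) := by
    rw [betaX_xg, inv_one, vgrp_one, one_mul, mul_one]
  have hA : betaX (GamInvX ε Ψ * Ψ.ser) = conjV ε Ψ := by
    rw [isHom_betaX.map_mul, betaX_GamInvX]
    rfl
  have hA' : betaX (Ψ.serInv * evalPS (Gam ε Ψ) (xg K 1)) = conjVInv ε Ψ := by
    rw [isHom_betaX.map_mul, isHom_betaX.map_evalPS (ord_xg 1) (hx ▸ ord_neg_ve1), hx]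
    rfl
  -- The antipode turns `Ψ⁻¹Γ(x₁)` into `Γ(-x₁)Ψ`. Written as `Γ(-x₁)Γ(x₁) · Γ⁻¹(x₁)Ψ`, it shows the
  -- series used on the left side of the conjugation, and the correction factor becomes `GamSym`.
  have hS : antiX K G (Ψ.serInv * evalPS (Gam ε Ψ) (xg K 1)) =
      evalPS (negVar K (Gam ε Ψ) * Gam ε Ψ) (xg K 1) * (GamInvX ε Ψ * Ψ.ser) := by
    rw [antiX_mul, antiX_evalPS, ← antiX_ser, antiX_antiX, evalPS_mul (ord_xg 1), GamInvX,
      mul_assoc, ← mul_assoc (evalPS (Gam ε Ψ) _), ← evalPS_mul (ord_xg 1), Gam_mul_inv,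
      evalPS_one (ord_xg 1), one_mul]
  have hc : autV0 Ψ (basis K (ve0 ^ ((a.1 : ℕ) - 1) * vgrp a.2)) =
      basis K (ve0 ^ ((a.1 : ℕ) - 1) * vgrp a.2) := by
    rw [← basis_mul_basis, ← basis_pow, (isHom_autV0 Ψ).map_mul, (isHom_autV0 Ψ).map_pow,
      autV0_e0, autV0_grp]
  have h1 : GamAutY ε Ψ (yl K a) = varpiInv (GamAutV1 ε Ψ (varpi (yl K a))) := rfl
  rw [h1, varpi_of, ← basis_mul_basis, map_neg, (isHom_GamAutV1 ε Ψ).map_mul, GamAutV1_e1,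
    GamAutV1_apply, hc, ← hA, ← hA', mul_assoc _ (betaX _) (basis K ve1), 
    ← antiX_antiX (Ψ.serInv * evalPS (Gam ε Ψ) (xg K 1)), varpiInv_betaX_mul, hS,
    homSer_evalPS_mul, sigma_mul, sigma_psY, ← mul_assoc]
  rfl

end Automorphism

/-! ### Powers of the primitive letter `y_{1,1}`. -/

section Primitive

variable {K : Type u} [CommRing K] {G : Type v} [CommGroup G] [Fintype G]

theorem coeff_yl_pow_eq_zero_of_deg {n : ℕ} {w : YWord G} (h : deg w ≠ n) :
    (yl K ((1 : ℕ+), (1 : G)) ^ n).coeff w = 0 := by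
  rw [basis_pow]
  refine coeff_basis_of_ne ?_
  rintro rfl
  refine h ?_
  clear h
  induction n with
  | zero => rw [pow_zero, deg_one]
  | succ n ih => rw [pow_succ, deg_mul, ih, deg_of_Y, PNat.one_coe]

theorem coeff_yl_pow_eq_zero_of_gdeg {n : ℕ} {w : YWord G} (h : gdeg G w ≠ 1) :
    (yl K ((1 : ℕ+), (1 : G)) ^ n).coeff w = 0 := by
  rw [basis_pow]
  refine coeff_basis_of_ne ?_
  rintro rfl
  exact h (by rw [map_pow, gdeg_of, one_pow])

theorem coeff_yl_pow_of {n : ℕ} (a : ℕ+ × G) (hn : 2 ≤ n) :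
    (yl K ((1 : ℕ+), (1 : G)) ^ n).coeff (FreeMonoid.of a) = 0 := by
  obtain ⟨n, rfl⟩ := Nat.exists_eq_add_of_le' hn
  rw [basis_pow, pow_succ', pow_succ']
  exact coeff_basis_of_ne (of_ne_of_mul _ _ _ _).symm

/-- The letter is primitive, so its power is expanded by the binomial theorem; the weight of `u`
leaves one term of the expansion. -/
theorem coeff_deltaAlg_yl_pow (n : ℕ) (u w : YWord G) :
    (deltaAlg K (yl K ((1 : ℕ+), (1 : G)) ^ n)).coeff (u, w) =
      (n.choose (deg u) : K) * ((yl K ((1 : ℕ+), (1 : G)) ^ deg u).coeff u *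
        (yl K ((1 : ℕ+), (1 : G)) ^ (n - deg u)).coeff w) := by
  set y : KY K G := yl K ((1 : ℕ+), (1 : G)) with hy
  have h1 : deltaAlg K y = tmul y 1 + tmul 1 y := by
    rw [hy, deltaAlg_yl, Finset.Ico_self, Finset.sum_empty, add_zero, basis_prod, basis_prod,
      one_def]
  have hl : ∀ m : ℕ, (tmul y 1 : KYY K G) ^ m = tmul (y ^ m) 1 := fun m => by
    induction m with
    | zero => rw [pow_zero, pow_zero, tmul_one_one]
    | succ m ih => rw [pow_succ, ih, tmul_mul_tmul, one_mul, pow_succ]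
  have hr : ∀ m : ℕ, (tmul 1 y : KYY K G) ^ m = tmul 1 (y ^ m) := fun m => by
    induction m with
    | zero => rw [pow_zero, pow_zero, tmul_one_one]
    | succ m ih => rw [pow_succ, ih, tmul_mul_tmul, one_mul, pow_succ]
  have hc : Commute (tmul y 1 : KYY K G) (tmul 1 y) := by
    rw [Commute, SemiconjBy, tmul_mul_tmul, tmul_mul_tmul, one_mul, mul_one]
  rw [isHom_deltaAlg.map_pow, h1, hc.add_pow, coeff_sum]
  have h2 : ∀ m ∈ Finset.range (n + 1),
      ((tmul y 1 : KYY K G) ^ m * tmul 1 y ^ (n - m) * (n.choose m : KYY K G)).coeff (u, w) =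
      (n.choose m : K) * ((y ^ m).coeff u * (y ^ (n - m)).coeff w) := fun m _ => by
    rw [hl, hr, tmul_mul_tmul, one_mul, mul_one, ← Nat.cast_comm, ← nsmul_eq_mul,
      ← Nat.cast_smul_eq_nsmul K, coeff_smul, coeff_tmul]
  rw [Finset.sum_congr rfl h2]
  by_cases h : deg u ≤ n
  · refine Finset.sum_eq_single_of_mem (deg u) (Finset.mem_range.2 (by omega)) fun m _ hm => ?_
    rw [coeff_yl_pow_eq_zero_of_deg hm.symm, zero_mul, mul_zero]
  · rw [Nat.choose_eq_zero_of_lt (by omega), Nat.cast_zero, zero_mul]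
    refine Finset.sum_eq_zero fun m hm => ?_
    rw [coeff_yl_pow_eq_zero_of_deg, zero_mul, mul_zero]
    have := Finset.mem_range.1 hm
    omega

end Primitive

/-! ### The argument in low weights. -/

section Weight

variable {K : Type u} [CommRing K] [Algebra ℚ K] {G : Type v} [CommGroup G] [Fintype G]

/-- Otherwise any two nontrivial elements are inverse to the same nontrivial element and hence
equal, so that `G` has at most two elements. -/
theorem exists_mul_ne_one (h : 2 < Fintype.card G) : ∃ p q : G, p ≠ 1 ∧ q ≠ 1 ∧ q * p ≠ 1 := by
  classical
  obtain ⟨a, b, c, hab, hac, hbc⟩ := Fintype.two_lt_card_iff.1 h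
  by_contra! hn
  have key : ∀ x y : G, x ≠ 1 → y ≠ 1 → x = y := fun x y hx hy => by
    have h1 := hn x x hx hx
    have h2 := hn x y hx hy
    exact mul_right_cancel (h1.trans h2.symm)
  by_cases ha : a = 1
  · exact hbc (key b c (fun h => hab (ha.trans h.symm)) fun h => hac (ha.trans h.symm))
  · by_cases hb : b = 1
    · exact hac (key a c ha fun h => hbc (hb.trans h.symm))
    · exact hab (key a b ha hb)

/-- A series that is primitive in low weights for the harmonic coproduct, satisfies the flatness
condition and whose part of the next weight and trivial `G`-degree is a multiple of a power of
`y_{1,1}` vanishes in low weights. -/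
theorem eq_zero_of_primitive {ξ : KY K G} {n : ℕ+} {γ : K}
    (h1 : ∀ w, deg w = (n : ℕ) + 2 → gdeg G w = 1 →
      ξ.coeff w = -γ * (yl K ((1 : ℕ+), (1 : G)) ^ ((n : ℕ) + 2)).coeff w)
    (h2 : ∀ u v, deg u + deg v ≤ (n : ℕ) + 2 → (deltaAlg K ξ).coeff (u, v) =
      (ySum K G).coeff u * ξ.coeff v + ξ.coeff u * (ySum K G).coeff v)
    (h3 : ∀ w, (raise K G ξ).coeff w = ((deg w : K) - ((n : ℕ) + 1 : ℕ)) * ξ.coeff w)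
    (h4 : n = 1 → Fintype.card G ≤ 2 → γ = 0) :
    γ = 0 ∧ ∀ w, deg w ≤ (n : ℕ) + 1 → ξ.coeff w = 0 := by
  have s1 : ∀ u v, deg u + deg v = (n : ℕ) + 2 → gdeg G u * gdeg G v = 1 →
      (ySum K G).coeff u * ξ.coeff v + ξ.coeff u * (ySum K G).coeff v =
        -γ * (((n : ℕ) + 2).choose (deg u) * ((yl K ((1 : ℕ+), (1 : G)) ^ deg u).coeff u *
          (yl K ((1 : ℕ+), (1 : G)) ^ ((n : ℕ) + 2 - deg u)).coeff v)) := fun u v hd hg => by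
    rw [← h2 u v hd.le, ← coeff_deltaAlg_yl_pow, ← coeff_smul, ← map_smul]
    exact coeff_deltaAlg_congr fun m hm hm' => h1 m (hm.trans hd) (hm'.trans hg)
  have hof : ∀ g : G, (deg (FreeMonoid.of ((1 : ℕ+), g) : YWord G)) = 1 := fun g => by
    rw [deg_of_Y, PNat.one_coe]
  -- The first component is a single letter whose label makes the total `G`-degree trivial. The
  -- second has length at least two, where `ySum` vanishes, so `ξ` is isolated there.
  have s2 : ∀ a b v, deg (FreeMonoid.of a * (FreeMonoid.of b * v) : YWord G) = (n : ℕ) + 1 →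
      ξ.coeff (FreeMonoid.of a * (FreeMonoid.of b * v)) = -γ * (((n : ℕ) + 2 : ℕ) *
        (yl K ((1 : ℕ+), (1 : G)) ^ ((n : ℕ) + 1)).coeff (FreeMonoid.of a * (FreeMonoid.of b * v)))
      := fun a b v hd => by
    have hs := s1 (FreeMonoid.of (1, (gdeg G (FreeMonoid.of a * (FreeMonoid.of b * v)))⁻¹))
      (FreeMonoid.of a * (FreeMonoid.of b * v))
      (by rw [hof, hd]; omega) (by rw [gdeg_of, inv_mul_cancel])
    rw [coeff_ySum_of, coeff_ySum_of_mul_of_mul, hof, one_mul, mul_zero, add_zero,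
      Nat.choose_one_right, pow_one, show (n : ℕ) + 2 - 1 = n + 1 by omega] at hs
    rw [hs]
    by_cases hg : gdeg G (FreeMonoid.of a * (FreeMonoid.of b * v)) = 1
    · rw [hg, inv_one, coeff_basis_self, one_mul]
    · rw [coeff_yl_pow_eq_zero_of_gdeg hg, mul_zero, mul_zero]
  -- Both components are letters, so both terms on the left survive; on the right the power
  -- `y_{1,1}^{n+1}` has no coefficient at a letter because `n + 1 ≥ 2`.
  have s3 : ∀ h : G, ξ.coeff (FreeMonoid.of (1, h)) = -ξ.coeff (FreeMonoid.of (n + 1, h⁻¹)) :=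
    fun h => by
      have hs := s1 (FreeMonoid.of (1, h)) (FreeMonoid.of (n + 1, h⁻¹))
        (by rw [hof, deg_of_Y, PNat.add_coe, PNat.one_coe]; omega)
        (by rw [gdeg_of, gdeg_of, mul_inv_cancel])
      rw [coeff_ySum_of, coeff_ySum_of, hof,
        coeff_yl_pow_of (n := (n : ℕ) + 2 - 1) _ (by have := n.pos; omega)] at hs
      linear_combination hs
  have s4 : ∀ p : G, ξ.coeff (FreeMonoid.of (n, p)) =
      -((n : ℕ) * ξ.coeff (FreeMonoid.of (n + 1, p))) := fun p => by
    have hs := h3 (FreeMonoid.of (n, p))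
    rw [coeff_raise_of, deg_of_Y] at hs
    push_cast at hs
    linear_combination hs
  have s5 : ∀ w, deg w = (n : ℕ) + 1 → ξ.coeff w =
      (ξ.coeff (FreeMonoid.of (n + 1, gdeg G w)) • yl K (n + 1, gdeg G w) +
        (-γ * ((n : ℕ) + 2 : ℕ)) • yl K ((1 : ℕ+), (1 : G)) ^ ((n : ℕ) + 1)).coeff w := fun w hw => by
    rw [coeff_add, coeff_smul, coeff_smul]
    rcases word_cases w with rfl | ⟨a, rfl⟩ | ⟨a, b, w, rfl⟩
    · rw [deg_one] at hw
      omega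
    · have ha : a = (n + 1, a.2) := Prod.ext (PNat.coe_injective (by
        rw [← deg_of_Y a, hw]; rfl)) rfl
      rw [gdeg_of, ← ha, coeff_basis_self, coeff_yl_pow_of _ (by have := n.pos; omega)]
      ring
    · rw [s2 a b w hw, coeff_basis_of_ne (of_ne_of_mul _ _ _ _)]
      ring
  set C : G → K := fun p => ξ.coeff (FreeMonoid.of (n + 1, p)) with hC
  have hCd : ∀ p, ξ.coeff (FreeMonoid.of (n + 1, p)) = C p := fun _ => rfl
  -- Primitivity is now used one weight lower, at `(y_{1,q}, y_{n,p})`; `s3`, `s4` and `s5` express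
  -- all terms by the coefficients `C` at the letters of weight `n + 1` and by `γ`.
  have hR : ∀ q p : G, C (q * p) + -γ * ((n : ℕ) + 2 : ℕ) * (((n : ℕ) + 1 : ℕ) *
      ((yl K ((1 : ℕ+), (1 : G))).coeff (FreeMonoid.of (1, q)) *
        (yl K ((1 : ℕ+), (1 : G)) ^ (n : ℕ)).coeff (FreeMonoid.of (n, p)))) =
      -((n : ℕ) * C p) - C q⁻¹ := fun q p => by
    classical
    have hs := h2 (FreeMonoid.of (1, q)) (FreeMonoid.of (n, p)) 
      (by rw [hof, deg_of_Y]; change 1 + (n : ℕ) ≤ n + 2; omega)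
    rw [coeff_ySum_of, coeff_ySum_of, s3, s4, coeff_deltaAlg_congr (g := C (q * p) •
      yl K (n + 1, q * p) + (-γ * ((n : ℕ) + 2 : ℕ)) • yl K ((1 : ℕ+), (1 : G)) ^ ((n : ℕ) + 1)),
      map_add, map_smul, map_smul, coeff_add, coeff_smul, coeff_smul, coeff_deltaAlg_yl, if_pos,
      coeff_ySum_of, coeff_ySum_of, coeff_deltaAlg_yl_pow, hof, pow_one, Nat.choose_one_right,
      Nat.add_sub_cancel] at hs
    · rw [hCd, hCd] at hs
      linear_combination hs
    · rw [hof, deg_of_Y, gdeg_of, gdeg_of, PNat.add_coe, PNat.one_coe]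
      exact ⟨add_comm _ _, rfl⟩
    · intro m hm hg
      rw [gdeg_of, gdeg_of] at hg
      rw [s5 m (by rw [hm, hof, deg_of_Y, add_comm]), hg]
  have hγ : γ = 0 := by
    by_cases hn : n = 1
    · subst hn
      by_cases hG : Fintype.card G ≤ 2
      · exact h4 rfl hG
      -- With `p`, `q` and `qp` all nontrivial, the relation at `(q, p)` contains no `γ`. Combined
      -- with those at `(1, 1)` and at `(1, p')` for `p' ≠ 1`, it forces `18γ = 0`.
      obtain ⟨p, q, hp, hq, hqp⟩ := exists_mul_ne_one (not_le.1 hG)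
      have hz : ∀ p : G, p ≠ 1 →
          (yl K ((1 : ℕ+), (1 : G))).coeff (FreeMonoid.of ((1 : ℕ+), p)) = 0 := fun p hp =>
        coeff_basis_of_ne fun h => hp (congrArg Prod.snd (FreeMonoid.of_injective h))
      have e1 := hR 1 1
      have e2 : ∀ p, p ≠ 1 → 2 * C p = - C 1 := fun p hp => by
        have := hR 1 p
        rw [PNat.one_coe, pow_one, hz p hp, one_mul, inv_one] at this
        push_cast at this
        linear_combination this
      have e3 := hR q p
      rw [hz q hq] at e3
      have e4 := e2 q⁻¹ (inv_ne_one.2 hq)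
      rw [PNat.one_coe, pow_one, coeff_basis_self, inv_one, one_mul] at e1
      rw [PNat.one_coe] at e3
      push_cast at e1 e3
      have h18 : ((18 : ℕ) : K) * γ = 0 := by
        push_cast
        linear_combination -3 * e1 - 6 * e3 + 3 * e2 (q * p) hqp + 3 * e2 p hp + 3 * e4
      exact (isUnit_natCast (by norm_num)).mul_right_eq_zero.1 h18
    · have hn2 : 2 ≤ (n : ℕ) := by
        have := n.pos
        have : (n : ℕ) ≠ 1 := fun h => hn (PNat.coe_injective h)
        omega
      obtain ⟨m, hm⟩ := Nat.exists_eq_add_of_le' hn2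
      have hd : ∀ m, deg (FreeMonoid.of ((1 : ℕ+), (1 : G)) ^ m : YWord G) = m := fun m => by
        induction m with
        | zero => rw [pow_zero, deg_one]
        | succ m ih => rw [pow_succ, deg_mul, ih, hof]
      -- For `n ≥ 2` both components have length at least two, so the left side vanishes and only
      -- the binomial coefficient `(n + 2 choose 2)` times `γ` remains; for `n = 1` the second
      -- component would be a single letter.
      have hs := s1 (FreeMonoid.of (1, 1) ^ 2) (FreeMonoid.of (1, 1) ^ (m + 2))
        (by rw [hd, hd, hm]; omega) (by rw [map_pow, map_pow, gdeg_of, one_pow, one_pow, one_mul])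
      have hZ : ∀ m, (ySum K G).coeff (FreeMonoid.of ((1 : ℕ+), (1 : G)) ^ (m + 2)) = 0 :=
        fun m => by rw [pow_succ', pow_succ', coeff_ySum_of_mul_of_mul]
      rw [hZ, show (2 : ℕ) = 0 + 2 from rfl, hZ, hd, basis_pow, basis_pow, coeff_basis_self,
        show (n : ℕ) + (0 + 2) - (0 + 2) = m + 2 by omega, coeff_basis_self] at hs
      have hc : (((n : ℕ) + 2).choose 2 : K) * γ = 0 := by linear_combination hs
      exact (isUnit_natCast (Nat.choose_pos (by omega)).ne').mul_right_eq_zero.1 hc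
  refine ⟨hγ, ?_⟩
  have hC0 : ∀ p, C p = 0 := fun p => by
    have e1 := hR 1 1
    have e2 := hR 1 p
    rw [hγ, inv_one, one_mul] at e1 e2
    have e3 : (((n : ℕ) + 2 : ℕ) : K) * C 1 = 0 := by
      push_cast
      linear_combination e1
    rw [(isUnit_natCast (by omega)).mul_right_eq_zero] at e3
    have e4 : (((n : ℕ) + 1 : ℕ) : K) * C p = 0 := by
      push_cast
      linear_combination e2 - e3
    exact (isUnit_natCast (by omega)).mul_right_eq_zero.1 e4
  have htop : ∀ w, deg w = (n : ℕ) + 1 → ξ.coeff w = 0 := fun w hw => by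
    rw [s5 w hw, hCd, hC0, hγ, neg_zero, zero_mul, zero_smul, zero_smul, add_zero, coeff_zero]
  -- Flatness carries the vanishing in weight `n + 1` down to all lower weights.
  have hlow : ∀ k w, deg w + k = (n : ℕ) + 1 → ξ.coeff w = 0 := fun k => by
    induction k with
    | zero => exact fun w hw => htop w hw
    | succ k ih =>
      intro w hw
      have hs := h3 w
      rw [coeff_raise_eq_zero fun m hm _ => ih m (by omega), ← hw] at hs
      push_cast at hs
      have hs' : ((k + 1 : ℕ) : K) * ξ.coeff w = 0 := by
        push_cast
        linear_combination hs
      exact (isUnit_natCast (by omega)).mul_right_eq_zero.1 hs'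
  exact fun w hw => hlow ((n : ℕ) + 1 - deg w) w (by omega)

end Weight

/-! ### Vanishing of the low weights of `adjSer`, by induction on the power of the variable. -/

section Vanishing

variable {K : Type u} [CommRing K] [Algebra ℚ K] {G : Type v} [CommGroup G] [Fintype G] (ε : ℤˣ)

theorem homY_zero {f : KX K G} (hf : f.coeff 1 = 1) : homY 0 f = 1 := by
  ext u
  rw [coeff_homY, one_def]
  by_cases h : u = 1
  · subst h
    rw [coeff_basis_self, if_pos (by rw [deg_one]), deg_one, pow_zero, mul_one, xyWord_one, hf]
  · rw [coeff_basis_of_ne h, if_neg fun h' => h (eq_one_of_deg_Y u (Nat.le_zero.1 h'))]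

theorem coeff_one_GamInvX_mul (Ψ : GroupLike K G) : (GamInvX ε Ψ * Ψ.ser).coeff 1 = 1 := by
  rw [coeff_one_mul eq_one_of_deg_X, GamInvX, coeff_evalPS_one (ord_xg 1), constantCoeff_inv_Gam,
    Ψ.coeff_one_ser, one_mul]

theorem coeff_zero_adjSer (Ψ : GroupLike K G) : PowerSeries.coeff 0 (adjSer ε Ψ) = ySum K G := by
  rw [adjSer, PowerSeries.coeff_mul, Finset.Nat.antidiagonal_zero, Finset.sum_singleton,
    PowerSeries.coeff_mul_C, coeff_sigma, coeff_homSer, homY_zero (coeff_one_GamInvX_mul ε Ψ),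
    tau_one, pow_zero, one_smul, one_mul, mul_one]

theorem isFlat_adjSer (Ψ : GroupLike K G) (h : Ψ.ser.coeff w0 = 0) : IsFlat (adjSer ε Ψ) :=
  have hA := isFlat_homSer (dX0_GamInvX_mul ε Ψ h)
  (hA.mul isFlat_C_ySum).mul hA.sigma

theorem coeff_mul_of {A : Type*} [FinGraded (FreeMonoid A)]
    (hM : ∀ m : FreeMonoid A, deg m = 0 → m = 1) (f f' : NCSeries K (FreeMonoid A)) (a : A) :
    (f * f').coeff (FreeMonoid.of a) =
      f.coeff (FreeMonoid.of a) * f'.coeff 1 + f.coeff 1 * f'.coeff (FreeMonoid.of a) := by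
  have h : ∀ f : NCSeries K (FreeMonoid A), f.coeff (FreeMonoid.of a) = (lderiv K a f).coeff 1 :=
    fun f => by rw [coeff_lderiv, mul_one]
  rw [h, lderiv_mul, coeff_add, coeff_smul, coeff_one_mul hM, ← h, ← h]

theorem coeff_evalPS_xg_one (p : PowerSeries K) {g : G} (hg : g ≠ 1) :
    (evalPS p (xg K 1)).coeff (wg g) = 0 :=
  (IsCont.lsum _).coeff_eq_zero (fun n => by
    rw [(locFin_pow (ord_xg 1)).lsum_basis, xg, basis_pow]
    refine coeff_basis_of_ne ?_
    rcases n with _ | _ | n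
    · exact FreeMonoid.of_ne_one _
    · rw [zero_add, pow_one]
      exact fun h => hg (Option.some.inj (FreeMonoid.of_injective h))
    · rw [pow_succ', pow_succ']
      exact (of_ne_of_mul _ _ _ _).symm) _

/-- The two outer factors contribute the coefficients at `x_g` and, with the sign from `sigma`, at
`x_{g⁻¹}`; by the symmetry hypothesis they cancel. -/
theorem coeff_one_adjSer (Ψ : GroupLike K G) (hΨ : ∀ g : G, Ψ.ser.coeff (wg g) =
    Ψ.ser.coeff (wg g⁻¹)) (g : G) :
    (PowerSeries.coeff 1 (adjSer ε Ψ)).coeff (FreeMonoid.of ((1 : ℕ+), g)) = 0 := by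
  have h1 := coeff_one_GamInvX_mul ε Ψ
  have hA : ∀ g : G, (homY 1 (GamInvX ε Ψ * Ψ.ser)).coeff (FreeMonoid.of ((1 : ℕ+), g)) =
      (GamInvX ε Ψ * Ψ.ser).coeff (wg g) := fun g => by
    rw [coeff_homY, deg_of_Y, PNat.one_coe, if_pos le_rfl, xyWord_of, PNat.one_coe, Nat.sub_self,
      pow_zero, one_mul, mul_one, one_mul]
  have hg : (GamInvX ε Ψ * Ψ.ser).coeff (wg g) = (GamInvX ε Ψ * Ψ.ser).coeff (wg g⁻¹) := by
    by_cases h : g = 1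
    · rw [h, inv_one]
    · rw [wg, wg, coeff_mul_of eq_one_of_deg_X, coeff_mul_of eq_one_of_deg_X, ← wg, ← wg, GamInvX,
        coeff_evalPS_xg_one _ h, coeff_evalPS_xg_one _ (inv_ne_one.2 h), hΨ]
  rw [adjSer, PowerSeries.coeff_mul, Finset.Nat.sum_antidiagonal_eq_sum_range_succ_mk,
    Finset.sum_range_succ, Finset.sum_range_succ, Finset.sum_range_zero, zero_add, Nat.sub_self,
    Nat.sub_zero, PowerSeries.coeff_mul_C, PowerSeries.coeff_mul_C, coeff_sigma, coeff_sigma,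
    coeff_homSer, coeff_homSer, homY_zero h1, tau_one, pow_zero, one_smul, mul_one, one_mul,
    pow_one, neg_one_smul, coeff_add, coeff_mul_of eq_one_of_deg_Y, coeff_mul_of eq_one_of_deg_Y,
    coeff_neg, coeff_neg, coeff_tau, coeff_tau, tauWord_one, tauWord_of, hA, hA, hg, coeff_ySum_one,
    coeff_ySum_of]
  ring

theorem coeff_GamSym_zero (Ψ : GroupLike K G) : PowerSeries.coeff 0 (GamSym ε Ψ) = 1 := by
  rw [GamSym, coeff_negVar, PowerSeries.coeff_mul, Finset.Nat.antidiagonal_zero,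
    Finset.sum_singleton, coeff_negVar, coeff_Gam_of_lt_two ε Ψ (by omega)]
  simp

theorem coeff_GamSym_one (Ψ : GroupLike K G) : PowerSeries.coeff 1 (GamSym ε Ψ) = 0 := by
  have h0 := coeff_Gam_of_lt_two ε Ψ (n := 0) (by omega)
  have h1 := coeff_Gam_of_lt_two ε Ψ (n := 1) (by omega)
  rw [GamSym, coeff_negVar, PowerSeries.coeff_mul,
    Finset.Nat.sum_antidiagonal_eq_sum_range_succ_mk]
  simp [Finset.sum_range_succ, coeff_negVar, h0, h1]

theorem coeff_GamSym_two (Ψ : GroupLike K G) (h : Ψ.ser.coeff (w0 * wg 1) = 0) :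
    PowerSeries.coeff 2 (GamSym ε Ψ) = 0 := by
  have h0 := coeff_Gam_of_lt_two ε Ψ (n := 0) (by omega)
  have h1 := coeff_Gam_of_lt_two ε Ψ (n := 1) (by omega)
  have h2 := coeff_two_Gam ε Ψ h
  rw [GamSym, coeff_negVar, PowerSeries.coeff_mul,
    Finset.Nat.sum_antidiagonal_eq_sum_range_succ_mk]
  simp [Finset.sum_range_succ, coeff_negVar, h0, h1, h2]

/-- The part of bidegree `(1, 1)` of this product is the image of `y_{1,1}`, hence `y_{1,1}` itself,
which has no terms of weight greater than `1`. -/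
theorem coeff_adjSer_mul_psY (Ψ : GroupLike K G) {w : YWord G} {j : ℕ} (hj : 1 ≤ j)
    (hw : deg w = j + 1) (hg : gdeg G w = 1) :
    (PowerSeries.coeff j (adjSer ε Ψ * psY K G (GamSym ε Ψ))).coeff w = 0 := by
  classical
  have h : yl K ((1 : ℕ+), (1 : G)) =
      diagPart ((1 : ℕ+) : ℕ) 1 (adjSer ε Ψ * psY K G (GamSym ε Ψ)) :=
    (GamAutY_y1 ε Ψ).symm.trans (GamAutY_yl ε Ψ (1, 1))
  have h' := congrArg (fun f => f.coeff w) h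
  simp only [coeff_diagPart] at h'
  rw [PNat.one_coe, hw, if_pos ⟨by omega, hg⟩, Nat.add_sub_cancel, coeff_basis_of_ne] at h'
  · exact h'.symm
  · rintro rfl
    rw [deg_of_Y, PNat.one_coe] at hw
    omega

/-- The symmetry of the coefficients of weight one of the elements of the double shuffle group. -/
theorem DMR0.coeff_wg_inv {Ψ : GroupLike K G} (h : Ψ ∈ DMR0 K G ε) (g : G) :
    Ψ.ser.coeff (wg g) = Ψ.ser.coeff (wg g⁻¹) := by
  rcases le_or_gt 3 (Fintype.card G) with h3 | h3
  · exact h.2.2.2.2 h3 g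
  · by_cases h1 : g = 1
    · rw [h1, inv_one]
    · by_cases h2 : g = g⁻¹
      · rw [← h2]
      · have := Fintype.two_lt_card_iff.2 ⟨1, g, g⁻¹, Ne.symm h1, (inv_ne_one.2 h1).symm, h2⟩
        omega

/-- By induction the lower coefficients of `adjSer` are trivial in low weights. Its coefficient of
`tʲ` is therefore primitive there, relative to `ySum`, while the invariance of `y_{1,1}` fixes its
part of weight `j + 1` and trivial `G`-degree up to the coefficient of `xʲ` in `GamSym`. Then
`eq_zero_of_primitive` applies. -/
theorem adjSer_vanishing {Ψ : GroupLike K G} (h : Ψ ∈ DMR0 K G ε) (j : ℕ) (hj : 1 ≤ j) :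
    PowerSeries.coeff j (GamSym ε Ψ) = 0 ∧
      ∀ w, deg w ≤ j → (PowerSeries.coeff j (adjSer ε Ψ)).coeff w = 0 := by
  have hA := isGroupLike_homSer ε Ψ h.1 h.2.2.1
  have hgl : IsGroupLike (adjSer ε Ψ) := (hA.mul isGroupLike_C_ySum).mul hA.sigma
  have hfl := isFlat_adjSer ε Ψ h.1
  induction j using Nat.strong_induction_on with
  | _ j ih =>
  rcases Nat.lt_or_ge 1 j with hj1 | hj1
  · obtain ⟨n, rfl⟩ : ∃ n : ℕ+, j = (n : ℕ) + 1 :=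
      ⟨⟨j - 1, by omega⟩, by rw [PNat.mk_coe]; omega⟩
    refine eq_zero_of_primitive (fun w hw hg => ?_) (fun u v huv => ?_) (hfl.coeff_eq _)
      (fun hn hG => ?_)
    · have hs := coeff_adjSer_mul_psY ε Ψ hj hw hg
      rw [PowerSeries.coeff_mul, coeff_sum] at hs
      -- The indices set aside are the constant term `1` of `GamSym` and the unknown `γ`; the
      -- coefficients in between vanish by induction.
      have hz : ∀ p ∈ Finset.HasAntidiagonal.antidiagonal ((n : ℕ) + 1), p ≠ ((n : ℕ) + 1, 0) →
          p ≠ (0, (n : ℕ) + 1) → PowerSeries.coeff p.2 (GamSym ε Ψ) = 0 := fun p hp h1 h2 => by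
        rw [Finset.HasAntidiagonal.mem_antidiagonal] at hp
        refine (ih p.2 ?_ ?_).1
        · rcases Nat.eq_zero_or_pos p.1 with h | h
          · exact absurd (Prod.ext h (by omega)) h2
          · omega
        · rcases Nat.eq_zero_or_pos p.2 with h | h
          · exact absurd (Prod.ext (by omega) h) h1
          · omega
      rw [Finset.sum_eq_add (((n : ℕ) + 1, 0) : ℕ × ℕ) (0, (n : ℕ) + 1) (by simp)
        (fun p hp h12 => by rw [coeff_psY, hz p hp h12.1 h12.2, zero_smul, mul_zero, coeff_zero])
        (fun h => (h (by simp)).elim) (fun h => (h (by simp)).elim), coeff_psY,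
        coeff_psY, coeff_GamSym_zero, one_smul, pow_zero, mul_one, coeff_zero_adjSer,
        mul_smul_comm, coeff_smul] at hs
      -- In weight `n + 2` and trivial `G`-degree the factor taken from `ySum` must have weight `1`
      -- and label `1`, so it is `y_{1,1}`.
      have hy : (ySum K G * yl K ((1 : ℕ+), (1 : G)) ^ ((n : ℕ) + 1)).coeff w =
          (yl K ((1 : ℕ+), (1 : G)) ^ ((n : ℕ) + 2)).coeff w := by
        rw [pow_succ' _ ((n : ℕ) + 1), basis_pow]
        have := coeff_basis_mul_mul_basis_congr (K := K) (u := 1) (w := w)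
          (v := FreeMonoid.of ((1 : ℕ+), (1 : G)) ^ ((n : ℕ) + 1)) (f := ySum K G)
          (f' := yl K ((1 : ℕ+), (1 : G))) fun m hm hm' => by
            have hd : ∀ m, deg (FreeMonoid.of ((1 : ℕ+), (1 : G)) ^ m : YWord G) = m := fun m => by
              induction m with
              | zero => rw [pow_zero, deg_one]
              | succ m ih => rw [pow_succ, deg_mul, ih, deg_of_Y, PNat.one_coe]
            refine coeff_ySum_eq_coeff_yl ?_ ?_
            · rw [deg_one, hd, hw] at hm
              rw [PNat.one_coe]
              omega
            · rwa [map_one, one_mul, map_pow, gdeg_of, one_pow, mul_one, hg] at hm'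
        rwa [← one_def, one_mul, one_mul] at this
      rw [hy] at hs
      linear_combination hs
    · rw [hgl, coeff_sum, Finset.sum_eq_add ((0, (n : ℕ) + 1) : ℕ × ℕ) ((n : ℕ) + 1, 0) (by simp)
        (fun p hp h12 => ?_) (fun h => (h (by simp)).elim) (fun h => (h (by simp)).elim),
        coeff_tmul, coeff_tmul, coeff_zero_adjSer]
      rw [Finset.HasAntidiagonal.mem_antidiagonal] at hp
      have hp1 : p.1 ≠ 0 := fun h => h12.1 (Prod.ext h (by omega))
      have hp2 : p.2 ≠ 0 := fun h => h12.2 (Prod.ext (by omega) h)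
      rw [coeff_tmul]
      -- As `deg u + deg v ≤ p.1 + p.2 + 1`, either `deg u ≤ p.1` or `deg v ≤ p.2`, and the
      -- induction hypothesis applies to that factor.
      rcases Nat.lt_or_ge p.1 (deg u) with hu | hu
      · rw [(ih p.2 (by omega) (by omega)).2 v (by omega), mul_zero]
      · rw [(ih p.1 (by omega) (by omega)).2 u hu, zero_mul]
    · subst hn
      exact coeff_GamSym_two ε Ψ (h.2.2.2.1 hG)
  · obtain rfl : j = 1 := by omega
    refine ⟨coeff_GamSym_one ε Ψ, fun w hw => ?_⟩
    rcases word_cases w with rfl | ⟨a, rfl⟩ | ⟨a, b, w, rfl⟩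
    · have hs := hfl.coeff_eq 1 1
      rw [coeff_raise_one, deg_one] at hs
      push_cast at hs
      linear_combination hs
    · rw [deg_of_Y] at hw
      obtain ⟨m, g⟩ := a
      obtain rfl : m = 1 := le_one_iff_eq_one.1 hw
      exact coeff_one_adjSer ε Ψ (DMR0.coeff_wg_inv ε h) g
    · rw [deg_mul, deg_mul, deg_of_Y, deg_of_Y] at hw
      have := a.1.pos
      have := b.1.pos
      omega

end Vanishing

/-! ### Compatibility with the harmonic coproduct on letters, and the subgroups. -/

section Conclusion

/-- The substitution `(i, k) ↦ (d - i, e - k)` turns shifts into exponents; terms with `i > d` or `k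
> e` vanish on both sides. -/
theorem sum_antidiagonal_reflect {K : Type*} [CommRing K] {A B : ℕ → K} {d e : ℕ}
    (hA : ∀ i, d < i → A i = 0) (hB : ∀ i, e < i → B i = 0) (n : ℕ) :
    (∑ p ∈ Finset.HasAntidiagonal.antidiagonal n,
      (if p.1 ≤ d then A (d - p.1) else 0) * (if p.2 ≤ e then B (e - p.2) else 0)) =
      if n ≤ d + e then
        ∑ p ∈ Finset.HasAntidiagonal.antidiagonal (d + e - n), A p.1 * B p.2 else 0 := by
  split_ifs with h
  · refine Finset.sum_bij_ne_zero (fun p _ _ => (d - p.1, e - p.2)) ?_ ?_ ?_ ?_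
    · intro p hp h0
      rw [Finset.HasAntidiagonal.mem_antidiagonal] at hp ⊢
      have h1 : p.1 ≤ d := by by_contra h1; exact h0 (by rw [if_neg h1, zero_mul])
      have h2 : p.2 ≤ e := by by_contra h2; exact h0 (by rw [if_neg h2, mul_zero])
      change d - p.1 + (e - p.2) = _
      omega
    · intro p hp h0 q hq h0' hpq
      have h1 : p.1 ≤ d := by by_contra h1; exact h0 (by rw [if_neg h1, zero_mul])
      have h2 : p.2 ≤ e := by by_contra h2; exact h0 (by rw [if_neg h2, mul_zero])
      have h1' : q.1 ≤ d := by by_contra h1; exact h0' (by rw [if_neg h1, zero_mul])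
      have h2' : q.2 ≤ e := by by_contra h2; exact h0' (by rw [if_neg h2, mul_zero])
      have e1 := congrArg Prod.fst hpq
      have e2 := congrArg Prod.snd hpq
      simp only at e1 e2
      exact Prod.ext (by omega) (by omega)
    · intro p hp h0
      rw [Finset.HasAntidiagonal.mem_antidiagonal] at hp
      have h1 : p.1 ≤ d := by by_contra h1; exact h0 (by rw [hA _ (by omega), zero_mul])
      have h2 : p.2 ≤ e := by by_contra h2; exact h0 (by rw [hB _ (by omega), mul_zero])
      refine ⟨(d - p.1, e - p.2), ?_, ?_, Prod.ext (Nat.sub_sub_self h1) (Nat.sub_sub_self h2)⟩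
      · rw [Finset.HasAntidiagonal.mem_antidiagonal]
        omega
      · rwa [if_pos (Nat.sub_le _ _), if_pos (Nat.sub_le _ _), Nat.sub_sub_self h1,
          Nat.sub_sub_self h2]
    · intro p hp h0
      have h1 : p.1 ≤ d := by by_contra h1; exact h0 (by rw [if_neg h1, zero_mul])
      have h2 : p.2 ≤ e := by by_contra h2; exact h0 (by rw [if_neg h2, mul_zero])
      rw [if_pos h1, if_pos h2]
  · refine Finset.sum_eq_zero fun p hp => ?_
    rw [Finset.HasAntidiagonal.mem_antidiagonal] at hp
    by_cases h1 : p.1 ≤ d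
    · rw [if_neg (show ¬p.2 ≤ e by omega), mul_zero]
    · rw [if_neg h1, zero_mul]

variable {K : Type u} [CommRing K] {G : Type v} [CommGroup G] [Fintype G]

/-- Group-likeness at `(u, w)` is a sum over exponents with total `deg u + deg w - n`. In terms of
shifts, weight minus exponent, it is a sum over `k + l = n`. The inner shifts give the double sum,
`G`-degrees selecting `h`, and the shifts `0` give the tensor factors `1`. -/
theorem deltaAlg_diagPart {F : PowerSeries (KY K G)} (hF : IsGroupLike F)
    (h0 : PowerSeries.coeff 0 F = ySum K G)
    (hv : ∀ j, 1 ≤ j → ∀ w, deg w ≤ j → (PowerSeries.coeff j F).coeff w = 0) (a : ℕ+ × G) :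
    deltaAlg K (diagPart a.1 a.2 F) =
      tmul (diagPart a.1 a.2 F) 1 + tmul 1 (diagPart a.1 a.2 F) +
        ∑ k ∈ Finset.Ico 1 a.1, ∑ h : G,
          tmul (diagPart k h F) (diagPart ((a.1 - k : ℕ+) : ℕ) (a.2 * h⁻¹) F) := by
  classical
  have hz : ∀ i w, deg w < i → (PowerSeries.coeff i F).coeff w = 0 := fun i w h =>
    hv i (by omega) w h.le
  -- The part of `F` with shift `0` is `1`: this is the case of equality in `hv`, together with the
  -- constant term of `ySum`.
  have h00 : ∀ w : YWord G, (1 : KY K G).coeff w =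
      if 0 ≤ deg w then (PowerSeries.coeff (deg w - 0) F).coeff w else 0 := fun w => by
    rw [if_pos (Nat.zero_le _), Nat.sub_zero]
    by_cases hw : w = 1
    · rw [hw, deg_one, h0, coeff_ySum_one, one_def, coeff_basis_self]
    · rw [hv _ (Nat.pos_of_ne_zero fun h => hw (eq_one_of_deg_Y w h)) w le_rfl, one_def,
        coeff_basis_of_ne hw]
  ext ⟨u, w⟩
  set A : ℕ → K := fun k => if k ≤ deg u then (PowerSeries.coeff (deg u - k) F).coeff u else 0
    with hA
  set B : ℕ → K := fun k => if k ≤ deg w then (PowerSeries.coeff (deg w - k) F).coeff w else 0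
    with hB
  have hAB := sum_antidiagonal_reflect (fun i => hz i u) (fun i => hz i w) a.1
  have hl : (deltaAlg K (diagPart a.1 a.2 F)).coeff (u, w) =
      if gdeg G u * gdeg G w = a.2 then
        ∑ p ∈ Finset.HasAntidiagonal.antidiagonal (a.1 : ℕ), A p.1 * B p.2 else 0 := by
    rw [hAB]
    split_ifs with hg hn
    · rw [coeff_deltaAlg_congr (g := PowerSeries.coeff (deg u + deg w - a.1) F), hF, coeff_sum]
      · rfl
      · intro m hm hm'
        rw [coeff_diagPart, if_pos ⟨hm ▸ hn, hm'.trans hg⟩, hm]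
    · refine coeff_deltaAlg_eq_zero fun m hm hm' => ?_
      rw [coeff_diagPart, if_neg fun h => hn (hm ▸ h.1)]
    · refine coeff_deltaAlg_eq_zero fun m hm hm' => ?_
      rw [coeff_diagPart, if_neg fun h => hg (hm'.symm.trans h.2)]
  have hd : ∀ (n : ℕ) (g : G) (m : YWord G), (diagPart n g F).coeff m = if gdeg G m = g then
      (if n ≤ deg m then (PowerSeries.coeff (deg m - n) F).coeff m else 0) else 0 := fun n g m => by
    rw [coeff_diagPart]
    split_ifs <;> first | rfl | (exfalso; tauto)
  have hsum : ∀ k ∈ Finset.Ico 1 a.1, (∑ h : G, tmul (diagPart (k : ℕ) h F)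
      (diagPart ((a.1 - k : ℕ+) : ℕ) (a.2 * h⁻¹) F)).coeff (u, w) =
      if gdeg G u * gdeg G w = a.2 then A k * B (a.1 - k) else 0 := fun k hk => by
    rw [Finset.mem_Ico] at hk
    rw [coeff_sum, Finset.sum_eq_single (gdeg G u)]
    · rw [coeff_tmul, hd, hd, if_pos rfl, PNat.sub_coe, if_pos hk.2, mul_ite, mul_zero]
      simp only [eq_mul_inv_iff_mul_eq, mul_comm (gdeg G w)]
      rfl
    · intro h _ hne
      rw [coeff_tmul, hd, if_neg hne.symm, zero_mul]
    · exact fun h => (h (Finset.mem_univ _)).elim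
  have h1 : ∀ f : ℕ → K, ∑ k ∈ Finset.Ico 1 a.1, f k = ∑ k ∈ Finset.Ico 1 (a.1 : ℕ), f k :=
    fun f => by
      have := PNat.map_subtype_embedding_Ico 1 a.1
      rw [PNat.one_coe] at this
      rw [← this]
      exact (Finset.sum_map (Finset.Ico 1 a.1) (Function.Embedding.subtype _) f).symm
  rw [hl, coeff_add, coeff_add, coeff_sum, Finset.sum_congr rfl hsum, coeff_tmul, coeff_tmul,
    h1 fun k => if gdeg G u * gdeg G w = a.2 then A k * B (a.1 - k) else 0]
  have hu : (diagPart a.1 a.2 F).coeff u * (1 : KY K G).coeff w =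
      if gdeg G u * gdeg G w = a.2 then A a.1 * B 0 else 0 := by
    have hB0 : B 0 = (1 : KY K G).coeff w := (h00 w).symm
    rw [hB0, hd]
    by_cases hw : w = 1
    · rw [hw, map_one, mul_one, ite_mul, zero_mul]
    · rw [one_def, coeff_basis_of_ne hw, mul_zero, mul_zero, ite_self]
  have hw : (1 : KY K G).coeff u * (diagPart a.1 a.2 F).coeff w =
      if gdeg G u * gdeg G w = a.2 then A 0 * B a.1 else 0 := by
    have hA0 : A 0 = (1 : KY K G).coeff u := (h00 u).symm
    rw [hA0, hd]
    by_cases hu : u = 1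
    · rw [hu, map_one, one_mul, mul_ite, mul_zero]
    · rw [one_def, coeff_basis_of_ne hu, zero_mul, zero_mul, ite_self]
  rw [hu, hw]
  split_ifs
  · rw [Finset.Nat.sum_antidiagonal_eq_sum_range_succ_mk, Finset.sum_range_succ,
      Finset.range_eq_Ico, Finset.sum_eq_sum_Ico_succ_bot a.1.pos]
    simp only [Nat.sub_self, Nat.sub_zero]
    ring
  · rw [Finset.sum_const_zero, add_zero, add_zero]

variable [Algebra ℚ K] (ε : ℤˣ)

/-- Both composites are algebra homomorphisms, so letters suffice. As `GamSym = 1`, the image of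
`y_{n,g}` is the part `(n, g)` of `adjSer`, and these parts satisfy the same coproduct formula as
the letters. -/
theorem DMR0_subset_stabAlg : DMR0 K G ε ⊆ stabAlg K G ε := fun Ψ h => by
  have hv := adjSer_vanishing ε h
  have hA := isGroupLike_homSer ε Ψ h.1 h.2.2.1
  have hgl : IsGroupLike (adjSer ε Ψ) := (hA.mul isGroupLike_C_ySum).mul hA.sigma
  have hγ : GamSym ε Ψ = 1 := by
    ext n
    rcases n with _ | n
    · rw [coeff_GamSym_zero, PowerSeries.coeff_zero_one]
    · rw [(hv (n + 1) (by omega)).1, PowerSeries.coeff_one, if_neg (by omega)]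
  have hψ : psY K G 1 = 1 := by
    have := psY_X_pow (K := K) (G := G) 0
    rwa [pow_zero, pow_zero, PowerSeries.monomial_zero_eq_C_apply, map_one PowerSeries.C] at this
  have hl : ∀ a : ℕ+ × G, GamAutY ε Ψ (yl K a) = diagPart a.1 a.2 (adjSer ε Ψ) := fun a => by
    rw [GamAutY_yl, hγ, hψ, mul_one]
  have hH := isHom_GamAutY ε Ψ
  rw [mem_stabAlg]
  refine (hH.tensorSq.comp isHom_deltaAlg).ext_free (isHom_deltaAlg.comp hH) fun a => ?_
  rw [LinearMap.comp_apply, LinearMap.comp_apply, hl, deltaAlg_yl,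
    deltaAlg_diagPart hgl (coeff_zero_adjSer ε Ψ) (fun j hj => (hv j hj).2), map_add, map_add,
    tensorSq_basis, tensorSq_basis, hl, ← one_def, hH.map_one, map_sum]
  congr 1
  refine Finset.sum_congr rfl fun k _ => ?_
  rw [map_sum]
  refine Finset.sum_congr rfl fun g _ => ?_
  rw [tensorSq_basis, hl, hl]

variable (K G)

/-- `Stab(Δ⋆^mod)(K)` as a subgroup. -/
noncomputable def stabModSubgroup : Subgroup (GroupLike K G) :=
  stabCoprod (GamSYY ε) (cont_GamSYY ε) (GamSYY_one ε) (GamSYY_mul ε) (deltaAlg K)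

/-- `Stab(Δ⋆^alg)(K)` as a subgroup. -/
noncomputable def stabAlgSubgroup : Subgroup (GroupLike K G) :=
  stabCoprod (GamAutY ε) (fun Ψ => (isHom_GamAutY ε Ψ).cont) (GamAutY_one ε) (GamAutY_mul ε)
    (deltaAlg K)

theorem coe_stabModSubgroup : (stabModSubgroup K G ε : Set (GroupLike K G)) = stabMod K G ε :=
  Set.ext fun Ψ => (mem_stabMod ε Ψ).symm

theorem coe_stabAlgSubgroup : (stabAlgSubgroup K G ε : Set (GroupLike K G)) = stabAlg K G ε := rfl

theorem stabModSubgroup_le : stabModSubgroup K G ε ≤ stabAlgSubgroup K G ε := fun Ψ hΨ =>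
  stabMod_subset_stabAlg ε ((mem_stabMod ε Ψ).2 hΨ)

end Conclusion

end DoubleShuffle

theorem mainTheorem4 {K : Type*} [CommRing K] [Algebra ℚ K] {G : Type*} [CommGroup G] [Fintype G]
    (ε : ℤˣ) :
    ∃ _grp : Group (DoubleShuffle.GroupLike K G),
      (∀ Ψ Φ : DoubleShuffle.GroupLike K G, (Ψ * Φ).ser = DoubleShuffle.S Ψ Φ.ser) ∧
      ∃ Hmod Halg : Subgroup (DoubleShuffle.GroupLike K G),
        (Hmod : Set (DoubleShuffle.GroupLike K G)) = DoubleShuffle.stabMod K G ε ∧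
        (Halg : Set (DoubleShuffle.GroupLike K G)) = DoubleShuffle.stabAlg K G ε ∧
        Hmod ≤ Halg ∧
        (IsCyclic G → DoubleShuffle.DMR0 K G ε ⊆ (Halg : Set (DoubleShuffle.GroupLike K G))) := by
  exact ⟨DoubleShuffle.GroupLike.instGroup, fun _ _ => rfl, DoubleShuffle.stabModSubgroup K G ε,
    DoubleShuffle.stabAlgSubgroup K G ε, DoubleShuffle.coe_stabModSubgroup K G ε,
    DoubleShuffle.coe_stabAlgSubgroup K G ε, DoubleShuffle.stabModSubgroup_le K G ε,
    fun _ => DoubleShuffle.DMR0_subset_stabAlg ε⟩
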